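/- **Setting.** Consider the planar circular restricted three-body problem in the rotating frame centred at the centre of mass, $$H_\mu=\tfrac12(p_x^2+p_y^2)+yp_x-xp_y-\frac{1-\mu}{\sqrt{(x+\mu)^2+y^2}}-\frac{\mu}{\sqrt{(x-1+\mu)^2+y^2}} ,$$ written in the Delaunay variables $(L,G,l,g)$, $0<G<L$: with $a=L^2$, $e=\sqrt{1-G^2/L^2}$, $l=E-e\sin E$, $r=a(1-e\cos E)$, $(\cos\nu,\sin\nu)=\frac{(\cos E-e,\ \sqrt{1-e^2}\sin E)}{1-e\cos E}$, $\theta=\nu+g$, $R=Le\sin E/r$, one puts $x=r\cos\theta$, $y=r\sin\theta$, $p_x=R\cos\theta-\frac Gr\sin\theta$, $p_y=R\sin\theta+\frac Gr\cos\theta$. Hamilton's equations are $\dot l=\partial_LH_\mu$, $\dot g=\partial_GH_\mu$, $\dot L=-\partial_lH_\mu$, $\dot G=-\partial_gH_\mu$; the angles $l,g$ are taken modulo $2\pi$, and solutions stay away from both primaries. A solution is symmetric if it is invariant under $(t,L,G,l,g)\mapsto(-t,L,G,-l,-g)$. Let $p,q$ be coprime positive integers, $n_l,n_g\in\{0,1\}$.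 For $0<e<1$, the unperturbed orbit ($\mu=0$) is $L=(p/q)^{1/3}$, $G=(p/q)^{1/3}\sqrt{1-e^2}$, $l=qt/p+n_l\pi$, $g=-t+n_g\pi$. Along it put $\Delta_1=(1+r^2-2r\cos\theta)^{1/2}$ and $$C(e,p,q)=-\frac{6\pi p^{5/3}}{q^{2/3}}\int_0^{2\pi p}\Bigl(\frac1{\Delta_1}\Bigr)_{\theta\theta}+\frac{\cos\theta}{r^2}\,dt ,$$ where $r,\theta$ are evaluated along the unperturbed orbit; $C$ also depends on $n_l,n_g$. The integral is defined by the same formulas (with $a=(p/q)^{2/3}$) for all real $e$ near $0$ if $p\ne q$. A *family of type $(n_l,n_g)$* is a family of symmetric periodic solutions, defined and analytic (solution and period $T$) for $\mu$ in an open interval around $0$, with $T=2\pi p+O(\mu)$, $L(0)=(p/q)^{1/3}+O(\mu)$, $G(0)=(p/q)^{1/3}\sqrt{1-e^2}+O(\mu)$, $l(0)=n_l\pi$, $g(0)=n_g\pi$. **Theorem.** (1) *Existence and uniqueness.* Let $0<e<1$ and assume $\Delta_1>0$ along the unperturbed orbit. Then for $|\mu|$ sufficiently small there is a family of type $(n_l,n_g)$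 with $G(0)=(p/q)^{1/3}\sqrt{1-e^2}$ exactly. It is unique: there is $\delta>0$ such that, for all sufficiently small $|\mu|$, a periodic solution with $l(0)=n_l\pi$, $g(0)=n_g\pi$ whose $L(0)$, $G(0)$ and period are within $\delta$ of their unperturbed values is determined, together with its period, by $\mu$ and $G(0)$; the members of the family are such solutions. (2) *Multipliers.* The characteristic multipliers of the solutions in this family are $1,1,\lambda_+(\mu),\lambda_-(\mu)$ with $\lambda_\pm(\mu)=1\pm\sqrt{C(e,p,q)\mu}+O(\mu)$ as $\mu\to0^+$ (complex square root). (3) *Only two distinct families.* Let $0<e<1$. If $pn_l+qn_g\equiv pn_l'+qn_g'\pmod 2$, then every family of type $(n_l,n_g)$ is, after a time shift depending on $\mu$, a family of type $(n_l',n_g')$. If the parities differ, then for small $|\mu|$ the orbits of a family of type $(n_l,n_g)$ and those of a family of type $(n_l',n_g')$ are disjoint. Thus the four choices of $(n_l,n_g)$ give exactly two distinct types. (4) *Expansion at $e=0$.* Let $p\ne q$. Then $C(e,p,q)$ is analytic at $e=0$, $C(e,p,q)=O(e^{|p-q|})$ as $e\to0$, and the coefficient of $e^{|p-q|}$ in its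 power series is $-6\pi p^2(c_1+c_2)$, as follows. Let $D=\alpha\frac{d}{d\alpha}$, let $\binom{X}{k}=X(X-1)\cdots(X-k+1)/k!$, and let $b_n(\alpha)$ be the Laplace coefficients, $(1+\alpha^2-2\alpha\cos\theta)^{-1/2}=\frac12\sum_{n\in\mathbb Z}b_n(\alpha)e^{in\theta}$. If $p<q$, $$c_1=-2\pi q^2\frac{(-1)^{q-p}}{2^{q-p}}(-1)^{n_gq+n_lp}\Bigl(\sum_{k=0}^{q-p}\binom{D+q}{k}\frac{p^{q-p-k}}{(q-p-k)!}\Bigr)(\alpha b_q(\alpha))\Big|_{\alpha=(p/q)^{2/3}};$$ if $p>q$, $$c_1=-2\pi q^2\frac{1}{2^{p-q}}(-1)^{n_gq+n_lp}\Bigl(\sum_{k=0}^{p-q}(-1)^k\binom{-D-q}{k}\frac{p^{p-q-k}}{(p-q-k)!}\Bigr)b_q(\alpha)\Big|_{\alpha=(q/p)^{2/3}}.$$ If $q\neq1$ then $c_2=0$; if $q=1$, then $c_2$ is the coefficient of $e^{p-1}$ in the power series about $e=0$ of $$(-1)^{n_g+n_lp}\,2\pi\,\frac{1+\beta^2}{p^{2/3}}\bigl(J_{p-1}(ep)+2J_{p-2}(ep)\beta+3J_{p-3}(ep)\beta^2+\cdots\bigr),\qquad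 e=\frac{2\beta}{1+\beta^2},\ |\beta|<1,$$ where $J_k$ are the Bessel functions of integer order. (5) Let $p\neq q$. For two choices of $(n_l,n_g)$ belonging to the two distinct types, the coefficients of $e^{|p-q|}$ in $C(e,p,q)$ sum to zero. -/

import Mathlib

open Filter Topology Asymptotics

noncomputable section

namespace RTBP

/-! ### Elliptic elements in the rotating frame -/

/-- The eccentric anomaly `E`: the solution of Kepler's equation `l = E - e sin E`, which is unique
for `|e| < 1`. -/
def eccAnomaly (e l : ℝ) : ℝ := Function.invFun (fun E : ℝ => E - e * Real.sin E) l

theorem eccAnomaly_spec {e : ℝ} (he : |e| < 1) (l : ℝ) :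
    eccAnomaly e l - e * Real.sin (eccAnomaly e l) = l := by
  have hc : Continuous fun E : ℝ => E - e * Real.sin E := by fun_prop
  have hb : ∀ E : ℝ, |e * Real.sin E| ≤ 1 := fun E => by
    rw [abs_mul]
    exact mul_le_one₀ he.le (abs_nonneg _) (Real.abs_sin_le_one E)
  refine Function.invFun_eq (f := fun E : ℝ => E - e * Real.sin E) ?_
  obtain ⟨x, -, hx⟩ := intermediate_value_Icc (show l - 1 ≤ l + 1 by linarith) hc.continuousOn
    (show l ∈ Set.Icc _ _ from
      ⟨by have := abs_le.mp (hb (l - 1)); linarith,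
       by have := abs_le.mp (hb (l + 1)); linarith⟩)
  exact ⟨x, hx⟩

/-- Distance to the origin, `r = a (1 - e cos E)`. -/
def radius (a e l : ℝ) : ℝ := a * (1 - e * Real.cos (eccAnomaly e l))

/-- The true anomaly `ν`, i.e. the polar angle of `(cos E - e, √(1 - e²) sin E)`; thus
`cos ν = (cos E - e) / (1 - e cos E)` and `sin ν` has the sign of `sin E`. -/
def trueAnomaly (e l : ℝ) : ℝ :=
  Complex.arg ⟨Real.cos (eccAnomaly e l) - e,
    Real.sqrt (1 - e ^ 2) * Real.sin (eccAnomaly e l)⟩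

/-- `Δ₁ = (1 + r² - 2 r cos θ)^{1/2}`, the distance of the point with polar coordinates `r, θ` to
the point `(1, 0)`. -/
def delta1 (r θ : ℝ) : ℝ := Real.sqrt (1 + r ^ 2 - 2 * r * Real.cos θ)

/-! ### The Hamiltonian -/

/-- The Hamiltonian of the planar circular restricted three-body problem in the rotating Cartesian
frame centred at the centre of mass. -/
def cartesianH (μ x y px py : ℝ) : ℝ :=
  (px ^ 2 + py ^ 2) / 2 + y * px - x * py
    - (1 - μ) / Real.sqrt ((x + μ) ^ 2 + y ^ 2) - μ / Real.sqrt ((x - 1 + μ) ^ 2 + y ^ 2)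

/-- Phase space in the Delaunay variables: `s 0 = L`, `s 1 = G`, `s 2 = l`, `s 3 = g`. The angles
`l` and `g` are lifted to `ℝ`. -/
abbrev State := Fin 4 → ℝ

/-- The eccentricity `e = √(1 - G²/L²)`; the semimajor axis is `a = L²`. -/
def ecc (s : State) : ℝ := Real.sqrt (1 - s 1 ^ 2 / s 0 ^ 2)

def polarR (s : State) : ℝ := radius (s 0 ^ 2) (ecc s) (s 2)

def polarTheta (s : State) : ℝ := trueAnomaly (ecc s) (s 2) + s 3

/-- The radial momentum, `R = L e sin E / r`. -/
def radialMomentum (s : State) : ℝ :=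
  s 0 * ecc s * Real.sin (eccAnomaly (ecc s) (s 2)) / polarR s

def posX (s : State) : ℝ := polarR s * Real.cos (polarTheta s)

def posY (s : State) : ℝ := polarR s * Real.sin (polarTheta s)

def momX (s : State) : ℝ :=
  radialMomentum s * Real.cos (polarTheta s) - s 1 / polarR s * Real.sin (polarTheta s)

def momY (s : State) : ℝ :=
  radialMomentum s * Real.sin (polarTheta s) + s 1 / polarR s * Real.cos (polarTheta s)

/-- The Hamiltonian in the Delaunay variables. -/
def H (μ : ℝ) (s : State) : ℝ := cartesianH μ (posX s) (posY s) (momX s) (momY s)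

/-- Direct elliptic states (`0 < G < L`, so `0 < e < 1`) away from both primaries. -/
def domain (μ : ℝ) : Set State :=
  {s | 0 < s 1 ∧ s 1 < s 0 ∧ (posX s, posY s) ≠ (-μ, 0) ∧ (posX s, posY s) ≠ (1 - μ, 0)}

/-- The partial derivative of `H` in the `i`-th Delaunay variable. -/
def dH (μ : ℝ) (i : Fin 4) (s : State) : ℝ := fderiv ℝ (H μ) s (Pi.single i 1)

/-- The Hamiltonian vector field: `L' = -H_l`, `G' = -H_g`, `l' = H_L`, `g' = H_G`. -/
def vectorField (μ : ℝ) (s : State) : State :=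
  ![-dH μ 2 s, -dH μ 3 s, dH μ 0 s, dH μ 1 s]

/-- A solution, defined for all time, of Hamilton's equations. -/
def IsSolution (μ : ℝ) (c : ℝ → State) : Prop :=
  ∀ t, c t ∈ domain μ ∧ HasDerivAt c (vectorField μ (c t)) t

/-- Two states agree, the angles `l` and `g` being taken modulo `2π`. -/
def SameState (s s' : State) : Prop :=
  s 0 = s' 0 ∧ s 1 = s' 1 ∧ (∃ j : ℤ, s 2 = s' 2 + 2 * Real.pi * j) ∧
    ∃ k : ℤ, s 3 = s' 3 + 2 * Real.pi * k

/-- `T > 0` is a period of `c` (the angles being taken modulo `2π`). -/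
def IsPeriod (c : ℝ → State) (T : ℝ) : Prop :=
  0 < T ∧ ∀ t, SameState (c (t + T)) (c t)

/-- The discrete symmetry `(L, G, l, g) ↦ (L, G, -l, -g)`. -/
def reflect (s : State) : State := ![s 0, s 1, -s 2, -s 3]

/-! ### Characteristic multipliers -/

/-- `M` is the monodromy operator of the solution `c` over the time `T`: the value at `T` of the
solution `Z` of the variational equation along `c` with `Z 0 = id`. -/
def IsMonodromy (μ : ℝ) (c : ℝ → State) (T : ℝ) (M : State →L[ℝ] State) : Prop :=
  ∃ Z : ℝ → State →L[ℝ] State, Z 0 = ContinuousLinearMap.id ℝ State ∧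
    (∀ t, HasDerivAt Z ((fderiv ℝ (vectorField μ) (c t)).comp (Z t)) t) ∧ Z T = M

/-- `S` is the multiset of the four characteristic multipliers of the `T`-periodic solution `c`,
i.e. of the complex eigenvalues, with multiplicity, of its monodromy operator. -/
def AreMultipliers (μ : ℝ) (c : ℝ → State) (T : ℝ) (S : Multiset ℂ) : Prop :=
  ∃ M : State →L[ℝ] State, IsMonodromy μ c T M ∧
    ((M : State →ₗ[ℝ] State).charpoly.map (algebraMap ℝ ℂ)).roots = S

/-! ### Resonant orbits and their continuations -/

/-- `L = (p/q)^{1/3}`. -/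
def resL (p q : ℕ) : ℝ := ((p : ℝ) / q) ^ ((1 : ℝ) / 3)

/-- `G = (p/q)^{1/3} (1 - e²)^{1/2}`. -/
def resG (p q : ℕ) (e : ℝ) : ℝ := resL p q * Real.sqrt (1 - e ^ 2)

/-- The radius at time `t` along the resonant Kepler ellipse with `a = (p/q)^{2/3}`,
`l = q t / p + n_l π`. -/
def orbitR (p q nl : ℕ) (e t : ℝ) : ℝ :=
  radius (((p : ℝ) / q) ^ ((2 : ℝ) / 3)) e (q * t / p + nl * Real.pi)

/-- The polar angle `θ = ν + g` at time `t` along the resonant Kepler ellipse, in the rotating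
frame, with `l = q t / p + n_l π` and `g = -t + n_g π`. -/
def orbitTheta (p q nl ng : ℕ) (e t : ℝ) : ℝ :=
  trueAnomaly e (q * t / p + nl * Real.pi) + (-t + ng * Real.pi)

/-- An analytic family, parametrized by `μ ∈ (-μ₀, μ₀)`, of symmetric periodic solutions `γ μ` with
periods `T μ = 2πp + O(μ)` and `L(0) = (p/q)^{1/3} + O(μ)`,
`G(0) = (p/q)^{1/3} (1 - e²)^{1/2} + O(μ)`, `l(0) = n_l π`, `g(0) = n_g π`. -/
structure IsFamily (p q : ℕ) (e : ℝ) (nl ng : ℕ) (μ₀ : ℝ) (γ : ℝ → ℝ → State) (T : ℝ → ℝ) :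
    Prop where
  pos : 0 < μ₀
  analytic : AnalyticOnNhd ℝ (Function.uncurry γ) (Set.Ioo (-μ₀) μ₀ ×ˢ Set.univ)
  analytic_period : AnalyticOnNhd ℝ T (Set.Ioo (-μ₀) μ₀)
  solution : ∀ μ ∈ Set.Ioo (-μ₀) μ₀, IsSolution μ (γ μ)
  periodic : ∀ μ ∈ Set.Ioo (-μ₀) μ₀, IsPeriod (γ μ) (T μ)
  symmetric : ∀ μ ∈ Set.Ioo (-μ₀) μ₀, ∀ t, SameState (γ μ (-t)) (reflect (γ μ t))
  period : (fun μ => T μ - 2 * Real.pi * p) =O[𝓝 0] fun μ => μ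
  init_L : (fun μ => γ μ 0 0 - resL p q) =O[𝓝 0] fun μ => μ
  init_G : (fun μ => γ μ 0 1 - resG p q e) =O[𝓝 0] fun μ => μ
  init_l : ∀ μ ∈ Set.Ioo (-μ₀) μ₀, γ μ 0 2 = nl * Real.pi
  init_g : ∀ μ ∈ Set.Ioo (-μ₀) μ₀, γ μ 0 3 = ng * Real.pi

/-- `c` is a periodic solution with period `T`, starting at `l = n_l π`, `g = n_g π`, such that
`L(0)`, `G(0)` and `T` are `δ`-close to their values on the unperturbed orbit. -/
structure IsNearby (p q : ℕ) (e : ℝ) (nl ng : ℕ) (δ μ : ℝ) (c : ℝ → State) (T : ℝ) :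
    Prop where
  solution : IsSolution μ c
  periodic : IsPeriod c T
  period : |T - 2 * Real.pi * p| < δ
  init_L : |c 0 0 - resL p q| < δ
  init_G : |c 0 1 - resG p q e| < δ
  init_l : c 0 2 = nl * Real.pi
  init_g : c 0 3 = ng * Real.pi

/-! ### The coefficient `C(e, p, q)` -/

/-- `C(e, p, q) = -(6π p^{5/3} / q^{2/3}) ∫₀^{2πp} ((1/Δ₁)_θθ + cos θ / r²) dt` along the
unperturbed orbit. -/
def stabC (p q nl ng : ℕ) (e : ℝ) : ℝ :=
  -(6 * Real.pi * (p : ℝ) ^ ((5 : ℝ) / 3) / (q : ℝ) ^ ((2 : ℝ) / 3)) *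
    ∫ t in (0 : ℝ)..(2 * Real.pi * p),
      (iteratedDeriv 2 (fun θ => 1 / delta1 (orbitR p q nl e t) θ) (orbitTheta p q nl ng e t)
        + Real.cos (orbitTheta p q nl ng e t) / orbitR p q nl e t ^ 2)

/-- The coefficient of `x ^ n` in the power series of `f` about `0`. -/
def taylorCoeff (f : ℝ → ℝ) (n : ℕ) : ℝ := iteratedDeriv n f 0 / n.factorial

/-- The Bessel function `J_k` of integer order. -/
def besselJ (k : ℤ) (x : ℝ) : ℝ :=
  1 / (2 * Real.pi) * ∫ τ in (0 : ℝ)..(2 * Real.pi), Real.cos (k * τ - x * Real.sin τ)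

/-- `β` with `e = 2β / (1 + β²)`, `|β| ≤ 1`. -/
def betaOf (e : ℝ) : ℝ := e / (1 + Real.sqrt (1 - e ^ 2))

/-- The Bessel series
`(-1)^{n_g + n_l p} 2π (1 + β²) p^{-2/3} (J_{p-1}(ep) + 2 J_{p-2}(ep) β + 3 J_{p-3}(ep) β² + ⋯)`. -/
def besselSeries (p nl ng : ℕ) (e : ℝ) : ℝ :=
  (-1) ^ (ng + nl * p) * (2 * Real.pi) * ((1 + betaOf e ^ 2) / (p : ℝ) ^ ((2 : ℝ) / 3)) *
    ∑' k : ℕ, ((k : ℝ) + 1) * besselJ ((p : ℤ) - 1 - k) (e * p) * betaOf e ^ k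

/-- The Laplace coefficient `b_n(α)`, defined by
`(1 + α² - 2 α cos θ)^{-1/2} = (1/2) ∑_{n ∈ ℤ} b_n(α) exp(i n θ)`. -/
def laplaceB (n : ℕ) (α : ℝ) : ℝ :=
  1 / Real.pi * ∫ θ in (0 : ℝ)..(2 * Real.pi),
    Real.cos (n * θ) / Real.sqrt (1 + α ^ 2 - 2 * α * Real.cos θ)

/-- The operator `binom(σ D + c, k)` with `D = α d/dα`, applied to `f`, where
`binom(X, k) = X (X - 1) ⋯ (X - k + 1) / k!`. -/
def binomOp (σ c : ℝ) : ℕ → (ℝ → ℝ) → ℝ → ℝ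
  | 0, f => f
  | k + 1, f => fun α =>
      (σ * (α * deriv (binomOp σ c k f) α) + (c - k) * binomOp σ c k f α) / (k + 1)

/-- The coefficient of `e^{|p-q|}` contributed by `(r/Δ₁)_θθ` if `p < q`. -/
def leadingInner (p q nl ng : ℕ) : ℝ :=
  -2 * Real.pi * q ^ 2 * ((-1) ^ (q - p) / 2 ^ (q - p)) * (-1) ^ (ng * q + nl * p) *
    ∑ k ∈ Finset.range (q - p + 1),
      (p : ℝ) ^ (q - p - k) / (q - p - k).factorial *
        binomOp 1 q k (fun α => α * laplaceB q α) (((p : ℝ) / q) ^ ((2 : ℝ) / 3))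

/-- The coefficient of `e^{|p-q|}` contributed by `(r/Δ₁)_θθ` if `p > q`. -/
def leadingOuter (p q nl ng : ℕ) : ℝ :=
  -2 * Real.pi * q ^ 2 * (1 / 2 ^ (p - q)) * (-1) ^ (ng * q + nl * p) *
    ∑ k ∈ Finset.range (p - q + 1),
      (-1) ^ k * ((p : ℝ) ^ (p - q - k) / (p - q - k).factorial) *
        binomOp (-1) (-q) k (laplaceB q) (((q : ℝ) / p) ^ ((2 : ℝ) / 3))

/-- The coefficient of `e^{|p-q|}` in the power series of `C(e, p, q)`, for `p ≠ q`. -/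
def leadingC (p q nl ng : ℕ) : ℝ :=
  -6 * Real.pi * p ^ 2 *
    ((if p < q then leadingInner p q nl ng else leadingOuter p q nl ng) +
      if q = 1 then taylorCoeff (besselSeries p nl ng) (p - 1) else 0)

end RTBP

end

/-!
# Periodic solutions of the second kind and their characteristic multipliers

**Continuation.** The reflection `(L, G, l, g) ↦ (L, G, -l, -g)` reverses the flow, so an orbit that
meets its fixed set `l, g ∈ πℤ` at the times `0` and `T / 2` is symmetric and closes up after the
time `T` (`IsVarSol.close_up`), and every periodic orbit starting on the fixed set arises in this way
(`IsSolution.half_period`). For `μ = 0` the angles are `l = n_l π + t / L³`, `g = n_g π - t`, which is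
a submersion in `(L, t)`; hence the implicit function theorem gives `L(0)` and `T` as analytic
functions of `μ` and `G(0)` (`exists_half_period_function`). It is applied to the analytic flow,
which is constructed from the analytic implicit function theorem in the Banach space of curves
(`exists_analytic_local_flow`) and concatenation (`exists_isFlowNear`).

**Multipliers.** The monodromy operator `M` satisfies `M R M = R` with the reflection `R` and fixes
the velocity, so its characteristic polynomial is `(X - 1)² (X² - (2 + κ) X + 1)` with
`κ = tr M - 4` (`charpoly_of_reversible`). As `κ` is analytic, everything follows from
`κ'(0) = C` (`IsContinuation.hasDerivAt_trace`). At `μ = 0` the only off-diagonal part of the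
linearized equation is the shear `δl' = -3 L⁻⁴ δL`, so the derivative of the trace is a multiple of the
mean of `∂²/∂l²` of the perturbing function `∂H/∂μ`. Along the resonant orbit `n ∂_l - ∂_g`, `n = q/p`,
is the time derivative; therefore `n² ∂_l²` and `∂_g²` have the same mean
(`integral_dirDeriv_two_two`), and `∂_g = ∂_θ`, which gives the integral defining `C`.

**Two types.** A translation by half a period changes `(n_l, n_g)` by `(q, -p)` modulo `2`, and
leaves the parity of `p n_l + q n_g` invariant (`IsFamily.exists_shift`). Kepler orbits of different
parity are disjoint, and by compactness so are their perturbations (`IsFamily.disjoint`).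

**Expansion in the eccentricity.** In terms of the eccentric anomaly `E = q x` the coefficient `C` is
the average over `x` of `Φ(e z, e / z)(ψ)`, where `z = exp(iE)`, `ψ = (q - p) x + const`, and `Φ` is
an analytic function of two variables with values in the Banach algebra of continuous functions of
the angle `ψ` (`eventually_stabC_eq`, `analyticAt_directKernel_par`). A monomial `u^a v^b` of `Φ`
contributes only if `q - p` divides `a - b`, and if `a = b` only the mean over `ψ` enters, which
vanishes because the kernel is a second derivative. So the order is `|p - q|`, and the leading
coefficient comes from `u^{|p-q|}` and `v^{|p-q|}` alone (`exists_hasTaylor_resonantIntegral`). On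
the axes `v = 0` and `u = 0` one has `exp(iθ) = w exp(iψ)` with an explicit factor `w > 0`; shifting
the contour of the Fourier integral turns it into `w^{-n}` times the Fourier coefficient for a
circular orbit, which is a Laplace coefficient (`eventually_fourierInt_axis`). The operators
`binom(σ D + c, k)` of the statement are the Taylor coefficients of
`(1 + y)^c F(α (1 + y)^σ)` (`taylorCoeff_binomOp`). The indirect term contributes in this order only
for `q = 1`; then `exp(iν) / r = (1 + β²) / a · z / (1 - β z)²` expands it into the Bessel series
(`hasSum_cos_div_radius`). Finally `n_l`, `n_g` enter the leading coefficient only through the sign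
`(-1)^(p n_l + q n_g)` (`leadingC_eq_mul`), so the coefficients of the two types are opposite.
-/

namespace RTBP

open scoped ContDiff

/-! ### Analytic local flows -/

section Nemytskii

set_option linter.unusedSectionVars false

variable {𝕜 X E F : Type*} [NontriviallyNormedField 𝕜] [TopologicalSpace X] [CompactSpace X]
  [NormedAddCommGroup E] [NormedSpace 𝕜 E] [NormedAddCommGroup F] [NormedSpace 𝕜 F]

open scoped Classical in
/-- The composition operator `c ↦ f ∘ c` on continuous curves, set to `0` at those `c` for which
`f ∘ c` is not continuous. -/
noncomputable def nemytskii (f : E → F) (c : C(X, E)) : C(X, F) :=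
  if h : Continuous (f ∘ c) then ⟨f ∘ c, h⟩ else 0

theorem nemytskii_apply {f : E → F} {c : C(X, E)} (h : Continuous (f ∘ c)) (s : X) :
    nemytskii f c s = f (c s) := by
  simp [nemytskii, dif_pos h]

/-- A continuous multilinear map acts on continuous curves pointwise. -/
noncomputable def pointwiseMultilinear {n : ℕ}
    (P : ContinuousMultilinearMap 𝕜 (fun _ : Fin n => E) F) :
    ContinuousMultilinearMap 𝕜 (fun _ : Fin n => C(X, E)) C(X, F) :=
  MultilinearMap.mkContinuous
    { toFun := fun h => ⟨fun s => P fun i => h i s, by fun_prop⟩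
      map_update_add' := by
        intro _ h i x y
        ext s
        have hu : ∀ z : C(X, E), (fun j => Function.update h i z j s)
            = Function.update (fun j => h j s) i (z s) := fun z => by
          ext j
          by_cases hj : j = i
          · subst hj; simp
          · simp [hj]
        change P (fun j => _) = P (fun j => _) + P (fun j => _)
        rw [hu, hu, hu]
        exact P.map_update_add (fun j => h j s) i (x s) (y s)
      map_update_smul' := by
        intro _ h i a x
        ext s
        have hu : ∀ z : C(X, E), (fun j => Function.update h i z j s)
            = Function.update (fun j => h j s) i (z s) := fun z => by
          ext j
          by_cases hj : j = i
          · subst hj; simp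
          · simp [hj]
        change P (fun j => _) = a • P (fun j => _)
        rw [hu, hu]
        exact P.map_update_smul (fun j => h j s) i a (x s) }
    ‖P‖ (fun h => by
      refine (ContinuousMap.norm_le _ (by positivity)).2 fun s => ?_
      refine (P.le_opNorm _).trans ?_
      gcongr with i
      exact (h i).norm_coe_le_norm s)

theorem pointwiseMultilinear_apply {n : ℕ}
    (P : ContinuousMultilinearMap 𝕜 (fun _ : Fin n => E) F) (h : Fin n → C(X, E)) (s : X) :
    pointwiseMultilinear P h s = P fun i => h i s := rfl

theorem norm_pointwiseMultilinear_le {n : ℕ}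
    (P : ContinuousMultilinearMap 𝕜 (fun _ : Fin n => E) F) :
    ‖pointwiseMultilinear (X := X) P‖ ≤ ‖P‖ :=
  MultilinearMap.mkContinuous_norm_le _ (norm_nonneg _) _

theorem exists_ball_continuous_comp {f : E → F} {x₀ : E} (hf : AnalyticAt 𝕜 f x₀)
    [CompleteSpace F] :
    ∃ r > 0, ∀ c : C(X, E), (∀ s, c s ∈ Metric.ball x₀ r) → Continuous (f ∘ c) := by
  obtain ⟨r, hr, h⟩ := Metric.eventually_nhds_iff_ball.1 hf.eventually_analyticAt
  refine ⟨r, hr, fun c hc => continuous_iff_continuousAt.2 fun s => ?_⟩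
  exact ContinuousAt.comp (h _ (hc s)).continuousAt c.continuous.continuousAt

/-- The composition operator of an analytic function is analytic at constant curves: its power
series is the pointwise one. -/
theorem analyticAt_nemytskii [CompleteSpace F] {f : E → F} {x₀ : E} (hf : AnalyticAt 𝕜 f x₀) :
    AnalyticAt 𝕜 (nemytskii (X := X) f) (ContinuousMap.const X x₀) := by
  obtain ⟨r₁, hr₁, hcont⟩ := exists_ball_continuous_comp (X := X) hf
  obtain ⟨P, r, hP⟩ := hf
  let Q : FormalMultilinearSeries 𝕜 C(X, E) C(X, F) := fun n => pointwiseMultilinear (P n)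
  have hrad : P.radius ≤ Q.radius :=
    FormalMultilinearSeries.radius_le_of_le fun n => norm_pointwiseMultilinear_le (P n)
  refine ⟨Q, min r (ENNReal.ofReal r₁), ⟨((min_le_left _ _).trans hP.r_le).trans hrad,
    lt_min hP.r_pos (by simpa using hr₁), ?_⟩⟩
  intro y hy
  rw [Metric.mem_eball] at hy
  have hy1 : edist y 0 < r := hy.trans_le (min_le_left _ _)
  have hy2 : edist y 0 < ENNReal.ofReal r₁ := hy.trans_le (min_le_right _ _)
  have hyn : ‖y‖ < r₁ := by
    rw [edist_dist, dist_zero_right] at hy2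
    exact (ENNReal.ofReal_lt_ofReal_iff hr₁).1 hy2
  have hsum : Summable fun n => Q n fun _ => y :=
    (Q.summable_norm_apply
      (Metric.mem_eball.2 (lt_of_lt_of_le hy1 (le_trans hP.r_le hrad)))).of_norm
  have hval : ∀ s, (∑' n, Q n fun _ => y) s = f (x₀ + y s) := by
    intro s
    have h1 := (ContinuousMap.evalCLM 𝕜 s : C(X, F) →L[𝕜] F).hasSum hsum.hasSum
    have e : (fun n => (ContinuousMap.evalCLM 𝕜 s : C(X, F) →L[𝕜] F) (Q n fun _ => y))
        = fun n => P n fun _ => y s :=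
      funext fun n => pointwiseMultilinear_apply (P n) _ s
    rw [e, ContinuousMap.evalCLM_apply] at h1
    refine h1.unique (hP.hasSum ?_)
    rw [Metric.mem_eball]
    refine lt_of_le_of_lt ?_ hy1
    rw [edist_dist, edist_dist, dist_zero_right, dist_zero_right]
    exact ENNReal.ofReal_le_ofReal (y.norm_coe_le_norm s)
  have heq : nemytskii f (ContinuousMap.const X x₀ + y) = ∑' n, Q n fun _ => y := by
    ext s
    rw [hval, nemytskii_apply]
    · rfl
    · refine hcont _ fun s => ?_
      simp only [ContinuousMap.add_apply, ContinuousMap.const_apply, Metric.mem_ball,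
        dist_self_add_left]
      exact (y.norm_coe_le_norm s).trans_lt hyn
  rw [heq]
  exact hsum.hasSum

end Nemytskii

section Curves

variable {X F : Type*} [TopologicalSpace X] [CompactSpace X] [NormedAddCommGroup F]
  [NormedSpace ℝ F]

/-- Evaluation of curves at a point. -/
noncomputable def evalCurve (s : X) : C(X, F) →L[ℝ] F :=
  LinearMap.mkContinuous
    { toFun := fun c => c s, map_add' := fun _ _ => rfl, map_smul' := fun _ _ => rfl } 1
    (fun c => by simpa using c.norm_coe_le_norm s)

/-- Points as constant curves. -/
noncomputable def constCurve : F →L[ℝ] C(X, F) :=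
  LinearMap.mkContinuous
    { toFun := fun x => ContinuousMap.const X x, map_add' := fun _ _ => rfl,
      map_smul' := fun _ _ => rfl } 1
    (fun x => (ContinuousMap.norm_le _ (by positivity)).2 fun s => by rw [one_mul]; exact le_rfl)

theorem constCurve_apply (x : F) : (constCurve x : C(X, F)) = ContinuousMap.const X x := rfl

end Curves

section LocalFlow

set_option linter.unusedSectionVars false

variable {E : Type*} [NormedAddCommGroup E] [NormedSpace ℝ E] [CompleteSpace E]

/-- Curves parametrized by `[-1, 1]`. -/
abbrev UnitCurve (E : Type*) [TopologicalSpace E] := C(Set.Icc (-1 : ℝ) 1, E)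

/-- A curve on `[-1, 1]`, continued by constants to the real line. -/
noncomputable def UnitCurve.ext (c : UnitCurve E) : ℝ → E := Set.IccExtend (by norm_num) c

theorem UnitCurve.ext_continuous (c : UnitCurve E) : Continuous c.ext :=
  c.continuous.Icc_extend'

theorem UnitCurve.ext_coe (c : UnitCurve E) (s : Set.Icc (-1 : ℝ) 1) : c.ext s = c s :=
  Set.IccExtend_val _ _ s

/-- The primitive `s ↦ ∫₀ˢ c` as an operator on curves. -/
noncomputable def primitiveCLM : UnitCurve E →L[ℝ] UnitCurve E :=
  LinearMap.mkContinuous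
    { toFun := fun c => ⟨fun s => ∫ u in (0 : ℝ)..s, c.ext u,
        (intervalIntegral.continuous_primitive
          (fun a b => c.ext_continuous.intervalIntegrable a b) 0).comp continuous_subtype_val⟩
      map_add' := fun c d => by
        ext s
        simp only [ContinuousMap.coe_mk, ContinuousMap.add_apply]
        rw [← intervalIntegral.integral_add (c.ext_continuous.intervalIntegrable _ _)
          (d.ext_continuous.intervalIntegrable _ _)]
        rfl
      map_smul' := fun a c => by
        ext s
        simp only [ContinuousMap.coe_mk, ContinuousMap.smul_apply, RingHom.id_apply]
        rw [← intervalIntegral.integral_smul]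
        rfl }
    1 (fun c => by
      refine (ContinuousMap.norm_le _ (by positivity)).2 fun s => ?_
      have h : ‖∫ u in (0 : ℝ)..s, c.ext u‖ ≤ ‖c‖ * |(s : ℝ) - 0| :=
        intervalIntegral.norm_integral_le_of_norm_le_const fun u _ => c.norm_coe_le_norm _
      have hs : |(s : ℝ) - 0| ≤ 1 := by
        rw [sub_zero]; exact abs_le.2 s.2
      calc _ ≤ ‖c‖ * |(s : ℝ) - 0| := h
        _ ≤ ‖c‖ * 1 := by gcongr
        _ = 1 * ‖c‖ := by ring)

theorem primitiveCLM_apply (c : UnitCurve E) (s : Set.Icc (-1 : ℝ) 1) :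
    primitiveCLM c s = ∫ u in (0 : ℝ)..s, c.ext u := rfl

/-- The map whose zeros `((x, τ), c)` are the solutions `c s = y (τ s)` of `y' = f y`, `y 0 = x`,
with time rescaled to `[-1, 1]`. -/
noncomputable def flowEquation (f : E → E) (v : (E × ℝ) × UnitCurve E) : UnitCurve E :=
  v.2 - constCurve v.1.1 - v.1.2 • primitiveCLM (nemytskii f v.2)

theorem analyticAt_flowEquation {f : E → E} {x₀ : E} (hf : AnalyticAt ℝ f x₀) :
    AnalyticAt ℝ (flowEquation f) ((x₀, 0), ContinuousMap.const _ x₀) := by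
  have hN : AnalyticAt ℝ (fun v : (E × ℝ) × UnitCurve E => nemytskii f v.2)
      ((x₀, 0), ContinuousMap.const _ x₀) :=
    AnalyticAt.fun_comp (analyticAt_nemytskii hf) analyticAt_snd
  have hV := (primitiveCLM (E := E)).analyticAt
    (nemytskii f (ContinuousMap.const (Set.Icc (-1 : ℝ) 1) x₀))
  have h1 : AnalyticAt ℝ (fun v : (E × ℝ) × UnitCurve E => primitiveCLM (nemytskii f v.2))
      ((x₀, 0), ContinuousMap.const _ x₀) :=
    AnalyticAt.fun_comp (g := fun c => primitiveCLM c)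
      (f := fun v : (E × ℝ) × UnitCurve E => nemytskii f v.2) hV hN
  have h2 : AnalyticAt ℝ (fun v : (E × ℝ) × UnitCurve E => (constCurve v.1.1 : UnitCurve E))
      ((x₀, 0), ContinuousMap.const _ x₀) :=
    AnalyticAt.fun_comp (g := fun x => (constCurve x : UnitCurve E))
      (f := fun v : (E × ℝ) × UnitCurve E => v.1.1)
      ((constCurve (X := Set.Icc (-1 : ℝ) 1) (F := E)).analyticAt _)
      (analyticAt_fst.fun_comp analyticAt_fst)
  have h3 : AnalyticAt ℝ (fun v : (E × ℝ) × UnitCurve E => v.1.2)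
      ((x₀, 0), ContinuousMap.const _ x₀) := analyticAt_snd.fun_comp analyticAt_fst
  exact (analyticAt_snd.sub h2).sub (h3.smul h1)

theorem flowEquation_eq_zero_iff {f : E → E} {x : E} {τ : ℝ} {c : UnitCurve E}
    (hc : Continuous (f ∘ c)) :
    flowEquation f ((x, τ), c) = 0 ↔
      ∀ s : Set.Icc (-1 : ℝ) 1, c s = x + τ • ∫ u in (0 : ℝ)..s, f (c.ext u) := by
  have hext : ∀ u, UnitCurve.ext (nemytskii f c) u = f (c.ext u) := fun _ =>
    nemytskii_apply hc _
  constructor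
  · intro h s
    have := congrArg (fun d : UnitCurve E => d s) h
    simp only [flowEquation, ContinuousMap.sub_apply, ContinuousMap.smul_apply,
      primitiveCLM_apply, constCurve_apply, ContinuousMap.const_apply, hext,
      ContinuousMap.zero_apply] at this
    rw [sub_sub, sub_eq_zero] at this
    exact this
  · intro h
    ext s
    simp only [flowEquation, ContinuousMap.sub_apply, ContinuousMap.smul_apply,
      primitiveCLM_apply, constCurve_apply, ContinuousMap.const_apply, hext,
      ContinuousMap.zero_apply]
    rw [sub_sub, sub_eq_zero]
    exact h s

/-- A curve on `[-1, 1]`, slowed down by the factor `a ∈ [-1, 1]`. -/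
noncomputable def UnitCurve.rescale (c : UnitCurve E) (a : ℝ) : UnitCurve E :=
  ⟨fun s => c.ext (a * s), c.ext_continuous.comp (by fun_prop)⟩

theorem UnitCurve.ext_of_mem (c : UnitCurve E) {s : ℝ} (hs : s ∈ Set.Icc (-1 : ℝ) 1) :
    c.ext s = c ⟨s, hs⟩ := c.ext_coe ⟨s, hs⟩

theorem mul_mem_Icc_neg_one {a s : ℝ} (ha : a ∈ Set.Icc (-1 : ℝ) 1)
    (hs : s ∈ Set.Icc (-1 : ℝ) 1) : a * s ∈ Set.Icc (-1 : ℝ) 1 := by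
  rw [Set.mem_Icc, ← abs_le] at *
  rw [abs_mul]
  exact mul_le_one₀ ha (abs_nonneg _) hs

theorem UnitCurve.rescale_ext (c : UnitCurve E) {a s : ℝ}
    (hs : s ∈ Set.Icc (-1 : ℝ) 1) : (c.rescale a).ext s = c.ext (a * s) :=
  (c.rescale a).ext_of_mem hs

/-- An analytic vector field has an analytic local flow. The curve `s ↦ φ (x, τ s)`, `|s| ≤ 1`,
is obtained from the implicit function theorem in the Banach space of continuous curves. -/
theorem exists_analytic_local_flow {f : E → E} {x₀ : E} (hf : AnalyticAt ℝ f x₀) {U : Set E}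
    (hU : U ∈ 𝓝 x₀) :
    ∃ φ : E × ℝ → E, ∃ ε > 0,
      AnalyticOnNhd ℝ φ (Metric.ball x₀ ε ×ˢ Set.Ioo (-ε) ε) ∧
      (∀ x ∈ Metric.ball x₀ ε, φ (x, 0) = x) ∧
      ∀ x ∈ Metric.ball x₀ ε, ∀ t ∈ Set.Ioo (-ε) ε,
        φ (x, t) ∈ U ∧ HasDerivAt (fun t => φ (x, t)) (f (φ (x, t))) t := by
  set c₀ : UnitCurve E := ContinuousMap.const _ x₀ with hc₀
  obtain ⟨r, hr, hcont⟩ := exists_ball_continuous_comp (X := Set.Icc (-1 : ℝ) 1) hf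
  have hG : ContDiffAt ℝ ω (flowEquation f) ((x₀, 0), c₀) :=
    (analyticAt_flowEquation hf).contDiffAt
  have hinr : (fderiv ℝ (flowEquation f) ((x₀, 0), c₀) ∘L .inr ℝ (E × ℝ) (UnitCurve E))
      = ContinuousLinearMap.id ℝ _ := by
    have h1 : HasFDerivAt (fun c : UnitCurve E => flowEquation f ((x₀, 0), c))
        (fderiv ℝ (flowEquation f) ((x₀, 0), c₀) ∘L .inr ℝ (E × ℝ) (UnitCurve E)) c₀ :=
      HasFDerivAt.comp c₀ (hG.differentiableAt (by simp)).hasFDerivAt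
        (hasFDerivAt_prodMk_right (x₀, (0 : ℝ)) c₀)
    have h2 : HasFDerivAt (fun c : UnitCurve E => flowEquation f ((x₀, 0), c))
        (ContinuousLinearMap.id ℝ _) c₀ := by
      have : (fun c : UnitCurve E => flowEquation f ((x₀, 0), c))
          = fun c => c - constCurve x₀ := by
        ext1 c
        simp [flowEquation]
      rw [this]
      exact (hasFDerivAt_id c₀).sub_const _
    exact h1.unique h2
  have hinv : (fderiv ℝ (flowEquation f) ((x₀, 0), c₀) ∘L
      .inr ℝ (E × ℝ) (UnitCurve E)).IsInvertible := by
    rw [hinr]; exact ⟨ContinuousLinearEquiv.refl ℝ _, rfl⟩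
  have hω : (ω : WithTop ℕ∞) ≠ 0 := by simp
  set ψ := hG.implicitFunction hω hinv with hψ
  have hψa : AnalyticAt ℝ ψ (x₀, 0) := (hG.contDiffAt_implicitFunction hω hinv).analyticAt
  have hψ0 : ψ (x₀, 0) = c₀ := hG.implicitFunction_apply_self hω hinv
  have hG0 : flowEquation f ((x₀, 0), c₀) = 0 := by
    simp [flowEquation, hc₀, constCurve_apply]
  have hev := hG.eventually_apply_eq_iff_implicitFunction hω hinv
  rw [hG0] at hev
  obtain ⟨r₂, hr₂, hev⟩ := Metric.eventually_nhds_iff_ball.1 hev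
  obtain ⟨rU, hrU, hrU'⟩ := Metric.mem_nhds_iff.1 hU
  set r₃ := min r (min r₂ rU) with hr₃
  have hr₃0 : 0 < r₃ := by positivity
  have hψc : ∀ᶠ p in 𝓝 (x₀, (0 : ℝ)), ψ p ∈ Metric.ball c₀ r₃ := by
    have := hψa.continuousAt
    rw [ContinuousAt, hψ0] at this
    exact this (Metric.ball_mem_nhds _ hr₃0)
  obtain ⟨r₄, hr₄, hgood⟩ := Metric.eventually_nhds_iff_ball.1
    (hψc.and hψa.eventually_analyticAt)
  set δ := min r₄ r₂ with hδ
  have hδ0 : 0 < δ := by positivity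
  have hball : ∀ x ∈ Metric.ball x₀ δ, ∀ t ∈ Set.Ioo (-δ) δ,
      (x, t) ∈ Metric.ball (x₀, (0 : ℝ)) δ := by
    intro x hx t ht
    rw [Metric.mem_ball, Prod.dist_eq, max_lt_iff]
    refine ⟨hx, ?_⟩
    simpa [abs_lt] using ht
  have hclose : ∀ c ∈ Metric.ball c₀ r₃, ∀ s, c s ∈ Metric.ball x₀ r₃ := fun c hc s =>
    (ContinuousMap.dist_apply_le_dist s).trans_lt hc
  have hsol : ∀ p ∈ Metric.ball (x₀, (0 : ℝ)) δ, ∀ c ∈ Metric.ball c₀ r₃,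
      flowEquation f (p, c) = 0 ↔ ψ p = c := by
    intro p hp c hc
    refine hev (p, c) ?_
    rw [Metric.mem_ball, Prod.dist_eq, max_lt_iff]
    exact ⟨lt_of_lt_of_le hp (min_le_right _ _),
      lt_of_lt_of_le hc ((min_le_right _ _).trans (min_le_left _ _))⟩
  have hψball : ∀ p ∈ Metric.ball (x₀, (0 : ℝ)) δ, ψ p ∈ Metric.ball c₀ r₃ := fun p hp =>
    (hgood p (Metric.ball_subset_ball (min_le_left _ _) hp)).1
  have hcont' : ∀ c ∈ Metric.ball c₀ r₃, Continuous (f ∘ c) := fun c hc =>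
    hcont c fun s => Metric.ball_subset_ball (min_le_left _ _) (hclose c hc s)
  have hone : (1 : ℝ) ∈ Set.Icc (-1 : ℝ) 1 := by norm_num
  -- the curve for the time `a τ` is the rescaled curve for the time `τ`
  have hresc : ∀ x ∈ Metric.ball x₀ δ, ∀ τ ∈ Set.Ioo (-δ) δ, ∀ a ∈ Set.Icc (-1 : ℝ) 1,
      ψ (x, a * τ) = (ψ (x, τ)).rescale a := by
    intro x hx τ hτ a ha
    have haτ : a * τ ∈ Set.Ioo (-δ) δ := by
      rw [Set.mem_Ioo, ← abs_lt] at *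
      rw [abs_mul]
      rw [Set.mem_Icc, ← abs_le] at ha
      calc |a| * |τ| ≤ 1 * |τ| := by gcongr
        _ < δ := by simpa using hτ
    have hp := hball x hx τ hτ
    have hc := hψball _ hp
    have hcc : (ψ (x, τ)).rescale a ∈ Metric.ball c₀ r₃ := by
      refine (ContinuousMap.dist_lt_iff hr₃0).2 fun s => ?_
      have : (ψ (x, τ)).rescale a s
          = ψ (x, τ) ⟨a * s, mul_mem_Icc_neg_one ha s.2⟩ :=
        (ψ (x, τ)).ext_of_mem (mul_mem_Icc_neg_one ha s.2)
      rw [this]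
      exact hclose _ hc _
    refine (hsol _ (hball x hx _ haτ) _ hcc).1 ((flowEquation_eq_zero_iff (hcont' _ hcc)).2 ?_)
    intro s
    have h0 := (flowEquation_eq_zero_iff (hcont' _ hc)).1 ((hsol _ hp _ hc).2 rfl)
      ⟨a * s, mul_mem_Icc_neg_one ha s.2⟩
    have h1 : (ψ (x, τ)).rescale a s = ψ (x, τ) ⟨a * s, mul_mem_Icc_neg_one ha s.2⟩ :=
      (ψ (x, τ)).ext_of_mem (mul_mem_Icc_neg_one ha s.2)
    rw [h1, h0]
    have h2 : ∫ u in (0 : ℝ)..s, f (((ψ (x, τ)).rescale a).ext u)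
        = ∫ u in (0 : ℝ)..s, f ((ψ (x, τ)).ext (a * u)) := by
      refine intervalIntegral.integral_congr fun u hu => ?_
      have hu' : u ∈ Set.Icc (-1 : ℝ) 1 := by
        have := s.2
        refine (Set.uIcc_subset_Icc ?_ s.2) hu
        norm_num
      simp only [(ψ (x, τ)).rescale_ext hu']
    have h3 := intervalIntegral.smul_integral_comp_mul_left
      (fun u => f ((ψ (x, τ)).ext u)) a (a := 0) (b := (s : ℝ))
    rw [h2, mul_comm a τ, mul_smul, h3, mul_zero]
  refine ⟨fun p => ψ p ⟨1, hone⟩, δ / 2, by positivity, ?_, ?_, ?_⟩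
  · rintro ⟨x, t⟩ ⟨hx, ht⟩
    have hx' := Metric.ball_subset_ball (half_le_self hδ0.le) hx
    have ht' : t ∈ Set.Ioo (-δ) δ := ⟨by linarith [ht.1], by linarith [ht.2]⟩
    have := (hgood (x, t) (Metric.ball_subset_ball (min_le_left _ _) (hball x hx' t ht'))).2
    exact ((evalCurve (X := Set.Icc (-1 : ℝ) 1) (F := E) ⟨1, hone⟩).analyticAt _).fun_comp this
  · intro x hx
    have hx' := Metric.ball_subset_ball (half_le_self hδ0.le) hx
    have hp := hball x hx' 0 ⟨by linarith, hδ0⟩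
    have := (flowEquation_eq_zero_iff (hcont' _ (hψball _ hp))).1
      ((hsol _ hp _ (hψball _ hp)).2 rfl) ⟨1, hone⟩
    simpa using this
  · intro x hx t ht
    have hx' := Metric.ball_subset_ball (half_le_self hδ0.le) hx
    have hτ : δ / 2 ∈ Set.Ioo (-δ) δ := ⟨by linarith, by linarith⟩
    have hτ0 : δ / 2 ≠ 0 := by positivity
    have hp := hball x hx' _ hτ
    set c := ψ (x, δ / 2) with hcdef
    have hc : c ∈ Metric.ball c₀ r₃ := hψball _ hp
    have hint := (flowEquation_eq_zero_iff (hcont' _ hc)).1 ((hsol _ hp _ hc).2 rfl)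
    have hfc : Continuous fun u => f (c.ext u) := by
      exact Continuous.Icc_extend' (f := f ∘ c) (hcont' c hc)
    have hφ : ∀ t ∈ Set.Ioo (-(δ / 2)) (δ / 2), ψ (x, t) ⟨1, hone⟩
        = x + (δ / 2) • ∫ u in (0 : ℝ)..(t / (δ / 2)), f (c.ext u) := by
      intro t ht
      have ha : t / (δ / 2) ∈ Set.Icc (-1 : ℝ) 1 := by
        rw [Set.mem_Icc, ← abs_le, abs_div, abs_of_pos (by positivity : 0 < δ / 2),
          div_le_one (by positivity), abs_le]
        exact ⟨ht.1.le, ht.2.le⟩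
      have h1 := hresc x hx' _ hτ _ ha
      rw [div_mul_cancel₀ _ hτ0] at h1
      rw [h1, ← hint ⟨_, ha⟩]
      change c.ext (t / (δ / 2) * 1) = _
      rw [mul_one, c.ext_of_mem ha]
    have hφ' : ∀ t ∈ Set.Ioo (-(δ / 2)) (δ / 2), ψ (x, t) ⟨1, hone⟩ = c.ext (t / (δ / 2)) := by
      intro t ht
      have ha : t / (δ / 2) ∈ Set.Icc (-1 : ℝ) 1 := by
        rw [Set.mem_Icc, ← abs_le, abs_div, abs_of_pos (by positivity : 0 < δ / 2),
          div_le_one (by positivity), abs_le]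
        exact ⟨ht.1.le, ht.2.le⟩
      rw [hφ t ht, c.ext_of_mem ha, hint ⟨_, ha⟩]
    constructor
    · change ψ (x, t) ⟨1, hone⟩ ∈ U
      rw [hφ' t ht]
      refine hrU' (Metric.ball_subset_ball ((min_le_right _ _).trans (min_le_right _ _))
        (hclose c hc _))
    · have h1 : HasDerivAt (fun t => x + (δ / 2) • ∫ u in (0 : ℝ)..(t / (δ / 2)), f (c.ext u))
          (f (ψ (x, t) ⟨1, hone⟩)) t := by
        have h2 : HasDerivAt (fun s => ∫ u in (0 : ℝ)..s, f (c.ext u))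
            (f (c.ext (t / (δ / 2)))) (t / (δ / 2)) :=
          hfc.integral_hasStrictDerivAt 0 _ |>.hasDerivAt
        have h3 : HasDerivAt (fun t : ℝ => t / (δ / 2)) (1 / (δ / 2)) t :=
          (hasDerivAt_id t).div_const _
        have h4 := ((h2.scomp t h3).const_smul (δ / 2)).const_add x
        rw [hφ' t ht]
        rw [smul_smul, mul_one_div_cancel hτ0, one_smul] at h4
        exact h4
      refine h1.congr_of_eventuallyEq ?_
      filter_upwards [Ioo_mem_nhds ht.1 ht.2] with u hu using hφ u hu

end LocalFlow

/-! ### Uniqueness and continuation of solutions -/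

section Flow

variable {E : Type*} [NormedAddCommGroup E] [NormedSpace ℝ E]

theorem eventuallyEq_of_hasDerivAt {f : E → E} {x y : ℝ → E} {t₀ : ℝ}
    (hf : ContDiffAt ℝ 1 f (x t₀))
    (hx : ∀ᶠ t in 𝓝 t₀, HasDerivAt x (f (x t)) t) (hy : ∀ᶠ t in 𝓝 t₀, HasDerivAt y (f (y t)) t)
    (h : x t₀ = y t₀) : x =ᶠ[𝓝 t₀] y := by
  obtain ⟨K, s, hs, hK⟩ := hf.exists_lipschitzOnWith
  have hxs : ∀ᶠ t in 𝓝 t₀, x t ∈ s := hx.self_of_nhds.continuousAt hs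
  have hys : ∀ᶠ t in 𝓝 t₀, y t ∈ s := by
    rw [h] at hs
    exact hy.self_of_nhds.continuousAt hs
  exact ODE_solution_unique_of_eventually (v := fun _ => f) (s := fun _ => s) (K := K)
    (Eventually.of_forall fun _ => hK) (hx.and hxs) (hy.and hys) h

/-- Two solutions of an autonomous equation on an open interval agree if they agree at one time. -/
theorem eqOn_of_hasDerivAt {f : E → E} {x y : ℝ → E} {I : Set ℝ} (hI : IsOpen I)
    (hI' : IsPreconnected I) (hf : ∀ t ∈ I, ContDiffAt ℝ 1 f (x t))
    (hx : ∀ t ∈ I, HasDerivAt x (f (x t)) t) (hy : ∀ t ∈ I, HasDerivAt y (f (y t)) t)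
    {t₀ : ℝ} (ht₀ : t₀ ∈ I) (h : x t₀ = y t₀) : Set.EqOn x y I := by
  have hev : ∀ t ∈ I, x t = y t → x =ᶠ[𝓝 t] y := fun t ht hxy =>
    eventuallyEq_of_hasDerivAt (hf t ht)
      (by filter_upwards [hI.mem_nhds ht] with s hs using hx s hs)
      (by filter_upwards [hI.mem_nhds ht] with s hs using hy s hs) hxy
  have hu : IsOpen {t | x =ᶠ[𝓝 t] y} := isOpen_setOfPred_eventually_nhds
  have hxc : ContinuousOn x I := HasDerivAt.continuousOn hx
  have hyc : ContinuousOn y I := HasDerivAt.continuousOn hy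
  have hv : IsOpen (I ∩ {t | x t ≠ y t}) := by
    rw [isOpen_iff_mem_nhds]
    rintro t ⟨ht, hne⟩
    have hxt := hxc.continuousAt (hI.mem_nhds ht)
    have hyt := hyc.continuousAt (hI.mem_nhds ht)
    refine inter_mem (hI.mem_nhds ht) ?_
    filter_upwards [(hxt.sub hyt).eventually_ne (sub_ne_zero.2 hne)] with s hs
    exact sub_ne_zero.1 hs
  have hsub : I ⊆ {t | x =ᶠ[𝓝 t] y} := by
    refine hI'.subset_left_of_subset_union hu hv ?_ ?_ ⟨t₀, ht₀, hev t₀ ht₀ h⟩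
    · rw [Set.disjoint_left]
      rintro t ht ⟨-, hne⟩
      exact hne ht.self_of_nhds
    · intro t ht
      by_cases hxy : x t = y t
      · exact Or.inl (hev t ht hxy)
      · exact Or.inr ⟨ht, hxy⟩
  exact fun t ht => (hsub ht).self_of_nhds

/-- `Ψ` is an analytic flow of `f` with values in `U`, for initial points in the `ε`-ball about `x₀`
and times in `(-ε, b + ε)`. -/
structure IsFlowNear (f : E → E) (U : Set E) (x₀ : E) (b ε : ℝ) (Ψ : E × ℝ → E) : Prop where
  pos : 0 < ε
  analytic : AnalyticOnNhd ℝ Ψ (Metric.ball x₀ ε ×ˢ Set.Ioo (-ε) (b + ε))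
  initial : ∀ x ∈ Metric.ball x₀ ε, Ψ (x, 0) = x
  mem : ∀ x ∈ Metric.ball x₀ ε, ∀ t ∈ Set.Ioo (-ε) (b + ε), Ψ (x, t) ∈ U
  hasDerivAt : ∀ x ∈ Metric.ball x₀ ε, ∀ t ∈ Set.Ioo (-ε) (b + ε),
    HasDerivAt (fun t => Ψ (x, t)) (f (Ψ (x, t))) t

theorem IsFlowNear.mono {f : E → E} {U : Set E} {x₀ y₀ : E} {b b' ε δ : ℝ} {Ψ : E × ℝ → E}
    (h : IsFlowNear f U x₀ b ε Ψ) (hδ : 0 < δ) (hδε : δ ≤ ε) (hb : b' + δ ≤ b + ε)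
    (hy : Metric.ball y₀ δ ⊆ Metric.ball x₀ ε) : IsFlowNear f U y₀ b' δ Ψ := by
  have ht : Set.Ioo (-δ) (b' + δ) ⊆ Set.Ioo (-ε) (b + ε) :=
    Set.Ioo_subset_Ioo (by linarith) hb
  exact ⟨hδ, h.analytic.mono (Set.prod_mono hy ht), fun x hx => h.initial x (hy hx),
    fun x hx t hxt => h.mem x (hy hx) t (ht hxt),
    fun x hx t hxt => h.hasDerivAt x (hy hx) t (ht hxt)⟩

/-- Concatenation: a flow up to time `b` followed by a local flow near the point reached. -/
theorem IsFlowNear.extend {f : E → E} {U : Set E} (hf : ∀ x ∈ U, ContDiffAt ℝ 1 f x)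
    {x₀ y₀ : E} {b b' ε η : ℝ} {Ψ φ : E × ℝ → E} (hb : 0 ≤ b)
    (h : IsFlowNear f U x₀ b ε Ψ) (hy : Ψ (x₀, b) = y₀) (hφ : IsFlowNear f U y₀ 0 η φ)
    (hbb' : b ≤ b') (hb' : b' < b + η) : ∃ δ Ψ', IsFlowNear f U x₀ b' δ Ψ' := by
  have hε := h.pos
  have hη := hφ.pos
  have hbm : b ∈ Set.Ioo (-ε) (b + ε) := ⟨by linarith, by linarith⟩
  have hcont : ContinuousAt (fun x => Ψ (x, b)) x₀ :=
    ContinuousAt.comp (g := Ψ) (f := fun x => (x, b))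
      (h.analytic (x₀, b) ⟨Metric.mem_ball_self hε, hbm⟩).continuousAt (by fun_prop)
  obtain ⟨ρ, hρ, hρ'⟩ := Metric.eventually_nhds_iff_ball.1
    (hcont.eventually_mem (Metric.ball_mem_nhds _ hη))
  rw [hy] at hρ'
  set κ := min ε η with hκ
  have hκ0 : 0 < κ := by positivity
  set δ := min (min ρ κ) (b + η - b') with hδ
  have hδ0 : 0 < δ := by
    have : 0 < b + η - b' := by linarith
    positivity
  have hδρ : δ ≤ ρ := (min_le_left _ _).trans (min_le_left _ _)
  have hδκ : δ ≤ κ := (min_le_left _ _).trans (min_le_right _ _)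
  have hκε : κ ≤ ε := min_le_left _ _
  have hκη : κ ≤ η := min_le_right _ _
  have hδb : δ ≤ b + η - b' := min_le_right _ _
  have hbε : Metric.ball x₀ δ ⊆ Metric.ball x₀ ε := Metric.ball_subset_ball (hδκ.trans hκε)
  have hbΨ : ∀ x ∈ Metric.ball x₀ δ, Ψ (x, b) ∈ Metric.ball y₀ η := fun x hx =>
    hρ' x (Metric.ball_subset_ball hδρ hx)
  have hagree : ∀ x ∈ Metric.ball x₀ δ, ∀ t ∈ Set.Ioo (b - κ) (b + κ),
      Ψ (x, t) = φ (Ψ (x, b), t - b) := by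
    intro x hx
    refine eqOn_of_hasDerivAt (f := f) isOpen_Ioo isPreconnected_Ioo (fun t ht => hf _ ?_) ?_ ?_
      (t₀ := b) ⟨by linarith, by linarith⟩ ?_
    · exact h.mem x (hbε hx) t ⟨by linarith [ht.1], by linarith [ht.2]⟩
    · exact fun t ht => h.hasDerivAt x (hbε hx) t ⟨by linarith [ht.1], by linarith [ht.2]⟩
    · intro t ht
      have := hφ.hasDerivAt _ (hbΨ x hx) (t - b) ⟨by linarith [ht.1], by linarith [ht.2]⟩
      exact this.comp_sub_const t b
    · simp [hφ.initial _ (hbΨ x hx)]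
  let Ψ' : E × ℝ → E := fun p => if p.2 < b then Ψ p else φ (Ψ (p.1, b), p.2 - b)
  have hΨ1 : ∀ x, ∀ t < b, Ψ' (x, t) = Ψ (x, t) := fun x t ht => if_pos ht
  have hΨ2 : ∀ x ∈ Metric.ball x₀ δ, ∀ t > b - κ, Ψ' (x, t) = φ (Ψ (x, b), t - b) := by
    intro x hx t ht
    by_cases htb : t < b
    · rw [hΨ1 x t htb]
      exact hagree x hx t ⟨ht, by linarith⟩
    · exact if_neg htb
  refine ⟨δ, Ψ', hδ0, ?_, ?_, ?_, ?_⟩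
  · rintro ⟨x, t⟩ ⟨hx, ht⟩
    simp only at hx ht
    by_cases htb : t < b
    · have h1 := h.analytic (x, t) ⟨hbε hx, by linarith [ht.1], by linarith⟩
      refine h1.congr ?_
      have : {p : E × ℝ | p.2 < b} ∈ 𝓝 (x, t) :=
        (isOpen_Iio.preimage continuous_snd).mem_nhds htb
      filter_upwards [this] with p hp
      exact (hΨ1 p.1 p.2 hp).symm
    · have h1 : AnalyticAt ℝ (fun p : E × ℝ => φ (Ψ (p.1, b), p.2 - b)) (x, t) := by
        refine AnalyticAt.comp (g := φ) (f := fun p : E × ℝ => (Ψ (p.1, b), p.2 - b))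
          (hφ.analytic _ ⟨hbΨ x hx, ?_⟩) ?_
        · simp only [Set.mem_Ioo]
          exact ⟨by linarith, by linarith [ht.2]⟩
        · refine AnalyticAt.prod ?_ (analyticAt_snd.sub analyticAt_const)
          exact AnalyticAt.comp (g := Ψ) (f := fun p : E × ℝ => (p.1, b))
            (h.analytic _ ⟨hbε hx, hbm⟩) (analyticAt_fst.prod analyticAt_const)
      refine h1.congr ?_
      have : Metric.ball x₀ δ ×ˢ Set.Ioi (b - κ) ∈ 𝓝 (x, t) :=
        (Metric.isOpen_ball.prod isOpen_Ioi).mem_nhds ⟨hx, by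
          simp only [Set.mem_Ioi]; linarith⟩
      filter_upwards [this] with p hp
      exact (hΨ2 p.1 hp.1 p.2 hp.2).symm
  · intro x hx
    rcases hb.lt_or_eq with hb0 | hb0
    · rw [hΨ1 x 0 hb0, h.initial x (hbε hx)]
    · rw [hΨ2 x hx 0 (by linarith), ← hb0, h.initial x (hbε hx), sub_zero]
      refine hφ.initial x ?_
      have := hbΨ x hx
      rwa [← hb0, h.initial x (hbε hx)] at this
  · intro x hx t ht
    by_cases htb : t < b
    · rw [hΨ1 x t htb]
      exact h.mem x (hbε hx) t ⟨by linarith [ht.1], by linarith⟩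
    · rw [hΨ2 x hx t (by linarith)]
      exact hφ.mem _ (hbΨ x hx) _ ⟨by linarith, by linarith [ht.2]⟩
  · intro x hx t ht
    by_cases htb : t < b
    · rw [hΨ1 x t htb]
      refine (h.hasDerivAt x (hbε hx) t ⟨by linarith [ht.1], by linarith⟩).congr_of_eventuallyEq ?_
      filter_upwards [Iio_mem_nhds htb] with s hs using hΨ1 x s hs
    · rw [hΨ2 x hx t (by linarith)]
      have h1 := hφ.hasDerivAt _ (hbΨ x hx) (t - b) ⟨by linarith, by linarith [ht.2]⟩
      refine (h1.comp_sub_const t b).congr_of_eventuallyEq ?_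
      filter_upwards [Ioi_mem_nhds (show b - κ < t by linarith)] with s hs using hΨ2 x hx s hs

/-- The flow of an analytic vector field is defined and analytic near a given solution. -/
theorem exists_isFlowNear [CompleteSpace E] {f : E → E} {U : Set E} (hU : IsOpen U)
    (hf : ∀ x ∈ U, AnalyticAt ℝ f x) {c : ℝ → E} (hcU : ∀ t, c t ∈ U)
    (hc : ∀ t, HasDerivAt c (f (c t)) t) {b : ℝ} (hb : 0 ≤ b) :
    ∃ ε Ψ, IsFlowNear f U (c 0) b ε Ψ := by
  have hcc : Continuous c := continuous_iff_continuousAt.2 fun t => (hc t).continuousAt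
  have hf1 : ∀ x ∈ U, ContDiffAt ℝ 1 f x := fun x hx => (hf x hx).contDiffAt
  have hloc : ∀ x ∈ U, ∃ η φ, IsFlowNear f U x 0 η φ := by
    intro x hx
    obtain ⟨φ, ε, hε, h1, h2, h3⟩ := exists_analytic_local_flow (hf x hx) (hU.mem_nhds hx)
    refine ⟨ε, φ, hε, by simpa using h1, h2, ?_, ?_⟩
    · intro y hy t ht
      exact (h3 y hy t (by simpa using ht)).1
    · intro y hy t ht
      exact (h3 y hy t (by simpa using ht)).2
  have hunif : ∃ η > 0, ∀ x ∈ c '' Set.Icc 0 b, ∃ φ, IsFlowNear f U x 0 η φ := by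
    refine (isCompact_Icc.image hcc).induction_on
      (p := fun S => ∃ η > 0, ∀ x ∈ S, ∃ φ, IsFlowNear f U x 0 η φ) ⟨1, one_pos, by simp⟩ ?_ ?_ ?_
    · rintro S S' hS ⟨η, hη, h⟩
      exact ⟨η, hη, fun x hx => h x (hS hx)⟩
    · rintro S S' ⟨η, hη, h⟩ ⟨η', hη', h'⟩
      refine ⟨min η η', lt_min hη hη', ?_⟩
      rintro x (hx | hx)
      · obtain ⟨φ, hφ⟩ := h x hx
        exact ⟨φ, hφ.mono (lt_min hη hη') (min_le_left _ _) (by simp)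
          (Metric.ball_subset_ball (min_le_left _ _))⟩
      · obtain ⟨φ, hφ⟩ := h' x hx
        exact ⟨φ, hφ.mono (lt_min hη hη') (min_le_right _ _) (by simp)
          (Metric.ball_subset_ball (min_le_right _ _))⟩
    · rintro x ⟨t, -, rfl⟩
      obtain ⟨η, φ, hφ⟩ := hloc _ (hcU t)
      have hη := hφ.pos
      refine ⟨Metric.ball (c t) (η / 2),
        mem_nhdsWithin_of_mem_nhds (Metric.ball_mem_nhds _ (by positivity)), η / 2,
        by positivity, fun y hy => ⟨φ, hφ.mono (by positivity) (by linarith) (by linarith) ?_⟩⟩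
      refine Metric.ball_subset_ball' ?_
      rw [Metric.mem_ball] at hy
      linarith
  obtain ⟨η, hη, hunif⟩ := hunif
  have key : ∀ k : ℕ, ∃ ε Ψ, IsFlowNear f U (c 0) (min b (k * (η / 2))) ε Ψ := by
    intro k
    induction k with
    | zero =>
      obtain ⟨φ, hφ⟩ := hunif (c 0) ⟨0, ⟨le_rfl, hb⟩, rfl⟩
      exact ⟨η, φ, by simpa [min_eq_right hb] using hφ⟩
    | succ k ih =>
      obtain ⟨ε, Ψ, h⟩ := ih
      set b₁ := min b (k * (η / 2)) with hb₁
      have hb₁0 : 0 ≤ b₁ := by positivity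
      obtain ⟨φ, hφ⟩ := hunif (c b₁) ⟨b₁, ⟨hb₁0, min_le_left _ _⟩, rfl⟩
      have hε := h.pos
      have hval : Ψ (c 0, b₁) = c b₁ := by
        have h0 := Metric.mem_ball_self (x := c 0) hε
        refine eqOn_of_hasDerivAt (f := f) (x := fun t => Ψ (c 0, t)) (y := c)
          (I := Set.Ioo (-ε) (b₁ + ε)) isOpen_Ioo isPreconnected_Ioo
          (fun t ht => hf1 _ (h.mem _ h0 t ht)) (fun t ht => h.hasDerivAt _ h0 t ht)
          (fun t _ => hc t) (t₀ := 0) ⟨by linarith, by linarith⟩ (h.initial _ h0)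
          ⟨by linarith, by linarith⟩
      refine IsFlowNear.extend hf1 hb₁0 h hval hφ ?_ ?_
      · refine min_le_min_left _ ?_
        push_cast
        nlinarith
      · rw [hb₁]
        rcases le_total b (k * (η / 2)) with hle | hle
        · rw [min_eq_left hle]
          exact (min_le_left _ _).trans_lt (by linarith)
        · rw [min_eq_right hle]
          refine (min_le_right _ _).trans_lt ?_
          push_cast
          linarith
  obtain ⟨k, hk⟩ := exists_nat_ge (b / (η / 2))
  have := key k
  rwa [min_eq_left] at this
  rwa [div_le_iff₀ (by positivity)] at hk

end Flow

/-! ### Periodic continuation -/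

section PeriodicExtension

variable {F : Type*}

/-- The continuation of `u`, given on a neighbourhood of `[0, T]`, to all times by the rule
`u (t + T) = σ (u t)`. -/
noncomputable def periodicExtension (T : ℝ) (σ : Equiv.Perm F) (u : ℝ → F) (t : ℝ) : F :=
  (σ ^ ⌊t / T⌋) (u (t - ⌊t / T⌋ * T))

theorem periodicExtension_eq {T ε : ℝ} (hT : 0 < T) (hεT : ε < T) {σ : Equiv.Perm F} {u : ℝ → F}
    (h : ∀ s ∈ Set.Ioo (-ε) ε, u (s + T) = σ (u s)) {t : ℝ} (j : ℤ)
    (ht : t - j * T ∈ Set.Ioo (-ε) (T + ε)) :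
    periodicExtension T σ u t = (σ ^ j) (u (t - j * T)) := by
  unfold periodicExtension
  set k := ⌊t / T⌋ with hk
  have h1 : (k : ℝ) * T ≤ t := by
    have := Int.floor_le (t / T)
    rwa [← hk, le_div_iff₀ hT] at this
  have h2 : t < (k + 1 : ℝ) * T := by
    have := Int.lt_floor_add_one (t / T)
    rwa [← hk, div_lt_iff₀ hT] at this
  obtain ⟨h3, h4⟩ := ht
  have hlo : j - 1 ≤ k := by
    by_contra hlt
    have : (k : ℝ) + 2 ≤ j := by
      have : k + 2 ≤ j := by omega
      exact_mod_cast this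
    nlinarith
  have hhi : k ≤ j + 1 := by
    by_contra hlt
    have : (j : ℝ) + 2 ≤ k := by
      have : j + 2 ≤ k := by omega
      exact_mod_cast this
    nlinarith
  rcases (by omega : k = j - 1 ∨ k = j ∨ k = j + 1) with hkj | hkj | hkj
  · have hkr : (k : ℝ) = j - 1 := by rw [hkj]; push_cast; ring
    have := h (t - j * T) ⟨h3, by nlinarith⟩
    rw [show t - k * T = t - j * T + T by rw [hkr]; ring, this, ← Equiv.Perm.mul_apply,
      ← zpow_add_one, hkj, sub_add_cancel]
  · rw [hkj]
  · have hkr : (k : ℝ) = j + 1 := by rw [hkj]; push_cast; ring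
    have := h (t - k * T) ⟨by nlinarith, by nlinarith⟩
    rw [show t - j * T = t - k * T + T by rw [hkr]; ring, this, ← Equiv.Perm.mul_apply,
      ← zpow_add_one, hkj]

theorem exists_int_sub_mul_mem {T : ℝ} (hT : 0 < T) (t : ℝ) :
    ∃ j : ℤ, t - j * T ∈ Set.Ico 0 T := by
  refine ⟨⌊t / T⌋, ?_, ?_⟩
  · have := Int.floor_le (t / T)
    rw [le_div_iff₀ hT] at this
    linarith
  · have := Int.lt_floor_add_one (t / T)
    rw [div_lt_iff₀ hT] at this
    linarith

theorem periodicExtension_add {T ε : ℝ} (hT : 0 < T) (hε : 0 < ε) (hεT : ε < T)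
    {σ : Equiv.Perm F} {u : ℝ → F} (h : ∀ s ∈ Set.Ioo (-ε) ε, u (s + T) = σ (u s)) (t : ℝ) :
    periodicExtension T σ u (t + T) = σ (periodicExtension T σ u t) := by
  obtain ⟨j, hj⟩ := exists_int_sub_mul_mem hT t
  have h1 := periodicExtension_eq hT hεT h (t := t) j ⟨by linarith [hj.1], by linarith [hj.2]⟩
  have e : t + T - ((j + 1 : ℤ) : ℝ) * T = t - j * T := by push_cast; ring
  have h2 := periodicExtension_eq hT hεT h (t := t + T) (j + 1)
    (by rw [e]; exact ⟨by linarith [hj.1], by linarith [hj.2]⟩)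
  rw [h1, h2, e, add_comm j 1, zpow_one_add, Equiv.Perm.mul_apply]

end PeriodicExtension

/-! ### Kepler's equation and the anomalies -/

theorem one_sub_mul_cos_pos {e : ℝ} (he : |e| < 1) (E : ℝ) : 0 < 1 - e * Real.cos E := by
  have h : |e * Real.cos E| < 1 := by
    rw [abs_mul]
    calc |e| * |Real.cos E| ≤ |e| * 1 := by gcongr; exact Real.abs_cos_le_one E
      _ < 1 := by simpa using he
  linarith [(abs_lt.1 h).2]

theorem hasDerivAt_kepler (e E : ℝ) :
    HasDerivAt (fun E : ℝ => E - e * Real.sin E) (1 - e * Real.cos E) E :=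
  (hasDerivAt_id E).sub ((Real.hasDerivAt_sin E).const_mul e)

theorem kepler_injective {e : ℝ} (he : |e| < 1) :
    Function.Injective fun E : ℝ => E - e * Real.sin E := by
  refine (strictMono_of_deriv_pos fun E => ?_).injective
  rw [(hasDerivAt_kepler e E).deriv]
  exact one_sub_mul_cos_pos he E

theorem eccAnomaly_eq {e l E : ℝ} (he : |e| < 1) (h : E - e * Real.sin E = l) :
    eccAnomaly e l = E :=
  kepler_injective he ((eccAnomaly_spec he l).trans h.symm)

theorem eccAnomaly_neg {e : ℝ} (he : |e| < 1) (l : ℝ) : eccAnomaly e (-l) = -eccAnomaly e l := by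
  refine eccAnomaly_eq he ?_
  rw [Real.sin_neg]
  linarith [eccAnomaly_spec he l]

theorem eccAnomaly_add {e : ℝ} (he : |e| < 1) (l : ℝ) (j : ℤ) :
    eccAnomaly e (l + 2 * Real.pi * j) = eccAnomaly e l + 2 * Real.pi * j := by
  refine eccAnomaly_eq he ?_
  rw [show eccAnomaly e l + 2 * Real.pi * j = eccAnomaly e l + j * (2 * Real.pi) by ring,
    Real.sin_add_int_mul_two_pi]
  linarith [eccAnomaly_spec he l]

theorem contDiffAt_eccAnomaly {e : ℝ} (he : |e| < 1) (l : ℝ) :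
    ContDiffAt ℝ ω (fun p : ℝ × ℝ => eccAnomaly p.1 p.2) (e, l) := by
  let f : (ℝ × ℝ) × ℝ → ℝ := fun v => v.2 - v.1.1 * Real.sin v.2 - v.1.2
  set u : (ℝ × ℝ) × ℝ := ((e, l), eccAnomaly e l) with hu
  have hf : ContDiffAt ℝ ω f u := by fun_prop
  have hfu : f u = 0 := by
    simp only [f, hu]
    linarith [eccAnomaly_spec he l]
  have hω : (ω : WithTop ℕ∞) ≠ 0 := by simp
  have h1 : HasFDerivAt (fun E : ℝ => f ((e, l), E))
      (fderiv ℝ f u ∘L .inr ℝ (ℝ × ℝ) ℝ) (eccAnomaly e l) :=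
    HasFDerivAt.comp (eccAnomaly e l) (hf.differentiableAt (by simp)).hasFDerivAt
      (hasFDerivAt_prodMk_right (e, l) (eccAnomaly e l))
  have h2 : HasFDerivAt (fun E : ℝ => f ((e, l), E)) _ (eccAnomaly e l) :=
    ((hasDerivAt_kepler e (eccAnomaly e l)).sub_const l).hasFDerivAt
  have hinv : (fderiv ℝ f u ∘L .inr ℝ (ℝ × ℝ) ℝ).IsInvertible := by
    rw [h1.unique h2]
    refine ⟨ContinuousLinearEquiv.unitsEquivAut ℝ
      (Units.mk0 _ (one_sub_mul_cos_pos he (eccAnomaly e l)).ne'), ?_⟩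
    ext
    simp
  have h3 := hf.contDiffAt_implicitFunction hω hinv
  refine h3.congr_of_eventuallyEq ?_
  have h4 := hf.eventually_apply_implicitFunction hω hinv
  have h5 : ∀ᶠ p : ℝ × ℝ in 𝓝 (e, l), |p.1| < 1 :=
    (isOpen_lt (by fun_prop) continuous_const).mem_nhds he
  filter_upwards [h4, h5] with p hp hp1
  rw [hfu] at hp
  refine eccAnomaly_eq hp1 ?_
  simp only [f] at hp
  linarith

theorem sqrt_one_sub_sq_pos {e : ℝ} (he : |e| < 1) : 0 < Real.sqrt (1 - e ^ 2) := by
  rw [Real.sqrt_pos]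
  nlinarith [abs_lt.1 he, sq_abs e, abs_nonneg e]

theorem sq_sqrt_one_sub_sq {e : ℝ} (he : |e| < 1) : Real.sqrt (1 - e ^ 2) ^ 2 = 1 - e ^ 2 := by
  rw [Real.sq_sqrt]
  nlinarith [abs_lt.1 he, sq_abs e, abs_nonneg e]

theorem norm_trueAnomaly_point {e : ℝ} (he : |e| < 1) (E : ℝ) :
    ‖(⟨Real.cos E - e, Real.sqrt (1 - e ^ 2) * Real.sin E⟩ : ℂ)‖ = 1 - e * Real.cos E := by
  rw [Complex.norm_def, Complex.normSq_mk, Real.sqrt_eq_iff_mul_self_eq_of_pos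
    (one_sub_mul_cos_pos he E)]
  nlinarith [sq_sqrt_one_sub_sq he, Real.sin_sq_add_cos_sq E]

theorem cos_trueAnomaly {e : ℝ} (he : |e| < 1) (l : ℝ) :
    Real.cos (trueAnomaly e l)
      = (Real.cos (eccAnomaly e l) - e) / (1 - e * Real.cos (eccAnomaly e l)) := by
  have h := norm_trueAnomaly_point he (eccAnomaly e l)
  have hp := one_sub_mul_cos_pos he (eccAnomaly e l)
  rw [trueAnomaly, Complex.cos_arg, h]
  rw [← norm_pos_iff, h]
  exact hp

theorem sin_trueAnomaly {e : ℝ} (he : |e| < 1) (l : ℝ) :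
    Real.sin (trueAnomaly e l)
      = Real.sqrt (1 - e ^ 2) * Real.sin (eccAnomaly e l)
          / (1 - e * Real.cos (eccAnomaly e l)) := by
  rw [trueAnomaly, Complex.sin_arg, norm_trueAnomaly_point he (eccAnomaly e l)]

theorem radius_pos {a e : ℝ} (ha : 0 < a) (he : |e| < 1) (l : ℝ) : 0 < radius a e l :=
  mul_pos ha (one_sub_mul_cos_pos he _)

/-! ### The Hamiltonian in Delaunay variables -/

/-- States with `0 < G < L`. -/
def elliptic : Set State := {s | 0 < s 1 ∧ s 1 < s 0}

theorem isOpen_elliptic : IsOpen elliptic :=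
  (isOpen_lt continuous_const (continuous_apply 1)).inter
    (isOpen_lt (continuous_apply 1) (continuous_apply 0))

theorem elliptic_pos {s : State} (hs : s ∈ elliptic) : 0 < s 0 := hs.1.trans hs.2

theorem one_sub_sq_div_sq_pos {s : State} (hs : s ∈ elliptic) :
    0 < 1 - s 1 ^ 2 / s 0 ^ 2 := by
  have h0 := elliptic_pos hs
  rw [sub_pos, div_lt_one (by positivity)]
  exact pow_lt_pow_left₀ hs.2 hs.1.le two_ne_zero

theorem ecc_sq {s : State} (hs : s ∈ elliptic) : ecc s ^ 2 = 1 - s 1 ^ 2 / s 0 ^ 2 :=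
  Real.sq_sqrt (one_sub_sq_div_sq_pos hs).le

theorem abs_ecc_lt_one {s : State} (hs : s ∈ elliptic) : |ecc s| < 1 := by
  have h0 := elliptic_pos hs
  have h1 := ecc_sq hs
  have h2 : 0 < s 1 ^ 2 / s 0 ^ 2 := div_pos (pow_pos hs.1 2) (by positivity)
  rw [← sq_lt_one_iff_abs_lt_one]
  linarith

theorem sqrt_one_sub_ecc_sq {s : State} (hs : s ∈ elliptic) :
    Real.sqrt (1 - ecc s ^ 2) = s 1 / s 0 := by
  have h0 := elliptic_pos hs
  rw [ecc_sq hs, sub_sub_cancel, ← div_pow, Real.sqrt_sq (div_nonneg hs.1.le h0.le)]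

theorem polarR_pos {s : State} (hs : s ∈ elliptic) : 0 < polarR s :=
  radius_pos (pow_pos (elliptic_pos hs) 2) (abs_ecc_lt_one hs) _

theorem contDiffAt_ecc {s : State} (hs : s ∈ elliptic) : ContDiffAt ℝ ω ecc s := by
  have h0 := elliptic_pos hs
  unfold ecc
  refine ContDiffAt.sqrt ?_ (one_sub_sq_div_sq_pos hs).ne'
  fun_prop (disch := positivity)

theorem contDiffAt_eccAnomaly_state {s : State} (hs : s ∈ elliptic) :
    ContDiffAt ℝ ω (fun s : State => eccAnomaly (ecc s) (s 2)) s :=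
  ContDiffAt.comp (g := fun p : ℝ × ℝ => eccAnomaly p.1 p.2)
    (f := fun s : State => (ecc s, s 2)) s
    (contDiffAt_eccAnomaly (abs_ecc_lt_one hs) (s 2))
    ((contDiffAt_ecc hs).prodMk (by fun_prop))

theorem contDiffAt_polarR {s : State} (hs : s ∈ elliptic) : ContDiffAt ℝ ω polarR s := by
  have h1 := contDiffAt_eccAnomaly_state hs
  have h2 := contDiffAt_ecc hs
  unfold polarR radius
  fun_prop

theorem cos_polarTheta {s : State} (hs : s ∈ elliptic) :
    Real.cos (polarTheta s) =
      ((Real.cos (eccAnomaly (ecc s) (s 2)) - ecc s) * Real.cos (s 3)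
        - s 1 / s 0 * Real.sin (eccAnomaly (ecc s) (s 2)) * Real.sin (s 3))
      / (1 - ecc s * Real.cos (eccAnomaly (ecc s) (s 2))) := by
  have he := abs_ecc_lt_one hs
  rw [polarTheta, Real.cos_add, cos_trueAnomaly he, sin_trueAnomaly he, sqrt_one_sub_ecc_sq hs]
  ring

theorem sin_polarTheta {s : State} (hs : s ∈ elliptic) :
    Real.sin (polarTheta s) =
      (s 1 / s 0 * Real.sin (eccAnomaly (ecc s) (s 2)) * Real.cos (s 3)
        + (Real.cos (eccAnomaly (ecc s) (s 2)) - ecc s) * Real.sin (s 3))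
      / (1 - ecc s * Real.cos (eccAnomaly (ecc s) (s 2))) := by
  have he := abs_ecc_lt_one hs
  rw [polarTheta, Real.sin_add, cos_trueAnomaly he, sin_trueAnomaly he, sqrt_one_sub_ecc_sq hs]
  ring

theorem contDiffAt_cos_polarTheta {s : State} (hs : s ∈ elliptic) :
    ContDiffAt ℝ ω (fun s => Real.cos (polarTheta s)) s := by
  have h1 := contDiffAt_eccAnomaly_state hs
  have h2 := contDiffAt_ecc hs
  have h0 := (elliptic_pos hs).ne'
  have h3 := (one_sub_mul_cos_pos (abs_ecc_lt_one hs) (eccAnomaly (ecc s) (s 2))).ne'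
  refine ContDiffAt.congr_of_eventuallyEq ?_
    ((isOpen_elliptic.eventually_mem hs).mono fun _ => cos_polarTheta)
  fun_prop (disch := assumption)

theorem contDiffAt_sin_polarTheta {s : State} (hs : s ∈ elliptic) :
    ContDiffAt ℝ ω (fun s => Real.sin (polarTheta s)) s := by
  have h1 := contDiffAt_eccAnomaly_state hs
  have h2 := contDiffAt_ecc hs
  have h0 := (elliptic_pos hs).ne'
  have h3 := (one_sub_mul_cos_pos (abs_ecc_lt_one hs) (eccAnomaly (ecc s) (s 2))).ne'
  refine ContDiffAt.congr_of_eventuallyEq ?_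
    ((isOpen_elliptic.eventually_mem hs).mono fun _ => sin_polarTheta)
  fun_prop (disch := assumption)

theorem contDiffAt_posX {s : State} (hs : s ∈ elliptic) : ContDiffAt ℝ ω posX s :=
  (contDiffAt_polarR hs).mul (contDiffAt_cos_polarTheta hs)

theorem contDiffAt_posY {s : State} (hs : s ∈ elliptic) : ContDiffAt ℝ ω posY s :=
  (contDiffAt_polarR hs).mul (contDiffAt_sin_polarTheta hs)

theorem kinetic_energy {s : State} (hs : s ∈ elliptic) :
    (momX s ^ 2 + momY s ^ 2) / 2 + posY s * momX s - posX s * momY s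
      = -1 / (2 * s 0 ^ 2) - s 1 + 1 / polarR s := by
  have h0 := (elliptic_pos hs).ne'
  have hr := (polarR_pos hs).ne'
  have hd := (one_sub_mul_cos_pos (abs_ecc_lt_one hs) (eccAnomaly (ecc s) (s 2))).ne'
  have hsc := Real.sin_sq_add_cos_sq (polarTheta s)
  have h1 : (momX s ^ 2 + momY s ^ 2) / 2 + posY s * momX s - posX s * momY s
      = (radialMomentum s ^ 2 + (s 1 / polarR s) ^ 2) / 2 - s 1 := by
    have h2 : momX s ^ 2 + momY s ^ 2 = radialMomentum s ^ 2 + (s 1 / polarR s) ^ 2 := by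
      unfold momX momY
      linear_combination (radialMomentum s ^ 2 + (s 1 / polarR s) ^ 2) * hsc
    have h3 : posY s * momX s - posX s * momY s = -s 1 := by
      have h4 : polarR s * (s 1 / polarR s) = s 1 := by field_simp
      unfold momX momY posX posY
      linear_combination (-(polarR s * (s 1 / polarR s))) * hsc - h4
    linear_combination h2 / 2 + h3
  rw [h1]
  have hE := Real.sin_sq_add_cos_sq (eccAnomaly (ecc s) (s 2))
  have hG : s 1 ^ 2 = s 0 ^ 2 * (1 - ecc s ^ 2) := by
    rw [ecc_sq hs]; field_simp; ring
  have hpr : polarR s = s 0 ^ 2 * (1 - ecc s * Real.cos (eccAnomaly (ecc s) (s 2))) := rfl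
  have h5 : radialMomentum s ^ 2 + (s 1 / polarR s) ^ 2
      = (s 0 ^ 2 * ecc s ^ 2 * Real.sin (eccAnomaly (ecc s) (s 2)) ^ 2
        + s 0 ^ 2 * (1 - ecc s ^ 2)) / polarR s ^ 2 := by
    rw [div_pow, hG, radialMomentum]
    ring
  rw [h5, hpr]
  field_simp
  linear_combination (ecc s ^ 2) * hE

theorem H_eq {s : State} (hs : s ∈ elliptic) (μ : ℝ) :
    H μ s = -1 / (2 * s 0 ^ 2) - s 1 + 1 / polarR s
      - (1 - μ) / Real.sqrt ((posX s + μ) ^ 2 + posY s ^ 2)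
      - μ / Real.sqrt ((posX s - 1 + μ) ^ 2 + posY s ^ 2) := by
  unfold H cartesianH
  rw [kinetic_energy hs]

theorem posX_sq_add_posY_sq (s : State) : posX s ^ 2 + posY s ^ 2 = polarR s ^ 2 := by
  unfold posX posY
  linear_combination polarR s ^ 2 * Real.sin_sq_add_cos_sq (polarTheta s)

theorem H_zero {s : State} (hs : s ∈ elliptic) : H 0 s = -1 / (2 * s 0 ^ 2) - s 1 := by
  rw [H_eq hs, add_zero, posX_sq_add_posY_sq, Real.sqrt_sq (polarR_pos hs).le]
  ring

/-- The pairs `(μ, s)` with `s ∈ domain μ`. -/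
def phaseDomain : Set (ℝ × State) := {p | p.2 ∈ domain p.1}

theorem mem_domain_iff {μ : ℝ} {s : State} :
    s ∈ domain μ ↔ s ∈ elliptic ∧ 0 < (posX s + μ) ^ 2 + posY s ^ 2 ∧
      0 < (posX s - 1 + μ) ^ 2 + posY s ^ 2 := by
  have key : ∀ a b c : ℝ, (a, b) ≠ (c, 0) ↔ 0 < (a - c) ^ 2 + b ^ 2 := by
    intro a b c
    rw [ne_eq, Prod.mk.injEq, ← sub_eq_zero (a := a) (b := c)]
    constructor
    · intro h
      rcases eq_or_ne (a - c) 0 with h1 | h1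
      · have : b ≠ 0 := fun h2 => h ⟨h1, h2⟩
        positivity
      · positivity
    · rintro h ⟨h1, h2⟩
      simp [h1, h2] at h
  rw [domain, Set.mem_ofPred_eq, ← and_assoc, key, key, sub_neg_eq_add,
    show posX s - (1 - μ) = posX s - 1 + μ by ring]
  rfl

theorem isOpen_phaseDomain : IsOpen phaseDomain := by
  rw [isOpen_iff_mem_nhds]
  rintro ⟨μ, s⟩ hp
  obtain ⟨hs, h1, h2⟩ := mem_domain_iff.1 hp
  have hX : ContinuousAt (fun p : ℝ × State => posX p.2) (μ, s) :=
    ContinuousAt.comp (g := posX) (f := Prod.snd) (contDiffAt_posX hs).continuousAt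
      continuousAt_snd
  have hY : ContinuousAt (fun p : ℝ × State => posY p.2) (μ, s) :=
    ContinuousAt.comp (g := posY) (f := Prod.snd) (contDiffAt_posY hs).continuousAt
      continuousAt_snd
  have e0 : ∀ᶠ p : ℝ × State in 𝓝 (μ, s), p.2 ∈ elliptic :=
    continuousAt_snd.eventually_mem (isOpen_elliptic.mem_nhds hs)
  have e1 : ∀ᶠ p : ℝ × State in 𝓝 (μ, s), 0 < (posX p.2 + p.1) ^ 2 + posY p.2 ^ 2 :=
    (((hX.add continuousAt_fst).pow 2).add (hY.pow 2)).eventually (lt_mem_nhds h1)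
  have e2 : ∀ᶠ p : ℝ × State in 𝓝 (μ, s), 0 < (posX p.2 - 1 + p.1) ^ 2 + posY p.2 ^ 2 :=
    ((((hX.sub continuousAt_const).add continuousAt_fst).pow 2).add (hY.pow 2)).eventually
      (lt_mem_nhds h2)
  filter_upwards [e0, e1, e2] with p h0 h1 h2
  exact mem_domain_iff.2 ⟨h0, h1, h2⟩

theorem contDiffAt_H {p : ℝ × State} (hp : p ∈ phaseDomain) :
    ContDiffAt ℝ ω (fun p : ℝ × State => H p.1 p.2) p := by
  obtain ⟨hs, h1, h2⟩ := mem_domain_iff.1 hp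
  have hX : ContDiffAt ℝ ω (fun p : ℝ × State => posX p.2) p :=
    (contDiffAt_posX hs).comp p contDiffAt_snd
  have hY : ContDiffAt ℝ ω (fun p : ℝ × State => posY p.2) p :=
    (contDiffAt_posY hs).comp p contDiffAt_snd
  have hR : ContDiffAt ℝ ω (fun p : ℝ × State => polarR p.2) p :=
    (contDiffAt_polarR hs).comp p contDiffAt_snd
  have h0 := elliptic_pos hs
  have h0' : (2 * p.2 0 ^ 2) ≠ 0 := by positivity
  have hr := (polarR_pos hs).ne'
  have h1' := h1.ne'
  have h2' := h2.ne'
  have h3 := (Real.sqrt_pos.2 h1).ne'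
  have h4 := (Real.sqrt_pos.2 h2).ne'
  refine ContDiffAt.congr_of_eventuallyEq ?_ ((continuousAt_snd.eventually_mem
    (isOpen_elliptic.mem_nhds hs)).mono fun q hq => H_eq hq q.1)
  fun_prop (disch := assumption)

/-! ### The Hamiltonian vector field -/

theorem isOpen_domain (μ : ℝ) : IsOpen (domain μ) :=
  isOpen_phaseDomain.preimage (f := fun s : State => (μ, s)) (by fun_prop)

theorem dH_eq {μ : ℝ} {s : State} (hs : s ∈ domain μ) (i : Fin 4) :
    dH μ i s = fderiv ℝ (fun p : ℝ × State => H p.1 p.2) (μ, s) (0, Pi.single i 1) := by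
  have h1 : HasFDerivAt (H μ)
      (fderiv ℝ (fun p : ℝ × State => H p.1 p.2) (μ, s) ∘L .inr ℝ ℝ State) s :=
    HasFDerivAt.comp (g := fun p : ℝ × State => H p.1 p.2) (f := fun s => (μ, s)) s
      ((contDiffAt_H (p := (μ, s)) hs).differentiableAt (by simp)).hasFDerivAt
      (hasFDerivAt_prodMk_right μ s)
  rw [dH, h1.fderiv]
  rfl

theorem contDiffAt_dH {p : ℝ × State} (hp : p ∈ phaseDomain) (i : Fin 4) :
    ContDiffAt ℝ ω (fun p : ℝ × State => dH p.1 i p.2) p := by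
  have h1 : ContDiffAt ℝ ω (fun q => fderiv ℝ (fun p : ℝ × State => H p.1 p.2) q
      ((0, Pi.single i 1) : ℝ × State)) p :=
    ((contDiffAt_H hp).fderiv_right (m := ω) (by simp)).clm_apply contDiffAt_const
  refine h1.congr_of_eventuallyEq ?_
  filter_upwards [isOpen_phaseDomain.mem_nhds hp] with q hq
  exact dH_eq hq i

theorem contDiffAt_vectorField {p : ℝ × State} (hp : p ∈ phaseDomain) :
    ContDiffAt ℝ ω (fun p : ℝ × State => vectorField p.1 p.2) p := by
  rw [contDiffAt_pi]
  intro i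
  have h0 := contDiffAt_dH hp 0
  have h1 := contDiffAt_dH hp 1
  have h2 := contDiffAt_dH hp 2
  have h3 := contDiffAt_dH hp 3
  fin_cases i
  · exact h2.neg
  · exact h3.neg
  · exact h0
  · exact h1

theorem contDiffAt_vectorField_right {μ : ℝ} {s : State} (hs : s ∈ domain μ) :
    ContDiffAt ℝ ω (vectorField μ) s :=
  ContDiffAt.comp (g := fun p : ℝ × State => vectorField p.1 p.2) (f := fun s => (μ, s)) s
    (contDiffAt_vectorField (p := (μ, s)) hs) (by fun_prop)

theorem contDiffAt_fderiv_vectorField {p : ℝ × State} (hp : p ∈ phaseDomain) :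
    ContDiffAt ℝ ω (fun p : ℝ × State => fderiv ℝ (vectorField p.1) p.2) p := by
  have h1 : ContDiffAt ℝ ω (fun q => (fderiv ℝ (fun p : ℝ × State => vectorField p.1 p.2) q).comp
      (ContinuousLinearMap.inr ℝ ℝ State)) p :=
    ((contDiffAt_vectorField hp).fderiv_right (m := ω) (by simp)).clm_comp contDiffAt_const
  refine h1.congr_of_eventuallyEq ?_
  filter_upwards [isOpen_phaseDomain.mem_nhds hp] with q hq
  have h1 : HasFDerivAt (vectorField q.1)
      (fderiv ℝ (fun p : ℝ × State => vectorField p.1 p.2) q ∘L .inr ℝ ℝ State) q.2 :=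
    HasFDerivAt.comp (g := fun p : ℝ × State => vectorField p.1 p.2) (f := fun s => (q.1, s)) q.2
      ((contDiffAt_vectorField (p := q) hq).differentiableAt (by simp)).hasFDerivAt
      (hasFDerivAt_prodMk_right q.1 q.2)
  exact h1.fderiv

/-! ### Symmetries -/

/-- The reflection `(L, G, l, g) ↦ (L, G, -l, -g)` as a linear equivalence. -/
noncomputable def reflectL : State ≃L[ℝ] State :=
  LinearEquiv.toContinuousLinearEquiv
    { toFun := reflect
      invFun := reflect
      map_add' := fun s s' => by
        ext i; fin_cases i <;> simp [reflect] <;> ring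
      map_smul' := fun a s => by
        ext i; fin_cases i <;> simp [reflect]
      left_inv := fun s => by ext i; fin_cases i <;> simp [reflect]
      right_inv := fun s => by ext i; fin_cases i <;> simp [reflect] }

theorem reflectL_apply (s : State) : reflectL s = reflect s := rfl

theorem reflect_reflect (s : State) : reflect (reflect s) = s := by
  ext i; fin_cases i <;> simp [reflect]

theorem reflect_neg (s : State) : reflect (-s) = -reflect s :=
  map_neg reflectL s

theorem reflect_mem_elliptic {s : State} (hs : s ∈ elliptic) : reflect s ∈ elliptic := hs

/-- The translation of the angles by `a` and `b`. -/
def angleShift (a b : ℝ) : State := ![0, 0, a, b]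

theorem add_angleShift_mem_elliptic {s : State} (hs : s ∈ elliptic) (a b : ℝ) :
    s + angleShift a b ∈ elliptic := by
  have h0 : (s + angleShift a b) 0 = s 0 := add_zero _
  have h1 : (s + angleShift a b) 1 = s 1 := add_zero _
  rw [elliptic, Set.mem_ofPred_eq, h0, h1]
  exact hs

theorem ecc_reflect (s : State) : ecc (reflect s) = ecc s := rfl

theorem ecc_add_angleShift (s : State) (a b : ℝ) : ecc (s + angleShift a b) = ecc s := by
  simp [ecc, angleShift]

theorem polarR_reflect {s : State} (hs : s ∈ elliptic) : polarR (reflect s) = polarR s := by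
  have h : reflect s 2 = -s 2 := rfl
  rw [polarR, radius, ecc_reflect, h, eccAnomaly_neg (abs_ecc_lt_one hs), Real.cos_neg]
  rfl

theorem cos_polarTheta_reflect {s : State} (hs : s ∈ elliptic) :
    Real.cos (polarTheta (reflect s)) = Real.cos (polarTheta s) := by
  have h2 : reflect s 2 = -s 2 := rfl
  have h3 : reflect s 3 = -s 3 := rfl
  have h0 : reflect s 0 = s 0 := rfl
  have h1 : reflect s 1 = s 1 := rfl
  rw [cos_polarTheta hs, cos_polarTheta (reflect_mem_elliptic hs), ecc_reflect, h0, h1, h2, h3,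
    eccAnomaly_neg (abs_ecc_lt_one hs)]
  simp

theorem sin_polarTheta_reflect {s : State} (hs : s ∈ elliptic) :
    Real.sin (polarTheta (reflect s)) = -Real.sin (polarTheta s) := by
  have h2 : reflect s 2 = -s 2 := rfl
  have h3 : reflect s 3 = -s 3 := rfl
  have h0 : reflect s 0 = s 0 := rfl
  have h1 : reflect s 1 = s 1 := rfl
  rw [sin_polarTheta hs, sin_polarTheta (reflect_mem_elliptic hs), ecc_reflect, h0, h1, h2, h3,
    eccAnomaly_neg (abs_ecc_lt_one hs)]
  simp only [Real.sin_neg, Real.cos_neg]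
  ring

theorem posX_reflect {s : State} (hs : s ∈ elliptic) : posX (reflect s) = posX s := by
  rw [posX, polarR_reflect hs, cos_polarTheta_reflect hs, posX]

theorem posY_reflect {s : State} (hs : s ∈ elliptic) : posY (reflect s) = -posY s := by
  rw [posY, polarR_reflect hs, sin_polarTheta_reflect hs, posY, mul_neg]

theorem H_reflect {s : State} (hs : s ∈ elliptic) (μ : ℝ) : H μ (reflect s) = H μ s := by
  rw [H_eq (reflect_mem_elliptic hs), H_eq hs, posX_reflect hs, posY_reflect hs,
    polarR_reflect hs, neg_sq]
  rfl

theorem reflect_mem_domain {μ : ℝ} {s : State} (hs : s ∈ domain μ) : reflect s ∈ domain μ := by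
  rw [mem_domain_iff] at hs ⊢
  rw [posX_reflect hs.1, posY_reflect hs.1, neg_sq]
  exact ⟨reflect_mem_elliptic hs.1, hs.2⟩

theorem polarR_add_angleShift {s : State} (hs : s ∈ elliptic) (j : ℤ) (b : ℝ) :
    polarR (s + angleShift (2 * Real.pi * j) b) = polarR s := by
  have h2 : (s + angleShift (2 * Real.pi * j) b) 2 = s 2 + 2 * Real.pi * j := rfl
  have h0 : (s + angleShift (2 * Real.pi * j) b) 0 = s 0 := add_zero _
  rw [polarR, radius, ecc_add_angleShift, h2, h0, eccAnomaly_add (abs_ecc_lt_one hs),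
    show ∀ x : ℝ, x + 2 * Real.pi * j = x + j * (2 * Real.pi) by intro x; ring,
    Real.cos_add_int_mul_two_pi]
  rfl

theorem trueAnomaly_add {e : ℝ} (he : |e| < 1) (l : ℝ) (j : ℤ) :
    trueAnomaly e (l + 2 * Real.pi * j) = trueAnomaly e l := by
  rw [trueAnomaly, eccAnomaly_add he,
    show ∀ x : ℝ, x + 2 * Real.pi * j = x + j * (2 * Real.pi) by intro x; ring,
    Real.cos_add_int_mul_two_pi, Real.sin_add_int_mul_two_pi]
  rfl

theorem polarTheta_add_angleShift {s : State} (hs : s ∈ elliptic) (j : ℤ) (b : ℝ) :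
    polarTheta (s + angleShift (2 * Real.pi * j) b) = polarTheta s + b := by
  have h2 : (s + angleShift (2 * Real.pi * j) b) 2 = s 2 + 2 * Real.pi * j := rfl
  have h3 : (s + angleShift (2 * Real.pi * j) b) 3 = s 3 + b := rfl
  rw [polarTheta, ecc_add_angleShift, h2, h3, trueAnomaly_add (abs_ecc_lt_one hs), polarTheta,
    add_assoc]

theorem posX_add_angleShift {s : State} (hs : s ∈ elliptic) (j k : ℤ) :
    posX (s + angleShift (2 * Real.pi * j) (2 * Real.pi * k)) = posX s := by
  rw [posX, polarR_add_angleShift hs, polarTheta_add_angleShift hs,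
    show ∀ x : ℝ, x + 2 * Real.pi * k = x + k * (2 * Real.pi) by intro x; ring,
    Real.cos_add_int_mul_two_pi]
  rfl

theorem posY_add_angleShift {s : State} (hs : s ∈ elliptic) (j k : ℤ) :
    posY (s + angleShift (2 * Real.pi * j) (2 * Real.pi * k)) = posY s := by
  rw [posY, polarR_add_angleShift hs, polarTheta_add_angleShift hs,
    show ∀ x : ℝ, x + 2 * Real.pi * k = x + k * (2 * Real.pi) by intro x; ring,
    Real.sin_add_int_mul_two_pi]
  rfl

theorem H_add_angleShift {s : State} (hs : s ∈ elliptic) (μ : ℝ) (j k : ℤ) :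
    H μ (s + angleShift (2 * Real.pi * j) (2 * Real.pi * k)) = H μ s := by
  have h0 : (s + angleShift (2 * Real.pi * j) (2 * Real.pi * k)) 0 = s 0 := add_zero _
  have h1 : (s + angleShift (2 * Real.pi * j) (2 * Real.pi * k)) 1 = s 1 := add_zero _
  rw [H_eq (add_angleShift_mem_elliptic hs _ _), H_eq hs, posX_add_angleShift hs,
    posY_add_angleShift hs, polarR_add_angleShift hs, h0, h1]

theorem add_angleShift_mem_domain {μ : ℝ} {s : State} (hs : s ∈ domain μ) (j k : ℤ) :
    s + angleShift (2 * Real.pi * j) (2 * Real.pi * k) ∈ domain μ := by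
  rw [mem_domain_iff] at hs ⊢
  rw [posX_add_angleShift hs.1, posY_add_angleShift hs.1]
  exact ⟨add_angleShift_mem_elliptic hs.1 _ _, hs.2⟩

theorem vectorField_add_angleShift {s : State} (hs : s ∈ elliptic) (μ : ℝ) (j k : ℤ) :
    vectorField μ (s + angleShift (2 * Real.pi * j) (2 * Real.pi * k)) = vectorField μ s := by
  have h : ∀ i, dH μ i (s + angleShift (2 * Real.pi * j) (2 * Real.pi * k)) = dH μ i s := by
    intro i
    rw [dH, ← fderiv_comp_add_right]
    refine congrArg (fun A : State →L[ℝ] ℝ => A (Pi.single i 1)) (Filter.EventuallyEq.fderiv_eq ?_)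
    filter_upwards [isOpen_elliptic.mem_nhds hs] with x hx using H_add_angleShift hx μ j k
  simp only [vectorField, h]

theorem reflect_single (i : Fin 4) :
    reflect (Pi.single i 1) = (if i.val < 2 then (1 : ℝ) else -1) • (Pi.single i 1 : State) := by
  ext j
  fin_cases i <;> fin_cases j <;> simp [reflect]

theorem vectorField_reflect {s : State} (hs : s ∈ elliptic) (μ : ℝ) :
    vectorField μ (reflect s) = -reflect (vectorField μ s) := by
  have h : ∀ i, dH μ i (reflect s) = (if i.val < 2 then (1 : ℝ) else -1) * dH μ i s := by
    intro i
    have h1 : fderiv ℝ (H μ ∘ reflectL) s = fderiv ℝ (H μ) s := by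
      refine Filter.EventuallyEq.fderiv_eq ?_
      filter_upwards [isOpen_elliptic.mem_nhds hs] with x hx using H_reflect hx μ
    rw [ContinuousLinearEquiv.comp_right_fderiv] at h1
    have h2 := congrArg (fun A : State →L[ℝ] ℝ => A (reflect (Pi.single i 1))) h1
    simp only [ContinuousLinearMap.comp_apply, ContinuousLinearEquiv.coe_coe, reflectL_apply,
      reflect_reflect] at h2
    rw [dH, h2, reflect_single, map_smul, smul_eq_mul, dH]
  simp only [vectorField, h]
  ext i
  fin_cases i <;> simp [reflect]

/-! ### The unperturbed problem -/

theorem vectorField_zero {s : State} (hs : s ∈ elliptic) :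
    vectorField 0 s = ![0, 0, 1 / s 0 ^ 3, -1] := by
  have h0 := (elliptic_pos hs).ne'
  have h1 : HasFDerivAt (fun s : State => -1 / (2 * s 0 ^ 2) - s 1)
      ((1 / s 0 ^ 3) • ContinuousLinearMap.proj (R := ℝ) (φ := fun _ : Fin 4 => ℝ) 0
        - ContinuousLinearMap.proj (R := ℝ) (φ := fun _ : Fin 4 => ℝ) 1) s := by
    have h2 : HasDerivAt (fun x : ℝ => -1 / (2 * x ^ 2)) (1 / s 0 ^ 3) (s 0) := by
      have h3 := ((hasDerivAt_pow 2 (s 0)).const_mul 2).fun_inv (by positivity) |>.const_mul (-1)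
      simp only [div_eq_mul_inv]
      refine h3.congr_deriv ?_
      field_simp
      norm_num
    exact (h2.comp_hasFDerivAt s (hasFDerivAt_apply (𝕜 := ℝ) (0 : Fin 4) s)).sub
      (hasFDerivAt_apply (𝕜 := ℝ) (1 : Fin 4) s)
  have h : ∀ i, dH 0 i s
      = (1 / s 0 ^ 3) * (Pi.single i 1 : State) 0 - (Pi.single i 1 : State) 1 := by
    intro i
    have h2 : H 0 =ᶠ[𝓝 s] fun s : State => -1 / (2 * s 0 ^ 2) - s 1 := by
      filter_upwards [isOpen_elliptic.mem_nhds hs] with x hx using H_zero hx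
    rw [dH, h2.fderiv_eq, h1.fderiv]
    rfl
  ext i
  fin_cases i <;> simp [vectorField, h]

/-- The nilpotent map `(δL, δG, δl, δg) ↦ (0, 0, δL, 0)`. -/
noncomputable def shear : State →L[ℝ] State :=
  (ContinuousLinearMap.proj (R := ℝ) (φ := fun _ : Fin 4 => ℝ) 0).smulRight (Pi.single 2 1)

theorem shear_apply (v : State) : shear v = Pi.single 2 (v 0) := by
  ext i
  fin_cases i <;> simp [shear]

theorem shear_comp_shear : shear.comp shear = 0 := by
  ext v i
  simp [shear_apply]

theorem fderiv_vectorField_zero {s : State} (hs : s ∈ elliptic) :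
    fderiv ℝ (vectorField 0) s = (-3 / s 0 ^ 4) • shear := by
  have h0 := (elliptic_pos hs).ne'
  have h1 : vectorField 0 =ᶠ[𝓝 s]
      fun s => (1 / s 0 ^ 3) • (Pi.single 2 1 : State) - Pi.single 3 1 := by
    filter_upwards [isOpen_elliptic.mem_nhds hs] with x hx
    rw [vectorField_zero hx]
    ext i
    fin_cases i <;> simp
  have h2 : HasDerivAt (fun x : ℝ => 1 / x ^ 3) (-3 / s 0 ^ 4) (s 0) := by
    have h3 := (hasDerivAt_pow 3 (s 0)).fun_inv (pow_ne_zero 3 h0)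
    simp only [one_div]
    refine h3.congr_deriv ?_
    push_cast
    field_simp
  have h3 := ((h2.comp_hasFDerivAt s (hasFDerivAt_apply (𝕜 := ℝ) (0 : Fin 4) s)).smul_const
    (Pi.single 2 1 : State)).sub_const (Pi.single 3 1 : State)
  rw [h1.fderiv_eq]
  refine h3.fderiv.trans ?_
  ext v i
  simp [shear, mul_assoc]

/-- The field of the equations together with their variational equation; the mass parameter is
carried along as a constant. -/
noncomputable def extField (x : ℝ × State × (State →L[ℝ] State)) :
    ℝ × State × (State →L[ℝ] State) :=
  (0, vectorField x.1 x.2.1, (fderiv ℝ (vectorField x.1) x.2.1).comp x.2.2)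

/-- The domain of `extField`. -/
def extDomain : Set (ℝ × State × (State →L[ℝ] State)) := {x | x.2.1 ∈ domain x.1}

theorem isOpen_extDomain : IsOpen extDomain :=
  isOpen_phaseDomain.preimage
    (f := fun x : ℝ × State × (State →L[ℝ] State) => (x.1, x.2.1)) (by fun_prop)

theorem contDiffAt_extField {x : ℝ × State × (State →L[ℝ] State)} (hx : x ∈ extDomain) :
    ContDiffAt ℝ ω extField x := by
  have h0 : ContDiffAt ℝ ω (fun x : ℝ × State × (State →L[ℝ] State) => (x.1, x.2.1)) x := by
    fun_prop
  have h1 : ContDiffAt ℝ ω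
      (fun x : ℝ × State × (State →L[ℝ] State) => vectorField x.1 x.2.1) x :=
    ContDiffAt.comp (g := fun p : ℝ × State => vectorField p.1 p.2)
      (f := fun x : ℝ × State × (State →L[ℝ] State) => (x.1, x.2.1)) x
      (contDiffAt_vectorField (p := (x.1, x.2.1)) hx) h0
  have h2 : ContDiffAt ℝ ω
      (fun x : ℝ × State × (State →L[ℝ] State) => fderiv ℝ (vectorField x.1) x.2.1) x :=
    ContDiffAt.comp (g := fun p : ℝ × State => fderiv ℝ (vectorField p.1) p.2)
      (f := fun x : ℝ × State × (State →L[ℝ] State) => (x.1, x.2.1)) x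
      (contDiffAt_fderiv_vectorField (p := (x.1, x.2.1)) hx) h0
  exact contDiffAt_const.prodMk (h1.prodMk (h2.clm_comp (by fun_prop)))

/-! ### Solutions of the equations and of the variational equation -/

section

/-- On `I`, `u` is a solution of Hamilton's equations and `Y` one of the variational equation
along `u`. -/
structure IsVarSol (μ : ℝ) (I : Set ℝ) (u : ℝ → State) (Y : ℝ → State →L[ℝ] State) : Prop where
  mem : ∀ t ∈ I, u t ∈ domain μ
  deriv : ∀ t ∈ I, HasDerivAt u (vectorField μ (u t)) t
  var : ∀ t ∈ I, HasDerivAt Y ((fderiv ℝ (vectorField μ) (u t)).comp (Y t)) t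

theorem elliptic_of_mem_domain {μ : ℝ} {s : State} (hs : s ∈ domain μ) : s ∈ elliptic :=
  (mem_domain_iff.1 hs).1

variable {μ : ℝ} {I : Set ℝ} {u v : ℝ → State} {Y W : ℝ → State →L[ℝ] State}

theorem IsVarSol.mono {J : Set ℝ} (h : IsVarSol μ I u Y) (hJ : J ⊆ I) : IsVarSol μ J u Y :=
  ⟨fun t ht => h.mem t (hJ ht), fun t ht => h.deriv t (hJ ht), fun t ht => h.var t (hJ ht)⟩

theorem IsVarSol.eqOn (h : IsVarSol μ I u Y) (h' : IsVarSol μ I v W) (hI : IsOpen I)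
    (hI' : IsPreconnected I) {t₀ : ℝ} (ht₀ : t₀ ∈ I) (hu : u t₀ = v t₀) (hY : Y t₀ = W t₀) :
    Set.EqOn u v I ∧ Set.EqOn Y W I := by
  have key : Set.EqOn (fun t => (μ, u t, Y t)) (fun t => (μ, v t, W t)) I := by
    refine eqOn_of_hasDerivAt (f := extField) hI hI' (fun t ht => ?_) (fun t ht => ?_)
      (fun t ht => ?_) ht₀ (by simp only [hu, hY])
    · exact (contDiffAt_extField (x := (μ, u t, Y t)) (h.mem t ht)).of_le (by simp)
    · exact (hasDerivAt_const t μ).prodMk ((h.deriv t ht).prodMk (h.var t ht))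
    · exact (hasDerivAt_const t μ).prodMk ((h'.deriv t ht).prodMk (h'.var t ht))
  exact ⟨fun t ht => congrArg (fun x => x.2.1) (key ht),
    fun t ht => congrArg (fun x => x.2.2) (key ht)⟩

theorem IsVarSol.comp_right (h : IsVarSol μ I u Y) (B : State →L[ℝ] State) :
    IsVarSol μ I u fun t => (Y t).comp B := by
  refine ⟨h.mem, h.deriv, fun t ht => ?_⟩
  have h1 := (h.var t ht).clm_comp (hasDerivAt_const t B)
  simpa [ContinuousLinearMap.comp_assoc] using h1

theorem fderiv_vectorField_add_angleShift {s : State} (hs : s ∈ elliptic) (μ : ℝ) (j k : ℤ) :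
    fderiv ℝ (vectorField μ) (s + angleShift (2 * Real.pi * j) (2 * Real.pi * k))
      = fderiv ℝ (vectorField μ) s := by
  rw [← fderiv_comp_add_right]
  refine Filter.EventuallyEq.fderiv_eq ?_
  filter_upwards [isOpen_elliptic.mem_nhds hs] with x hx using vectorField_add_angleShift hx μ j k

theorem fderiv_vectorField_reflect {s : State} (hs : s ∈ elliptic) (μ : ℝ) :
    (fderiv ℝ (vectorField μ) (reflect s)).comp (reflectL : State →L[ℝ] State)
      = -(reflectL : State →L[ℝ] State).comp (fderiv ℝ (vectorField μ) s) := by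
  have h1 : fderiv ℝ (vectorField μ ∘ reflectL) s
      = fderiv ℝ (fun x => -(reflectL ∘ vectorField μ) x) s := by
    refine Filter.EventuallyEq.fderiv_eq ?_
    filter_upwards [isOpen_elliptic.mem_nhds hs] with x hx using vectorField_reflect hx μ
  rw [ContinuousLinearEquiv.comp_right_fderiv, fderiv_fun_neg,
    ContinuousLinearEquiv.comp_fderiv] at h1
  exact h1

/-- Translations of time and of the angles by multiples of `2π` map solutions to solutions. -/
theorem IsVarSol.shift (h : IsVarSol μ I u Y) (T : ℝ) (j k : ℤ) :
    IsVarSol μ ((fun t => t + T) ⁻¹' I)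
      (fun t => u (t + T) + angleShift (2 * Real.pi * j) (2 * Real.pi * k))
      (fun t => Y (t + T)) := by
  refine ⟨fun t ht => add_angleShift_mem_domain (h.mem _ ht) j k, fun t ht => ?_, fun t ht => ?_⟩
  · rw [vectorField_add_angleShift (elliptic_of_mem_domain (h.mem _ ht))]
    exact ((h.deriv _ ht).comp_add_const t T).add_const _
  · rw [fderiv_vectorField_add_angleShift (elliptic_of_mem_domain (h.mem _ ht))]
    exact (h.var _ ht).comp_add_const t T

/-- Reversibility: the reflection combined with `t ↦ a - t` maps solutions to solutions. -/
theorem IsVarSol.reverse (h : IsVarSol μ I u Y) (a : ℝ) (j k : ℤ) :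
    IsVarSol μ ((fun t => a - t) ⁻¹' I)
      (fun t => reflect (u (a - t)) + angleShift (2 * Real.pi * j) (2 * Real.pi * k))
      (fun t => (reflectL : State →L[ℝ] State).comp (Y (a - t))) := by
  have hell : ∀ t, a - t ∈ I → u (a - t) ∈ elliptic := fun t ht =>
    elliptic_of_mem_domain (h.mem _ ht)
  refine ⟨fun t ht => add_angleShift_mem_domain (reflect_mem_domain (h.mem _ ht)) j k,
    fun t ht => ?_, fun t ht => ?_⟩
  · rw [vectorField_add_angleShift (reflect_mem_elliptic (hell t ht)),
      vectorField_reflect (hell t ht)]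
    have h1 := (reflectL : State →L[ℝ] State).hasFDerivAt.comp_hasDerivAt t
      ((h.deriv _ ht).comp_const_sub a t)
    simpa [reflectL_apply, reflect_neg] using
      h1.add_const (angleShift (2 * Real.pi * j) (2 * Real.pi * k))
  · rw [fderiv_vectorField_add_angleShift (reflect_mem_elliptic (hell t ht)),
      ← ContinuousLinearMap.comp_assoc, fderiv_vectorField_reflect (hell t ht)]
    have h1 := (hasDerivAt_const t (reflectL : State →L[ℝ] State)).clm_comp
      ((h.var _ ht).comp_const_sub a t)
    simpa [ContinuousLinearMap.comp_assoc] using h1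

/-- The velocity of a solution solves the variational equation. -/
theorem IsVarSol.velocity (h : IsVarSol μ I u Y) (φ : State →L[ℝ] ℝ) :
    IsVarSol μ I u fun t => φ.smulRight (vectorField μ (u t)) := by
  refine ⟨h.mem, h.deriv, fun t ht => ?_⟩
  have h1 : HasDerivAt (fun t => vectorField μ (u t))
      (fderiv ℝ (vectorField μ) (u t) (vectorField μ (u t))) t :=
    ((contDiffAt_vectorField_right (h.mem t ht)).differentiableAt
      (by simp)).hasFDerivAt.comp_hasDerivAt t (h.deriv t ht)
  have h2 := (ContinuousLinearMap.smulRightL ℝ State State φ).hasFDerivAt.comp_hasDerivAt t h1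
  refine h2.congr_deriv ?_
  ext w
  simp

theorem isSolution_iff_isVarSol {c : ℝ → State} :
    IsSolution μ c ↔ IsVarSol μ Set.univ c fun _ => 0 := by
  constructor
  · intro h
    refine ⟨fun t _ => (h t).1, fun t _ => (h t).2, fun t _ => ?_⟩
    simpa using hasDerivAt_const t (0 : State →L[ℝ] State)
  · exact fun h t => ⟨h.mem t trivial, h.deriv t trivial⟩

theorem IsSolution.eq {c c' : ℝ → State} (h : IsSolution μ c) (h' : IsSolution μ c') {t₀ : ℝ}
    (h0 : c t₀ = c' t₀) : c = c' := by
  have := (isSolution_iff_isVarSol.1 h).eqOn (isSolution_iff_isVarSol.1 h') isOpen_univ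
    isPreconnected_univ (Set.mem_univ t₀) h0 rfl
  exact funext fun t => this.1 trivial

/-- A solution that starts on the fixed set `l ∈ πℤ`, `g ∈ πℤ` of the reflection is symmetric. -/
theorem IsSolution.symmetric {c : ℝ → State} (h : IsSolution μ c) {m n : ℤ}
    (hl : c 0 2 = m * Real.pi) (hg : c 0 3 = n * Real.pi) (t : ℝ) :
    c (-t) = reflect (c t) + angleShift (2 * Real.pi * m) (2 * Real.pi * n) := by
  have h1 := (isSolution_iff_isVarSol.1 h).reverse 0 m n
  have h2 := (h1.eqOn (W := fun _ => 0) ⟨fun t _ => (h t).1, fun t _ => (h t).2, fun t _ => by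
      simpa using hasDerivAt_const t (0 : State →L[ℝ] State)⟩
    isOpen_univ isPreconnected_univ (Set.mem_univ (0 : ℝ)) ?_ (by simp)).1
  · have := h2 (Set.mem_univ (-t))
    simp only [zero_sub, neg_neg] at this
    exact this.symm
  · ext i
    fin_cases i
    · simp [reflect, angleShift]
    · simp [reflect, angleShift]
    · simp [reflect, angleShift, hl]; ring
    · simp [reflect, angleShift, hg]; ring

/-- A periodic solution that starts on the fixed set of the reflection meets it again after half
a period. -/
theorem IsSolution.half_period {c : ℝ → State} (h : IsSolution μ c) {m n : ℤ}
    (hl : c 0 2 = m * Real.pi) (hg : c 0 3 = n * Real.pi) {T : ℝ} (hT : IsPeriod c T) :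
    (∃ j : ℤ, c (T / 2) 2 = j * Real.pi) ∧ ∃ k : ℤ, c (T / 2) 3 = k * Real.pi := by
  obtain ⟨-, -, ⟨j, hj⟩, ⟨k, hk⟩⟩ := hT.2 (-(T / 2))
  have h1 := h.symmetric hl hg (T / 2)
  rw [show -(T / 2) + T = T / 2 by ring] at hj hk
  have h2 : c (-(T / 2)) 2 = -c (T / 2) 2 + 2 * Real.pi * m := by rw [h1]; rfl
  have h3 : c (-(T / 2)) 3 = -c (T / 2) 3 + 2 * Real.pi * n := by rw [h1]; rfl
  refine ⟨⟨m + j, ?_⟩, ⟨n + k, ?_⟩⟩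
  · push_cast; linarith
  · push_cast; linarith

/-! ### The unperturbed orbits -/

/-- The Kepler orbit in the rotating frame. -/
noncomputable def keplerOrbit (L G l g t : ℝ) : State := ![L, G, l + t / L ^ 3, g - t]

theorem hasDerivAt_keplerOrbit {L G : ℝ} (hG : 0 < G) (hL : G < L) (l g t : ℝ) :
    HasDerivAt (keplerOrbit L G l g) (vectorField 0 (keplerOrbit L G l g t)) t := by
  rw [vectorField_zero (s := keplerOrbit L G l g t) ⟨hG, hL⟩, hasDerivAt_pi]
  intro i
  fin_cases i
  · exact hasDerivAt_const t L
  · exact hasDerivAt_const t G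
  · simpa [keplerOrbit] using ((hasDerivAt_id t).div_const (L ^ 3)).const_add l
  · simpa [keplerOrbit] using (hasDerivAt_id t).const_sub g

/-- The solution of the variational equation along a Kepler orbit. -/
theorem isVarSol_keplerOrbit {L G : ℝ} (hG : 0 < G) (hL : G < L) {l g : ℝ}
    (hd : ∀ t ∈ I, keplerOrbit L G l g t ∈ domain 0) :
    IsVarSol 0 I (keplerOrbit L G l g)
      fun t => ContinuousLinearMap.id ℝ State + (-3 / L ^ 4 * t) • shear := by
  refine ⟨hd, fun t _ => hasDerivAt_keplerOrbit hG hL l g t, fun t _ => ?_⟩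
  rw [fderiv_vectorField_zero (s := keplerOrbit L G l g t) ⟨hG, hL⟩]
  have h1 := (((hasDerivAt_id t).const_mul (-3 / L ^ 4)).smul_const shear).const_add
    (ContinuousLinearMap.id ℝ State)
  refine h1.congr_deriv ?_
  have h2 : keplerOrbit L G l g t 0 = L := rfl
  rw [h2, ContinuousLinearMap.comp_add, ContinuousLinearMap.comp_smul,
    ContinuousLinearMap.smul_comp, ContinuousLinearMap.smul_comp, shear_comp_shear]
  simp

/-- `S` is the flow of Hamilton's equations and `Z` its linearization, as functions of the mass
parameter, the initial state and the time, near `μ = 0`, `s = s₀` and for times in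
`(-ε, b + ε)`. -/
structure IsVarFlow (s₀ : State) (b ε : ℝ) (S : ℝ × State × ℝ → State)
    (Z : ℝ × State × ℝ → State →L[ℝ] State) : Prop where
  pos : 0 < ε
  contDiffAt_S : ∀ μ ∈ Set.Ioo (-ε) ε, ∀ s ∈ Metric.ball s₀ ε, ∀ t ∈ Set.Ioo (-ε) (b + ε),
    ContDiffAt ℝ ω S (μ, s, t)
  contDiffAt_Z : ∀ μ ∈ Set.Ioo (-ε) ε, ∀ s ∈ Metric.ball s₀ ε, ∀ t ∈ Set.Ioo (-ε) (b + ε),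
    ContDiffAt ℝ ω Z (μ, s, t)
  initial_S : ∀ μ ∈ Set.Ioo (-ε) ε, ∀ s ∈ Metric.ball s₀ ε, S (μ, s, 0) = s
  initial_Z : ∀ μ ∈ Set.Ioo (-ε) ε, ∀ s ∈ Metric.ball s₀ ε,
    Z (μ, s, 0) = ContinuousLinearMap.id ℝ State
  isVarSol : ∀ μ ∈ Set.Ioo (-ε) ε, ∀ s ∈ Metric.ball s₀ ε,
    IsVarSol μ (Set.Ioo (-ε) (b + ε)) (fun t => S (μ, s, t)) fun t => Z (μ, s, t)

theorem exists_isVarFlow (h : IsVarSol 0 Set.univ u Y)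
    (hY : Y 0 = ContinuousLinearMap.id ℝ State) {b : ℝ} (hb : 0 ≤ b) :
    ∃ ε S Z, IsVarFlow (u 0) b ε S Z := by
  obtain ⟨ε, Ψ, hΨ⟩ := exists_isFlowNear isOpen_extDomain
    (fun x hx => (contDiffAt_extField hx).analyticAt) (c := fun t => ((0 : ℝ), u t, Y t))
    (fun t => h.mem t trivial)
    (fun t => (hasDerivAt_const t (0 : ℝ)).prodMk ((h.deriv t trivial).prodMk (h.var t trivial)))
    hb
  have hε := hΨ.pos
  have hball : ∀ μ ∈ Set.Ioo (-ε) ε, ∀ s ∈ Metric.ball (u 0) ε,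
      ((μ, s, ContinuousLinearMap.id ℝ State) : ℝ × State × (State →L[ℝ] State))
        ∈ Metric.ball ((0 : ℝ), u 0, Y 0) ε := by
    intro μ hμ s hs
    rw [Metric.mem_ball, Prod.dist_eq, Prod.dist_eq, hY, dist_self]
    refine max_lt ?_ (max_lt hs hε)
    rw [Real.dist_eq, sub_zero]
    exact abs_lt.2 hμ
  have h0 : (0 : ℝ) ∈ Set.Ioo (-ε) (b + ε) := ⟨by linarith, by linarith⟩
  have hcd : ∀ μ ∈ Set.Ioo (-ε) ε, ∀ s ∈ Metric.ball (u 0) ε, ∀ t ∈ Set.Ioo (-ε) (b + ε),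
      ContDiffAt ℝ ω (fun x : ℝ × State × ℝ =>
        Ψ ((x.1, x.2.1, ContinuousLinearMap.id ℝ State), x.2.2)) (μ, s, t) := by
    intro μ hμ s hs t ht
    exact ContDiffAt.comp (g := Ψ)
      (f := fun x : ℝ × State × ℝ => ((x.1, x.2.1, ContinuousLinearMap.id ℝ State), x.2.2))
      (μ, s, t) (hΨ.analytic _ ⟨hball μ hμ s hs, ht⟩).contDiffAt (by fun_prop)
  -- the mass parameter is constant along the flow
  have hfst : ∀ μ ∈ Set.Ioo (-ε) ε, ∀ s ∈ Metric.ball (u 0) ε, ∀ t ∈ Set.Ioo (-ε) (b + ε),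
      (Ψ ((μ, s, ContinuousLinearMap.id ℝ State), t)).1 = μ := by
    intro μ hμ s hs
    refine eqOn_of_hasDerivAt (f := fun _ : ℝ => (0 : ℝ)) (y := fun _ => μ) isOpen_Ioo
      isPreconnected_Ioo (fun _ _ => contDiffAt_const) (fun t ht => ?_)
      (fun t _ => hasDerivAt_const t μ) h0 ?_
    · exact (hΨ.hasDerivAt _ (hball μ hμ s hs) t ht).fst
    · rw [hΨ.initial _ (hball μ hμ s hs)]
  refine ⟨ε, fun x => (Ψ ((x.1, x.2.1, ContinuousLinearMap.id ℝ State), x.2.2)).2.1,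
    fun x => (Ψ ((x.1, x.2.1, ContinuousLinearMap.id ℝ State), x.2.2)).2.2, hε,
    fun μ hμ s hs t ht => (hcd μ hμ s hs t ht).snd.fst,
    fun μ hμ s hs t ht => (hcd μ hμ s hs t ht).snd.snd, fun μ hμ s hs => ?_,
    fun μ hμ s hs => ?_, fun μ hμ s hs => ⟨fun t ht => ?_, fun t ht => ?_, fun t ht => ?_⟩⟩
  · simp only [hΨ.initial _ (hball μ hμ s hs)]
  · simp only [hΨ.initial _ (hball μ hμ s hs)]
  · have := hΨ.mem _ (hball μ hμ s hs) t ht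
    rw [extDomain, Set.mem_ofPred_eq, hfst μ hμ s hs t ht] at this
    exact this
  · have := (hΨ.hasDerivAt _ (hball μ hμ s hs) t ht).snd.fst
    simp only [extField, hfst μ hμ s hs t ht] at this
    exact this
  · have := (hΨ.hasDerivAt _ (hball μ hμ s hs) t ht).snd.snd
    simp only [extField, hfst μ hμ s hs t ht] at this
    exact this

end

/-! ### Closing up symmetric orbits -/

section

theorem angleShift_zsmul (m j k : ℤ) :
    m • angleShift (2 * Real.pi * j) (2 * Real.pi * k)
      = angleShift (2 * Real.pi * (m * j : ℤ)) (2 * Real.pi * (m * k : ℤ)) := by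
  ext i
  fin_cases i <;> simp [angleShift] <;> ring

theorem addRight_zpow_apply {A : Type*} [AddCommGroup A] (a : A) (m : ℤ) (x : A) :
    (Equiv.addRight a ^ m) x = x + m • a := by
  simp

theorem mulRight_zpow_apply {A : Type*} [Monoid A] (M : Aˣ) (m : ℤ) (x : A) :
    ((Units.mulRight M) ^ m) x = x * ↑(M ^ m) := by
  induction m using Int.induction_on generalizing x with
  | zero => simp
  | succ k ih => rw [zpow_add_one, Equiv.Perm.mul_apply, ih, Units.mulRight_apply, mul_assoc,
      ← Units.val_mul, ← zpow_one_add, add_comm (1 : ℤ)]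
  | pred k ih =>
    rw [zpow_sub_one, Equiv.Perm.mul_apply, ih]
    have : (Units.mulRight M)⁻¹ x = x * ↑(M⁻¹) := by
      rw [Equiv.Perm.inv_eq_iff_eq]
      simp
    rw [this, mul_assoc, ← Units.val_mul, ← zpow_neg_one, ← zpow_add]
    congr 3
    ring

variable {μ : ℝ} {u : ℝ → State} {Y : ℝ → State →L[ℝ] State}

/-- A solution that meets the fixed set of the reflection at times `0` and `T / 2` closes up after
the time `T`, and the monodromy operator `M` satisfies `M R M = R`. -/
theorem IsVarSol.close_up {b ε δ T : ℝ} {j k m n : ℤ}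
    (h : IsVarSol μ (Set.Ioo (-ε) (b + ε)) u Y) (hY : Y 0 = ContinuousLinearMap.id ℝ State)
    (hδ : 0 < δ) (hδε : 2 * δ ≤ ε) (hT : |T - b| < δ) (hTpos : 0 < T)
    (hl : u 0 2 = j * Real.pi) (hg : u 0 3 = k * Real.pi)
    (hl' : u (T / 2) 2 = (m + j) * Real.pi) (hg' : u (T / 2) 3 = (n + k) * Real.pi) :
    (∀ s ∈ Set.Ioo (-δ) δ, u (s + T) = u s + angleShift (2 * Real.pi * m) (2 * Real.pi * n)) ∧
    (∀ s ∈ Set.Ioo (-δ) δ, Y (s + T) = (Y s).comp (Y T)) ∧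
    (Y T).comp ((reflectL : State →L[ℝ] State).comp (Y T)) = reflectL := by
  obtain ⟨hT1, hT2⟩ := abs_lt.1 hT
  set I := Set.Ioo (-ε) (b + ε) with hI
  set J := Set.Ioo (-δ) (T + δ) with hJ
  have hJI : J ⊆ I := Set.Ioo_subset_Ioo (by linarith) (by linarith)
  have hJI' : J ⊆ (fun t => T - t) ⁻¹' I := by
    intro t ht
    exact ⟨by linarith [ht.2], by linarith [ht.1]⟩
  have h0J : (0 : ℝ) ∈ J := ⟨by linarith, by linarith⟩
  have hTJ : T ∈ J := ⟨by linarith, by linarith⟩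
  have hr := (h.reverse T (m + j) (n + k)).mono hJI'
  have hu : Set.EqOn (fun t => reflect (u (T - t)) +
      angleShift (2 * Real.pi * (m + j : ℤ)) (2 * Real.pi * (n + k : ℤ))) u J := by
    refine ((hr.comp_right 0).eqOn ((h.mono hJI).comp_right 0) isOpen_Ioo isPreconnected_Ioo
      (t₀ := T / 2) ⟨by linarith, by linarith⟩ ?_ (by simp)).1
    have e : T - T / 2 = T / 2 := by ring
    simp only [e]
    ext i
    fin_cases i
    · simp [reflect, angleShift]
    · simp [reflect, angleShift]
    · simp [reflect, angleShift, hl']; ring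
    · simp [reflect, angleShift, hg']; ring
  have hYr : Set.EqOn (fun t => (reflectL : State →L[ℝ] State).comp (Y (T - t)))
      (fun t => (Y t).comp ((reflectL : State →L[ℝ] State).comp (Y T))) J := by
    refine (hr.eqOn ((h.mono hJI).comp_right _) isOpen_Ioo isPreconnected_Ioo
      (t₀ := 0) h0J (hu h0J) ?_).2
    simp [hY]
  have huT : u T = u 0 + angleShift (2 * Real.pi * m) (2 * Real.pi * n) := by
    have := hu hTJ
    simp only [sub_self] at this
    rw [← this]
    ext i
    fin_cases i
    · simp [reflect, angleShift]
    · simp [reflect, angleShift]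
    · simp [reflect, angleShift, hl]; ring
    · simp [reflect, angleShift, hg]; ring
  have hK : Set.Ioo (-δ) δ ⊆ (fun t => t + T) ⁻¹' I := by
    intro t ht
    exact ⟨by linarith [ht.1], by linarith [ht.2]⟩
  have hK' : Set.Ioo (-δ) δ ⊆ I := Set.Ioo_subset_Ioo (by linarith) (by linarith)
  have hcancel : angleShift (2 * Real.pi * m) (2 * Real.pi * n)
      + angleShift (2 * Real.pi * (-m : ℤ)) (2 * Real.pi * (-n : ℤ)) = 0 := by
    ext i
    fin_cases i <;> simp [angleShift]
  have hs := ((h.shift T (-m) (-n)).mono hK).eqOn ((h.mono hK').comp_right (Y T)) isOpen_Ioo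
    isPreconnected_Ioo (t₀ := 0) ⟨by linarith, hδ⟩ (by
      simp only [zero_add, huT]
      rw [add_assoc, hcancel, add_zero]) (by simp [hY])
  refine ⟨fun s hs' => ?_, fun s hs' => hs.2 hs', ?_⟩
  · rw [← hs.1 hs', add_assoc, add_comm (angleShift _ _), hcancel, add_zero]
  · have := hYr hTJ
    simp only [sub_self, hY, ContinuousLinearMap.comp_id] at this
    exact this.symm

/-- The periodic continuation of a solution that closes up is a solution for all times. -/
theorem IsVarSol.periodicExtension {δ T : ℝ} {m n : ℤ} {M : (State →L[ℝ] State)ˣ}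
    (h : IsVarSol μ (Set.Ioo (-δ) (T + δ)) u Y) (hδ : 0 < δ) (hT : δ < T)
    (hu : ∀ s ∈ Set.Ioo (-δ) δ,
      u (s + T) = u s + angleShift (2 * Real.pi * m) (2 * Real.pi * n))
    (hY : ∀ s ∈ Set.Ioo (-δ) δ, Y (s + T) = Y s * M) :
    IsVarSol μ Set.univ
      (periodicExtension T (Equiv.addRight (angleShift (2 * Real.pi * m) (2 * Real.pi * n))) u)
      (RTBP.periodicExtension T (Units.mulRight M) Y) := by
  have hT0 : 0 < T := hδ.trans hT
  have key : ∀ t, ∃ j : ℤ, t - j * T ∈ Set.Ioo (-δ) (T + δ) ∧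
      RTBP.periodicExtension T (Equiv.addRight (angleShift (2 * Real.pi * m) (2 * Real.pi * n))) u
        =ᶠ[𝓝 t] (fun t => u (t + -(j * T))
          + angleShift (2 * Real.pi * (j * m : ℤ)) (2 * Real.pi * (j * n : ℤ))) ∧
      RTBP.periodicExtension T (Units.mulRight M) Y
        =ᶠ[𝓝 t] fun t => (Y (t + -(j * T))).comp
          ((M ^ j : (State →L[ℝ] State)ˣ) : State →L[ℝ] State) := by
    intro t
    obtain ⟨j, hj⟩ := exists_int_sub_mul_mem hT0 t
    have hj' : t - j * T ∈ Set.Ioo (-δ) (T + δ) := ⟨by linarith [hj.1], by linarith [hj.2]⟩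
    have hev : ∀ᶠ s in 𝓝 t, s - j * T ∈ Set.Ioo (-δ) (T + δ) :=
      (continuous_id.sub continuous_const).continuousAt.eventually_mem (Ioo_mem_nhds hj'.1 hj'.2)
    refine ⟨j, hj', ?_, ?_⟩
    · filter_upwards [hev] with s hs
      rw [periodicExtension_eq hT0 hT hu j hs, addRight_zpow_apply, angleShift_zsmul,
        sub_eq_add_neg]
    · filter_upwards [hev] with s hs
      rw [periodicExtension_eq hT0 hT (σ := Units.mulRight M) (u := Y)
        (fun s hs => hY s hs) j hs, mulRight_zpow_apply, sub_eq_add_neg]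
      rfl
  have hsol : ∀ j : ℤ, IsVarSol μ ((fun t => t + -(j * T)) ⁻¹' Set.Ioo (-δ) (T + δ))
      (fun t => u (t + -(j * T))
          + angleShift (2 * Real.pi * (j * m : ℤ)) (2 * Real.pi * (j * n : ℤ)))
      fun t => (Y (t + -(j * T))).comp
        ((M ^ j : (State →L[ℝ] State)ˣ) : State →L[ℝ] State) := fun j =>
    (h.shift (-(j * T)) (j * m) (j * n)).comp_right _
  refine ⟨fun t _ => ?_, fun t _ => ?_, fun t _ => ?_⟩
  · obtain ⟨j, hj, h1, h2⟩ := key t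
    rw [h1.self_of_nhds]
    exact (hsol j).mem t hj
  · obtain ⟨j, hj, h1, h2⟩ := key t
    rw [h1.self_of_nhds]
    exact ((hsol j).deriv t hj).congr_of_eventuallyEq h1
  · obtain ⟨j, hj, h1, h2⟩ := key t
    rw [h1.self_of_nhds, h2.self_of_nhds]
    exact ((hsol j).var t hj).congr_of_eventuallyEq h2

/-! ### The resonant orbits -/

section Resonant

variable {p q : ℕ} {e : ℝ}

theorem resL_pos (hp : 0 < p) (hq : 0 < q) : 0 < resL p q := by
  unfold resL; positivity

theorem resL_pow_three (p q : ℕ) : resL p q ^ 3 = p / q := by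
  unfold resL
  rw [← Real.rpow_natCast, ← Real.rpow_mul (by positivity)]
  norm_num

theorem resL_sq (p q : ℕ) : resL p q ^ 2 = ((p : ℝ) / q) ^ ((2 : ℝ) / 3) := by
  unfold resL
  rw [← Real.rpow_natCast, ← Real.rpow_mul (by positivity)]
  norm_num

theorem resG_pos (hp : 0 < p) (hq : 0 < q) (he : 0 < e) (he1 : e < 1) : 0 < resG p q e :=
  mul_pos (resL_pos hp hq) (sqrt_one_sub_sq_pos (abs_lt.2 ⟨by linarith, he1⟩))

theorem resG_lt (hp : 0 < p) (hq : 0 < q) (he : 0 < e) : resG p q e < resL p q := by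
  have h : Real.sqrt (1 - e ^ 2) < 1 := by
    rw [Real.sqrt_lt' one_pos]
    nlinarith
  have := resL_pos hp hq
  unfold resG
  nlinarith

/-- The resonant Kepler orbit. -/
noncomputable def resonantOrbit (p q : ℕ) (e : ℝ) (nl ng : ℕ) : ℝ → State :=
  keplerOrbit (resL p q) (resG p q e) (nl * Real.pi) (ng * Real.pi)

theorem resonantOrbit_mem_elliptic (hp : 0 < p) (hq : 0 < q) (he : 0 < e) (he1 : e < 1)
    (nl ng : ℕ) (t : ℝ) : resonantOrbit p q e nl ng t ∈ elliptic :=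
  ⟨resG_pos hp hq he he1, resG_lt hp hq he⟩

theorem ecc_resonantOrbit (hp : 0 < p) (hq : 0 < q) (he : 0 < e) (he1 : e < 1)
    (nl ng : ℕ) (t : ℝ) : ecc (resonantOrbit p q e nl ng t) = e := by
  have h0 := (resL_pos hp hq).ne'
  have h1 : resonantOrbit p q e nl ng t 0 = resL p q := rfl
  have h2 : resonantOrbit p q e nl ng t 1 = resL p q * Real.sqrt (1 - e ^ 2) := rfl
  rw [ecc, h1, h2, mul_pow, mul_div_cancel_left₀ _ (pow_ne_zero 2 h0),
    sq_sqrt_one_sub_sq (abs_lt.2 ⟨by linarith, he1⟩), sub_sub_cancel, Real.sqrt_sq he.le]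

theorem resonantOrbit_two (p q : ℕ) (e : ℝ) (nl ng : ℕ) (t : ℝ) :
    resonantOrbit p q e nl ng t 2 = q * t / p + nl * Real.pi := by
  change nl * Real.pi + t / resL p q ^ 3 = _
  rw [resL_pow_three, add_comm, div_div_eq_mul_div, mul_comm t]

theorem resonantOrbit_three (p q : ℕ) (e : ℝ) (nl ng : ℕ) (t : ℝ) :
    resonantOrbit p q e nl ng t 3 = -t + ng * Real.pi := by
  change ng * Real.pi - t = _
  ring

theorem polarR_resonantOrbit (hp : 0 < p) (hq : 0 < q) (he : 0 < e) (he1 : e < 1)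
    (nl ng : ℕ) (t : ℝ) : polarR (resonantOrbit p q e nl ng t) = orbitR p q nl e t := by
  rw [polarR, ecc_resonantOrbit hp hq he he1, resonantOrbit_two, orbitR, ← resL_sq]
  rfl

theorem polarTheta_resonantOrbit (hp : 0 < p) (hq : 0 < q) (he : 0 < e) (he1 : e < 1)
    (nl ng : ℕ) (t : ℝ) :
    polarTheta (resonantOrbit p q e nl ng t) = orbitTheta p q nl ng e t := by
  rw [polarTheta, ecc_resonantOrbit hp hq he he1, resonantOrbit_two, resonantOrbit_three,
    orbitTheta]

theorem distance_sq (s : State) :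
    (posX s - 1) ^ 2 + posY s ^ 2
      = 1 + polarR s ^ 2 - 2 * polarR s * Real.cos (polarTheta s) := by
  unfold posX posY
  linear_combination polarR s ^ 2 * Real.sin_sq_add_cos_sq (polarTheta s)

theorem resonantOrbit_mem_domain (hp : 0 < p) (hq : 0 < q) (he : 0 < e) (he1 : e < 1)
    {nl ng : ℕ}
    (hΔ : ∀ t : ℝ, 0 < delta1 (orbitR p q nl e t) (orbitTheta p q nl ng e t)) (t : ℝ) :
    resonantOrbit p q e nl ng t ∈ domain 0 := by
  have hs := resonantOrbit_mem_elliptic hp hq he he1 nl ng t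
  rw [mem_domain_iff, add_zero, add_zero, posX_sq_add_posY_sq, distance_sq,
    polarR_resonantOrbit hp hq he he1, polarTheta_resonantOrbit hp hq he he1,
    ← polarR_resonantOrbit hp hq he he1 nl ng]
  refine ⟨hs, pow_pos (polarR_pos hs) 2, ?_⟩
  rw [polarR_resonantOrbit hp hq he he1]
  exact Real.sqrt_pos.1 (hΔ t)

/-- The starting point with actions `L`, `G` on the fixed set of the reflection. -/
noncomputable def startState (nl ng : ℕ) (L G : ℝ) : State :=
  ![L, G, nl * Real.pi, ng * Real.pi]

theorem resonantOrbit_at_zero (p q : ℕ) (e : ℝ) (nl ng : ℕ) :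
    resonantOrbit p q e nl ng 0 = startState nl ng (resL p q) (resG p q e) := by
  ext i
  fin_cases i <;> simp [resonantOrbit, keplerOrbit, startState]

theorem contDiff_startState (nl ng : ℕ) :
    ContDiff ℝ ω fun x : ℝ × ℝ => startState nl ng x.1 x.2 := by
  rw [contDiff_pi]
  intro i
  fin_cases i
  · exact contDiff_fst
  · exact contDiff_snd
  · exact contDiff_const
  · exact contDiff_const

/-- The angles `(l, g)` reached at time `t` from the starting point with actions `L`, `G`, as a
function of `((μ, G), (L, t))`. -/
noncomputable def anglesAt (nl ng : ℕ) (S : ℝ × State × ℝ → State) (v : (ℝ × ℝ) × (ℝ × ℝ)) :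
    ℝ × ℝ :=
  (S (v.1.1, startState nl ng v.2.1 v.1.2, v.2.2) 2,
    S (v.1.1, startState nl ng v.2.1 v.1.2, v.2.2) 3)

theorem flow_zero_eq {s₀ : State} {b ε : ℝ} {S : ℝ × State × ℝ → State}
    {Z : ℝ × State × ℝ → State →L[ℝ] State} (hS : IsVarFlow s₀ b ε S Z) (hb : 0 ≤ b) {nl ng : ℕ}
    {L G : ℝ} (hG : 0 < G) (hGL : G < L) (hs : startState nl ng L G ∈ Metric.ball s₀ ε)
    {t : ℝ} (ht : t ∈ Set.Ioo (-ε) (b + ε)) :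
    S (0, startState nl ng L G, t) = keplerOrbit L G (nl * Real.pi) (ng * Real.pi) t := by
  have hε := hS.pos
  have h0 : (0 : ℝ) ∈ Set.Ioo (-ε) ε := ⟨by linarith, hε⟩
  have h := hS.isVarSol 0 h0 _ hs
  refine eqOn_of_hasDerivAt (f := vectorField 0) isOpen_Ioo isPreconnected_Ioo
    (x := fun t => S (0, startState nl ng L G, t))
    (fun t ht => (contDiffAt_vectorField_right (h.mem t ht)).of_le (by simp)) h.deriv
    (fun t _ => hasDerivAt_keplerOrbit hG hGL _ _ t) (t₀ := 0) ⟨by linarith, by linarith⟩ ?_ ht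
  simp only [hS.initial_S 0 h0 _ hs]
  ext i
  fin_cases i <;> simp [keplerOrbit, startState]

/-- The time and the action `L` for which the orbit meets the fixed set of the reflection again are
analytic functions of `μ` and `G`, and they are locally unique: at `μ = 0` the angles are
`l = n_l π + t / L³` and `g = n_g π - t`, so `∂(l, g)/∂(L, t)` is invertible. -/
theorem exists_half_period_function (hp : 0 < p) (hq : 0 < q) (he : 0 < e) (he1 : e < 1)
    {nl ng : ℕ} {b ε : ℝ} {S : ℝ × State × ℝ → State} {Z : ℝ × State × ℝ → State →L[ℝ] State}
    (hS : IsVarFlow (startState nl ng (resL p q) (resG p q e)) b ε S Z)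
    (hb : Real.pi * p ≤ b) :
    ContinuousAt (anglesAt nl ng S) ((0, resG p q e), (resL p q, Real.pi * p)) ∧
    anglesAt nl ng S ((0, resG p q e), (resL p q, Real.pi * p))
      = ((q + nl) * Real.pi, (-p + ng) * Real.pi) ∧
    ∃ ψ : ℝ × ℝ → ℝ × ℝ, ContDiffAt ℝ ω ψ (0, resG p q e) ∧
      ψ (0, resG p q e) = (resL p q, Real.pi * p) ∧
      (∀ᶠ x in 𝓝 ((0 : ℝ), resG p q e), anglesAt nl ng S (x, ψ x)
        = ((q + nl) * Real.pi, (-p + ng) * Real.pi)) ∧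
      ∀ᶠ v in 𝓝 (((0 : ℝ), resG p q e), (resL p q, Real.pi * p)),
        anglesAt nl ng S v = ((q + nl) * Real.pi, (-p + ng) * Real.pi) → ψ v.1 = v.2 := by
  have hε := hS.pos
  have hL := resL_pos hp hq
  have hG := resG_pos hp hq he he1
  have hGL := resG_lt hp hq he
  have hpi := Real.pi_pos
  have hp' : (0 : ℝ) < p := by exact_mod_cast hp
  have hq' : (0 : ℝ) < q := by exact_mod_cast hq
  have hpp : 0 < Real.pi * p := by positivity
  set u : (ℝ × ℝ) × (ℝ × ℝ) := ((0, resG p q e), (resL p q, Real.pi * p)) with hu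
  have hmem0 : (0 : ℝ) ∈ Set.Ioo (-ε) ε := ⟨by linarith, hε⟩
  have htm : Real.pi * p ∈ Set.Ioo (-ε) (b + ε) := ⟨by linarith, by linarith⟩
  have hf : ContDiffAt ℝ ω (anglesAt nl ng S) u := by
    have h1 : ContDiffAt ℝ ω (fun v : (ℝ × ℝ) × (ℝ × ℝ) =>
        S (v.1.1, startState nl ng v.2.1 v.1.2, v.2.2)) u := by
      refine ContDiffAt.comp (g := S)
        (f := fun v : (ℝ × ℝ) × (ℝ × ℝ) => (v.1.1, startState nl ng v.2.1 v.1.2, v.2.2)) u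
        (hS.contDiffAt_S 0 hmem0 _ (Metric.mem_ball_self hε) _ htm) ?_
      have h2 : ContDiffAt ℝ ω (fun v : (ℝ × ℝ) × (ℝ × ℝ) => startState nl ng v.2.1 v.1.2) u :=
        ContDiffAt.comp (g := fun x : ℝ × ℝ => startState nl ng x.1 x.2)
          (f := fun v : (ℝ × ℝ) × (ℝ × ℝ) => (v.2.1, v.1.2)) u
          (contDiff_startState nl ng).contDiffAt (by fun_prop)
      fun_prop
    rw [contDiffAt_pi] at h1
    exact (h1 2).prodMk (h1 3)
  have hkep : ∀ᶠ y : ℝ × ℝ in 𝓝 (resL p q, Real.pi * p),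
      anglesAt nl ng S ((0, resG p q e), y)
        = (nl * Real.pi + y.2 / y.1 ^ 3, ng * Real.pi - y.2) := by
    have h1 : ∀ᶠ y : ℝ × ℝ in 𝓝 (resL p q, Real.pi * p), resG p q e < y.1 :=
      continuousAt_fst.eventually (lt_mem_nhds hGL)
    have h2 : ∀ᶠ y : ℝ × ℝ in 𝓝 (resL p q, Real.pi * p), y.2 ∈ Set.Ioo (-ε) (b + ε) :=
      continuousAt_snd.eventually_mem (Ioo_mem_nhds htm.1 htm.2)
    have h3 : ∀ᶠ y : ℝ × ℝ in 𝓝 (resL p q, Real.pi * p),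
        startState nl ng y.1 (resG p q e)
          ∈ Metric.ball (startState nl ng (resL p q) (resG p q e)) ε := by
      have h4 : ContinuousAt (fun y : ℝ × ℝ => startState nl ng y.1 (resG p q e))
          (resL p q, Real.pi * p) :=
        ((contDiff_startState nl ng).continuous.comp
          (f := fun y : ℝ × ℝ => (y.1, resG p q e)) (by fun_prop)).continuousAt
      exact h4.eventually_mem (Metric.ball_mem_nhds _ hε)
    filter_upwards [h1, h2, h3] with y h1 h2 h3
    rw [anglesAt, flow_zero_eq hS (by linarith) hG h1 h3 h2]
    rfl
  have hLne := hL.ne'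
  have hfu : anglesAt nl ng S u = ((q + nl) * Real.pi, (-p + ng) * Real.pi) := by
    rw [hu, hkep.self_of_nhds, resL_pow_three]
    ext
    · simp only; field_simp; ring
    · simp only; ring
  have hinv : (fderiv ℝ (anglesAt nl ng S) u ∘L .inr ℝ (ℝ × ℝ) (ℝ × ℝ)).IsInvertible := by
    have h1 : HasFDerivAt (fun y : ℝ × ℝ => anglesAt nl ng S ((0, resG p q e), y))
        (fderiv ℝ (anglesAt nl ng S) u ∘L .inr ℝ (ℝ × ℝ) (ℝ × ℝ)) u.2 :=
      HasFDerivAt.comp u.2 (hf.differentiableAt (by simp)).hasFDerivAt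
        (hasFDerivAt_prodMk_right u.1 u.2)
    set α : ℝ := -3 * (Real.pi * p) / resL p q ^ 4 with hα
    set β : ℝ := 1 / resL p q ^ 3 with hβ
    have hα0 : α ≠ 0 := by
      rw [hα]
      have : resL p q ^ 4 ≠ 0 := by positivity
      have : -3 * (Real.pi * p) ≠ 0 := by nlinarith
      positivity
    have h2 : HasFDerivAt (fun y : ℝ × ℝ => (nl * Real.pi + y.2 / y.1 ^ 3, ng * Real.pi - y.2))
        ((α • ContinuousLinearMap.fst ℝ ℝ ℝ + β • ContinuousLinearMap.snd ℝ ℝ ℝ).prod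
          (-ContinuousLinearMap.snd ℝ ℝ ℝ)) u.2 := by
      have h3 : HasDerivAt (fun x : ℝ => (x ^ 3)⁻¹) (-3 / resL p q ^ 4) (resL p q) := by
        refine ((hasDerivAt_pow 3 (resL p q)).fun_inv (pow_ne_zero 3 hLne)).congr_deriv ?_
        push_cast
        field_simp
      have h3' := h3.comp_hasFDerivAt u.2 (hasFDerivAt_fst (𝕜 := ℝ) (p := u.2))
      have h4 := (hasFDerivAt_snd (𝕜 := ℝ) (p := u.2)).mul h3'
      have h5 := (h4.const_add (nl * Real.pi)).prodMk
        ((hasFDerivAt_snd (𝕜 := ℝ) (p := u.2)).const_sub (ng * Real.pi))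
      simp only [div_eq_mul_inv]
      refine h5.congr_fderiv ?_
      ext <;> (simp [hu, hα, hβ]; try ring)
    rw [h1.unique (h2.congr_of_eventuallyEq hkep)]
    refine ContinuousLinearMap.IsInvertible.of_inverse (g := ((α⁻¹ • (ContinuousLinearMap.fst ℝ ℝ ℝ
      + β • ContinuousLinearMap.snd ℝ ℝ ℝ)).prod (-ContinuousLinearMap.snd ℝ ℝ ℝ))) ?_ ?_
    · ext <;> simp [hα0]
    · ext <;> simp [hα0]
  have hω : (ω : WithTop ℕ∞) ≠ 0 := by simp
  refine ⟨hf.continuousAt, hfu, hf.implicitFunction hω hinv, hf.contDiffAt_implicitFunction hω hinv,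
    hf.implicitFunction_apply_self hω hinv, ?_, ?_⟩
  · have := hf.eventually_apply_implicitFunction hω hinv
    rw [hfu] at this
    exact this
  · have := hf.eventually_apply_eq_iff_implicitFunction hω hinv
    rw [hfu] at this
    exact this.mono fun v hv => hv.1

end Resonant

end

/-! ### The analytic family -/

section

/-- A family with `G(0)` fixed, together with the solution `Y` of the variational equation along its
members. -/
structure IsContinuation (p q : ℕ) (e : ℝ) (nl ng : ℕ) (μ₀ : ℝ) (γ : ℝ → ℝ → State) (T : ℝ → ℝ)
    (η : ℝ) (Y : ℝ × ℝ → State →L[ℝ] State) : Prop where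
  family : IsFamily p q e nl ng μ₀ γ T
  action_G : ∀ μ ∈ Set.Ioo (-μ₀) μ₀, γ μ 0 1 = resG p q e
  closes : ∀ μ ∈ Set.Ioo (-μ₀) μ₀, ∀ t,
    γ μ (t + T μ) = γ μ t + angleShift (2 * Real.pi * (q : ℤ)) (2 * Real.pi * (-p : ℤ))
  width_pos : 0 < η
  period_close : ∀ μ ∈ Set.Ioo (-μ₀) μ₀, |T μ - 2 * Real.pi * p| < η
  contDiffAt_Y : ∀ μ ∈ Set.Ioo (-μ₀) μ₀, ∀ t ∈ Set.Ioo (-η) (2 * Real.pi * p + η),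
    ContDiffAt ℝ ω Y (μ, t)
  Y_zero : ∀ μ ∈ Set.Ioo (-μ₀) μ₀, Y (μ, 0) = ContinuousLinearMap.id ℝ State
  isVarSol : ∀ μ ∈ Set.Ioo (-μ₀) μ₀,
    IsVarSol μ (Set.Ioo (-η) (2 * Real.pi * p + η)) (γ μ) fun t => Y (μ, t)
  monodromy : ∀ μ ∈ Set.Ioo (-μ₀) μ₀, IsMonodromy μ (γ μ) (T μ) (Y (μ, T μ))
  reversible : ∀ μ ∈ Set.Ioo (-μ₀) μ₀,
    (Y (μ, T μ)).comp ((reflectL : State →L[ℝ] State).comp (Y (μ, T μ))) = reflectL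

variable {p q : ℕ} {e : ℝ} {nl ng : ℕ}

theorem IsFamily.mono {μ₀ μ₁ : ℝ} {γ : ℝ → ℝ → State} {T : ℝ → ℝ}
    (h : IsFamily p q e nl ng μ₀ γ T) (h1 : 0 < μ₁) (h2 : μ₁ ≤ μ₀) :
    IsFamily p q e nl ng μ₁ γ T := by
  have hs : Set.Ioo (-μ₁) μ₁ ⊆ Set.Ioo (-μ₀) μ₀ := Set.Ioo_subset_Ioo (by linarith) h2
  exact ⟨h1, h.analytic.mono (Set.prod_mono hs le_rfl), h.analytic_period.mono hs,
    fun μ hμ => h.solution μ (hs hμ), fun μ hμ => h.periodic μ (hs hμ),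
    fun μ hμ => h.symmetric μ (hs hμ), h.period, h.init_L, h.init_G,
    fun μ hμ => h.init_l μ (hs hμ), fun μ hμ => h.init_g μ (hs hμ)⟩

/-- For small `μ`, a periodic solution near the resonant orbit that starts on the fixed set of the
reflection is determined, together with its period, by `G(0)`. -/
def IsLocallyUnique (p q : ℕ) (e : ℝ) (nl ng : ℕ) (δ μ : ℝ) : Prop :=
  ∀ (c c' : ℝ → State) (τ τ' : ℝ), IsNearby p q e nl ng δ μ c τ → IsNearby p q e nl ng δ μ c' τ' →
    c 0 1 = c' 0 1 → c = c' ∧ τ = τ'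

theorem sameState_iff {s s' : State} :
    SameState s s' ↔ ∃ j k : ℤ, s = s' + angleShift (2 * Real.pi * j) (2 * Real.pi * k) := by
  constructor
  · rintro ⟨h0, h1, ⟨j, hj⟩, ⟨k, hk⟩⟩
    refine ⟨j, k, ?_⟩
    ext i
    fin_cases i
    · exact h0.trans (add_zero _).symm
    · exact h1.trans (add_zero _).symm
    · exact hj
    · exact hk
  · rintro ⟨j, k, rfl⟩
    exact ⟨add_zero _, add_zero _, ⟨j, rfl⟩, ⟨k, rfl⟩⟩

theorem eq_startState {s : State} {nl ng : ℕ} (hl : s 2 = nl * Real.pi) (hg : s 3 = ng * Real.pi) :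
    s = startState nl ng (s 0) (s 1) := by
  ext i
  fin_cases i
  · rfl
  · rfl
  · exact hl
  · exact hg

theorem int_mul_pi_eq_of_abs_sub_lt {j k : ℤ} (h : |(j : ℝ) * Real.pi - k * Real.pi| < 1) :
    (j : ℝ) * Real.pi = k * Real.pi := by
  rw [← sub_mul, abs_mul, abs_of_pos Real.pi_pos] at h
  have h1 : |(j : ℝ) - k| < 1 := by
    by_contra hge
    push Not at hge
    nlinarith [Real.pi_gt_three]
  have h2 : |j - k| < 1 := by exact_mod_cast h1
  rw [Int.abs_lt_one_iff, sub_eq_zero] at h2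
  rw [h2]

/-- A reversible linear map is invertible: the inverse is its conjugate by the reflection. -/
theorem exists_unit_of_reversible {M : State →L[ℝ] State}
    (h : M.comp ((reflectL : State →L[ℝ] State).comp M) = (reflectL : State →L[ℝ] State)) :
    ∃ U : (State →L[ℝ] State)ˣ, (U : State →L[ℝ] State) = M := by
  have h' : ∀ v, M (reflectL (M v)) = reflectL v := fun v => DFunLike.congr_fun h v
  have hr : ∀ v : State, reflectL (reflectL v) = v := reflect_reflect
  refine ⟨⟨M, (reflectL : State →L[ℝ] State).comp
    (M.comp (reflectL : State →L[ℝ] State)), ?_, ?_⟩, rfl⟩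
  · refine ContinuousLinearMap.ext fun v => ?_
    exact (h' (reflectL v)).trans (hr v)
  · refine ContinuousLinearMap.ext fun v => ?_
    exact (congrArg reflectL (h' v)).trans (hr v)

set_option maxHeartbeats 1600000 in
/-- For each `μ` near `0` the orbit that starts on the fixed set with the prescribed `G(0)` and with
the value of `L(0)` from `exists_half_period_function` closes up. -/
theorem exists_isContinuation (hp : 0 < p) (hq : 0 < q) (he : 0 < e) (he1 : e < 1)
    (hΔ : ∀ t : ℝ, 0 < delta1 (orbitR p q nl e t) (orbitTheta p q nl ng e t)) :
    ∃ μ₀ γ T η Y, IsContinuation p q e nl ng μ₀ γ T η Y ∧ ∃ δ > 0,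
      (∀ μ ∈ Set.Ioo (-μ₀) μ₀, IsNearby p q e nl ng δ μ (γ μ) (T μ)) ∧
      ∀ μ ∈ Set.Ioo (-μ₀) μ₀, IsLocallyUnique p q e nl ng δ μ := by
  have hp' : (1 : ℝ) ≤ p := by exact_mod_cast hp
  have hpi := Real.pi_gt_three
  set b : ℝ := 2 * Real.pi * p with hb
  have hb6 : 6 < b := by rw [hb]; nlinarith
  have hG := resG_pos hp hq he he1
  have hGL := resG_lt hp hq he
  obtain ⟨ε, S, Z, hS⟩ := exists_isVarFlow
    (isVarSol_keplerOrbit (I := Set.univ) (l := nl * Real.pi) (g := ng * Real.pi) hG hGL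
      (fun t _ => resonantOrbit_mem_domain hp hq he he1 hΔ t)) (by simp) (b := b) (by linarith)
  change IsVarFlow (resonantOrbit p q e nl ng 0) b ε S Z at hS
  rw [resonantOrbit_at_zero] at hS
  have hε := hS.pos
  obtain ⟨hcont, hbase, ψ, hψ, hψ0, hψe, hψu⟩ := exists_half_period_function hp hq he he1 hS
    (by rw [hb]; nlinarith)
  set G₀ := resG p q e with hG₀
  set L₀ := resL p q with hL₀
  set s₀ := startState nl ng L₀ G₀ with hs₀
  set δ : ℝ := min (ε / 2) 1 with hδ
  have hδ0 : 0 < δ := by positivity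
  have hδε : 2 * δ ≤ ε := by have := min_le_left (ε / 2) 1; linarith
  have hδ1 : δ ≤ 1 := min_le_right _ _
  -- a neighbourhood on which uniqueness holds
  have hstart : ContinuousAt (fun v : (ℝ × ℝ) × (ℝ × ℝ) => startState nl ng v.2.1 v.1.2)
      ((0, G₀), (L₀, Real.pi * p)) :=
    ((contDiff_startState nl ng).continuous.comp
      (f := fun v : (ℝ × ℝ) × (ℝ × ℝ) => (v.2.1, v.1.2)) (by fun_prop)).continuousAt
  have hU : ∀ᶠ v in 𝓝 (((0 : ℝ), G₀), (L₀, Real.pi * p)),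
      (anglesAt nl ng S v = ((q + nl) * Real.pi, (-p + ng) * Real.pi) → ψ v.1 = v.2) ∧
      dist (anglesAt nl ng S v) ((q + nl) * Real.pi, (-p + ng) * Real.pi) < 1 ∧
      startState nl ng v.2.1 v.1.2 ∈ Metric.ball s₀ ε ∧ v.1.1 ∈ Set.Ioo (-ε) ε ∧
      v.2.2 ∈ Set.Ioo (-ε) (b + ε) := by
    have h1 : ∀ᶠ v in 𝓝 (((0 : ℝ), G₀), (L₀, Real.pi * p)),
        dist (anglesAt nl ng S v) ((q + nl) * Real.pi, (-p + ng) * Real.pi) < 1 := by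
      rw [ContinuousAt, hbase] at hcont
      exact hcont (Metric.ball_mem_nhds _ one_pos)
    have h2 := hstart.eventually_mem (Metric.ball_mem_nhds s₀ hε)
    have h3 : ∀ᶠ v in 𝓝 (((0 : ℝ), G₀), (L₀, Real.pi * p)), v.1.1 ∈ Set.Ioo (-ε) ε :=
      (continuous_fst.fst.continuousAt).eventually_mem (Ioo_mem_nhds (by linarith) hε)
    have h4 : ∀ᶠ v in 𝓝 (((0 : ℝ), G₀), (L₀, Real.pi * p)), v.2.2 ∈ Set.Ioo (-ε) (b + ε) :=
      (continuous_snd.snd.continuousAt).eventually_mem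
        (Ioo_mem_nhds (by nlinarith) (by rw [hb]; nlinarith))
    filter_upwards [hψu, h1, h2, h3, h4] with v a1 a2 a3 a4 a5 using ⟨a1, a2, a3, a4, a5⟩
  obtain ⟨ρ, hρ, hU⟩ := Metric.eventually_nhds_iff_ball.1 hU
  -- the initial value, the period and the solutions
  let L : ℝ → ℝ := fun μ => (ψ (μ, G₀)).1
  let T : ℝ → ℝ := fun μ => 2 * (ψ (μ, G₀)).2
  let x : ℝ → State := fun μ => startState nl ng (L μ) G₀
  have hin : ContDiff ℝ ω fun μ : ℝ => (μ, G₀) := by fun_prop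
  have hLT : ∀ μ, ContDiffAt ℝ ω ψ (μ, G₀) → ContDiffAt ℝ ω L μ ∧ ContDiffAt ℝ ω T μ := by
    intro μ h
    have h1 : ContDiffAt ℝ ω (fun μ => ψ (μ, G₀)) μ :=
      ContDiffAt.comp (g := ψ) (f := fun μ : ℝ => (μ, G₀)) μ h hin.contDiffAt
    exact ⟨h1.fst, contDiffAt_const.mul h1.snd⟩
  obtain ⟨hL0, hT0⟩ := hLT 0 hψ
  have hL00 : L 0 = L₀ := by simp only [L, hψ0]
  have hT00 : T 0 = b := by simp only [T, hψ0]; rw [hb]; ring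
  have hxd : ∀ μ, ContDiffAt ℝ ω L μ → ContDiffAt ℝ ω x μ := fun μ h =>
    ContDiffAt.comp (g := fun y : ℝ × ℝ => startState nl ng y.1 y.2) (f := fun μ => (L μ, G₀)) μ
      (contDiff_startState nl ng).contDiffAt (h.prodMk contDiffAt_const)
  have hgood : ∀ᶠ μ in 𝓝 (0 : ℝ), ContDiffAt ℝ ω ψ (μ, G₀) ∧ x μ ∈ Metric.ball s₀ ε ∧
      μ ∈ Set.Ioo (-ε) ε ∧ |T μ - b| < δ / 2 ∧
      anglesAt nl ng S ((μ, G₀), ψ (μ, G₀)) = ((q + nl) * Real.pi, (-p + ng) * Real.pi) ∧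
      |μ| < ρ ∧ |T μ - b| < ρ ∧ |L μ - L₀| < ρ := by
    have hc : ContinuousAt (fun μ : ℝ => (μ, G₀)) 0 := hin.continuous.continuousAt
    have h1 := hc.eventually (hψ.analyticAt.eventually_analyticAt)
    have h2 : ∀ᶠ μ in 𝓝 (0 : ℝ), x μ ∈ Metric.ball s₀ ε := by
      refine (hxd 0 hL0).continuousAt.eventually_mem ?_
      have : x 0 = s₀ := by simp only [x, hL00, hs₀]
      rw [this]
      exact Metric.ball_mem_nhds _ hε
    have h3 : ∀ᶠ μ in 𝓝 (0 : ℝ), μ ∈ Set.Ioo (-ε) ε := Ioo_mem_nhds (by linarith) hε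
    have h4 : ∀ r > 0, ∀ᶠ μ in 𝓝 (0 : ℝ), |T μ - b| < r := by
      intro r hr
      have := hT0.continuousAt
      rw [ContinuousAt, hT00] at this
      exact this (Metric.ball_mem_nhds b hr)
    have h5 := hc.eventually hψe
    have h6 : ∀ᶠ μ in 𝓝 (0 : ℝ), |μ| < ρ := by
      filter_upwards [Metric.ball_mem_nhds (0 : ℝ) hρ] with μ hμ
      simpa using hμ
    have h7 : ∀ᶠ μ in 𝓝 (0 : ℝ), |L μ - L₀| < ρ := by
      have := hL0.continuousAt
      rw [ContinuousAt, hL00] at this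
      exact this (Metric.ball_mem_nhds L₀ hρ)
    filter_upwards [h1, h2, h3, h4 _ (half_pos hδ0), h5, h6, h4 ρ hρ, h7]
      with μ a1 a2 a3 a4 a5 a6 a7 a8 using ⟨a1.contDiffAt, a2, a3, a4, a5, a6, a7, a8⟩
  obtain ⟨μ₀, hμ₀, hgood⟩ := Metric.eventually_nhds_iff_ball.1 hgood
  rw [Real.ball_eq_Ioo, zero_sub, zero_add] at hgood
  set J : ℝ → Set ℝ := fun μ => Set.Ioo (-δ) (T μ + δ) with hJ
  let u : ℝ → ℝ → State := fun μ t => S (μ, x μ, t)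
  let Y : ℝ × ℝ → State →L[ℝ] State := fun v => Z (v.1, x v.1, v.2)
  let σ : Equiv.Perm State :=
    Equiv.addRight (angleShift (2 * Real.pi * (q : ℤ)) (2 * Real.pi * (-p : ℤ)))
  let γ : ℝ → ℝ → State := fun μ => periodicExtension (T μ) σ (u μ)
  have hTb : ∀ μ ∈ Set.Ioo (-μ₀) μ₀, b - δ / 2 < T μ ∧ T μ < b + δ / 2 := by
    intro μ hμ
    have := abs_lt.1 (hgood μ hμ).2.2.2.1
    exact ⟨by linarith, by linarith⟩
  have hJI : ∀ μ ∈ Set.Ioo (-μ₀) μ₀, J μ ⊆ Set.Ioo (-ε) (b + ε) := fun μ hμ =>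
    Set.Ioo_subset_Ioo (by linarith) (by linarith [hTb μ hμ])
  have hsol : ∀ μ ∈ Set.Ioo (-μ₀) μ₀,
      IsVarSol μ (Set.Ioo (-ε) (b + ε)) (u μ) fun t => Y (μ, t) := fun μ hμ =>
    hS.isVarSol μ (hgood μ hμ).2.2.1 _ (hgood μ hμ).2.1
  have hu0 : ∀ μ ∈ Set.Ioo (-μ₀) μ₀, u μ 0 = x μ := fun μ hμ =>
    hS.initial_S μ (hgood μ hμ).2.2.1 _ (hgood μ hμ).2.1
  have hY0 : ∀ μ ∈ Set.Ioo (-μ₀) μ₀, Y (μ, 0) = ContinuousLinearMap.id ℝ State := fun μ hμ =>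
    hS.initial_Z μ (hgood μ hμ).2.2.1 _ (hgood μ hμ).2.1
  have hclose : ∀ μ ∈ Set.Ioo (-μ₀) μ₀, _ := fun μ hμ =>
    IsVarSol.close_up (T := T μ) (δ := δ) (j := nl) (k := ng) (m := q) (n := -p) (hsol μ hμ)
      (hY0 μ hμ) hδ0 hδε (by linarith [(hgood μ hμ).2.2.2.1]) (by linarith [hTb μ hμ])
      (by rw [hu0 μ hμ]; simp [x, startState]) (by rw [hu0 μ hμ]; simp [x, startState])
      (by
        have := congrArg Prod.fst (hgood μ hμ).2.2.2.2.1
        simp only [anglesAt] at this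
        rw [show T μ / 2 = (ψ (μ, G₀)).2 by simp only [T]; ring]
        push_cast
        exact this)
      (by
        have := congrArg Prod.snd (hgood μ hμ).2.2.2.2.1
        simp only [anglesAt] at this
        rw [show T μ / 2 = (ψ (μ, G₀)).2 by simp only [T]; ring]
        push_cast
        exact this)
  have hT0' : ∀ μ ∈ Set.Ioo (-μ₀) μ₀, 0 < T μ := fun μ hμ => by linarith [hTb μ hμ]
  have hδT : ∀ μ ∈ Set.Ioo (-μ₀) μ₀, δ < T μ := fun μ hμ => by linarith [hTb μ hμ]
  have hγu : ∀ μ ∈ Set.Ioo (-μ₀) μ₀, ∀ (j : ℤ) (t : ℝ), t - j * T μ ∈ J μ →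
      γ μ t = S (μ, x μ, t - j * T μ)
        + angleShift (2 * Real.pi * (j * q : ℤ)) (2 * Real.pi * (j * -p : ℤ)) := by
    intro μ hμ j t ht
    simp only [γ]
    rw [periodicExtension_eq (hT0' μ hμ) (hδT μ hμ) (σ := σ) (u := u μ) (hclose μ hμ).1 j ht,
      addRight_zpow_apply, angleShift_zsmul]
  have hγu0 : ∀ μ ∈ Set.Ioo (-μ₀) μ₀, ∀ t ∈ J μ, γ μ t = u μ t := by
    intro μ hμ t ht
    have := hγu μ hμ 0 t (by simpa using ht)
    rw [this]
    ext i
    fin_cases i <;> simp [angleShift, u]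
  have hγ0 : ∀ μ ∈ Set.Ioo (-μ₀) μ₀, γ μ 0 = x μ := fun μ hμ => by
    rw [hγu0 μ hμ 0 ⟨by linarith, by linarith [hT0' μ hμ]⟩, hu0 μ hμ]
  have hglob : ∀ μ ∈ Set.Ioo (-μ₀) μ₀, ∃ W : ℝ → State →L[ℝ] State,
      IsVarSol μ Set.univ (γ μ) W ∧ ∀ t ∈ J μ, W t = Y (μ, t) := by
    intro μ hμ
    obtain ⟨h1, h2, h3⟩ := hclose μ hμ
    obtain ⟨M, hM⟩ := exists_unit_of_reversible h3
    refine ⟨periodicExtension (T μ) (Units.mulRight M) fun t => Y (μ, t),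
      ((hsol μ hμ).mono (hJI μ hμ)).periodicExtension hδ0 (hδT μ hμ) h1
        (fun s hs => by rw [hM]; exact h2 s hs),
      fun t ht => ?_⟩
    rw [periodicExtension_eq (hT0' μ hμ) (hδT μ hμ) (σ := Units.mulRight M)
      (u := fun t => Y (μ, t))
      (fun s hs => by rw [Units.mulRight_apply, hM]; exact h2 s hs) 0
      (by simpa [hJ] using ht)]
    simp
  have hγsol : ∀ μ ∈ Set.Ioo (-μ₀) μ₀, IsSolution μ (γ μ) := by
    intro μ hμ t
    obtain ⟨W, hW, -⟩ := hglob μ hμ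
    exact ⟨hW.mem t trivial, hW.deriv t trivial⟩
  have hcl : ∀ μ ∈ Set.Ioo (-μ₀) μ₀, ∀ t, γ μ (t + T μ)
      = γ μ t + angleShift (2 * Real.pi * (q : ℤ)) (2 * Real.pi * (-p : ℤ)) := fun μ hμ t =>
    periodicExtension_add (hT0' μ hμ) hδ0 (hδT μ hμ) (σ := σ) (u := u μ) (hclose μ hμ).1 t
  have hper : ∀ μ ∈ Set.Ioo (-μ₀) μ₀, IsPeriod (γ μ) (T μ) := fun μ hμ =>
    ⟨hT0' μ hμ, fun t => sameState_iff.2 ⟨q, -p, by rw [hcl μ hμ t]⟩⟩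
  have h0 : (0 : ℝ) ∈ Set.Ioo (-μ₀) μ₀ := ⟨by linarith, hμ₀⟩
  have hxT : ∀ μ ∈ Set.Ioo (-μ₀) μ₀, ContDiffAt ℝ ω x μ ∧ ContDiffAt ℝ ω T μ := fun μ hμ =>
    ⟨hxd μ (hLT μ (hgood μ hμ).1).1, (hLT μ (hgood μ hμ).1).2⟩
  have hinit_l : ∀ μ ∈ Set.Ioo (-μ₀) μ₀, γ μ 0 2 = nl * Real.pi := fun μ hμ => by
    rw [hγ0 μ hμ]; rfl
  have hinit_g : ∀ μ ∈ Set.Ioo (-μ₀) μ₀, γ μ 0 3 = ng * Real.pi := fun μ hμ => by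
    rw [hγ0 μ hμ]; rfl
  have hinit_G : ∀ μ ∈ Set.Ioo (-μ₀) μ₀, γ μ 0 1 = G₀ := fun μ hμ => by
    rw [hγ0 μ hμ]; rfl
  have hinit_L : ∀ μ ∈ Set.Ioo (-μ₀) μ₀, γ μ 0 0 = L μ := fun μ hμ => by
    rw [hγ0 μ hμ]; rfl
  have hev0 : ∀ᶠ μ in 𝓝 (0 : ℝ), μ ∈ Set.Ioo (-μ₀) μ₀ := Ioo_mem_nhds (by linarith) hμ₀
  have hfam : IsFamily p q e nl ng μ₀ γ T := by
    refine ⟨hμ₀, ?_, fun μ hμ => (hxT μ hμ).2.analyticAt, hγsol, hper, ?_, ?_, ?_, ?_, hinit_l,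
      hinit_g⟩
    · rintro ⟨μ, t⟩ ⟨hμ, -⟩
      simp only at hμ
      obtain ⟨j, hj⟩ := exists_int_sub_mul_mem (hT0' μ hμ) t
      have hjJ : t - j * T μ ∈ Set.Ioo (-ε) (b + ε) :=
        hJI μ hμ ⟨by linarith [hj.1], by linarith [hj.2]⟩
      have hx' : ContDiffAt ℝ ω (fun v : ℝ × ℝ => x v.1) (μ, t) :=
        ContDiffAt.comp (g := x) (f := Prod.fst) (μ, t) (hxT μ hμ).1 contDiffAt_fst
      have hT' : ContDiffAt ℝ ω (fun v : ℝ × ℝ => T v.1) (μ, t) :=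
        ContDiffAt.comp (g := T) (f := Prod.fst) (μ, t) (hxT μ hμ).2 contDiffAt_fst
      have h1 : ContDiffAt ℝ ω (fun v : ℝ × ℝ => S (v.1, x v.1, v.2 - j * T v.1)
          + angleShift (2 * Real.pi * (j * q : ℤ)) (2 * Real.pi * (j * -p : ℤ))) (μ, t) := by
        refine ContDiffAt.add (ContDiffAt.comp (g := S)
          (f := fun v : ℝ × ℝ => (v.1, x v.1, v.2 - j * T v.1)) (μ, t)
          (hS.contDiffAt_S μ (hgood μ hμ).2.2.1 _ (hgood μ hμ).2.1 _ hjJ) ?_) contDiffAt_const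
        exact contDiffAt_fst.prodMk
          (hx'.prodMk (contDiffAt_snd.sub (contDiffAt_const.mul hT')))
      refine (h1.congr_of_eventuallyEq ?_).analyticAt
      have e1 : ∀ᶠ v : ℝ × ℝ in 𝓝 (μ, t), v.1 ∈ Set.Ioo (-μ₀) μ₀ :=
        continuousAt_fst.eventually_mem (Ioo_mem_nhds hμ.1 hμ.2)
      have e2 : ∀ᶠ v : ℝ × ℝ in 𝓝 (μ, t), -δ < v.2 - j * T v.1 :=
        (continuousAt_snd.sub (continuousAt_const.mul hT'.continuousAt)).eventually
          (lt_mem_nhds ((by linarith [hj.1] : -δ < t - j * T μ)))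
      have e3 : ∀ᶠ v : ℝ × ℝ in 𝓝 (μ, t), v.2 - j * T v.1 - T v.1 < δ :=
        ((continuousAt_snd.sub (continuousAt_const.mul hT'.continuousAt)).sub
          hT'.continuousAt).eventually (gt_mem_nhds ((by linarith [hj.2] : t - j * T μ - T μ < δ)))
      filter_upwards [e1, e2, e3] with v h1 h2 h3
      exact hγu v.1 h1 j v.2 ⟨h2, by linarith⟩
    · intro μ hμ t
      refine sameState_iff.2 ⟨nl, ng, ?_⟩
      exact (hγsol μ hμ).symmetric (by simpa using hinit_l μ hμ) (by simpa using hinit_g μ hμ) t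
    · have := (hT0.differentiableAt (by simp)).hasDerivAt.isBigO_sub
      simpa [hT00] using this
    · have := (hL0.differentiableAt (by simp)).hasDerivAt.isBigO_sub
      rw [hL00] at this
      refine (this.congr' ?_ ?_)
      · filter_upwards [hev0] with μ hμ
        rw [hinit_L μ hμ]
      · simp
    · refine IsBigO.congr' (isBigO_zero _ _) ?_ (Eventually.of_forall fun _ => rfl)
      filter_upwards [hev0] with μ hμ
      rw [hinit_G μ hμ, sub_self]
  have hK : ∀ μ ∈ Set.Ioo (-μ₀) μ₀, Set.Ioo (-(δ / 2)) (2 * Real.pi * p + δ / 2) ⊆ J μ := by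
    intro μ hμ
    exact Set.Ioo_subset_Ioo (by linarith) (by linarith [hTb μ hμ])
  refine ⟨μ₀, γ, T, δ / 2, Y, ⟨hfam, hinit_G, hcl, half_pos hδ0,
    fun μ hμ => (hgood μ hμ).2.2.2.1, fun μ hμ t ht => ?_, hY0, fun μ hμ => ⟨?_, ?_, ?_⟩,
    fun μ hμ => ?_, fun μ hμ => (hclose μ hμ).2.2⟩, ρ, hρ, fun μ hμ => ?_, fun μ hμ => ?_⟩
  · have hx' : ContDiffAt ℝ ω (fun v : ℝ × ℝ => x v.1) (μ, t) :=
      ContDiffAt.comp (g := x) (f := Prod.fst) (μ, t) (hxT μ hμ).1 contDiffAt_fst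
    exact ContDiffAt.comp (g := Z) (f := fun v : ℝ × ℝ => (v.1, x v.1, v.2)) (μ, t)
      (hS.contDiffAt_Z μ (hgood μ hμ).2.2.1 _ (hgood μ hμ).2.1 _ (hJI μ hμ (hK μ hμ ht)))
      (contDiffAt_fst.prodMk (hx'.prodMk contDiffAt_snd))
  · exact fun t _ => (hγsol μ hμ t).1
  · exact fun t _ => (hγsol μ hμ t).2
  · intro t ht
    rw [hγu0 μ hμ t (hK μ hμ ht)]
    exact (hsol μ hμ).var t (hJI μ hμ (hK μ hμ ht))
  · obtain ⟨W, hW, hWY⟩ := hglob μ hμ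
    refine ⟨W, ?_, fun t => hW.var t trivial, ?_⟩
    · rw [hWY 0 ⟨by linarith, by linarith [hT0' μ hμ]⟩, hY0 μ hμ]
    · rw [hWY (T μ) ⟨by linarith [hT0' μ hμ], by linarith⟩]
  · obtain ⟨-, -, -, -, -, -, h7, h8⟩ := hgood μ hμ
    refine ⟨hγsol μ hμ, hper μ hμ, h7, ?_, ?_, hinit_l μ hμ, hinit_g μ hμ⟩
    · rw [hinit_L μ hμ]; exact h8
    · rw [hinit_G μ hμ, sub_self, abs_zero]; exact hρ
  · have key : ∀ c τ, IsNearby p q e nl ng ρ μ c τ → ψ (μ, c 0 1) = (c 0 0, τ / 2) := by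
      intro c τ hc
      have hμρ := (hgood μ hμ).2.2.2.2.2.1
      have hball : ((μ, c 0 1), (c 0 0, τ / 2))
          ∈ Metric.ball ((((0 : ℝ), G₀), (L₀, Real.pi * p))) ρ := by
        rw [Metric.mem_ball, Prod.dist_eq, Prod.dist_eq, Prod.dist_eq]
        refine max_lt (max_lt ?_ hc.init_G) (max_lt hc.init_L ?_)
        · simpa [Real.dist_eq] using hμρ
        · rw [Real.dist_eq, show τ / 2 - Real.pi * p = (τ - 2 * Real.pi * p) / 2 by ring,
            abs_div, abs_two]
          linarith [hc.period, abs_nonneg (τ - 2 * Real.pi * p)]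
      obtain ⟨h1, h2, h3, h4, h5⟩ := hU _ hball
      refine h1 ?_
      simp only at h1 h2 h3 h4 h5
      have hc0 := eq_startState hc.init_l hc.init_g
      have hflow : S (μ, startState nl ng (c 0 0) (c 0 1), τ / 2) = c (τ / 2) := by
        refine (((hS.isVarSol μ h4 _ h3).comp_right 0).eqOn (v := c) (W := fun _ => 0)
          ⟨fun t _ => (hc.solution t).1, fun t _ => (hc.solution t).2, fun t _ => by
            simpa using hasDerivAt_const t (0 : State →L[ℝ] State)⟩ isOpen_Ioo
          isPreconnected_Ioo (t₀ := 0) ⟨by linarith, by linarith⟩ ?_ (by simp)).1 h5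
        rw [hS.initial_S μ h4 _ h3, ← hc0]
      obtain ⟨⟨j, hj⟩, ⟨k, hk⟩⟩ := hc.solution.half_period (m := nl) (n := ng)
        (by simpa using hc.init_l) (by simpa using hc.init_g) hc.periodic
      rw [anglesAt] at h2 ⊢
      simp only [hflow, hj, hk] at h2 ⊢
      rw [Prod.dist_eq, max_lt_iff, Real.dist_eq, Real.dist_eq] at h2
      have e1 := int_mul_pi_eq_of_abs_sub_lt (j := j) (k := q + nl) (by push_cast; exact h2.1)
      have e2 := int_mul_pi_eq_of_abs_sub_lt (j := k) (k := -p + ng) (by push_cast; exact h2.2)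
      rw [e1, e2]
      push_cast
      rfl
    intro c c' τ τ' hc hc' hG'
    have k1 := key c τ hc
    have k2 := key c' τ' hc'
    rw [← hG', k1, Prod.mk.injEq] at k2
    refine ⟨hc.solution.eq hc'.solution (t₀ := 0) ?_, by linarith [k2.2]⟩
    rw [eq_startState hc.init_l hc.init_g, eq_startState hc'.init_l hc'.init_g, k2.1, hG']

end

/-! ### Characteristic multipliers of a reversible monodromy operator -/

open Matrix Polynomial in
/-- The characteristic polynomial of a reversible `4 × 4` matrix of positive determinant is
palindromic; if `1` is an eigenvalue, it is a double one. -/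
theorem charpoly_of_reversible {A R : Matrix (Fin 4) (Fin 4) ℝ} (hR : R * R = 1)
    (hA : A * R * A = R) (hdet : 0 < A.det) {v : Fin 4 → ℝ} (hv : v ≠ 0) (hAv : A *ᵥ v = v) :
    A.charpoly = (X - 1) ^ 2 * (X ^ 2 - C (A.trace - 2) * X + 1) := by
  have hRdet : R.det * R.det = 1 := by rw [← det_mul, hR, det_one]
  have hdet1 : A.det = 1 := by
    have h := congrArg det hA
    rw [det_mul, det_mul] at h
    have h2 : (A.det * A.det) * (R.det * R.det) = R.det * R.det := by linear_combination R.det * h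
    rw [hRdet, mul_one] at h2
    nlinarith
  have hdeg : A.charpoly.natDegree = 4 := by rw [charpoly_natDegree_eq_dim]; rfl
  have hc4 : A.charpoly.coeff 4 = 1 := by
    have := (charpoly_monic A).coeff_natDegree
    rwa [hdeg] at this
  have hc3 : A.charpoly.coeff 3 = -A.trace := by
    have := trace_eq_neg_charpoly_coeff A
    rw [this]; simp
  have hc0 : A.charpoly.coeff 0 = 1 := by
    have := det_eq_sign_charpoly_coeff A
    rw [hdet1] at this
    norm_num at this
    exact this.symm
  have heval : ∀ x : ℝ, A.charpoly.eval x = 1 + A.charpoly.coeff 1 * x + A.charpoly.coeff 2 * x ^ 2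
      - A.trace * x ^ 3 + x ^ 4 := by
    intro x
    rw [eval_eq_sum_range, hdeg]
    simp only [Finset.sum_range_succ, Finset.sum_range_zero, hc4, hc3, hc0]
    ring
  have h1 : A.charpoly.eval 1 = 0 := by
    rw [eval_charpoly]
    refine exists_mulVec_eq_zero_iff.1 ⟨v, hv, ?_⟩
    rw [sub_mulVec, hAv, map_one, one_mulVec, sub_self]
  have h2 : A.charpoly.eval 2 = 16 * A.charpoly.eval (1 / 2) := by
    have e : (Matrix.scalar (Fin 4) (2 : ℝ) - A)
        = A * R * ((-2 : ℝ) • (Matrix.scalar (Fin 4) (1 / 2 : ℝ) - A)) * R := by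
      have e1 : ∀ c : ℝ, Matrix.scalar (Fin 4) c = c • (1 : Matrix (Fin 4) (Fin 4) ℝ) := by
        intro c; rw [Matrix.smul_one_eq_diagonal]; rfl
      rw [e1, e1, smul_sub, smul_smul, mul_sub, sub_mul, mul_smul_comm, mul_smul_comm,
        hA, mul_one, smul_mul_assoc, smul_mul_assoc, hR, mul_assoc, hR, mul_one]
      norm_num
      abel
    have h := congrArg det e
    rw [det_mul, det_mul, det_mul, det_smul, hdet1] at h
    rw [eval_charpoly, eval_charpoly, h]
    simp only [Fintype.card_fin]
    linear_combination 16 * (Matrix.scalar (Fin 4) (1 / 2 : ℝ) - A).det * hRdet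
  rw [heval] at h1
  rw [heval, heval] at h2
  have hc1 : A.charpoly.coeff 1 = -A.trace := by linarith
  have hc2 : A.charpoly.coeff 2 = 2 * A.trace - 2 := by linarith
  refine Polynomial.funext fun x => ?_
  rw [heval, hc1, hc2]
  simp
  ring

/-- The eigenvalues, apart from the double eigenvalue `1`, of a reversible map of trace `4 + κ`, the
sign of the square root being given by `s = ±1`. -/
noncomputable def multiplier (s : ℂ) (κ : ℝ) : ℂ :=
  1 + κ / 2 + s * ((κ + κ ^ 2 / 4 : ℝ) : ℂ) ^ (1 / 2 : ℂ)

open Polynomial in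
theorem roots_charpoly_of_reversible {M : State →L[ℝ] State}
    (hM : M.comp ((reflectL : State →L[ℝ] State).comp M) = (reflectL : State →L[ℝ] State))
    (hdet : 0 < LinearMap.det (M : State →ₗ[ℝ] State)) {v : State} (hv : v ≠ 0) (hMv : M v = v) :
    ((M : State →ₗ[ℝ] State).charpoly.map (algebraMap ℝ ℂ)).roots
      = {1, 1, multiplier 1 (LinearMap.trace ℝ State M - 4),
          multiplier (-1) (LinearMap.trace ℝ State M - 4)} := by
  set f : State →ₗ[ℝ] State := (M : State →ₗ[ℝ] State) with hf
  set r : State →ₗ[ℝ] State := ((reflectL : State →L[ℝ] State) : State →ₗ[ℝ] State) with hr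
  set τ := LinearMap.trace ℝ State f with hτ
  have hrr : r.comp r = LinearMap.id := LinearMap.ext fun v => reflect_reflect v
  have hfr : (f.comp r).comp f = r := LinearMap.ext fun v => DFunLike.congr_fun hM v
  have hchar : f.charpoly = (X - 1) ^ 2 * (X ^ 2 - C (τ - 2) * X + 1) := by
    rw [← LinearMap.charpoly_toMatrix f (Pi.basisFun ℝ (Fin 4))]
    have key := charpoly_of_reversible (A := LinearMap.toMatrix' f) (R := LinearMap.toMatrix' r)
      (by rw [← LinearMap.toMatrix'_comp, hrr, LinearMap.toMatrix'_id])
      (by rw [← LinearMap.toMatrix'_comp, ← LinearMap.toMatrix'_comp, hfr])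
      (by rwa [LinearMap.det_toMatrix']) hv
      (by rw [LinearMap.toMatrix'_mulVec]; exact hMv)
    rw [LinearMap.toMatrix_eq_toMatrix', key, hτ,
      LinearMap.trace_eq_matrix_trace ℝ (Pi.basisFun ℝ (Fin 4)), LinearMap.toMatrix_eq_toMatrix']
  have hw : ((((τ - 4) + (τ - 4) ^ 2 / 4 : ℝ) : ℂ) ^ (1 / 2 : ℂ)) ^ 2
      = (((τ - 4) + (τ - 4) ^ 2 / 4 : ℝ) : ℂ) := by
    rw [one_div]
    exact Complex.cpow_nat_inv_pow _ two_ne_zero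
  have hsum : multiplier 1 (τ - 4) + multiplier (-1) (τ - 4) = (τ - 2 : ℝ) := by
    simp only [multiplier]; push_cast; ring
  have hprod : multiplier 1 (τ - 4) * multiplier (-1) (τ - 4) = 1 := by
    simp only [multiplier]
    push_cast at hw ⊢
    linear_combination -hw
  have hfac : f.charpoly.map (algebraMap ℝ ℂ)
      = (({1, 1, multiplier 1 (τ - 4), multiplier (-1) (τ - 4)} : Multiset ℂ).map
          fun a => X - C a).prod := by
    have h1 : C (multiplier 1 (τ - 4)) + C (multiplier (-1) (τ - 4)) = C ((τ - 2 : ℝ) : ℂ) := by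
      rw [← C_add, hsum]
    have h2 : C (multiplier 1 (τ - 4)) * C (multiplier (-1) (τ - 4)) = 1 := by
      rw [← C_mul, hprod, C_1]
    rw [hchar]
    simp only [Polynomial.map_mul, Polynomial.map_pow, Polynomial.map_sub, Polynomial.map_add,
      Polynomial.map_X, Polynomial.map_one, Polynomial.map_C, Multiset.insert_eq_cons,
      Multiset.map_cons, Multiset.prod_cons, Multiset.map_singleton, Multiset.prod_singleton, C_1,
      Complex.coe_algebraMap]
    rw [← h1]
    linear_combination -(X - 1) ^ 2 * h2
  rw [hfac, roots_multiset_prod_X_sub_C]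

/-- The complex square root on the real line is Hölder continuous of exponent `1/2`. -/
theorem norm_cpow_half_sub_sq_le (x y : ℝ) :
    ‖(x : ℂ) ^ (1 / 2 : ℂ) - (y : ℂ) ^ (1 / 2 : ℂ)‖ ^ 2 ≤ |x - y| := by
  have key : ∀ x : ℝ, (x : ℂ) ^ (1 / 2 : ℂ)
      = (Real.sqrt x : ℂ) + (Real.sqrt (-x) : ℂ) * Complex.I := by
    intro x
    rcases le_total 0 x with h | h
    · rw [Real.sqrt_eq_zero'.2 (neg_nonpos.2 h), Real.sqrt_eq_rpow,
        Complex.ofReal_cpow h]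
      simp
    · rw [Real.sqrt_eq_zero'.2 h, Complex.ofReal_cpow_of_nonpos h, Real.sqrt_eq_rpow,
        Complex.ofReal_cpow (neg_nonneg.2 h)]
      have : Complex.exp (Real.pi * Complex.I * (1 / 2 : ℂ)) = Complex.I := by
        rw [show (Real.pi * Complex.I * (1 / 2 : ℂ)) = Real.pi / 2 * Complex.I by ring]
        exact Complex.exp_pi_div_two_mul_I
      rw [this]
      simp
  have hre : (x : ℂ) ^ (1 / 2 : ℂ) - (y : ℂ) ^ (1 / 2 : ℂ)
      = ⟨Real.sqrt x - Real.sqrt y, Real.sqrt (-x) - Real.sqrt (-y)⟩ := by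
    rw [key, key]
    apply Complex.ext <;> simp
  rw [hre, Complex.sq_norm, Complex.normSq_mk]
  have hs : ∀ {a b : ℝ}, 0 ≤ b → b ≤ a → (Real.sqrt a - Real.sqrt b) ^ 2 ≤ a - b := by
    intro a b hb hab
    have h1 := Real.sq_sqrt hb
    have h2 := Real.sq_sqrt (hb.trans hab)
    have h3 := Real.sqrt_le_sqrt hab
    have h4 := Real.sqrt_nonneg b
    nlinarith
  wlog hxy : y ≤ x generalizing x y
  · rw [abs_sub_comm]
    refine le_of_eq_of_le ?_ (this y x ?_ (le_of_not_ge hxy))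
    · ring
    · rw [key, key]
      apply Complex.ext <;> simp
  rw [abs_of_nonneg (sub_nonneg.2 hxy)]
  rcases le_total 0 y with hy | hy
  · rw [Real.sqrt_eq_zero'.2 (neg_nonpos.2 hy), Real.sqrt_eq_zero'.2 (neg_nonpos.2 (hy.trans hxy))]
    have := hs hy hxy
    nlinarith
  · rcases le_total 0 x with hx | hx
    · rw [Real.sqrt_eq_zero'.2 (neg_nonpos.2 hx), Real.sqrt_eq_zero'.2 hy]
      have h1 := Real.mul_self_sqrt hx
      have h2 := Real.mul_self_sqrt (neg_nonneg.2 hy)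
      nlinarith
    · rw [Real.sqrt_eq_zero'.2 hx, Real.sqrt_eq_zero'.2 hy]
      have := hs (neg_nonneg.2 hx) (neg_le_neg hxy)
      nlinarith

/-- If `κ(μ) = C μ + O(μ²)`, the multipliers are `1 ± √(C μ) + O(μ)`. -/
theorem multiplier_sub_isBigO {κ : ℝ → ℝ} {C : ℝ}
    (hκ : (fun μ => κ μ - C * μ) =O[𝓝 0] fun μ => μ ^ 2) (s : ℂ) :
    (fun μ : ℝ => multiplier s (κ μ) - (1 + s * ((C * μ : ℝ) : ℂ) ^ (1 / 2 : ℂ)))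
      =O[𝓝 0] fun μ : ℝ => μ := by
  have hid : (fun μ : ℝ => μ ^ 2) =O[𝓝 0] fun μ : ℝ => μ := by
    have : (fun μ : ℝ => μ) =O[𝓝 0] fun _ : ℝ => (1 : ℝ) :=
      (continuous_id.tendsto (0 : ℝ)).isBigO_one ℝ
    simpa [sq] using (isBigO_refl (fun μ : ℝ => μ) (𝓝 0)).mul this
  have h1 : κ =O[𝓝 0] fun μ : ℝ => μ := by
    have := (hκ.trans hid).add ((isBigO_refl (fun μ : ℝ => μ) (𝓝 0)).const_mul_left C)
    simpa using this
  have h2 : (fun μ => κ μ ^ 2) =O[𝓝 0] fun μ : ℝ => μ ^ 2 := h1.pow 2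
  have h3 : (fun μ => (κ μ + κ μ ^ 2 / 4) - C * μ) =O[𝓝 0] fun μ : ℝ => μ ^ 2 := by
    have := hκ.add (h2.const_mul_left (1 / 4))
    refine this.congr_left fun μ => ?_
    ring
  have h4 : (fun μ : ℝ => ((κ μ + κ μ ^ 2 / 4 : ℝ) : ℂ) ^ (1 / 2 : ℂ)
      - ((C * μ : ℝ) : ℂ) ^ (1 / 2 : ℂ)) =O[𝓝 0] fun μ : ℝ => μ := by
    obtain ⟨K, hK⟩ := h3.bound
    refine IsBigO.of_bound (Real.sqrt K) ?_
    filter_upwards [hK] with μ hμ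
    have hb := (norm_cpow_half_sub_sq_le (κ μ + κ μ ^ 2 / 4) (C * μ)).trans
      (by simpa [Real.norm_eq_abs] using hμ)
    rw [Real.norm_eq_abs, ← Real.sqrt_sq (abs_nonneg μ), sq_abs, ← Real.sqrt_mul' _ (sq_nonneg μ)]
    exact Real.le_sqrt_of_sq_le hb
  have h5 : (fun μ : ℝ => ((κ μ / 2 : ℝ) : ℂ)) =O[𝓝 0] fun μ : ℝ => μ := by
    refine IsBigO.of_norm_left ?_
    simp only [Complex.norm_real]
    refine IsBigO.norm_left ?_
    refine (h1.const_mul_left (1 / 2)).congr_left fun μ => ?_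
    ring
  refine (h5.add (h4.const_mul_left s)).congr_left fun μ => ?_
  simp only [multiplier]
  push_cast
  ring

/-! ### The first-order variation of the trace of the monodromy operator -/

section Partial

variable {E F : Type*} [NormedAddCommGroup E] [NormedSpace ℝ E] [NormedAddCommGroup F]
  [NormedSpace ℝ F]

/-- The derivative of `f` in the direction `a`. -/
noncomputable def dirDeriv (a : E) (f : E → F) (x : E) : F := fderiv ℝ f x a

theorem _root_.ContDiffAt.dirDeriv {f : E → F} {x : E} (hf : ContDiffAt ℝ ω f x) (a : E) :
    ContDiffAt ℝ ω (dirDeriv a f) x :=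
  (hf.fderiv_right (m := ω) (by simp)).clm_apply contDiffAt_const

theorem dirDeriv_congr {f g : E → F} {x : E} (h : f =ᶠ[𝓝 x] g) (a : E) :
    dirDeriv a f =ᶠ[𝓝 x] dirDeriv a g := by
  filter_upwards [h.fderiv (𝕜 := ℝ)] with y hy
  rw [dirDeriv, dirDeriv, hy]

theorem dirDeriv_comm [CompleteSpace F] {f : E → F} {x : E} (hf : ContDiffAt ℝ ω f x) (a b : E) :
    dirDeriv a (dirDeriv b f) x = dirDeriv b (dirDeriv a f) x := by
  have h1 : DifferentiableAt ℝ (fderiv ℝ f) x :=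
    (hf.fderiv_right (m := ω) (by simp)).differentiableAt (by simp)
  have h2 : ∀ a b : E, dirDeriv a (dirDeriv b f) x = fderiv ℝ (fderiv ℝ f) x a b := by
    intro a b
    have := (h1.hasFDerivAt.clm_apply (hasFDerivAt_const b x)).fderiv
    change fderiv ℝ (fun y => fderiv ℝ f y b) x a = _
    rw [this]
    simp
  rw [h2, h2]
  exact (hf.isSymmSndFDerivAt (by simp)) a b

theorem hasDerivAt_dirDeriv {f : E → F} {x : E} (hf : DifferentiableAt ℝ f x) (a : E)
    {c : ℝ → E} {t : ℝ} (hc : HasDerivAt c a t) (hx : c t = x) :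
    HasDerivAt (fun t => f (c t)) (dirDeriv a f x) t := by
  subst hx
  exact hf.hasFDerivAt.comp_hasDerivAt t hc

end Partial

/-- The perturbing function `∂H/∂μ` at `μ = 0`. -/
noncomputable def perturbation (s : State) : ℝ :=
  1 / polarR s + Real.cos (polarTheta s) / polarR s ^ 2 - 1 / delta1 (polarR s) (polarTheta s)

theorem hasDerivAt_H_zero {s : State} (hs : s ∈ domain 0) :
    HasDerivAt (fun μ => H μ s) (perturbation s) 0 := by
  obtain ⟨h0, h1, h2⟩ := mem_domain_iff.1 hs
  have hr := polarR_pos h0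
  have e : ∀ c : ℝ, HasDerivAt (fun μ : ℝ => (c + μ) ^ 2 + posY s ^ 2) (2 * c) 0 := by
    intro c
    have := ((((hasDerivAt_id (0 : ℝ)).const_add c).pow 2)).add_const (posY s ^ 2)
    simpa using this
  have d1 := (e (posX s)).sqrt h1.ne'
  have d2 := (e (posX s - 1)).sqrt h2.ne'
  have k1 := ((hasDerivAt_id (0 : ℝ)).const_sub 1).fun_div d1 (Real.sqrt_pos.2 h1).ne'
  have k2 := (hasDerivAt_id (0 : ℝ)).fun_div d2 (Real.sqrt_pos.2 h2).ne'
  have k := (k1.const_sub (-1 / (2 * s 0 ^ 2) - s 1 + 1 / polarR s)).fun_sub k2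
  have hX : posX s = polarR s * Real.cos (polarTheta s) := rfl
  have hfun : (fun μ => H μ s) = fun μ => -1 / (2 * s 0 ^ 2) - s 1 + 1 / polarR s
      - (1 - id μ) / Real.sqrt ((posX s + μ) ^ 2 + posY s ^ 2)
      - id μ / Real.sqrt ((posX s - 1 + μ) ^ 2 + posY s ^ 2) := funext fun μ => H_eq h0 μ
  rw [hfun]
  refine k.congr_deriv ?_
  rw [add_zero] at h2
  have hd : delta1 (polarR s) (polarTheta s) = Real.sqrt ((posX s - 1) ^ 2 + posY s ^ 2) := by
    rw [distance_sq]; rfl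
  have hdp := Real.sqrt_pos.2 h2
  rw [perturbation, hd]
  simp only [id, add_zero]
  rw [posX_sq_add_posY_sq, Real.sqrt_sq hr.le]
  generalize Real.sqrt ((posX s - 1) ^ 2 + posY s ^ 2) = Δ at hdp ⊢
  rw [hX]
  field_simp
  ring

theorem perturbation_add_angleShift {s : State} (hs : s ∈ elliptic) (j k : ℤ) :
    perturbation (s + angleShift (2 * Real.pi * j) (2 * Real.pi * k)) = perturbation s := by
  have h : Real.cos (polarTheta s + 2 * Real.pi * k) = Real.cos (polarTheta s) := by
    rw [show 2 * Real.pi * k = k * (2 * Real.pi) by ring, Real.cos_add_int_mul_two_pi]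
  simp only [perturbation, delta1, polarR_add_angleShift hs, polarTheta_add_angleShift hs, h]

theorem mem_nhds_domain {μ : ℝ} {s : State} (hs : s ∈ domain μ) : domain μ ∈ 𝓝 s :=
  (isOpen_domain μ).mem_nhds hs

/-- The Hamiltonian, as a function of the mass ratio and the state. -/
noncomputable def jointH (p : ℝ × State) : ℝ := H p.1 p.2

theorem contDiffAt_jointH {p : ℝ × State} (hp : p ∈ phaseDomain) : ContDiffAt ℝ ω jointH p :=
  contDiffAt_H hp

theorem dirDeriv_jointH {s : State} (hs : s ∈ domain 0) :
    dirDeriv ((1, 0) : ℝ × State) jointH (0, s) = perturbation s := by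
  have hd : DifferentiableAt ℝ jointH (0, s) :=
    (contDiffAt_jointH (p := ((0 : ℝ), s)) hs).differentiableAt (by simp)
  have hc : HasDerivAt (fun μ : ℝ => (μ, s)) ((1, 0) : ℝ × State) 0 :=
    (hasDerivAt_id (0 : ℝ)).prodMk (hasDerivAt_const (0 : ℝ) s)
  exact (hasDerivAt_dirDeriv hd _ hc rfl).unique (hasDerivAt_H_zero hs)

theorem contDiffAt_perturbation {s : State} (hs : s ∈ domain 0) :
    ContDiffAt ℝ ω perturbation s := by
  have h1 : ContDiffAt ℝ ω (fun s' : State => dirDeriv ((1, 0) : ℝ × State) jointH (0, s')) s :=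
    ContDiffAt.comp (g := dirDeriv ((1, 0) : ℝ × State) jointH) (f := fun s' => ((0 : ℝ), s')) s
      ((contDiffAt_jointH (p := ((0 : ℝ), s)) hs).dirDeriv _) (by fun_prop)
  refine h1.congr_of_eventuallyEq ?_
  filter_upwards [mem_nhds_domain hs] with s' hs' using (dirDeriv_jointH hs').symm

/-- The coordinate vectors of the phase space, as vectors of `ℝ × State`. -/
abbrev coord (i : Fin 4) : ℝ × State := (0, Pi.single i 1)

theorem dirDeriv_prod_right {F : Type*} [NormedAddCommGroup F] [NormedSpace ℝ F]
    {f : ℝ × State → F} {μ : ℝ} {s : State} (hf : DifferentiableAt ℝ f (μ, s)) (v : State) :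
    dirDeriv v (fun s => f (μ, s)) s = dirDeriv ((0, v) : ℝ × State) f (μ, s) := by
  have h1 : HasFDerivAt (fun s => f (μ, s)) (fderiv ℝ f (μ, s) ∘L .inr ℝ ℝ State) s :=
    hf.hasFDerivAt.comp s (hasFDerivAt_prodMk_right μ s)
  rw [dirDeriv, h1.fderiv]
  rfl

theorem fderiv_vectorField_apply {p : ℝ × State} (hp : p ∈ phaseDomain) (i j : Fin 4) :
    fderiv ℝ (vectorField p.1) p.2 (Pi.single j 1) i
      = ![-dirDeriv (coord j) (dirDeriv (coord 2) jointH) p,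
          -dirDeriv (coord j) (dirDeriv (coord 3) jointH) p,
          dirDeriv (coord j) (dirDeriv (coord 0) jointH) p,
          dirDeriv (coord j) (dirDeriv (coord 1) jointH) p] i := by
  have hp' : p.2 ∈ domain p.1 := hp
  have hdH : ∀ k : Fin 4, HasFDerivAt (dH p.1 k) (fderiv ℝ (dH p.1 k) p.2) p.2 := by
    intro k
    have := ContDiffAt.comp (g := fun p : ℝ × State => dH p.1 k p.2) (f := fun s => (p.1, s)) p.2
      (contDiffAt_dH hp k) (by fun_prop)
    exact (this.differentiableAt (by simp)).hasFDerivAt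
  have hv : ∀ k : Fin 4, fderiv ℝ (dH p.1 k) p.2 (Pi.single j 1)
      = dirDeriv (coord j) (dirDeriv (coord k) jointH) p := by
    intro k
    have h1 : dH p.1 k =ᶠ[𝓝 p.2]
        fun s => dirDeriv (coord k) (jointH) (p.1, s) := by
      filter_upwards [mem_nhds_domain hp'] with s hs using dH_eq hs k
    rw [h1.fderiv_eq]
    exact dirDeriv_prod_right (((contDiffAt_jointH hp).dirDeriv _).differentiableAt (by simp)) _
  have hd : DifferentiableAt ℝ (vectorField p.1) p.2 :=
    (contDiffAt_vectorField_right hp').differentiableAt (by simp)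
  have hi : fderiv ℝ (vectorField p.1) p.2 (Pi.single j 1) i
      = fderiv ℝ (fun s => vectorField p.1 s i) p.2 (Pi.single j 1) := by
    rw [fderiv_pi (fun i => (hasFDerivAt_pi'.1 hd.hasFDerivAt i).differentiableAt)]
    rfl
  rw [hi]
  fin_cases i
  · change fderiv ℝ (fun s => -dH p.1 2 s) p.2 _ = _
    rw [(hdH 2).fun_neg.fderiv]
    simpa using hv 2
  · change fderiv ℝ (fun s => -dH p.1 3 s) p.2 _ = _
    rw [(hdH 3).fun_neg.fderiv]
    simpa using hv 3
  · exact hv 0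
  · exact hv 1

/-- The Hamiltonian vector field is divergence-free. -/
theorem trace_fderiv_vectorField {p : ℝ × State} (hp : p ∈ phaseDomain) :
    ∑ i, fderiv ℝ (vectorField p.1) p.2 (Pi.single i 1) i = 0 := by
  simp only [Fin.sum_univ_four, fderiv_vectorField_apply hp]
  simp only [Matrix.cons_val]
  rw [dirDeriv_comm (contDiffAt_jointH hp) (coord 0),
    dirDeriv_comm (contDiffAt_jointH hp) (coord 1)]
  ring

/-- The derivative in `μ`, at `μ = 0`, of the entry `-∂²H/∂l²` of the linearized vector field along
a curve of states does not depend on the motion of the states, because `∂²H/∂l² = 0` for `μ = 0`. -/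
theorem hasDerivAt_fderiv_vectorField_entry {x : ℝ → State} {v : State} (hx : HasDerivAt x v 0)
    (hd : x 0 ∈ domain 0) :
    HasDerivAt (fun μ => fderiv ℝ (vectorField μ) (x μ) (Pi.single 2 1) 0)
      (-dirDeriv (Pi.single 2 1) (dirDeriv (Pi.single 2 1) perturbation) (x 0)) 0 := by
  have hp : ((0 : ℝ), x 0) ∈ phaseDomain := hd
  set D := dirDeriv (coord 2) (dirDeriv (coord 2) jointH) with hD
  have hDc : ContDiffAt ℝ ω D (0, x 0) := ((contDiffAt_jointH hp).dirDeriv _).dirDeriv _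
  have hDd : DifferentiableAt ℝ D (0, x 0) := hDc.differentiableAt (by simp)
  have hcurve : HasDerivAt (fun μ => ((μ, x μ) : ℝ × State)) (1, v) 0 :=
    (hasDerivAt_id (0 : ℝ)).prodMk hx
  have hev : ∀ᶠ p in 𝓝 ((0 : ℝ), x 0), p ∈ phaseDomain := isOpen_phaseDomain.mem_nhds hp
  have h1 : HasDerivAt (fun μ => D (μ, x μ)) (dirDeriv (1, v) D (0, x 0)) 0 :=
    hasDerivAt_dirDeriv hDd _ hcurve rfl
  -- the derivative in the direction of the states vanishes
  have h2 : dirDeriv ((0, v) : ℝ × State) D (0, x 0) = 0 := by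
    rw [← dirDeriv_prod_right hDd]
    have : (fun s => D (0, s)) =ᶠ[𝓝 (x 0)] fun _ => 0 := by
      filter_upwards [mem_nhds_domain hd] with s hs
      have h3 := fderiv_vectorField_apply (p := ((0 : ℝ), s)) hs 0 2
      simp only [Matrix.cons_val_zero] at h3
      rw [fderiv_vectorField_zero (elliptic_of_mem_domain hs)] at h3
      simpa [shear_apply] using h3.symm
    rw [dirDeriv, this.fderiv_eq]
    simp
  have h3 : dirDeriv ((1, 0) : ℝ × State) D (0, x 0)
      = dirDeriv (Pi.single 2 1) (dirDeriv (Pi.single 2 1) perturbation) (x 0) := by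
    have hc1 : dirDeriv ((1, 0) : ℝ × State) (dirDeriv (coord 2) jointH)
        =ᶠ[𝓝 ((0 : ℝ), x 0)] dirDeriv (coord 2) (dirDeriv ((1, 0) : ℝ × State) jointH) := by
      filter_upwards [hev] with p hp using dirDeriv_comm (contDiffAt_jointH hp) _ _
    rw [hD, dirDeriv_comm ((contDiffAt_jointH hp).dirDeriv _),
      (dirDeriv_congr hc1 (coord 2)).eq_of_nhds]
    set K := dirDeriv ((1, 0) : ℝ × State) jointH with hK
    have hK1 : ∀ s ∈ domain 0, K (0, s) = perturbation s := fun s hs => dirDeriv_jointH hs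
    have hKc : ∀ s ∈ domain 0, ContDiffAt ℝ ω K (0, s) := fun s hs =>
      (contDiffAt_jointH (p := (0, s)) hs).dirDeriv _
    have hK2 : ∀ s ∈ domain 0, dirDeriv (coord 2) K (0, s)
        = dirDeriv (Pi.single 2 1) perturbation s := by
      intro s hs
      rw [← dirDeriv_prod_right ((hKc s hs).differentiableAt (by simp))]
      refine (dirDeriv_congr ?_ _).eq_of_nhds
      filter_upwards [mem_nhds_domain hs] with s' hs' using hK1 s' hs'
    rw [← dirDeriv_prod_right (((hKc _ hd).dirDeriv _).differentiableAt (by simp))]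
    refine (dirDeriv_congr ?_ _).eq_of_nhds
    filter_upwards [mem_nhds_domain hd] with s hs using hK2 s hs
  have h4 : dirDeriv (1, v) D (0, x 0)
      = dirDeriv (Pi.single 2 1) (dirDeriv (Pi.single 2 1) perturbation) (x 0) := by
    have h5 : dirDeriv ((1, v) : ℝ × State) D (0, x 0)
        = dirDeriv ((1, 0) : ℝ × State) D (0, x 0) + dirDeriv ((0, v) : ℝ × State) D (0, x 0) := by
      rw [dirDeriv, dirDeriv, dirDeriv, ← map_add]
      simp
    rw [h5, h2, h3, add_zero]
  rw [← h4]
  refine h1.fun_neg.congr_of_eventuallyEq ?_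
  filter_upwards [hcurve.continuousAt.eventually_mem (isOpen_phaseDomain.mem_nhds hp)] with μ hμ
  have := fderiv_vectorField_apply hμ 0 2
  simpa using this

/-! ### The perturbing function along the resonant orbits -/

section

theorem contDiffAt_delta1 {r θ : ℝ} (h : 0 < delta1 r θ) : ContDiffAt ℝ ω (delta1 r) θ := by
  have h' : 0 < 1 + r ^ 2 - 2 * r * Real.cos θ := Real.sqrt_pos.1 h
  unfold delta1
  refine ContDiffAt.sqrt ?_ h'.ne'
  fun_prop

/-- The perturbing function in polar coordinates. -/
noncomputable def polarPerturbation (r θ : ℝ) : ℝ :=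
  1 / r + Real.cos θ / r ^ 2 - 1 / delta1 r θ

theorem deriv_deriv_polarPerturbation {r θ : ℝ} (h : 0 < delta1 r θ) :
    deriv (deriv (polarPerturbation r)) θ
      = -(iteratedDeriv 2 (fun θ => 1 / delta1 r θ) θ + Real.cos θ / r ^ 2) := by
  have hd : ContDiffAt ℝ ω (fun θ => 1 / delta1 r θ) θ :=
    contDiffAt_const.div (contDiffAt_delta1 h) h.ne'
  have hcont : ContinuousAt (delta1 r) θ := (contDiffAt_delta1 h).continuousAt
  have h1 : deriv (polarPerturbation r) =ᶠ[𝓝 θ]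
      fun θ => -Real.sin θ / r ^ 2 - deriv (fun θ => 1 / delta1 r θ) θ := by
    filter_upwards [hcont.eventually (lt_mem_nhds h)] with x hx
    have e1 : HasDerivAt (fun θ => 1 / delta1 r θ) (deriv (fun θ => 1 / delta1 r θ) x) x :=
      ((contDiffAt_const.div (contDiffAt_delta1 hx) hx.ne').differentiableAt
        (n := ω) (by simp)).hasDerivAt
    exact ((((Real.hasDerivAt_cos x).div_const (r ^ 2)).const_add (1 / r)).fun_sub e1).deriv
  have h2 : HasDerivAt (deriv fun θ => 1 / delta1 r θ)
      (iteratedDeriv 2 (fun θ => 1 / delta1 r θ) θ) θ := by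
    rw [iteratedDeriv_succ, iteratedDeriv_one]
    refine DifferentiableAt.hasDerivAt ?_
    have : ContDiffAt ℝ ω (fun θ' => fderiv ℝ (fun θ => 1 / delta1 r θ) θ' 1) θ :=
      (hd.fderiv_right (m := ω) (by simp)).clm_apply contDiffAt_const
    exact this.differentiableAt (by simp)
  rw [h1.deriv_eq, (((Real.hasDerivAt_sin θ).fun_neg.div_const (r ^ 2)).fun_sub h2).deriv]
  ring

theorem polarR_add_single_three (s : State) (y : ℝ) :
    polarR (s + y • Pi.single 3 1) = polarR s := by
  simp [polarR, ecc]

theorem polarTheta_add_single_three (s : State) (y : ℝ) :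
    polarTheta (s + y • Pi.single 3 1) = polarTheta s + y := by
  simp [polarTheta, ecc, add_assoc]

theorem delta1_pos_of_mem_domain {s : State} (hs : s ∈ domain 0) :
    0 < delta1 (polarR s) (polarTheta s) := by
  have h := (mem_domain_iff.1 hs).2.2
  rw [add_zero, distance_sq] at h
  exact Real.sqrt_pos.2 h

theorem hasDerivAt_line {E : Type*} [NormedAddCommGroup E] [NormedSpace ℝ E] (s v : E) :
    HasDerivAt (fun y : ℝ => s + y • v) v 0 := by
  simpa using ((hasDerivAt_id (0 : ℝ)).smul_const v).const_add s

theorem dirDeriv_three_perturbation {s : State} (hs : s ∈ domain 0) :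
    dirDeriv (Pi.single 3 1) perturbation s
      = deriv (polarPerturbation (polarR s)) (polarTheta s) := by
  have h1 := hasDerivAt_dirDeriv ((contDiffAt_perturbation hs).differentiableAt (by simp))
    (Pi.single 3 1) (hasDerivAt_line s (Pi.single 3 1)) (by simp)
  have h2 : (fun y : ℝ => perturbation (s + y • Pi.single 3 1))
      = fun y => polarPerturbation (polarR s) (polarTheta s + y) := by
    funext y
    rw [perturbation, polarR_add_single_three, polarTheta_add_single_three, polarPerturbation]
  rw [h2] at h1
  rw [← h1.deriv, deriv_comp_const_add, add_zero]

theorem dirDeriv_three_three_perturbation {s : State} (hs : s ∈ domain 0) :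
    dirDeriv (Pi.single 3 1) (dirDeriv (Pi.single 3 1) perturbation) s
      = -(iteratedDeriv 2 (fun θ => 1 / delta1 (polarR s) θ) (polarTheta s)
        + Real.cos (polarTheta s) / polarR s ^ 2) := by
  rw [← deriv_deriv_polarPerturbation (delta1_pos_of_mem_domain hs)]
  have hl := hasDerivAt_line s (Pi.single 3 (1 : ℝ))
  have h1 := hasDerivAt_dirDeriv
    (((contDiffAt_perturbation hs).dirDeriv (Pi.single 3 1)).differentiableAt (by simp))
    (Pi.single 3 1) hl (by simp)
  have h2 : (fun y : ℝ => dirDeriv (Pi.single 3 1) perturbation (s + y • Pi.single 3 1))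
      =ᶠ[𝓝 0] fun y => deriv (polarPerturbation (polarR s)) (polarTheta s + y) := by
    filter_upwards [hl.continuousAt.eventually_mem (mem_nhds_domain (s := s + (0 : ℝ) • _)
      (by simpa using hs))] with y hy
    rw [dirDeriv_three_perturbation hy, polarR_add_single_three, polarTheta_add_single_three]
  rw [← h1.deriv, h2.deriv_eq, deriv_comp_const_add, add_zero]

variable {p q : ℕ} {e : ℝ} {nl ng : ℕ}

theorem hasDerivAt_resonantOrbit (t : ℝ) :
    HasDerivAt (resonantOrbit p q e nl ng)
      (((q : ℝ) / p) • (Pi.single 2 1 : State) - (Pi.single 3 1 : State)) t := by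
  rw [hasDerivAt_pi]
  have e2 := resonantOrbit_two p q e nl ng
  have e3 := resonantOrbit_three p q e nl ng
  intro i
  fin_cases i
  · exact (hasDerivAt_const t (resL p q)).congr_deriv (by simp)
  · exact (hasDerivAt_const t (resG p q e)).congr_deriv (by simp)
  · have : HasDerivAt (fun t => (q : ℝ) * t / p + nl * Real.pi) (q * 1 / p) t :=
      (((hasDerivAt_id t).const_mul (q : ℝ)).div_const (p : ℝ)).add_const _
    simpa [e2] using this
  · have : HasDerivAt (fun t : ℝ => -t + ng * Real.pi) (-1) t :=
      (hasDerivAt_id t).fun_neg.add_const _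
    simpa [e3] using this

theorem resonantOrbit_add_period (hp : 0 < p) (nl ng : ℕ) (t : ℝ) :
    resonantOrbit p q e nl ng (t + 2 * Real.pi * p)
      = resonantOrbit p q e nl ng t
        + angleShift (2 * Real.pi * (q : ℤ)) (2 * Real.pi * (-p : ℤ)) := by
  have hp' : (p : ℝ) ≠ 0 := by positivity
  ext i
  fin_cases i
  · exact (add_zero _).symm
  · exact (add_zero _).symm
  · change resonantOrbit p q e nl ng _ 2 = resonantOrbit p q e nl ng _ 2 + 2 * Real.pi * (q : ℤ)
    rw [resonantOrbit_two, resonantOrbit_two]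
    push_cast
    field_simp
    ring
  · change resonantOrbit p q e nl ng _ 3 = resonantOrbit p q e nl ng _ 3
      + 2 * Real.pi * (-p : ℤ)
    rw [resonantOrbit_three, resonantOrbit_three]
    push_cast
    ring

/-- A directional derivative of a function with the periodicity of the angles is periodic. -/
theorem dirDeriv_perturbation_add_angleShift {s : State} (hs : s ∈ elliptic) (v : State)
    (j k : ℤ) :
    dirDeriv v perturbation (s + angleShift (2 * Real.pi * j) (2 * Real.pi * k))
      = dirDeriv v perturbation s := by
  rw [dirDeriv, dirDeriv, ← fderiv_comp_add_right]
  refine congrArg (fun A : State →L[ℝ] ℝ => A v) (Filter.EventuallyEq.fderiv_eq ?_)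
  filter_upwards [isOpen_elliptic.mem_nhds hs] with x hx using perturbation_add_angleShift hx j k

theorem continuous_dirDeriv_resonantOrbit
    (hd : ∀ t, resonantOrbit p q e nl ng t ∈ domain 0) (v w : State) :
    Continuous fun t => dirDeriv v (dirDeriv w perturbation) (resonantOrbit p q e nl ng t) :=
  continuous_iff_continuousAt.2 fun t => ContinuousAt.comp
    (g := dirDeriv v (dirDeriv w perturbation))
    (((contDiffAt_perturbation (hd t)).dirDeriv w).dirDeriv v).continuousAt
    (hasDerivAt_resonantOrbit t).continuousAt

/-- Along the resonant orbit `n ∂/∂l - ∂/∂g`, `n = q / p`, is the time derivative, so the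
integral of `n² ∂²/∂l² - ∂²/∂g² = (n ∂/∂l - ∂/∂g) (n ∂/∂l + ∂/∂g)` over a period vanishes. -/
theorem integral_dirDeriv_two_two (hp : 0 < p) (hq : 0 < q) (he : 0 < e) (he1 : e < 1)
    (hd : ∀ t, resonantOrbit p q e nl ng t ∈ domain 0) :
    ((q : ℝ) / p) ^ 2 * ∫ t in (0 : ℝ)..(2 * Real.pi * p), dirDeriv (Pi.single 2 1)
        (dirDeriv (Pi.single 2 1) perturbation) (resonantOrbit p q e nl ng t)
      = ∫ t in (0 : ℝ)..(2 * Real.pi * p), dirDeriv (Pi.single 3 1)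
        (dirDeriv (Pi.single 3 1) perturbation) (resonantOrbit p q e nl ng t) := by
  set n : ℝ := (q : ℝ) / p with hn
  set a : State := Pi.single 2 1 with ha
  set b : State := Pi.single 3 1 with hb
  set x := resonantOrbit p q e nl ng with hx
  have hder : ∀ t, HasDerivAt (fun t => n * dirDeriv a perturbation (x t)
      + dirDeriv b perturbation (x t)) (n ^ 2 * dirDeriv a (dirDeriv a perturbation) (x t)
        - dirDeriv b (dirDeriv b perturbation) (x t)) t := by
    intro t
    have hc := contDiffAt_perturbation (hd t)
    have key : ∀ v, HasDerivAt (fun t => dirDeriv v perturbation (x t))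
        (n * dirDeriv a (dirDeriv v perturbation) (x t)
          - dirDeriv b (dirDeriv v perturbation) (x t)) t := by
      intro v
      have h1 := hasDerivAt_dirDeriv ((hc.dirDeriv v).differentiableAt (by simp)) _
        (hasDerivAt_resonantOrbit (nl := nl) (ng := ng) t) rfl
      refine h1.congr_deriv ?_
      simp only [dirDeriv, map_sub, map_smul, smul_eq_mul]
      rfl
    refine (((key a).const_mul n).fun_add (key b)).congr_deriv ?_
    rw [dirDeriv_comm hc a b]
    ring
  have hca : Continuous fun t => n ^ 2 * dirDeriv a (dirDeriv a perturbation) (x t) :=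
    continuous_const.mul (continuous_dirDeriv_resonantOrbit hd a a)
  have hcb := continuous_dirDeriv_resonantOrbit hd b b
  have hint := intervalIntegral.integral_eq_sub_of_hasDerivAt (a := 0) (b := 2 * Real.pi * p)
    (fun t _ => hder t) ((hca.sub hcb).intervalIntegrable _ _)
  have hz : x (2 * Real.pi * p) = x 0
      + angleShift (2 * Real.pi * (q : ℤ)) (2 * Real.pi * (-p : ℤ)) := by
    rw [← resonantOrbit_add_period hp nl ng 0, zero_add]
  have h0 := resonantOrbit_mem_elliptic hp hq he he1 nl ng 0
  rw [hz, dirDeriv_perturbation_add_angleShift h0, dirDeriv_perturbation_add_angleShift h0,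
    sub_self, intervalIntegral.integral_sub (hca.intervalIntegrable _ _)
      (hcb.intervalIntegrable _ _), sub_eq_zero] at hint
  rw [← hint, ← intervalIntegral.integral_const_mul]

theorem stabC_eq (hp : 0 < p) (hq : 0 < q) (he : 0 < e) (he1 : e < 1)
    (hd : ∀ t, resonantOrbit p q e nl ng t ∈ domain 0) :
    stabC p q nl ng e = -3 / resL p q ^ 4 * (2 * Real.pi * p) *
      ∫ t in (0 : ℝ)..(2 * Real.pi * p), -dirDeriv (Pi.single 2 1)
        (dirDeriv (Pi.single 2 1) perturbation) (resonantOrbit p q e nl ng t) := by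
  have hp' : (p : ℝ) ≠ 0 := by positivity
  have hq' : (q : ℝ) ≠ 0 := by positivity
  have h1 := integral_dirDeriv_two_two hp hq he he1 hd
  have h2 : ∀ t, dirDeriv (Pi.single 3 1) (dirDeriv (Pi.single 3 1) perturbation)
      (resonantOrbit p q e nl ng t)
      = -(iteratedDeriv 2 (fun θ => 1 / delta1 (orbitR p q nl e t) θ) (orbitTheta p q nl ng e t)
        + Real.cos (orbitTheta p q nl ng e t) / orbitR p q nl e t ^ 2) := by
    intro t
    rw [dirDeriv_three_three_perturbation (hd t), polarR_resonantOrbit hp hq he he1,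
      polarTheta_resonantOrbit hp hq he he1]
  simp only [h2, intervalIntegral.integral_neg] at h1
  rw [stabC, intervalIntegral.integral_neg]
  have h3 : (p : ℝ) ^ ((5 : ℝ) / 3) / (q : ℝ) ^ ((2 : ℝ) / 3) * resL p q ^ 4
      = p ^ 3 / q ^ 2 := by
    have hL := resL_pow_three p q
    have hp53 : (p : ℝ) ^ ((5 : ℝ) / 3) / (q : ℝ) ^ ((2 : ℝ) / 3) = resL p q ^ 2 * p := by
      rw [resL_sq, Real.div_rpow (by positivity) (by positivity),
        show (5 : ℝ) / 3 = 2 / 3 + 1 by norm_num, Real.rpow_add (by positivity), Real.rpow_one]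
      ring
    rw [hp53, show resL p q ^ 2 * p * resL p q ^ 4 = (resL p q ^ 3) ^ 2 * p by ring, hL]
    field_simp
  have hL0 := (resL_pos hp hq).ne'
  have h4 : (p : ℝ) ^ ((5 : ℝ) / 3) / (q : ℝ) ^ ((2 : ℝ) / 3)
      = p ^ 3 / q ^ 2 / resL p q ^ 4 := by
    rw [← h3]; field_simp
  rw [mul_div_assoc, h4]
  rw [← neg_eq_iff_eq_neg] at h1
  rw [← h1]
  field_simp
  ring

end

/-! ### The derivative of the trace with respect to `μ` -/

section

variable {p q : ℕ} {e : ℝ} {nl ng : ℕ}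

/-- At `μ = 0` the member of a family is the resonant Kepler orbit. -/
theorem IsFamily.zero {μ₀ : ℝ} {γ : ℝ → ℝ → State} {T : ℝ → ℝ} (hp : 0 < p) (hq : 0 < q)
    (he : 0 < e) (he1 : e < 1) (h : IsFamily p q e nl ng μ₀ γ T) :
    γ 0 = resonantOrbit p q e nl ng ∧ T 0 = 2 * Real.pi * p := by
  have h0 : (0 : ℝ) ∈ Set.Ioo (-μ₀) μ₀ := ⟨by linarith [h.pos], h.pos⟩
  have hO : ∀ f : ℝ → ℝ, (f =O[𝓝 0] fun μ : ℝ => μ) → f 0 = 0 := by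
    intro f hf
    obtain ⟨K, hK⟩ := hf.bound
    have := hK.self_of_nhds
    simpa using this
  have hL : γ 0 0 0 = resL p q := sub_eq_zero.1 (hO _ h.init_L)
  have hG : γ 0 0 1 = resG p q e := sub_eq_zero.1 (hO _ h.init_G)
  refine ⟨?_, sub_eq_zero.1 (hO _ h.period)⟩
  have hsol := h.solution 0 h0
  have := eqOn_of_hasDerivAt (f := vectorField 0) (I := Set.univ) (x := γ 0)
    (y := resonantOrbit p q e nl ng) isOpen_univ isPreconnected_univ
    (fun t _ => (contDiffAt_vectorField_right (hsol t).1).of_le (by simp)) (fun t _ => (hsol t).2)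
    (fun t _ => hasDerivAt_keplerOrbit (resG_pos hp hq he he1) (resG_lt hp hq he) _ _ t)
    (t₀ := 0) trivial (by
      rw [resonantOrbit_at_zero, ← hL, ← hG, eq_startState (h.init_l 0 h0) (h.init_g 0 h0)]
      rfl)
  exact funext fun t => this trivial

/-- The trace, as a continuous linear form. -/
noncomputable def traceL : (State →L[ℝ] State) →L[ℝ] ℝ :=
  ∑ i : Fin 4, (ContinuousLinearMap.proj (R := ℝ) (φ := fun _ : Fin 4 => ℝ) i).comp
    (ContinuousLinearMap.apply ℝ State (Pi.single i 1))

theorem traceL_apply (A : State →L[ℝ] State) : traceL A = ∑ i, A (Pi.single i 1) i := by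
  simp [traceL]

theorem traceL_eq_trace (A : State →L[ℝ] State) :
    traceL A = LinearMap.trace ℝ State (A : State →ₗ[ℝ] State) := by
  rw [LinearMap.trace_eq_matrix_trace ℝ (Pi.basisFun ℝ (Fin 4)), traceL_apply, Matrix.trace]
  refine Finset.sum_congr rfl fun i _ => ?_
  simp

/-- The entry in the row `L` and the column `l`, as a continuous linear form. -/
noncomputable def entryL : (State →L[ℝ] State) →L[ℝ] ℝ :=
  (ContinuousLinearMap.proj (R := ℝ) (φ := fun _ : Fin 4 => ℝ) 0).comp
    (ContinuousLinearMap.apply ℝ State (Pi.single 2 1))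

theorem entryL_apply (A : State →L[ℝ] State) : entryL A = A (Pi.single 2 1) 0 := rfl

theorem traceL_comp_shear (A : State →L[ℝ] State) : traceL (A.comp shear) = entryL A := by
  simp [traceL_apply, entryL_apply, Fin.sum_univ_four, shear_apply]

theorem traceL_shear_comp (A : State →L[ℝ] State) : traceL (shear.comp A) = entryL A := by
  simp [traceL_apply, entryL_apply, Fin.sum_univ_four, shear_apply]

theorem entryL_comp_shear (A : State →L[ℝ] State) : entryL (A.comp shear) = 0 := by
  simp [entryL_apply, shear_apply]

theorem entryL_shear_comp (A : State →L[ℝ] State) : entryL (shear.comp A) = 0 := by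
  simp [entryL_apply, shear_apply]

section

variable {μ₀ η : ℝ} {γ : ℝ → ℝ → State} {T : ℝ → ℝ} {Y : ℝ × ℝ → State →L[ℝ] State}

theorem IsContinuation.resonantOrbit_mem_domain (hp : 0 < p) (hq : 0 < q)
    (he : 0 < e) (he1 : e < 1) (h : IsContinuation p q e nl ng μ₀ γ T η Y) (t : ℝ) :
    resonantOrbit p q e nl ng t ∈ domain 0 := by
  have h0 : (0 : ℝ) ∈ Set.Ioo (-μ₀) μ₀ := ⟨by linarith [h.family.pos], h.family.pos⟩
  rw [← (h.family.zero hp hq he he1).1]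
  exact (h.family.solution 0 h0 t).1

theorem IsContinuation.Y_zero_left (hp : 0 < p) (hq : 0 < q)
    (he : 0 < e) (he1 : e < 1) (h : IsContinuation p q e nl ng μ₀ γ T η Y) :
    ∀ t ∈ Set.Ioo (-η) (2 * Real.pi * p + η),
      Y (0, t) = ContinuousLinearMap.id ℝ State + (-3 / resL p q ^ 4 * t) • shear := by
  have h0 : (0 : ℝ) ∈ Set.Ioo (-μ₀) μ₀ := ⟨by linarith [h.family.pos], h.family.pos⟩
  have hη := h.width_pos
  have hpi := Real.pi_pos
  have h1 := h.isVarSol 0 h0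
  rw [(h.family.zero hp hq he he1).1] at h1
  have h2 := isVarSol_keplerOrbit (I := Set.Ioo (-η) (2 * Real.pi * p + η))
    (resG_pos hp hq he he1) (resG_lt hp hq he) (l := nl * Real.pi) (g := ng * Real.pi)
    fun t _ => h.resonantOrbit_mem_domain hp hq he he1 t
  have h3 : (0 : ℝ) ∈ Set.Ioo (-η) (2 * Real.pi * p + η) := ⟨by linarith, by positivity⟩
  exact (h1.eqOn h2 isOpen_Ioo isPreconnected_Ioo h3 rfl (by
    simp only [h.Y_zero 0 h0]
    simp)).2

/-- The variation of the linearized vector field along the family is trace-free, and its entry in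
the row `L` and the column `l` comes from the perturbing function. -/
theorem IsContinuation.exists_variation (hp : 0 < p) (hq : 0 < q) (he : 0 < e) (he1 : e < 1)
    (h : IsContinuation p q e nl ng μ₀ γ T η Y) (t : ℝ) :
    ∃ B : State →L[ℝ] State,
      HasDerivAt (fun μ => fderiv ℝ (vectorField μ) (γ μ t)) B 0 ∧ traceL B = 0 ∧
      entryL B = -dirDeriv (Pi.single 2 1) (dirDeriv (Pi.single 2 1) perturbation)
        (resonantOrbit p q e nl ng t) := by
  have h0 : (0 : ℝ) ∈ Set.Ioo (-μ₀) μ₀ := ⟨by linarith [h.family.pos], h.family.pos⟩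
  have hz := (h.family.zero hp hq he he1).1
  have hγ : ContDiffAt ℝ ω (fun μ => γ μ t) 0 :=
    ContDiffAt.comp (g := Function.uncurry γ) (f := fun μ => (μ, t)) 0
      (h.family.analytic (0, t) ⟨h0, trivial⟩).contDiffAt (by fun_prop)
  have hm : ((0 : ℝ), γ 0 t) ∈ phaseDomain := (h.family.solution 0 h0 t).1
  have hA : ContDiffAt ℝ ω (fun μ => fderiv ℝ (vectorField μ) (γ μ t)) 0 :=
    ContDiffAt.comp (g := fun p : ℝ × State => fderiv ℝ (vectorField p.1) p.2)
      (f := fun μ => (μ, γ μ t)) 0 (contDiffAt_fderiv_vectorField hm) (contDiffAt_id.prodMk hγ)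
  have hB := (hA.differentiableAt (by simp)).hasDerivAt
  refine ⟨_, hB, ?_, ?_⟩
  · have h1 := traceL.hasFDerivAt.comp_hasDerivAt (0 : ℝ) hB
    refine h1.unique ((hasDerivAt_const (0 : ℝ) (0 : ℝ)).congr_of_eventuallyEq ?_)
    filter_upwards [Ioo_mem_nhds h0.1 h0.2] with μ hμ
    have := trace_fderiv_vectorField (p := (μ, γ μ t)) (h.family.solution μ hμ t).1
    rw [Function.comp_apply, traceL_apply]
    exact this
  · have h1 := entryL.hasFDerivAt.comp_hasDerivAt (0 : ℝ) hB
    rw [← hz]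
    exact h1.unique (hasDerivAt_fderiv_vectorField_entry
      (hγ.differentiableAt (by simp)).hasDerivAt (h.family.solution 0 h0 t).1)

/-- The variational equation of second order for the derivative of `Y` in `μ`. -/
theorem IsContinuation.hasDerivAt_dirDeriv_Y (hp : 0 < p) (hq : 0 < q) (he : 0 < e) (he1 : e < 1)
    (h : IsContinuation p q e nl ng μ₀ γ T η Y) {t : ℝ}
    (ht : t ∈ Set.Ioo (-η) (2 * Real.pi * p + η)) {B : State →L[ℝ] State}
    (hB : HasDerivAt (fun μ => fderiv ℝ (vectorField μ) (γ μ t)) B 0) :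
    HasDerivAt (fun t => dirDeriv ((1, 0) : ℝ × ℝ) Y (0, t))
      (B.comp (ContinuousLinearMap.id ℝ State + (-3 / resL p q ^ 4 * t) • shear)
        + ((-3 / resL p q ^ 4) • shear).comp (dirDeriv ((1, 0) : ℝ × ℝ) Y (0, t))) t := by
  have h0 : (0 : ℝ) ∈ Set.Ioo (-μ₀) μ₀ := ⟨by linarith [h.family.pos], h.family.pos⟩
  have hz := (h.family.zero hp hq he he1).1
  have hY := h.contDiffAt_Y 0 h0 t ht
  have hYd : ∀ μ ∈ Set.Ioo (-μ₀) μ₀, ∀ t ∈ Set.Ioo (-η) (2 * Real.pi * p + η),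
      DifferentiableAt ℝ Y (μ, t) := fun μ hμ t ht =>
    (h.contDiffAt_Y μ hμ t ht).differentiableAt (by simp)
  have c1 : ∀ μ t : ℝ, HasDerivAt (fun t => (μ, t)) ((0, 1) : ℝ × ℝ) t := fun μ t =>
    (hasDerivAt_const t μ).prodMk (hasDerivAt_id t)
  have c2 : ∀ μ t : ℝ, HasDerivAt (fun μ => (μ, t)) ((1, 0) : ℝ × ℝ) μ := fun μ t =>
    (hasDerivAt_id μ).prodMk (hasDerivAt_const μ t)
  have h1 := hasDerivAt_dirDeriv ((hY.dirDeriv (1, 0)).differentiableAt (by simp)) (0, 1) (c1 0 t)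
    rfl
  rw [dirDeriv_comm hY] at h1
  refine h1.congr_deriv ?_
  have h2 := hasDerivAt_dirDeriv ((hY.dirDeriv (0, 1)).differentiableAt (by simp)) (1, 0) (c2 0 t)
    rfl
  have h3 : (fun μ => dirDeriv ((0, 1) : ℝ × ℝ) Y (μ, t))
      =ᶠ[𝓝 0] fun μ => (fderiv ℝ (vectorField μ) (γ μ t)).comp (Y (μ, t)) := by
    filter_upwards [Ioo_mem_nhds h0.1 h0.2] with μ hμ
    exact (hasDerivAt_dirDeriv (hYd μ hμ t ht) (0, 1) (c1 μ t) rfl).unique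
      ((h.isVarSol μ hμ).var t ht)
  have h4 := hB.clm_comp (hasDerivAt_dirDeriv (hYd 0 h0 t ht) (1, 0) (c2 0 t) rfl)
  have h5 := h2.unique (h4.congr_of_eventuallyEq h3)
  rw [h5, h.Y_zero_left hp hq he he1 t ht, hz, fderiv_vectorField_zero
    (resonantOrbit_mem_elliptic hp hq he he1 nl ng t)]
  rfl

/-- To first order in `μ` the trace of the monodromy operator is `4 + C μ`. -/
theorem IsContinuation.hasDerivAt_trace (hp : 0 < p) (hq : 0 < q) (he : 0 < e) (he1 : e < 1)
    (h : IsContinuation p q e nl ng μ₀ γ T η Y) :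
    HasDerivAt (fun μ => traceL (Y (μ, T μ))) (stabC p q nl ng e) 0 := by
  have h0 : (0 : ℝ) ∈ Set.Ioo (-μ₀) μ₀ := ⟨by linarith [h.family.pos], h.family.pos⟩
  obtain ⟨hz, hT0⟩ := h.family.zero hp hq he he1
  have hη := h.width_pos
  have hpi := Real.pi_pos
  have hd := h.resonantOrbit_mem_domain hp hq he he1
  set k : ℝ := -3 / resL p q ^ 4 with hk
  set b : ℝ := 2 * Real.pi * p with hb
  have hb0 : 0 < b := by positivity
  set I := Set.Ioo (-η) (b + η) with hI
  have hsub : Set.uIcc 0 b ⊆ I := by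
    rw [Set.uIcc_of_le hb0.le]
    exact fun t ht => ⟨by linarith [ht.1], by linarith [ht.2]⟩
  choose B hB hB1 hB2 using h.exists_variation hp hq he he1
  set W : ℝ → State →L[ℝ] State := fun t => dirDeriv ((1, 0) : ℝ × ℝ) Y (0, t) with hW
  have hWd : ∀ t ∈ I, HasDerivAt W
      ((B t).comp (ContinuousLinearMap.id ℝ State + (k * t) • shear) + (k • shear).comp (W t)) t :=
    fun t ht => h.hasDerivAt_dirDeriv_Y hp hq he he1 ht (hB t)
  have hexp : ∀ t, (B t).comp (ContinuousLinearMap.id ℝ State + (k * t) • shear)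
      + (k • shear).comp (W t) = B t + (k * t) • (B t).comp shear + k • shear.comp (W t) := by
    intro t
    simp [ContinuousLinearMap.comp_add]
  have hw : ∀ t ∈ I, HasDerivAt (fun t => entryL (W t)) (entryL (B t)) t := by
    intro t ht
    refine (entryL.hasFDerivAt.comp_hasDerivAt t (hWd t ht)).congr_deriv ?_
    rw [hexp, map_add, map_add, map_smul, map_smul, entryL_comp_shear, entryL_shear_comp]
    simp
  have htr : ∀ t ∈ I, HasDerivAt (fun t => traceL (W t))
      (k * t * entryL (B t) + k * entryL (W t)) t := by
    intro t ht
    refine (traceL.hasFDerivAt.comp_hasDerivAt t (hWd t ht)).congr_deriv ?_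
    rw [hexp, map_add, map_add, map_smul, map_smul, traceL_comp_shear, traceL_shear_comp, hB1]
    simp
  have hD : ∀ t ∈ I, HasDerivAt (fun t => traceL (W t) - k * t * entryL (W t)) 0 t := by
    intro t ht
    refine ((htr t ht).fun_sub ((((hasDerivAt_id t).const_mul k)).fun_mul (hw t ht))).congr_deriv ?_
    simp only [id]
    ring
  have hW0 : W 0 = 0 := by
    have h00 : (0 : ℝ) ∈ I := ⟨by linarith, by linarith⟩
    have h1 := hasDerivAt_dirDeriv ((h.contDiffAt_Y 0 h0 0 h00).differentiableAt (by simp))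
      ((1, 0) : ℝ × ℝ) ((hasDerivAt_id (0 : ℝ)).prodMk (hasDerivAt_const (0 : ℝ) (0 : ℝ))) rfl
    refine h1.unique
      ((hasDerivAt_const (0 : ℝ) (ContinuousLinearMap.id ℝ State)).congr_of_eventuallyEq
      ?_)
    filter_upwards [Ioo_mem_nhds h0.1 h0.2] with μ hμ using h.Y_zero μ hμ
  have hint1 := intervalIntegral.integral_eq_sub_of_hasDerivAt (a := 0) (b := b)
    (fun t ht => hD t (hsub ht)) (by simp)
  have hcont : Continuous fun t => entryL (B t) := by
    simp only [hB2]
    exact (continuous_dirDeriv_resonantOrbit hd _ _).neg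
  have hint2 := intervalIntegral.integral_eq_sub_of_hasDerivAt (a := 0) (b := b)
    (fun t ht => hw t (hsub ht)) (hcont.intervalIntegrable _ _)
  rw [hW0, map_zero, sub_zero] at hint2
  simp only [hW0, map_zero, mul_zero, sub_zero, intervalIntegral.integral_zero] at hint1
  have hTd : HasDerivAt T (deriv T 0) 0 :=
    (h.family.analytic_period 0 h0).differentiableAt.hasDerivAt
  have hbI : b ∈ I := ⟨by linarith, by linarith⟩
  have hYb := (h.contDiffAt_Y 0 h0 b hbI).differentiableAt (n := ω) (by simp)
  have hfin := traceL.hasFDerivAt.comp_hasDerivAt (0 : ℝ)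
    (hasDerivAt_dirDeriv hYb ((1, deriv T 0) : ℝ × ℝ) ((hasDerivAt_id (0 : ℝ)).prodMk hTd)
      (by simp [hT0]))
  refine hfin.congr_deriv ?_
  have hsplit : dirDeriv ((1, deriv T 0) : ℝ × ℝ) Y (0, b)
      = W b + deriv T 0 • (k • shear).comp (Y (0, b)) := by
    have e1 : dirDeriv ((0, 1) : ℝ × ℝ) Y (0, b) = (k • shear).comp (Y (0, b)) := by
      have := (h.isVarSol 0 h0).var b hbI
      rw [hz, fderiv_vectorField_zero (resonantOrbit_mem_elliptic hp hq he he1 nl ng b)] at this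
      exact (hasDerivAt_dirDeriv hYb (0, 1) ((hasDerivAt_const b (0 : ℝ)).prodMk
        (hasDerivAt_id b)) rfl).unique this
    rw [← e1]
    simp only [hW, dirDeriv]
    rw [← map_smul, ← map_add]
    simp
  have hshear : traceL ((k • shear).comp (Y (0, b))) = 0 := by
    rw [h.Y_zero_left hp hq he he1 b hbI]
    have : (k • shear).comp (ContinuousLinearMap.id ℝ State + (k * b) • shear) = k • shear := by
      rw [ContinuousLinearMap.comp_add, ContinuousLinearMap.comp_smul,
        ContinuousLinearMap.smul_comp, ContinuousLinearMap.smul_comp, shear_comp_shear]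
      simp
    rw [this, map_smul, traceL_apply]
    simp [Fin.sum_univ_four, shear_apply]
  rw [hsplit, map_add, map_smul, hshear, smul_zero, add_zero, stabC_eq hp hq he he1 hd]
  simp only [hB2] at hint2
  rw [hint2]
  linarith

end

end

/-! ### The characteristic multipliers of the family -/

section

variable {p q : ℕ} {e : ℝ} {nl ng : ℕ}
variable {μ₀ η : ℝ} {γ : ℝ → ℝ → State} {T : ℝ → ℝ} {Y : ℝ × ℝ → State →L[ℝ] State}

theorem IsContinuation.period_mem (h : IsContinuation p q e nl ng μ₀ γ T η Y) {μ : ℝ}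
    (hμ : μ ∈ Set.Ioo (-μ₀) μ₀) : T μ ∈ Set.Ioo (-η) (2 * Real.pi * p + η) := by
  have h1 := abs_lt.1 (h.period_close μ hμ)
  have h2 := h.width_pos
  have h3 : 0 ≤ 2 * Real.pi * p := by positivity
  exact ⟨by linarith, by linarith⟩

/-- The velocity is a fixed vector of the monodromy operator. -/
theorem IsContinuation.monodromy_velocity (h : IsContinuation p q e nl ng μ₀ γ T η Y) {μ : ℝ}
    (hμ : μ ∈ Set.Ioo (-μ₀) μ₀) :
    Y (μ, T μ) (vectorField μ (γ μ 0)) = vectorField μ (γ μ 0) := by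
  have hη := h.width_pos
  have h3 : 0 ≤ 2 * Real.pi * p := by positivity
  let φ : State →L[ℝ] ℝ := ContinuousLinearMap.proj (R := ℝ) (φ := fun _ : Fin 4 => ℝ) 0
  have hvar := h.isVarSol μ hμ
  have h1 := ((hvar.comp_right (φ.smulRight (vectorField μ (γ μ 0)))).eqOn (hvar.velocity φ)
    isOpen_Ioo isPreconnected_Ioo (t₀ := 0) ⟨by linarith, by linarith⟩ rfl (by
      simp only [h.Y_zero μ hμ]
      rfl)).2 (h.period_mem hμ)
  have h2 := DFunLike.congr_fun h1 (Pi.single 0 1)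
  simp only at h2
  have h4 : γ μ (T μ) = γ μ 0 + angleShift (2 * Real.pi * (q : ℤ)) (2 * Real.pi * (-p : ℤ)) := by
    rw [← h.closes μ hμ 0, zero_add]
  rw [h4, vectorField_add_angleShift
    (elliptic_of_mem_domain (h.family.solution μ hμ 0).1)] at h2
  simpa [φ] using h2

theorem _root_.AnalyticAt.sub_linear_isBigO {f : ℝ → ℝ} {C : ℝ} (hf : AnalyticAt ℝ f 0)
    (h0 : f 0 = 0)
    (h1 : HasDerivAt f C 0) : (fun x => f x - C * x) =O[𝓝 0] fun x => x ^ 2 := by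
  obtain ⟨P, hP⟩ := hf
  have h2 := hP.isBigO_sub_partialSum_pow 2
  have e0 : P.coeff 0 = 0 := (hP.coeff_zero _).trans h0
  have e1 : P.coeff 1 = C := hP.hasDerivAt.unique h1
  have h4 : ∀ x : ℝ, P.partialSum 2 x = C * x := by
    intro x
    simp [FormalMultilinearSeries.partialSum, Finset.sum_range_succ, e0, e1, mul_comm]
  refine (h2.congr (g₂ := fun x => x ^ 2) (fun x => ?_) fun x => ?_)
  · rw [h4, zero_add]
  · rw [Real.norm_eq_abs, sq_abs]

/-- The characteristic multipliers of the continuation. -/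
theorem IsContinuation.exists_multipliers (hp : 0 < p) (hq : 0 < q) (he : 0 < e) (he1 : e < 1)
    (h : IsContinuation p q e nl ng μ₀ γ T η Y) :
    ∃ μ₁ > 0, μ₁ ≤ μ₀ ∧ ∃ κ : ℝ → ℝ,
      (∀ μ ∈ Set.Ioo (-μ₁) μ₁,
        AreMultipliers μ (γ μ) (T μ) {1, 1, multiplier 1 (κ μ), multiplier (-1) (κ μ)}) ∧
      (fun μ => κ μ - stabC p q nl ng e * μ) =O[𝓝 0] fun μ => μ ^ 2 := by
  have h0 : (0 : ℝ) ∈ Set.Ioo (-μ₀) μ₀ := ⟨by linarith [h.family.pos], h.family.pos⟩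
  obtain ⟨hz, hT0⟩ := h.family.zero hp hq he he1
  set κ : ℝ → ℝ := fun μ => traceL (Y (μ, T μ)) - 4 with hκ
  have hT : ContDiffAt ℝ ω T 0 := (h.family.analytic_period 0 h0).contDiffAt
  have hM : ContDiffAt ℝ ω (fun μ => Y (μ, T μ)) 0 :=
    ContDiffAt.comp (g := Y) (f := fun μ => (μ, T μ)) 0 (h.contDiffAt_Y 0 h0 _ (h.period_mem h0))
      (contDiffAt_id.prodMk hT)
  have hM0 : Y (0, T 0) = ContinuousLinearMap.id ℝ State
      + (-3 / resL p q ^ 4 * T 0) • shear := h.Y_zero_left hp hq he he1 _ (h.period_mem h0)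
  -- the determinant is a square at `μ = 0`
  have hdet0 : 0 < (Y (0, T 0)).det := by
    set c := -3 / resL p q ^ 4 * T 0 with hc
    have e1 : Y (0, T 0) = (ContinuousLinearMap.id ℝ State + (c / 2) • shear).comp
        (ContinuousLinearMap.id ℝ State + (c / 2) • shear) := by
      rw [hM0]
      simp only [ContinuousLinearMap.comp_add, ContinuousLinearMap.add_comp,
        ContinuousLinearMap.comp_smul, ContinuousLinearMap.smul_comp, shear_comp_shear,
        ContinuousLinearMap.comp_id, ContinuousLinearMap.id_comp, smul_zero, add_zero]
      rw [add_assoc, ← add_smul, add_halves]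
    have e2 : (Y (0, T 0)).det ≠ 0 := by
      obtain ⟨U, hU⟩ := exists_unit_of_reversible (h.reversible 0 h0)
      have h1 : ((U : State →L[ℝ] State)).comp ((U⁻¹ : (State →L[ℝ] State)ˣ) : State →L[ℝ] State)
          = ContinuousLinearMap.id ℝ State := U.mul_inv
      have h2 : LinearMap.det ((U : State →L[ℝ] State) : State →ₗ[ℝ] State) *
          LinearMap.det (((U⁻¹ : (State →L[ℝ] State)ˣ) : State →L[ℝ] State) : State →ₗ[ℝ] State)
          = 1 := by
        rw [← LinearMap.det_comp]
        exact (congrArg (fun A : State →L[ℝ] State => LinearMap.det (A : State →ₗ[ℝ] State))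
          h1).trans LinearMap.det_id
      rw [← hU]
      exact left_ne_zero_of_mul_eq_one h2
    refine lt_of_le_of_ne ?_ e2.symm
    rw [e1]
    exact (mul_self_nonneg _).trans_eq (LinearMap.det_comp _ _).symm
  have hev1 : ∀ᶠ μ in 𝓝 (0 : ℝ), 0 < (Y (μ, T μ)).det :=
    (ContinuousLinearMap.continuous_det.continuousAt.comp (f := fun μ => Y (μ, T μ))
      hM.continuousAt).eventually (lt_mem_nhds hdet0)
  have hev2 : ∀ᶠ μ in 𝓝 (0 : ℝ), vectorField μ (γ μ 0) ≠ 0 := by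
    have hγ : ContinuousAt (fun μ => (μ, γ μ 0)) 0 :=
      continuousAt_id.prodMk (ContinuousAt.comp (g := Function.uncurry γ)
        (f := fun μ => (μ, (0 : ℝ))) (h.family.analytic (0, 0) ⟨h0, trivial⟩).continuousAt
        (by fun_prop))
    have hv : ContinuousAt (fun μ => vectorField μ (γ μ 0)) 0 :=
      ContinuousAt.comp (g := fun p : ℝ × State => vectorField p.1 p.2) (f := fun μ => (μ, γ μ 0))
        (contDiffAt_vectorField (p := (0, γ 0 0)) (h.family.solution 0 h0 0).1).continuousAt hγ
    refine hv.eventually_ne ?_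
    rw [hz, vectorField_zero (resonantOrbit_mem_elliptic hp hq he he1 nl ng 0)]
    intro h3
    have := congrFun h3 3
    simp at this
  have hev := (hev1.and hev2).and (Ioo_mem_nhds h0.1 h0.2)
  obtain ⟨μ₁, hμ₁, hgood⟩ := Metric.eventually_nhds_iff_ball.1 hev
  rw [Real.ball_eq_Ioo, zero_sub, zero_add] at hgood
  refine ⟨min μ₁ μ₀, lt_min hμ₁ h.family.pos, min_le_right _ _, κ, fun μ hμ => ?_, ?_⟩
  · have hm : μ ∈ Set.Ioo (-μ₁) μ₁ :=
      ⟨by linarith [hμ.1, min_le_left μ₁ μ₀], hμ.2.trans_le (min_le_left _ _)⟩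
    obtain ⟨⟨h1, h2⟩, h3⟩ := hgood μ hm
    refine ⟨Y (μ, T μ), h.monodromy μ h3, ?_⟩
    rw [roots_charpoly_of_reversible (h.reversible μ h3) h1 h2 (h.monodromy_velocity h3),
      ← traceL_eq_trace]
  · refine AnalyticAt.sub_linear_isBigO ?_ ?_
      ((h.hasDerivAt_trace hp hq he he1).sub_const 4)
    · exact ((traceL.contDiff.contDiffAt.comp 0 hM).sub contDiffAt_const).analyticAt
    · simp only [hκ, hM0, map_add, map_smul]
      simp [traceL_apply, Fin.sum_univ_four, shear_apply]

end

/-! ### The two types of families -/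

section

variable {p q : ℕ} {e : ℝ} {nl ng : ℕ}

/-- A continuous function on an interval with values in `ℤ π` is constant. -/
theorem eq_of_mem_int_mul_pi {f : ℝ → ℝ} {a : ℝ} (hf : ContinuousOn f (Set.Ioo (-a) a))
    (h : ∀ x ∈ Set.Ioo (-a) a, ∃ k : ℤ, f x = k * Real.pi) {x y : ℝ} (hx : x ∈ Set.Ioo (-a) a)
    (hy : y ∈ Set.Ioo (-a) a) : f x = f y := by
  refine isPreconnected_Ioo.constant_of_mapsTo (T := (AddSubgroup.zmultiples Real.pi : Set ℝ))
    (isDiscrete_iff_discreteTopology.2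
      (inferInstanceAs (DiscreteTopology (AddSubgroup.zmultiples Real.pi)))) hf
    (fun z hz => ?_) hx hy
  obtain ⟨k, hk⟩ := h z hz
  exact ⟨k, by simp [hk]⟩

/-- The translate of a family by half a period is a family again, of a type in which both angles
are shifted by the half-period rotation numbers `q` and `-p`. -/
theorem IsFamily.half_shift {μ₀ : ℝ} {γ : ℝ → ℝ → State} {T : ℝ → ℝ} (hp : 0 < p) (hq : 0 < q)
    (he : 0 < e) (he1 : e < 1) (h : IsFamily p q e nl ng μ₀ γ T) {nl' ng' : ℕ} {j k : ℤ}
    (hj : (nl' : ℤ) = q + nl + 2 * j) (hk : (ng' : ℤ) = -p + ng + 2 * k) :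
    IsFamily p q e nl' ng' μ₀
      (fun μ t => γ μ (t + T μ / 2) + angleShift (2 * Real.pi * j) (2 * Real.pi * k)) T := by
  have h0 : (0 : ℝ) ∈ Set.Ioo (-μ₀) μ₀ := ⟨by linarith [h.pos], h.pos⟩
  obtain ⟨hz, hT0⟩ := h.zero hp hq he he1
  have hp' : (p : ℝ) ≠ 0 := by positivity
  have hpi := Real.pi_pos
  have hana : AnalyticOnNhd ℝ (Function.uncurry fun μ t =>
      γ μ (t + T μ / 2) + angleShift (2 * Real.pi * j) (2 * Real.pi * k))
      (Set.Ioo (-μ₀) μ₀ ×ˢ Set.univ) := by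
    rintro ⟨μ, t⟩ ⟨hμ, -⟩
    have hT : ContDiffAt ℝ ω (fun v : ℝ × ℝ => T v.1) (μ, t) :=
      ContDiffAt.comp (g := T) (f := Prod.fst) (μ, t) (h.analytic_period μ hμ).contDiffAt
        contDiffAt_fst
    have h1 : ContDiffAt ℝ ω (fun v : ℝ × ℝ => γ v.1 (v.2 + T v.1 / 2)) (μ, t) :=
      ContDiffAt.comp (g := Function.uncurry γ) (f := fun v : ℝ × ℝ => (v.1, v.2 + T v.1 / 2))
        (μ, t) (h.analytic (μ, t + T μ / 2) ⟨hμ, trivial⟩).contDiffAt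
        (contDiffAt_fst.prodMk (contDiffAt_snd.add (hT.div_const 2)))
    exact (h1.add contDiffAt_const).analyticAt
  have hsol : ∀ μ ∈ Set.Ioo (-μ₀) μ₀, IsSolution μ (fun t =>
      γ μ (t + T μ / 2) + angleShift (2 * Real.pi * j) (2 * Real.pi * k)) := by
    intro μ hμ t
    obtain ⟨h1, h2⟩ := h.solution μ hμ (t + T μ / 2)
    refine ⟨add_angleShift_mem_domain h1 j k, ?_⟩
    rw [vectorField_add_angleShift (elliptic_of_mem_domain h1)]
    exact (h2.comp_add_const t (T μ / 2)).add_const _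
  have hdiff : ∀ i, ∀ μ ∈ Set.Ioo (-μ₀) μ₀, DifferentiableAt ℝ (fun μ => γ μ (T μ / 2) i) μ := by
    intro i μ hμ
    have h1 : ContDiffAt ℝ ω (fun μ => γ μ (T μ / 2)) μ :=
      ContDiffAt.comp (g := Function.uncurry γ) (f := fun μ => (μ, T μ / 2))
        μ (h.analytic (μ, T μ / 2) ⟨hμ, trivial⟩).contDiffAt
        (contDiffAt_id.prodMk ((h.analytic_period μ hμ).contDiffAt.div_const 2))
    exact (contDiffAt_pi.1 h1 i).differentiableAt (by simp)
  have hhalf : ∀ μ ∈ Set.Ioo (-μ₀) μ₀, _ := fun μ hμ =>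
    (h.solution μ hμ).half_period (m := nl) (n := ng) (by simpa using h.init_l μ hμ)
      (by simpa using h.init_g μ hμ) (h.periodic μ hμ)
  have hl : ∀ μ ∈ Set.Ioo (-μ₀) μ₀,
      γ μ (0 + T μ / 2) 2 + 2 * Real.pi * j = nl' * Real.pi := by
    intro μ hμ
    rw [zero_add, eq_of_mem_int_mul_pi (f := fun μ => γ μ (T μ / 2) 2)
      (fun μ hμ => (hdiff 2 μ hμ).continuousAt.continuousWithinAt)
      (fun μ hμ => (hhalf μ hμ).1) hμ h0]
    simp only [hz, hT0]
    rw [resonantOrbit_two]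
    have : (nl' : ℝ) = q + nl + 2 * j := by exact_mod_cast hj
    rw [this]
    field_simp
  have hg : ∀ μ ∈ Set.Ioo (-μ₀) μ₀,
      γ μ (0 + T μ / 2) 3 + 2 * Real.pi * k = ng' * Real.pi := by
    intro μ hμ
    rw [zero_add, eq_of_mem_int_mul_pi (f := fun μ => γ μ (T μ / 2) 3)
      (fun μ hμ => (hdiff 3 μ hμ).continuousAt.continuousWithinAt)
      (fun μ hμ => (hhalf μ hμ).2) hμ h0]
    simp only [hz, hT0]
    rw [resonantOrbit_three]
    have : (ng' : ℝ) = -p + ng + 2 * k := by exact_mod_cast hk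
    rw [this]
    ring
  have hact : ∀ i, (fun μ => γ μ (T μ / 2) i - γ 0 (T 0 / 2) i) =O[𝓝 0] fun μ => μ := by
    intro i
    simpa using (hdiff i 0 h0).hasDerivAt.isBigO_sub
  refine ⟨h.pos, hana, h.analytic_period, hsol, fun μ hμ => ⟨(h.periodic μ hμ).1, fun t => ?_⟩,
    fun μ hμ t => sameState_iff.2 ⟨nl', ng', ?_⟩, h.period, ?_, ?_, hl, hg⟩
  · obtain ⟨a, b, hab⟩ := sameState_iff.1 ((h.periodic μ hμ).2 (t + T μ / 2))
    refine sameState_iff.2 ⟨a, b, ?_⟩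
    simp only
    rw [show t + T μ + T μ / 2 = t + T μ / 2 + T μ by ring, hab]
    abel
  · exact (hsol μ hμ).symmetric (m := nl') (n := ng') (hl μ hμ) (hg μ hμ) t
  · refine (hact 0).congr_left fun μ => ?_
    simp only [hz, zero_add]
    exact congrArg (· - resL p q) (add_zero _).symm
  · refine (hact 1).congr_left fun μ => ?_
    simp only [hz, zero_add]
    exact congrArg (· - resG p q e) (add_zero _).symm

/-- Types of equal parity are the same up to half a period. -/
theorem IsFamily.exists_shift {μ₀ : ℝ} {γ : ℝ → ℝ → State} {T : ℝ → ℝ} (hp : 0 < p) (hq : 0 < q)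
    (hpq : Nat.Coprime p q) (he : 0 < e) (he1 : e < 1) {nl ng nl' ng' : Fin 2}
    (h : IsFamily p q e nl ng μ₀ γ T)
    (hpar : p * (nl : ℕ) + q * (ng : ℕ) ≡ p * (nl' : ℕ) + q * (ng' : ℕ) [MOD 2]) :
    ∃ (γ' : ℝ → ℝ → State) (σ : ℝ → ℝ), IsFamily p q e nl' ng' μ₀ γ' T ∧
      ∀ μ ∈ Set.Ioo (-μ₀) μ₀, ∀ t, SameState (γ' μ t) (γ μ (t + σ μ)) := by
  have hnot : ¬ (2 ∣ p ∧ 2 ∣ q) := fun ⟨h1, h2⟩ => by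
    have := Nat.dvd_gcd h1 h2
    rw [hpq] at this
    omega
  have hcase : (nl = nl' ∧ ng = ng') ∨
      (((nl' : ℕ) : ℤ) % 2 = (q + (nl : ℕ)) % 2 ∧ ((ng' : ℕ) : ℤ) % 2 = (-p + (ng : ℕ)) % 2) := by
    rw [Nat.ModEq] at hpar
    rcases Nat.mod_two_eq_zero_or_one p with h1 | h1 <;>
    rcases Nat.mod_two_eq_zero_or_one q with h2 | h2 <;>
    fin_cases nl <;> fin_cases ng <;> fin_cases nl' <;> fin_cases ng' <;>
    simp at hpar ⊢ <;> omega
  rcases hcase with ⟨rfl, rfl⟩ | ⟨h1, h2⟩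
  · refine ⟨γ, fun _ => 0, h, fun μ _ t => ?_⟩
    rw [add_zero]
    exact sameState_iff.2 ⟨0, 0, by ext i; fin_cases i <;> simp [angleShift]⟩
  · obtain ⟨j, hj⟩ := (Int.ModEq.dvd h1.symm :
      (2 : ℤ) ∣ ((nl' : ℕ) : ℤ) - (q + (nl : ℕ)))
    obtain ⟨k, hk⟩ := (Int.ModEq.dvd h2.symm : (2 : ℤ) ∣ ((ng' : ℕ) : ℤ) - (-p + (ng : ℕ)))
    refine ⟨_, fun μ => T μ / 2, h.half_shift hp hq he he1 (j := j) (k := k) (by linarith)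
      (by linarith), fun μ _ t => sameState_iff.2 ⟨j, k, rfl⟩⟩

/-- The angles of a state as points of the unit circle. -/
noncomputable def anglePoints (s : State) : (ℝ × ℝ) × (ℝ × ℝ) :=
  ((Real.cos (s 2), Real.sin (s 2)), (Real.cos (s 3), Real.sin (s 3)))

theorem continuous_anglePoints : Continuous anglePoints := by
  unfold anglePoints
  fun_prop

theorem SameState.anglePoints_eq {s s' : State} (h : SameState s s') :
    anglePoints s = anglePoints s' := by
  obtain ⟨-, -, ⟨j, hj⟩, ⟨k, hk⟩⟩ := h
  have e : ∀ (x : ℝ) (j : ℤ), x + 2 * Real.pi * j = x + j * (2 * Real.pi) := by intro x j; ring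
  rw [anglePoints, hj, hk, e, e]
  simp only [Real.cos_add_int_mul_two_pi, Real.sin_add_int_mul_two_pi]
  rfl

theorem exists_of_cos_eq_sin_eq {x y : ℝ} (hc : Real.cos x = Real.cos y)
    (hs : Real.sin x = Real.sin y) : ∃ k : ℤ, x = y + 2 * Real.pi * k := by
  obtain ⟨k, hk⟩ := Real.Angle.angle_eq_iff_two_pi_dvd_sub.1 (Real.Angle.cos_sin_inj hc hs)
  exact ⟨k, by linarith⟩

/-- The resonant Kepler orbits of different parity are disjoint. -/
theorem anglePoints_resonantOrbit_ne (hp : 0 < p) {nl ng nl' ng' : ℕ}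
    (hpar : ¬ p * nl + q * ng ≡ p * nl' + q * ng' [MOD 2]) (t t' : ℝ) :
    anglePoints (resonantOrbit p q e nl ng t) ≠ anglePoints (resonantOrbit p q e nl' ng' t') := by
  intro h
  have hp' : (p : ℝ) ≠ 0 := by positivity
  simp only [anglePoints, Prod.mk.injEq, resonantOrbit_two, resonantOrbit_three] at h
  obtain ⟨j, hj⟩ := exists_of_cos_eq_sin_eq h.1.1 h.1.2
  obtain ⟨k, hk⟩ := exists_of_cos_eq_sin_eq h.2.1 h.2.2
  have h1 : Real.pi * ((p * nl + q * ng : ℝ) - (p * nl' + q * ng') - 2 * (p * j + q * k)) = 0 := by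
    have hj' : (q : ℝ) * t + p * (nl * Real.pi)
        = q * t' + p * (nl' * Real.pi + 2 * Real.pi * j) := by
      field_simp at hj
      linarith
    linear_combination hj' + q * hk
  have h2 : ((p * nl + q * ng : ℕ) : ℤ) - (p * nl' + q * ng' : ℕ) = 2 * (p * j + q * k) := by
    have := (mul_eq_zero.1 h1).resolve_left Real.pi_ne_zero
    have h3 : (p * nl + q * ng : ℝ) - (p * nl' + q * ng') = 2 * (p * j + q * k) := by linarith
    exact_mod_cast h3
  refine hpar (Nat.ModEq.symm ((Nat.modEq_iff_dvd).2 ⟨p * j + q * k, ?_⟩))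
  rw [h2]
  rfl

/-- Orbits of families of different parity are disjoint for small `μ`: they are so for `μ = 0`, and
by periodicity only a compact set of times matters. -/
theorem IsFamily.disjoint (hp : 0 < p) (hq : 0 < q) (he : 0 < e) (he1 : e < 1)
    {nl ng nl' ng' : ℕ} (hpar : ¬ p * nl + q * ng ≡ p * nl' + q * ng' [MOD 2]) {μ₀ μ₀' : ℝ}
    {γ γ' : ℝ → ℝ → State} {T T' : ℝ → ℝ} (h : IsFamily p q e nl ng μ₀ γ T)
    (h' : IsFamily p q e nl' ng' μ₀' γ' T') :
    ∃ μ₁ > 0, ∀ μ ∈ Set.Ioo (-μ₁) μ₁, ∀ t t' : ℝ, ¬ SameState (γ μ t) (γ' μ t') := by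
  have h0 : (0 : ℝ) ∈ Set.Ioo (-μ₀) μ₀ := ⟨by linarith [h.pos], h.pos⟩
  have h0' : (0 : ℝ) ∈ Set.Ioo (-μ₀') μ₀' := ⟨by linarith [h'.pos], h'.pos⟩
  obtain ⟨hz, hT0⟩ := h.zero hp hq he he1
  obtain ⟨hz', hT0'⟩ := h'.zero hp hq he he1
  set b : ℝ := 2 * Real.pi * p + 1 with hb
  have hK : IsCompact (Set.Icc 0 b ×ˢ Set.Icc (0 : ℝ) b) := isCompact_Icc.prod isCompact_Icc
  have hcomp : ∀ᶠ μ in 𝓝 (0 : ℝ), ∀ v ∈ Set.Icc 0 b ×ˢ Set.Icc (0 : ℝ) b,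
      anglePoints (γ μ v.1) ≠ anglePoints (γ' μ v.2) := by
    refine hK.eventually_forall_of_forall_eventually fun v _ => ?_
    have c1 : ContinuousAt (fun z : ℝ × (ℝ × ℝ) => anglePoints (γ z.1 z.2.1)) (0, v) :=
      continuous_anglePoints.continuousAt.comp (f := fun z : ℝ × (ℝ × ℝ) => γ z.1 z.2.1)
        (ContinuousAt.comp (g := Function.uncurry γ) (f := fun z : ℝ × (ℝ × ℝ) => (z.1, z.2.1))
          (h.analytic (0, v.1) ⟨h0, trivial⟩).continuousAt (by fun_prop))
    have c2 : ContinuousAt (fun z : ℝ × (ℝ × ℝ) => anglePoints (γ' z.1 z.2.2)) (0, v) :=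
      continuous_anglePoints.continuousAt.comp (f := fun z : ℝ × (ℝ × ℝ) => γ' z.1 z.2.2)
        (ContinuousAt.comp (g := Function.uncurry γ') (f := fun z : ℝ × (ℝ × ℝ) => (z.1, z.2.2))
          (h'.analytic (0, v.2) ⟨h0', trivial⟩).continuousAt (by fun_prop))
    refine (c1.prodMk c2).eventually_mem (s := {w | w.1 ≠ w.2}) ?_
    refine (isOpen_ne_fun continuous_fst continuous_snd).mem_nhds ?_
    simp only [Set.mem_ofPred_eq, hz, hz']
    exact anglePoints_resonantOrbit_ne hp hpar v.1 v.2
  have hTev : ∀ᶠ μ in 𝓝 (0 : ℝ), T μ < b :=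
    (h.analytic_period 0 h0).continuousAt.eventually (gt_mem_nhds (by rw [hT0, hb]; linarith))
  have hTev' : ∀ᶠ μ in 𝓝 (0 : ℝ), T' μ < b :=
    (h'.analytic_period 0 h0').continuousAt.eventually (gt_mem_nhds (by rw [hT0', hb]; linarith))
  have hI : ∀ᶠ μ in 𝓝 (0 : ℝ), μ ∈ Set.Ioo (-μ₀) μ₀ := Ioo_mem_nhds h0.1 h0.2
  have hI' : ∀ᶠ μ in 𝓝 (0 : ℝ), μ ∈ Set.Ioo (-μ₀') μ₀' := Ioo_mem_nhds h0'.1 h0'.2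
  have hev := (hcomp.and (hTev.and hTev')).and (hI.and hI')
  obtain ⟨μ₁, hμ₁, hgood⟩ := Metric.eventually_nhds_iff_ball.1 hev
  rw [Real.ball_eq_Ioo, zero_sub, zero_add] at hgood
  refine ⟨μ₁, hμ₁, fun μ hμ t t' hs => ?_⟩
  obtain ⟨⟨g1, g2, g3⟩, g4, g5⟩ := hgood μ hμ
  have hper : Function.Periodic (fun t => anglePoints (γ μ t)) (T μ) := fun t =>
    ((h.periodic μ g4).2 t).anglePoints_eq
  have hper' : Function.Periodic (fun t => anglePoints (γ' μ t)) (T' μ) := fun t =>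
    ((h'.periodic μ g5).2 t).anglePoints_eq
  obtain ⟨x, hx, hxe⟩ := hper.exists_mem_Ico₀ (h.periodic μ g4).1 t
  obtain ⟨y, hy, hye⟩ := hper'.exists_mem_Ico₀ (h'.periodic μ g5).1 t'
  refine g1 (x, y) ⟨⟨hx.1, by linarith [hx.2]⟩, ⟨hy.1, by linarith [hy.2]⟩⟩ ?_
  simp only at hxe hye ⊢
  rw [← hxe, ← hye, hs.anglePoints_eq]

end

/-! ### Power series in one real variable -/

section

section Taylor

variable {E F : Type*} [NormedAddCommGroup E] [NormedSpace ℝ E] [NormedAddCommGroup F]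
  [NormedSpace ℝ F]

/-- `f` is the sum of the power series with coefficients `c` near `0`. -/
def HasTaylor (f : ℝ → E) (c : ℕ → E) : Prop :=
  ∀ᶠ x in 𝓝 (0 : ℝ), HasSum (fun n => x ^ n • c n) (f x)

/-- The power series with coefficients `c`. -/
noncomputable def powerSeriesOf (c : ℕ → E) : FormalMultilinearSeries ℝ ℝ E := fun n =>
  ContinuousMultilinearMap.mkPiRing ℝ (Fin n) (c n)

theorem coeff_powerSeriesOf (c : ℕ → E) (n : ℕ) : (powerSeriesOf c).coeff n = c n := by
  simp [FormalMultilinearSeries.coeff, powerSeriesOf]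

theorem hasTaylor_iff {f : ℝ → E} {c : ℕ → E} :
    HasTaylor f c ↔ HasFPowerSeriesAt f (powerSeriesOf c) 0 := by
  rw [hasFPowerSeriesAt_iff]
  simp only [HasTaylor, coeff_powerSeriesOf, zero_add]

theorem HasTaylor.analyticAt {f : ℝ → E} {c : ℕ → E} (h : HasTaylor f c) : AnalyticAt ℝ f 0 :=
  ⟨_, hasTaylor_iff.1 h⟩

theorem _root_.AnalyticAt.exists_hasTaylor {f : ℝ → E} (h : AnalyticAt ℝ f 0) :
    ∃ c, HasTaylor f c := by
  obtain ⟨P, hP⟩ := h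
  refine ⟨P.coeff, ?_⟩
  rw [hasFPowerSeriesAt_iff] at hP
  simpa [HasTaylor] using hP

theorem HasTaylor.unique {f : ℝ → E} {c d : ℕ → E} (h : HasTaylor f c) (h' : HasTaylor f d) :
    c = d := by
  have := (hasTaylor_iff.1 h).eq_formalMultilinearSeries (hasTaylor_iff.1 h')
  funext n
  have h1 := congrArg (fun P : FormalMultilinearSeries ℝ ℝ E => P.coeff n) this
  simpa only [coeff_powerSeriesOf] using h1

theorem HasTaylor.congr {f g : ℝ → E} {c : ℕ → E} (h : HasTaylor f c) (hfg : f =ᶠ[𝓝 0] g) :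
    HasTaylor g c := by
  filter_upwards [h, hfg] with x h1 h2
  rwa [← h2]

theorem HasTaylor.map {f : ℝ → E} {c : ℕ → E} (h : HasTaylor f c) (A : E →L[ℝ] F) :
    HasTaylor (fun x => A (f x)) fun n => A (c n) := by
  filter_upwards [h] with x hx
  simpa using A.hasSum hx

theorem HasTaylor.add {f g : ℝ → E} {c d : ℕ → E} (h : HasTaylor f c) (h' : HasTaylor g d) :
    HasTaylor (fun x => f x + g x) fun n => c n + d n := by
  filter_upwards [h, h'] with x h1 h2
  simpa [smul_add] using h1.add h2

theorem HasTaylor.comp_mul {f : ℝ → E} {c : ℕ → E} (h : HasTaylor f c) (a : ℝ) :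
    HasTaylor (fun x => f (a * x)) fun n => a ^ n • c n := by
  have ht : Tendsto (fun x : ℝ => a * x) (𝓝 0) (𝓝 0) := by
    have : Continuous fun x : ℝ => a * x := by fun_prop
    simpa using this.tendsto 0
  filter_upwards [ht.eventually h] with x hx
  simpa [mul_pow, smul_smul, mul_comm] using hx

theorem HasTaylor.taylorCoeff_eq {f : ℝ → ℝ} {c : ℕ → ℝ} (h : HasTaylor f c) (n : ℕ) :
    taylorCoeff f n = c n := by
  have h1 := h.analyticAt.hasFPowerSeriesAt
  have h2 := h1.eq_formalMultilinearSeries (hasTaylor_iff.1 h)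
  have h3 := congrArg (fun P : FormalMultilinearSeries ℝ ℝ ℝ => P.coeff n) h2
  simp only [FormalMultilinearSeries.coeff_ofScalars] at h3
  rw [taylorCoeff, h3, coeff_powerSeriesOf]

theorem HasTaylor.isBigO {f : ℝ → ℝ} {c : ℕ → ℝ} (h : HasTaylor f c) {m : ℕ}
    (hc : ∀ n < m, c n = 0) : f =O[𝓝 0] fun x => x ^ m := by
  have h1 := (hasTaylor_iff.1 h).isBigO_sub_partialSum_pow m
  refine IsBigO.of_norm_right ?_
  refine h1.congr (fun x => ?_) fun x => by rw [norm_pow]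
  have : (powerSeriesOf c).partialSum m x = 0 := by
    refine Finset.sum_eq_zero fun n hn => ?_
    simp [powerSeriesOf, hc n (Finset.mem_range.1 hn)]
  rw [this, sub_zero, zero_add]

end Taylor

/-! ### Averaging along a resonant line -/

instance : Fact (0 < 2 * Real.pi) := ⟨Real.two_pi_pos⟩

/-- The Banach algebra of continuous functions of an angle. -/
abbrev AngleFun := C(AddCircle (2 * Real.pi), ℂ)

theorem continuous_angleFun_comp (f : AngleFun) {g : ℝ → ℝ} (hg : Continuous g) :
    Continuous fun x => f (g x : AddCircle (2 * Real.pi)) :=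
  f.continuous.comp ((AddCircle.continuous_mk' _).comp hg)

/-- The Fourier integral `∫₀^{2π} exp(i n ψ) f(ψ) dψ`. -/
noncomputable def fourierInt (n : ℤ) : AngleFun →L[ℂ] ℂ :=
  LinearMap.mkContinuous
    { toFun := fun f => ∫ ψ in (0 : ℝ)..(2 * Real.pi),
        Complex.exp (n * ψ * Complex.I) * f (ψ : AddCircle (2 * Real.pi))
      map_add' := fun f g => by
        rw [← intervalIntegral.integral_add]
        · simp [mul_add]
        · exact (Continuous.mul (by fun_prop)
            (continuous_angleFun_comp f continuous_id)).intervalIntegrable _ _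
        · exact (Continuous.mul (by fun_prop)
            (continuous_angleFun_comp g continuous_id)).intervalIntegrable _ _
      map_smul' := fun c f => by
        rw [RingHom.id_apply, smul_eq_mul, ← intervalIntegral.integral_const_mul]
        simp [mul_left_comm] }
    (2 * Real.pi) (fun f => by
      refine (intervalIntegral.norm_integral_le_of_norm_le_const (C := ‖f‖) fun ψ _ => ?_).trans
        (le_of_eq ?_)
      · rw [norm_mul, show (n : ℂ) * ψ * Complex.I = ((n * ψ : ℝ) : ℂ) * Complex.I by
          push_cast; ring,
          Complex.norm_exp_ofReal_mul_I, one_mul]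
        exact f.norm_coe_le_norm _
      · rw [sub_zero, abs_of_pos Real.two_pi_pos, mul_comm])

theorem fourierInt_apply (n : ℤ) (f : AngleFun) :
    fourierInt n f
      = ∫ ψ in (0 : ℝ)..(2 * Real.pi),
          Complex.exp (n * ψ * Complex.I) * f (ψ : AddCircle (2 * Real.pi)) := rfl

theorem periodic_angleFun (f : AngleFun) (c : ℝ) :
    Function.Periodic (fun x : ℝ => f ((x + c : ℝ) : AddCircle (2 * Real.pi))) (2 * Real.pi) := by
  intro x
  simp only
  rw [show x + 2 * Real.pi + c = x + c + 2 * Real.pi by ring, AddCircle.coe_add_period]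

theorem exp_int_mul_add_two_pi (k : ℤ) (x : ℝ) :
    Complex.exp (k * ((x + 2 * Real.pi : ℝ) : ℂ) * Complex.I)
      = Complex.exp (k * x * Complex.I) := by
  rw [show (k : ℂ) * ((x + 2 * Real.pi : ℝ) : ℂ) * Complex.I
    = k * x * Complex.I + k * (2 * Real.pi * Complex.I) by push_cast; ring]
  exact Complex.exp_periodic.int_mul k _

/-- The integral of a `2π`-periodic function over a period does not change if the argument is
multiplied by a nonzero integer. -/
theorem integral_comp_int_mul {f : ℝ → ℂ} (hf : Function.Periodic f (2 * Real.pi))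
    (hc : Continuous f) {d : ℤ} (hd : d ≠ 0) :
    ∫ x in (0 : ℝ)..(2 * Real.pi), f (d * x) = ∫ x in (0 : ℝ)..(2 * Real.pi), f x := by
  have hd' : (d : ℝ) ≠ 0 := by exact_mod_cast hd
  rw [intervalIntegral.integral_comp_mul_left _ hd', mul_zero]
  have := hf.intervalIntegral_add_zsmul_eq d 0 fun a b => hc.intervalIntegrable a b
  rw [zero_add, zero_add, zsmul_eq_mul] at this
  rw [this, zsmul_eq_mul, Complex.real_smul, ← mul_assoc]
  push_cast
  rw [inv_mul_cancel₀ (by exact_mod_cast hd), one_mul]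

variable {d q : ℤ}

theorem integral_resonant_of_dvd (A : AngleFun) (c : ℝ) (hd : d ≠ 0) (s : ℤ) :
    ∫ x in (0 : ℝ)..(2 * Real.pi), Complex.exp (((d * s * q : ℤ) : ℂ) * x * Complex.I)
        * A ((d * x + c : ℝ) : AddCircle (2 * Real.pi))
      = Complex.exp (-((s * q : ℤ) : ℂ) * c * Complex.I) * fourierInt (s * q) A := by
  set H : ℝ → ℂ := fun y => Complex.exp (((s * q : ℤ) : ℂ) * y * Complex.I)
    * A ((y + c : ℝ) : AddCircle (2 * Real.pi)) with hH
  have hHp : Function.Periodic H (2 * Real.pi) := fun y => by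
    simp only [hH]
    rw [exp_int_mul_add_two_pi]
    congr 1
    exact periodic_angleFun A c y
  have hHc : Continuous H := Continuous.mul (by fun_prop)
    (continuous_angleFun_comp A (continuous_id.add continuous_const))
  have e1 : ∀ x : ℝ, Complex.exp (((d * s * q : ℤ) : ℂ) * x * Complex.I)
      * A ((d * x + c : ℝ) : AddCircle (2 * Real.pi)) = H (d * x) := by
    intro x
    simp only [hH]
    congr 2
    push_cast
    ring
  simp only [e1]
  rw [integral_comp_int_mul hHp hHc hd]
  have e2 : ∀ y : ℝ, H y = (fun y : ℝ => Complex.exp (-((s * q : ℤ) : ℂ) * c * Complex.I) *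
      (Complex.exp (((s * q : ℤ) : ℂ) * y * Complex.I)
        * A (y : AddCircle (2 * Real.pi)))) (y + c) := by
    intro y
    simp only [hH]
    rw [← mul_assoc, ← Complex.exp_add]
    congr 2
    push_cast
    ring
  simp only [e2]
  rw [intervalIntegral.integral_comp_add_right fun y : ℝ =>
    Complex.exp (-((s * q : ℤ) : ℂ) * c * Complex.I) *
      (Complex.exp (((s * q : ℤ) : ℂ) * y * Complex.I)
        * A ((y : ℝ) : AddCircle (2 * Real.pi))), intervalIntegral.integral_const_mul,
    fourierInt_apply]
  congr 1
  have hper : Function.Periodic (fun y : ℝ => Complex.exp (((s * q : ℤ) : ℂ) * y * Complex.I)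
        * A ((y : ℝ) : AddCircle (2 * Real.pi))) (2 * Real.pi) := fun y => by
    simp only
    rw [exp_int_mul_add_two_pi, AddCircle.coe_add_period]
  have := hper.intervalIntegral_add_eq c 0
  rw [zero_add] at this
  rw [zero_add, add_comm (2 * Real.pi) c]
  exact this

theorem integral_resonant_of_not_dvd (A : AngleFun) (c : ℝ) (hd : d ≠ 0) (hdq : IsCoprime d q)
    {k : ℤ} (hk : ¬ d ∣ k) :
    ∫ x in (0 : ℝ)..(2 * Real.pi), Complex.exp (((k * q : ℤ) : ℂ) * x * Complex.I)
        * A ((d * x + c : ℝ) : AddCircle (2 * Real.pi)) = 0 := by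
  have hd' : (d : ℝ) ≠ 0 := by exact_mod_cast hd
  set H : ℝ → ℂ := fun x => Complex.exp (((k * q : ℤ) : ℂ) * x * Complex.I)
    * A ((d * x + c : ℝ) : AddCircle (2 * Real.pi)) with hH
  set ζ := Complex.exp (2 * Real.pi * Complex.I * ((k * q : ℤ) / d)) with hζ
  have hHp : Function.Periodic H (2 * Real.pi) := fun x => by
    simp only [hH]
    rw [exp_int_mul_add_two_pi]
    congr 2
    rw [show (d : ℝ) * (x + 2 * Real.pi) + c = (d * x + c) + d • (2 * Real.pi) by
      rw [zsmul_eq_mul]; ring]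
    simp
  have hshift : ∀ x, H (x + 2 * Real.pi / d) = ζ * H x := fun x => by
    simp only [hH, hζ]
    rw [show (d : ℝ) * (x + 2 * Real.pi / d) + c = (d * x + c) + 2 * Real.pi by
        field_simp; ring,
      AddCircle.coe_add_period, ← mul_assoc, ← Complex.exp_add]
    congr 2
    have : (d : ℂ) ≠ 0 := by exact_mod_cast hd
    push_cast
    field_simp
    ring
  have h1 : ∫ x in (0 : ℝ)..(2 * Real.pi), H (x + 2 * Real.pi / d)
      = ∫ x in (0 : ℝ)..(2 * Real.pi), H x := by
    rw [intervalIntegral.integral_comp_add_right H]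
    have := hHp.intervalIntegral_add_eq (2 * Real.pi / d) 0
    rw [zero_add] at this
    rw [zero_add, add_comm (2 * Real.pi)]
    exact this
  simp only [hshift] at h1
  rw [intervalIntegral.integral_const_mul] at h1
  have hζ1 : ζ ≠ 1 := by
    intro h
    rw [hζ, Complex.exp_eq_one_iff] at h
    obtain ⟨n, hn⟩ := h
    have hc : (d : ℂ) ≠ 0 := by exact_mod_cast hd
    have h2 : ((k * q : ℤ) : ℂ) = n * d := by
      have h3 : (2 * Real.pi * Complex.I : ℂ) ≠ 0 := Complex.two_pi_I_ne_zero
      have h4 : (2 * Real.pi * Complex.I : ℂ) * (((k * q : ℤ) : ℂ) / d)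
          = (2 * Real.pi * Complex.I) * n := by rw [hn]; ring
      have h5 := mul_left_cancel₀ h3 h4
      field_simp at h5
      rw [h5]; ring
    have h6 : k * q = n * d := by exact_mod_cast h2
    exact hk (hdq.dvd_of_dvd_mul_right ⟨n, by rw [h6]; ring⟩)
  have : (ζ - 1) * ∫ x in (0 : ℝ)..(2 * Real.pi), H x = 0 := by
    rw [sub_mul, h1, one_mul, sub_self]
  exact (mul_eq_zero.1 this).resolve_left (sub_ne_zero.2 hζ1)

end

section

variable {d q : ℤ}

/-- The point `(exp(i q x), exp(-i q x))`. -/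
noncomputable def circlePair (q : ℤ) (x : ℝ) : ℂ × ℂ :=
  (Complex.exp (q * x * Complex.I), Complex.exp (-(q * x * Complex.I)))

theorem norm_circlePair (q : ℤ) (x : ℝ) : ‖circlePair q x‖ = 1 := by
  have e1 : (q : ℂ) * x * Complex.I = ((q * x : ℝ) : ℂ) * Complex.I := by push_cast; ring
  have e2 : -((q : ℂ) * x * Complex.I) = ((-(q * x) : ℝ) : ℂ) * Complex.I := by push_cast; ring
  rw [circlePair, Prod.norm_def, e2, e1]
  simp only [Complex.norm_exp_ofReal_mul_I, max_self]

theorem continuous_circlePair (q : ℤ) : Continuous (circlePair q) := by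
  unfold circlePair
  fun_prop

theorem circlePair_eq (q : ℤ) (x : ℝ) :
    circlePair q x = Complex.exp (q * x * Complex.I) • ((1, 0) : ℂ × ℂ)
      + Complex.exp (-(q * x * Complex.I)) • ((0, 1) : ℂ × ℂ) := by
  simp [circlePair]

theorem continuous_multilinear_circlePair {j : ℕ}
    (P : ContinuousMultilinearMap ℂ (fun _ : Fin j => ℂ × ℂ) AngleFun) (q d : ℤ) (c : ℝ) :
    Continuous fun x : ℝ =>
      P (fun _ => circlePair q x) ((d * x + c : ℝ) : AddCircle (2 * Real.pi)) := by
  have h1 : Continuous fun x : ℝ => P (fun _ => circlePair q x) :=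
    P.cont.comp (continuous_pi fun _ => continuous_circlePair q)
  have h2 : Continuous fun x : ℝ => ((d * x + c : ℝ) : AddCircle (2 * Real.pi)) :=
    (AddCircle.continuous_mk' _).comp (by fun_prop)
  exact h1.eval h2

/-- Power series expansion under the integral sign. -/
theorem hasTaylor_integral_circlePair {Φ : ℂ × ℂ → AngleFun}
    {P : FormalMultilinearSeries ℂ (ℂ × ℂ) AngleFun} (hΦ : HasFPowerSeriesAt Φ P 0) (q d : ℤ)
    (c : ℝ) :
    HasTaylor (fun e : ℝ => ∫ x in (0 : ℝ)..(2 * Real.pi),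
        Φ ((e : ℂ) • circlePair q x) ((d * x + c : ℝ) : AddCircle (2 * Real.pi)))
      fun j => ∫ x in (0 : ℝ)..(2 * Real.pi),
        P j (fun _ => circlePair q x) ((d * x + c : ℝ) : AddCircle (2 * Real.pi)) := by
  obtain ⟨R, hR⟩ := hΦ
  obtain ⟨ρ, hρ0, hρR⟩ := ENNReal.lt_iff_exists_nnreal_btwn.1 hR.r_pos
  have hρ : (0 : ℝ) < ρ := by exact_mod_cast hρ0
  filter_upwards [Metric.ball_mem_nhds (0 : ℝ) hρ] with e he
  have he' : ‖e‖₊ < ρ := by simpa [← NNReal.coe_lt_coe] using he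
  have hmem : ∀ x, (e : ℂ) • circlePair q x ∈ Metric.eball (0 : ℂ × ℂ) R := by
    intro x
    rw [Metric.mem_eball, edist_zero_right]
    refine lt_trans ?_ hρR
    rw [← ofReal_norm, norm_smul, norm_circlePair, mul_one, Complex.norm_real,
      ← ENNReal.ofReal_coe_nnreal]
    exact (ENNReal.ofReal_lt_ofReal_iff hρ).2 (by exact_mod_cast he')
  have hsum : Summable fun j => ‖P j‖ * ‖e‖ ^ j := by
    have : (‖e‖₊ : ENNReal) < P.radius :=
      lt_of_lt_of_le (lt_trans (by exact_mod_cast he') hρR) hR.r_le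
    simpa using P.summable_norm_mul_pow this
  set f : ℝ → ℂ := fun x =>
    Φ ((e : ℂ) • circlePair q x) ((d * x + c : ℝ) : AddCircle (2 * Real.pi)) with hf
  set F : ℕ → ℝ → ℂ := fun j x =>
    P j (fun _ => circlePair q x) ((d * x + c : ℝ) : AddCircle (2 * Real.pi)) with hF
  have hFc : ∀ j, Continuous (F j) := fun j => continuous_multilinear_circlePair (P j) q d c
  have hFn : ∀ j x, ‖F j x‖ ≤ ‖P j‖ := fun j x => by
    refine (ContinuousMap.norm_coe_le_norm _ _).trans (((P j).le_opNorm _).trans ?_)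
    simp [norm_circlePair]
  have hFs : ∀ x, HasSum (fun j => e ^ j • F j x) (f x) := fun x => by
    have h1 := hR.hasSum (hmem x)
    rw [zero_add] at h1
    have h2 := (evalCurve (F := ℂ) ((d * x + c : ℝ) : AddCircle (2 * Real.pi))).hasSum h1
    have h4 : ∀ j, e ^ j • F j x
        = P j (fun _ => (e : ℂ) • circlePair q x) ((d * x + c : ℝ) : AddCircle (2 * Real.pi)) := by
      intro j
      have h3 := (P j).map_smul_univ (fun _ => (e : ℂ)) fun _ => circlePair q x
      simp only [Finset.prod_const, Finset.card_univ, Fintype.card_fin] at h3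
      rw [h3, ContinuousMap.smul_apply, ← Complex.ofReal_pow]
      rfl
    simp only [h4]
    exact h2
  have hFi : ∀ j, ∫ x in (0 : ℝ)..(2 * Real.pi),
      P j (fun _ => circlePair q x) ((d * x + c : ℝ) : AddCircle (2 * Real.pi))
        = ∫ x in (0 : ℝ)..(2 * Real.pi), F j x := fun _ => rfl
  clear_value f F
  have key := intervalIntegral.hasSum_integral_of_dominated_convergence (μ := MeasureTheory.volume)
    (a := 0) (b := 2 * Real.pi) (F := fun j x => e ^ j • F j x) (f := f)
    (fun j _ => ‖P j‖ * ‖e‖ ^ j)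
    (fun j => ((hFc j).const_smul (e ^ j)).aestronglyMeasurable)
    (fun j => Eventually.of_forall fun x _ => by
      rw [norm_smul, norm_pow, mul_comm]
      gcongr
      exact hFn j x)
    (Eventually.of_forall fun x _ => hsum) intervalIntegrable_const
    (Eventually.of_forall fun x _ => hFs x)
  simp only [intervalIntegral.integral_smul] at key
  simp only [hFi]
  exact key

/-- The monomials in the expansion of a homogeneous term at `(exp(i q x), exp(-i q x))`. -/
theorem multilinear_circlePair {j : ℕ}
    (D : ContinuousMultilinearMap ℂ (fun _ : Fin j => ℂ × ℂ) AngleFun) (q : ℤ) (x : ℝ) :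
    D (fun _ => circlePair q x) = ∑ S : Finset (Fin j),
      Complex.exp ((((2 * (S.card : ℤ) - j) * q : ℤ) : ℂ) * x * Complex.I) •
        D (S.piecewise (fun _ => (1, 0)) fun _ => (0, 1)) := by
  have e : (fun _ : Fin j => circlePair q x)
      = (fun _ => Complex.exp (q * x * Complex.I) • ((1, 0) : ℂ × ℂ))
        + fun _ => Complex.exp (-(q * x * Complex.I)) • ((0, 1) : ℂ × ℂ) := by
    funext i
    exact circlePair_eq q x
  rw [e, D.map_add_univ]
  refine Finset.sum_congr rfl fun S _ => ?_
  have h1 : S.piecewise (fun _ => Complex.exp (q * x * Complex.I) • ((1, 0) : ℂ × ℂ))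
      (fun _ => Complex.exp (-(q * x * Complex.I)) • ((0, 1) : ℂ × ℂ))
      = fun i => (if i ∈ S then Complex.exp (q * x * Complex.I)
          else Complex.exp (-(q * x * Complex.I))) •
            (S.piecewise (fun _ => ((1, 0) : ℂ × ℂ)) (fun _ => ((0, 1) : ℂ × ℂ))) i := by
    funext i
    by_cases hi : i ∈ S <;> simp [Finset.piecewise, hi]
  rw [h1, D.map_smul_univ, Finset.prod_ite]
  congr 1
  have hS : S.card ≤ j := by simpa using S.card_le_univ
  have hc : (Finset.univ.filter fun i => i ∉ S).card = j - S.card := by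
    rw [Finset.filter_not, Finset.filter_mem_eq_inter, Finset.univ_inter,
      Finset.card_sdiff_of_subset (Finset.subset_univ S)]
    simp
  rw [Finset.prod_const, Finset.prod_const, hc, Finset.filter_mem_eq_inter, Finset.univ_inter,
    ← Complex.exp_nat_mul, ← Complex.exp_nat_mul, ← Complex.exp_add]
  congr 1
  push_cast [Nat.cast_sub hS]
  ring

/-- Expansion in powers of `e` of the average of `Φ(e z, e / z)`, `z = exp(i q x)`, along the line
`ψ = d x + c`. A monomial `u^a v^b` contributes only if `d` divides `a - b`; since the mean of `Φ`
vanishes, the terms with `a = b` do not contribute, and the lowest order is `|d|`, to which only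
the pure powers of `u` and of `v` contribute. -/
theorem exists_hasTaylor_resonantIntegral {Φ : ℂ × ℂ → AngleFun} (hΦ : AnalyticAt ℂ Φ 0)
    (hmean : ∀ᶠ y in 𝓝 0, fourierInt 0 (Φ y) = 0) (hd : d ≠ 0) (hdq : IsCoprime d q) (c : ℝ) :
    ∃ a : ℕ → ℂ,
      HasTaylor (fun e : ℝ => ∫ x in (0 : ℝ)..(2 * Real.pi),
        Φ ((e : ℂ) • circlePair q x) ((d * x + c : ℝ) : AddCircle (2 * Real.pi))) a ∧
      (∀ j < d.natAbs, a j = 0) ∧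
      ∀ bp bm : ℕ → ℂ,
        HasTaylor (fun u : ℝ => fourierInt (d.sign * q) (Φ ((u : ℂ), 0))) bp →
        HasTaylor (fun u : ℝ => fourierInt (-(d.sign * q)) (Φ (0, (u : ℂ)))) bm →
        a d.natAbs = Complex.exp (-((d.sign * q : ℤ) : ℂ) * c * Complex.I) * bp d.natAbs
          + Complex.exp (((d.sign * q : ℤ) : ℂ) * c * Complex.I) * bm d.natAbs := by
  obtain ⟨P, hP⟩ := hΦ
  have hc : ContDiffAt ℂ ω Φ 0 := hP.analyticAt.contDiffAt
  refine ⟨_, hasTaylor_integral_circlePair hP q d c, ?_⟩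
  set D : (j : ℕ) → ContinuousMultilinearMap ℂ (fun _ : Fin j => ℂ × ℂ) AngleFun := fun j =>
    iteratedFDeriv ℂ j Φ 0 with hD
  have hfac : ∀ j y, P j (fun _ => y) = ((j.factorial : ℂ))⁻¹ • D j fun _ => y := by
    intro j y
    obtain ⟨R, hR⟩ := hP
    have := hR.factorial_smul y j
    rw [hD, ← this, ← Nat.cast_smul_eq_nsmul ℂ, smul_smul, inv_mul_cancel₀, one_smul]
    exact_mod_cast j.factorial_ne_zero
  have hmeanD : ∀ j v, fourierInt 0 (D j v) = 0 := by
    intro j v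
    have h1 := (fourierInt 0).iteratedFDeriv_comp_left hc (i := j) (by exact_mod_cast le_top)
    have h2 : (fourierInt 0 ∘ Φ) =ᶠ[𝓝 0] fun _ => (0 : ℂ) := hmean
    rw [h2.iteratedFDeriv ℂ j |>.eq_of_nhds] at h1
    have h3 := DFunLike.congr_fun h1 v
    simpa [iteratedFDeriv_fun_zero, hD] using h3.symm
  -- the contribution of a single monomial
  set B : (j : ℕ) → Finset (Fin j) → AngleFun := fun j S =>
    D j (S.piecewise (fun _ => (1, 0)) fun _ => (0, 1)) with hB
  set I : (j : ℕ) → Finset (Fin j) → ℂ := fun j S => ∫ x in (0 : ℝ)..(2 * Real.pi),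
    Complex.exp ((((2 * (S.card : ℤ) - j) * q : ℤ) : ℂ) * x * Complex.I)
      * B j S ((d * x + c : ℝ) : AddCircle (2 * Real.pi)) with hI
  have hsum : ∀ j, ∫ x in (0 : ℝ)..(2 * Real.pi),
      P j (fun _ => circlePair q x) ((d * x + c : ℝ) : AddCircle (2 * Real.pi))
        = ((j.factorial : ℂ))⁻¹ * ∑ S, I j S := by
    intro j
    rw [← intervalIntegral.integral_finsetSum, ← intervalIntegral.integral_const_mul]
    · refine intervalIntegral.integral_congr fun x _ => ?_
      rw [hfac, multilinear_circlePair]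
      simp [hB]
    · intro S _
      refine (Continuous.mul (by fun_prop) (continuous_angleFun_comp _ ?_)).intervalIntegrable _ _
      fun_prop
  have hzero : ∀ (j : ℕ) (S : Finset (Fin j)),
      ¬ (d ∣ 2 * (S.card : ℤ) - j ∧ 2 * (S.card : ℤ) - j ≠ 0) → I j S = 0 := by
    intro j S h
    by_cases h1 : d ∣ 2 * (S.card : ℤ) - j
    · have h2 : 2 * (S.card : ℤ) - j = 0 := by
        by_contra h3
        exact h ⟨h1, h3⟩
      have := integral_resonant_of_dvd (q := q) (B j S) c hd 0
      simp only [hI, h2]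
      simp only [mul_zero, zero_mul] at this ⊢
      rw [this, hB, hmeanD, mul_zero]
    · exact integral_resonant_of_not_dvd _ c hd hdq h1
  have hcard : ∀ (j : ℕ) (S : Finset (Fin j)), S.card ≤ j := fun j S => by
    simpa using S.card_le_univ
  refine ⟨fun j hj => ?_, fun bp bm hbp hbm => ?_⟩
  · rw [hsum, Finset.sum_eq_zero, mul_zero]
    intro S _
    refine hzero j S fun ⟨h1, h2⟩ => ?_
    have := Int.natAbs_le_of_dvd_ne_zero h1 h2
    have := hcard j S
    omega
  · set m := d.natAbs with hm
    have hm0 : 0 < m := Int.natAbs_pos.2 hd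
    have hsgn : d * d.sign = m := by rw [Int.mul_sign_self]
    have hue : (Finset.univ : Finset (Fin m)) ≠ ∅ := by
      intro h
      have := congrArg Finset.card h
      simp at this
      omega
    have hI2 : ∑ S, I m S = I m Finset.univ + I m ∅ := by
      rw [← Finset.sum_pair hue]
      refine (Finset.sum_subset (Finset.subset_univ _) fun S _ hS => ?_).symm
      refine hzero m S fun ⟨h1, h2⟩ => ?_
      have h3 := Int.natAbs_le_of_dvd_ne_zero h1 h2
      have h4 := hcard m S
      simp only [Finset.mem_insert, Finset.mem_singleton, not_or] at hS
      have h5 : S.card ≠ m := fun h => hS.1 (by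
        rw [← Finset.card_eq_iff_eq_univ, h, Fintype.card_fin])
      have h6 : S.card ≠ 0 := fun h => hS.2 (Finset.card_eq_zero.1 h)
      omega
    have hIu : I m Finset.univ = Complex.exp (-((d.sign * q : ℤ) : ℂ) * c * Complex.I)
        * fourierInt (d.sign * q) (D m fun _ => (1, 0)) := by
      rw [← integral_resonant_of_dvd _ c hd]
      simp only [hI, hB, Finset.card_univ, Fintype.card_fin, Finset.piecewise_univ]
      rw [show (2 * (m : ℤ) - m) * q = d * d.sign * q by rw [hsgn]; ring]
    have hIe : I m ∅ = Complex.exp (((d.sign * q : ℤ) : ℂ) * c * Complex.I)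
        * fourierInt (-(d.sign * q)) (D m fun _ => (0, 1)) := by
      have h1 := integral_resonant_of_dvd (q := q) (D m fun _ => (0, 1)) c hd (-d.sign)
      rw [show -d.sign * q = -(d.sign * q) by ring] at h1
      rw [show ((d.sign * q : ℤ) : ℂ) = -((-(d.sign * q) : ℤ) : ℂ) by push_cast; ring, ← h1]
      simp only [hI, hB, Finset.card_empty, Finset.piecewise_empty]
      rw [show (2 * ((0 : ℕ) : ℤ) - m) * q = d * -d.sign * q by
        rw [mul_neg, hsgn]; push_cast; ring]
    -- the Taylor coefficients on the axes
    have haxis : ∀ (n : ℤ) (v : ℂ × ℂ) (b : ℕ → ℂ),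
        HasTaylor (fun u : ℝ => fourierInt n (Φ ((u : ℂ) • v))) b →
        b m = ((m.factorial : ℂ))⁻¹ * fourierInt n (D m fun _ => v) := by
      intro n v b hb
      have h1 : HasTaylor (fun u : ℝ => fourierInt n (Φ ((u : ℂ) • v)))
          fun j => fourierInt n (P j fun _ => v) := by
        obtain ⟨R, hR⟩ := hP
        have ht : Tendsto (fun u : ℝ => (u : ℂ) • v) (𝓝 0) (𝓝 0) := by
          have : Continuous fun u : ℝ => (u : ℂ) • v := by fun_prop
          simpa using this.tendsto 0
        filter_upwards [ht.eventually (Metric.eball_mem_nhds 0 hR.r_pos)] with u hu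
        have h2 := hR.hasSum hu
        rw [zero_add] at h2
        refine ((fourierInt n).hasSum h2).congr_fun fun j => ?_
        have h3 := (P j).map_smul_univ (fun _ => (u : ℂ)) fun _ => v
        simp only [Finset.prod_const, Finset.card_univ, Fintype.card_fin] at h3
        rw [h3, map_smul, ← Complex.ofReal_pow]
        rfl
      rw [hb.unique h1]
      simp only [hfac, map_smul, smul_eq_mul]
    rw [hsum, hI2, hIu, hIe, haxis (d.sign * q) (1, 0) bp (by simpa using hbp),
      haxis (-(d.sign * q)) (0, 1) bm (by simpa using hbm)]
    ring

end

/-! ### The disturbing function as a function of the angle -/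

/-- The function `ψ ↦ exp(iψ)`. -/
noncomputable def angleExp : AngleFun := fourier 1

/-- The function `ψ ↦ exp(-iψ)`. -/
noncomputable def angleExpNeg : AngleFun := fourier (-1)

theorem angleExp_apply (ψ : ℝ) :
    angleExp (ψ : AddCircle (2 * Real.pi)) = Complex.exp (ψ * Complex.I) := by
  rw [angleExp, fourier_coe_apply]
  congr 1
  have : (Real.pi : ℂ) ≠ 0 := by exact_mod_cast Real.pi_ne_zero
  push_cast
  field_simp

theorem angleExpNeg_apply (ψ : ℝ) :
    angleExpNeg (ψ : AddCircle (2 * Real.pi)) = Complex.exp (-(ψ * Complex.I)) := by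
  rw [angleExpNeg, fourier_coe_apply]
  congr 1
  have : (Real.pi : ℂ) ≠ 0 := by exact_mod_cast Real.pi_ne_zero
  push_cast
  field_simp

theorem forall_angle {P : AddCircle (2 * Real.pi) → Prop} (h : ∀ ψ : ℝ, P ψ) (x) : P x :=
  QuotientAddGroup.induction_on x h

/-- The square `1 + r² - r (X + X⁻¹)` of the distance to the point `1`, as a function of `ψ`, where
`X = w exp(iψ)`. -/
noncomputable def distSq (r w : ℂ) : AngleFun :=
  (1 + r ^ 2) • (1 : AngleFun) - (r * w) • angleExp - (r * w⁻¹) • angleExpNeg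

/-- The function `(X + X⁻¹) / 2`, where `X = w exp(iψ)`. -/
noncomputable def cosFun (w : ℂ) : AngleFun := (w / 2) • angleExp + (w⁻¹ / 2) • angleExpNeg

/-- The inverse distance, with the principal branch of the root. -/
noncomputable def invDist (r w : ℂ) : AngleFun :=
  nemytskii (fun z : ℂ => z ^ (-1 / 2 : ℂ)) (distSq r w)

/-- The second derivative of `r (1 + r² - 2 r cos θ)^{-1/2}` with respect to `θ`, for
`exp(iθ) = w exp(iψ)`. -/
noncomputable def directKernel (r w : ℂ) : AngleFun :=
  r • (-(r • (cosFun w * invDist r w ^ 3)) +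
    (3 * r ^ 2) • ((1 - cosFun w ^ 2) * invDist r w ^ 5))

/-- The function `cos θ / r`, for `exp(iθ) = w exp(iψ)`. -/
noncomputable def indirectKernel (r w : ℂ) : AngleFun := r⁻¹ • cosFun w

/-- The parameters for which the principal branch of the root can be used. -/
def Regular (r w : ℂ) : Prop := w ≠ 0 ∧ ∀ x, 0 < (distSq r w x).re

theorem distSq_apply (r w : ℂ) (ψ : ℝ) : distSq r w (ψ : AddCircle (2 * Real.pi))
    = 1 + r ^ 2 - r * w * Complex.exp (ψ * Complex.I)
      - r * w⁻¹ * Complex.exp (-(ψ * Complex.I)) := by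
  simp [distSq, angleExp_apply, angleExpNeg_apply]

theorem cosFun_apply (w : ℂ) (ψ : ℝ) : cosFun w (ψ : AddCircle (2 * Real.pi))
    = w / 2 * Complex.exp (ψ * Complex.I) + w⁻¹ / 2 * Complex.exp (-(ψ * Complex.I)) := by
  simp [cosFun, angleExp_apply, angleExpNeg_apply]

theorem invDist_apply {r w : ℂ} (h : Regular r w) (x : AddCircle (2 * Real.pi)) :
    invDist r w x = distSq r w x ^ (-1 / 2 : ℂ) := by
  refine nemytskii_apply ?_ x
  rw [continuous_iff_continuousAt]
  intro y
  exact ContinuousAt.comp (f := distSq r w) (continuousAt_cpow_const (Or.inl (h.2 y)))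
    (distSq r w).continuous.continuousAt

theorem distSq_re (r w ψ : ℝ) : distSq r w (ψ : AddCircle (2 * Real.pi))
    = ((1 + r ^ 2 - r * (w + w⁻¹) * Real.cos ψ : ℝ) : ℂ)
      + ((r * (w⁻¹ - w) * Real.sin ψ : ℝ) : ℂ) * Complex.I := by
  rw [distSq_apply, Complex.exp_mul_I, ← neg_mul, Complex.exp_mul_I, Complex.cos_neg,
    Complex.sin_neg]
  push_cast
  ring

theorem regular_of_lt {r w : ℝ} (hr : 0 < r) (hw : 0 < w) (h : r * (w + w⁻¹) < 1 + r ^ 2) :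
    Regular r w := by
  refine ⟨by exact_mod_cast hw.ne', forall_angle fun ψ => ?_⟩
  rw [distSq_re r w ψ]
  simp only [Complex.add_re, Complex.ofReal_re, Complex.mul_re, Complex.I_re, mul_zero,
    Complex.ofReal_im, zero_mul, sub_zero, add_zero]
  have h1 : 0 < r * (w + w⁻¹) := by positivity
  nlinarith [Real.cos_le_one ψ]

theorem regular_one {a : ℝ} (ha : 0 < a) (ha1 : a ≠ 1) : Regular a 1 := by
  have := regular_of_lt (r := a) (w := 1) ha one_pos (by
    have := sq_pos_of_ne_zero (sub_ne_zero.2 ha1)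
    rw [inv_one]
    nlinarith)
  simpa using this

theorem analyticAt_distSq {a : ℂ} :
    AnalyticAt ℂ (fun v : ℂ × ℂ => distSq v.1 v.2) (a, 1) := by
  have h1 : AnalyticAt ℂ (fun v : ℂ × ℂ => v.2⁻¹) (a, (1 : ℂ)) :=
    analyticAt_snd.fun_inv one_ne_zero
  unfold distSq
  exact ((((analyticAt_const.add (analyticAt_fst.pow 2)).fun_smul analyticAt_const).fun_sub
    ((analyticAt_fst.mul analyticAt_snd).fun_smul analyticAt_const)).fun_sub
    ((analyticAt_fst.mul h1).fun_smul analyticAt_const))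

theorem analyticAt_cosFun : AnalyticAt ℂ cosFun 1 := by
  have h1 : AnalyticAt ℂ (fun v : ℂ => v⁻¹ / 2) (1 : ℂ) :=
    (analyticAt_id.fun_inv one_ne_zero).div_const
  have h2 : AnalyticAt ℂ (fun v : ℂ => v / 2) (1 : ℂ) := analyticAt_id.div_const
  unfold cosFun
  exact (h2.fun_smul analyticAt_const).fun_add (h1.fun_smul analyticAt_const)

theorem eventually_regular {a : ℝ} (ha : 0 < a) (ha1 : a ≠ 1) :
    ∀ᶠ v in 𝓝 ((a : ℂ), (1 : ℂ)), Regular v.1 v.2 := by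
  have hc : ContinuousAt (fun v : ℂ × ℂ => distSq v.1 v.2) ((a : ℂ), 1) :=
    analyticAt_distSq.continuousAt
  obtain ⟨x₀, -, hx₀⟩ := isCompact_univ.exists_isMinOn (Set.univ_nonempty)
    (f := fun x => (distSq a 1 x).re)
    (Complex.continuous_re.comp (distSq a 1).continuous).continuousOn
  have hpos := (regular_one ha ha1).2 x₀
  filter_upwards [hc.eventually (Metric.ball_mem_nhds _ hpos),
    continuousAt_snd.eventually_ne (one_ne_zero : ((a : ℂ), (1 : ℂ)).2 ≠ 0)] with v hv hv2
  refine ⟨hv2, fun x => ?_⟩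
  have h1 : (distSq a 1 x₀).re ≤ (distSq a 1 x).re := hx₀ (Set.mem_univ x)
  rw [dist_eq_norm] at hv
  have h2 : |(distSq v.1 v.2 x - distSq a 1 x).re| < (distSq a 1 x₀).re :=
    (Complex.abs_re_le_norm _).trans_lt
      (((distSq v.1 v.2 - distSq a 1).norm_coe_le_norm x).trans_lt hv)
  rw [Complex.sub_re, abs_lt] at h2
  linarith [h2.1]

/-- Near circular orbits the inverse distance is an analytic function of the parameters, with
values in the Banach algebra of functions of `ψ`: it is the product of the inverse distance for
the circular orbit, and of the root of an element close to `1`. -/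
theorem analyticAt_invDist {a : ℝ} (ha : 0 < a) (ha1 : a ≠ 1) :
    AnalyticAt ℂ (fun v : ℂ × ℂ => invDist v.1 v.2) ((a : ℂ), 1) := by
  set D₀ := distSq a 1 with hD₀
  have hreg := regular_one ha ha1
  have hreal : ∀ x, ∃ s : ℝ, 0 < s ∧ D₀ x = s := by
    refine forall_angle fun ψ => ?_
    have h1 := distSq_re a 1 ψ
    have h2 := hreg.2 ψ
    simp only [Complex.ofReal_one, inv_one, sub_self, mul_zero, zero_mul, Complex.ofReal_zero,
      add_zero] at h1
    rw [h1, Complex.ofReal_re] at h2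
    exact ⟨_, h2, h1⟩
  have hunit : IsUnit D₀ := (ContinuousMap.isUnit_iff_forall_ne_zero _).2 fun x => by
    obtain ⟨s, hs, h⟩ := hreal x
    rw [h]
    exact_mod_cast hs.ne'
  have hmul := Ring.mul_inverse_cancel D₀ hunit
  set f : ℂ → ℂ := fun z => z ^ (-1 / 2 : ℂ) with hf
  have hfa : AnalyticAt ℂ f 1 :=
    analyticAt_id.cpow analyticAt_const (Or.inl (by simp))
  have hQ : AnalyticAt ℂ (fun v : ℂ × ℂ => distSq v.1 v.2 * Ring.inverse D₀) ((a : ℂ), 1) :=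
    analyticAt_distSq.fun_mul analyticAt_const
  have hQ1 : distSq ((a : ℂ), (1 : ℂ)).1 ((a : ℂ), (1 : ℂ)).2 * Ring.inverse D₀
      = ContinuousMap.const _ 1 := hmul
  have hN : AnalyticAt ℂ (fun v : ℂ × ℂ =>
      nemytskii f (distSq v.1 v.2 * Ring.inverse D₀)) ((a : ℂ), 1) := by
    refine AnalyticAt.fun_comp (g := nemytskii f)
      (f := fun v : ℂ × ℂ => distSq v.1 v.2 * Ring.inverse D₀) ?_ hQ
    rw [hQ1]
    exact analyticAt_nemytskii hfa
  obtain ⟨ρ, hρ, hcont⟩ := exists_ball_continuous_comp (X := AddCircle (2 * Real.pi)) hfa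
  have hclose : ∀ᶠ v in 𝓝 ((a : ℂ), (1 : ℂ)),
      distSq v.1 v.2 * Ring.inverse D₀ ∈ Metric.ball (ContinuousMap.const _ (1 : ℂ)) ρ := by
    have := hQ.continuousAt.eventually (Metric.ball_mem_nhds _ hρ)
    simp only [hQ1] at this
    exact this
  refine ((analyticAt_const (v := invDist a 1)).fun_mul hN).congr ?_
  filter_upwards [eventually_regular ha ha1, hclose] with v hv hv2
  ext x
  obtain ⟨s, hs, h⟩ := hreal x
  have hinv : Ring.inverse D₀ x = ((s⁻¹ : ℝ) : ℂ) := by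
    have h1 := DFunLike.congr_fun hmul x
    rw [ContinuousMap.mul_apply, ContinuousMap.one_apply, h] at h1
    rw [Complex.ofReal_inv]
    exact eq_inv_of_mul_eq_one_right h1
  have hball : ∀ y, (distSq v.1 v.2 * Ring.inverse D₀) y ∈ Metric.ball (1 : ℂ) ρ := fun y =>
    (ContinuousMap.dist_apply_le_dist y).trans_lt hv2
  rw [ContinuousMap.mul_apply, invDist_apply hreg, nemytskii_apply (hcont _ hball),
    invDist_apply hv, ← hD₀, h, ContinuousMap.mul_apply, hinv]
  have hx0 : distSq v.1 v.2 x ≠ 0 := fun h0 => by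
    have := hv.2 x
    simp [h0] at this
  have hs0 : (s : ℂ) ≠ 0 := by exact_mod_cast hs.ne'
  have hsi : ((s⁻¹ : ℝ) : ℂ) ≠ 0 := by exact_mod_cast (inv_pos.2 hs).ne'
  simp only [hf]
  rw [Complex.cpow_def_of_ne_zero hs0, Complex.cpow_def_of_ne_zero (mul_ne_zero hx0 hsi),
    Complex.cpow_def_of_ne_zero hx0, ← Complex.exp_add, mul_comm (distSq v.1 v.2 x),
    Complex.log_ofReal_mul (inv_pos.2 hs) hx0, Real.log_inv, ← Complex.ofReal_log hs.le]
  congr 1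
  push_cast
  ring

theorem analyticAt_directKernel {a : ℝ} (ha : 0 < a) (ha1 : a ≠ 1) :
    AnalyticAt ℂ (fun v : ℂ × ℂ => directKernel v.1 v.2) ((a : ℂ), 1) := by
  have hS := analyticAt_invDist ha ha1
  have hC : AnalyticAt ℂ (fun v : ℂ × ℂ => cosFun v.2) ((a : ℂ), 1) :=
    AnalyticAt.fun_comp (g := cosFun) (f := fun v : ℂ × ℂ => v.2) analyticAt_cosFun analyticAt_snd
  unfold directKernel
  have h1 := (analyticAt_fst.fun_smul (hC.fun_mul (hS.fun_pow 3))).fun_neg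
  exact analyticAt_fst.fun_smul (h1.fun_add
    ((analyticAt_const.fun_mul (analyticAt_fst.fun_pow 2)).fun_smul
      ((analyticAt_const.fun_sub (hC.fun_pow 2)).fun_mul (hS.fun_pow 5))))

theorem analyticAt_indirectKernel {a : ℝ} (ha : 0 < a) :
    AnalyticAt ℂ (fun v : ℂ × ℂ => indirectKernel v.1 v.2) ((a : ℂ), 1) := by
  have hC : AnalyticAt ℂ (fun v : ℂ × ℂ => cosFun v.2) ((a : ℂ), 1) :=
    AnalyticAt.fun_comp (g := cosFun) (f := fun v : ℂ × ℂ => v.2) analyticAt_cosFun analyticAt_snd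
  unfold indirectKernel
  have : ((a : ℂ), (1 : ℂ)).1 ≠ 0 := by
    simpa using ha.ne'
  exact (analyticAt_fst.fun_inv this).fun_smul hC

/-! ### Fourier integrals of the disturbing function -/

/-- Integration by parts: twice differentiating in the angle multiplies the Fourier integral by
`-n²`. -/
theorem fourierInt_directKernel {r w : ℂ} (h : Regular r w) (n : ℤ) :
    fourierInt n (directKernel r w) = -(n ^ 2 * r) * fourierInt n (invDist r w) := by
  set G : ℂ → ℂ := fun z => 1 + r ^ 2 - r * w * Complex.exp (z * Complex.I)
    - r * w⁻¹ * Complex.exp (-(z * Complex.I)) with hG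
  set N : ℂ → ℂ := fun z => -Complex.I / 2 * (w * Complex.exp (z * Complex.I)
    - w⁻¹ * Complex.exp (-(z * Complex.I))) with hN
  set C : ℂ → ℂ := fun z => w / 2 * Complex.exp (z * Complex.I)
    + w⁻¹ / 2 * Complex.exp (-(z * Complex.I)) with hC
  have hI : Complex.I ^ 2 = -1 := Complex.I_sq
  have he : ∀ z, HasDerivAt (fun z => Complex.exp (z * Complex.I))
      (Complex.exp (z * Complex.I) * Complex.I) z := fun z => by
    simpa using ((hasDerivAt_id z).mul_const Complex.I).cexp
  have he' : ∀ z, HasDerivAt (fun z => Complex.exp (-(z * Complex.I)))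
      (Complex.exp (-(z * Complex.I)) * -Complex.I) z := fun z => by
    simpa using ((hasDerivAt_id z).mul_const Complex.I).fun_neg.cexp
  have hG' : ∀ z, HasDerivAt G (2 * r * N z) z := fun z => by
    refine ((((he z).const_mul (r * w)).const_sub (1 + r ^ 2)).fun_sub
      ((he' z).const_mul (r * w⁻¹))).congr_deriv ?_
    simp only [hN]
    ring
  have hN' : ∀ z, HasDerivAt N (C z) z := fun z => by
    refine (((he z).const_mul w).fun_sub ((he' z).const_mul w⁻¹)).const_mul
      (-Complex.I / 2) |>.congr_deriv ?_
    simp only [hC]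
    linear_combination (-(w / 2 * Complex.exp (z * Complex.I))
      - w⁻¹ / 2 * Complex.exp (-(z * Complex.I))) * hI
  have hNC : ∀ z, N z ^ 2 = 1 - C z ^ 2 := fun z => by
    have h1 : Complex.exp (z * Complex.I) * Complex.exp (-(z * Complex.I)) = 1 := by
      rw [← Complex.exp_add, add_neg_cancel, Complex.exp_zero]
    have h2 : w * w⁻¹ = 1 := mul_inv_cancel₀ h.1
    simp only [hN, hC]
    linear_combination (w * Complex.exp (z * Complex.I)
      - w⁻¹ * Complex.exp (-(z * Complex.I))) ^ 2 / 4 * hI + w * w⁻¹ * h1 + h2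
  set P : ℂ → ℂ := fun z => Complex.exp (n * z * Complex.I) *
    (-(r ^ 2 * (N z * G z ^ (-3 / 2 : ℂ))) - Complex.I * n * r * G z ^ (-1 / 2 : ℂ)) with hP
  have hGψ : ∀ ψ : ℝ, distSq r w (ψ : AddCircle (2 * Real.pi)) = G ψ := distSq_apply r w
  have hS : ∀ ψ : ℝ, invDist r w (ψ : AddCircle (2 * Real.pi)) = G ψ ^ (-1 / 2 : ℂ) := fun ψ => by
    rw [invDist_apply h, hGψ]
  have hpow : ∀ (ψ : ℝ) (k : ℕ), invDist r w (ψ : AddCircle (2 * Real.pi)) ^ k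
      = G ψ ^ (-k / 2 : ℂ) := fun ψ k => by
    rw [hS, ← Complex.cpow_nat_mul]
    congr 1
    ring
  have hderiv : ∀ ψ : ℝ, HasDerivAt (fun x : ℝ => P x) (Complex.exp (n * ψ * Complex.I) *
      (directKernel r w + (n ^ 2 * r) • invDist r w : AngleFun)
        (ψ : AddCircle (2 * Real.pi))) ψ := by
    intro ψ
    have hsl : G ψ ∈ Complex.slitPlane := by
      rw [← hGψ]
      exact Or.inl (h.2 _)
    have h1 := (hG' ψ).cpow_const (c := (-3 / 2 : ℂ)) hsl
    have h2 := (hG' ψ).cpow_const (c := (-1 / 2 : ℂ)) hsl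
    have h3 : HasDerivAt (fun z : ℂ => Complex.exp (n * z * Complex.I))
        (Complex.exp (n * ψ * Complex.I) * (n * Complex.I)) ψ := by
      simpa using (((hasDerivAt_id (ψ : ℂ)).const_mul (n : ℂ)).mul_const Complex.I).cexp
    have h4 := h3.fun_mul ((((hN' ψ).fun_mul h1).const_mul (r ^ 2)).fun_neg.fun_sub
      (h2.const_mul (Complex.I * n * r)))
    refine h4.comp_ofReal.congr_deriv ?_
    have hCψ : cosFun w (ψ : AddCircle (2 * Real.pi)) = C ψ := cosFun_apply w ψ
    have e3 := hpow ψ 3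
    have e5 := hpow ψ 5
    rw [show (-3 / 2 : ℂ) - 1 = -((5 : ℕ) : ℂ) / 2 by norm_num, ← e5,
      show (-1 / 2 : ℂ) - 1 = -((3 : ℕ) : ℂ) / 2 by norm_num, ← e3,
      show (-3 / 2 : ℂ) = -((3 : ℕ) : ℂ) / 2 by norm_num, ← e3, ← hS]
    simp only [directKernel, ContinuousMap.add_apply, ContinuousMap.smul_apply,
      ContinuousMap.neg_apply, ContinuousMap.mul_apply, ContinuousMap.pow_apply,
      ContinuousMap.sub_apply, ContinuousMap.one_apply, smul_eq_mul, hCψ]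
    rw [← hNC]
    linear_combination (-Complex.exp (n * ψ * Complex.I) * n ^ 2 * r
      * invDist r w (ψ : AddCircle (2 * Real.pi))) * hI
  have key : fourierInt n (directKernel r w + (n ^ 2 * r) • invDist r w) = 0 := by
    rw [fourierInt_apply, intervalIntegral.integral_eq_sub_of_hasDerivAt fun ψ _ => hderiv ψ]
    · have e1 : Complex.exp (n * ((2 * Real.pi : ℝ) : ℂ) * Complex.I) = 1 := by
        have := exp_int_mul_add_two_pi n 0
        simpa using this
      have e2 : Complex.exp (((2 * Real.pi : ℝ) : ℂ) * Complex.I) = 1 := by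
        simp
      simp only [hP, hN, hG, e1, e2, Complex.exp_neg]
      simp
    · exact (Continuous.mul (by fun_prop)
        (continuous_angleFun_comp _ continuous_id)).intervalIntegrable _ _
  rw [map_add, map_smul, smul_eq_mul] at key
  linear_combination key

/-- Moving the circle of integration inside the annulus where the root is holomorphic. -/
theorem fourierInt_invDist_radius {r s t : ℝ} (hr : 0 < r) (hs : 0 < s) (hst : s ≤ t)
    (h : ∀ ρ, s ≤ ρ → ρ ≤ t → r * (ρ + ρ⁻¹) < 1 + r ^ 2) (n : ℤ) :
    (s : ℂ) ^ n * fourierInt n (invDist r s) = (t : ℂ) ^ n * fourierInt n (invDist r t) := by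
  set f : ℂ → ℂ := fun X => X ^ n * (1 + (r : ℂ) ^ 2 - r * (X + X⁻¹)) ^ (-1 / 2 : ℂ) with hf
  have hX0 : ∀ X : ℂ, s ≤ ‖X‖ → X ≠ 0 := fun X hX h0 => by
    rw [h0, norm_zero] at hX
    linarith
  have hslit : ∀ X : ℂ, s ≤ ‖X‖ → ‖X‖ ≤ t →
      1 + (r : ℂ) ^ 2 - r * (X + X⁻¹) ∈ Complex.slitPlane := by
    intro X h1 h2
    refine Or.inl ?_
    have h3 : (X + X⁻¹).re ≤ ‖X‖ + ‖X‖⁻¹ :=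
      (Complex.re_le_norm _).trans ((norm_add_le _ _).trans (by rw [norm_inv]))
    have h4 := h _ h1 h2
    have h5 : (1 + (r : ℂ) ^ 2 - r * (X + X⁻¹)).re = 1 + r ^ 2 - r * (X + X⁻¹).re := by
      rw [Complex.sub_re, Complex.re_ofReal_mul, ← Complex.ofReal_pow, Complex.add_re,
        Complex.one_re, Complex.ofReal_re]
    rw [h5]
    nlinarith
  have hd : ∀ X : ℂ, s ≤ ‖X‖ → ‖X‖ ≤ t → DifferentiableAt ℂ f X := by
    intro X h1 h2
    have h0 := hX0 X h1
    refine DifferentiableAt.mul (differentiableAt_zpow.2 (Or.inl h0)) ?_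
    refine DifferentiableAt.cpow ?_ (differentiableAt_const _) (hslit X h1 h2)
    exact (differentiableAt_const _).sub
      ((differentiableAt_const _).mul (differentiableAt_id.add (differentiableAt_inv h0)))
  have hann :=
    Complex.circleIntegral_sub_center_inv_smul_eq_of_differentiable_on_annulus_off_countable
    (c := 0) hs hst (f := f) Set.countable_empty
    (fun X hX => by
      simp only [Set.mem_sdiff, mem_closedBall_zero_iff, mem_ball_zero_iff, not_lt] at hX
      exact (hd X hX.2 hX.1).continuousAt.continuousWithinAt)
    (fun X hX => by
      simp only [Set.mem_sdiff, mem_closedBall_zero_iff, mem_ball_zero_iff, not_le,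
        Set.mem_empty_iff_false, not_false_eq_true, and_true] at hX
      exact hd X hX.2.le hX.1.le)
  have hcirc : ∀ R : ℝ, s ≤ R → R ≤ t → ∮ z in C(0, R), (z - 0)⁻¹ • f z
      = Complex.I * ((R : ℂ) ^ n * fourierInt n (invDist r R)) := by
    intro R h1 h2
    have hR : 0 < R := lt_of_lt_of_le hs h1
    have hR0 : (R : ℂ) ≠ 0 := by exact_mod_cast hR.ne'
    have hreg : Regular r R := regular_of_lt hr hR (h R h1 h2)
    rw [circleIntegral, fourierInt_apply, ← intervalIntegral.integral_const_mul,
      ← intervalIntegral.integral_const_mul]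
    refine intervalIntegral.integral_congr fun ψ _ => ?_
    have h3 : circleMap 0 R ψ ≠ 0 := circleMap_ne_center hR.ne'
    have h4 : circleMap 0 R ψ = R * Complex.exp (ψ * Complex.I) := by
      rw [circleMap, zero_add]
    simp only [deriv_circleMap, smul_eq_mul, sub_zero]
    rw [invDist_apply hreg, distSq_apply, mul_right_comm, ← mul_assoc (circleMap 0 R ψ),
      mul_inv_cancel₀ h3, one_mul, mul_comm]
    simp only [hf]
    rw [h4, mul_zpow, ← Complex.exp_int_mul, mul_inv, ← Complex.exp_neg]
    rw [show (n : ℂ) * ψ * Complex.I = n * (ψ * Complex.I) by ring, mul_assoc ((R : ℂ) ^ n)]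
    congr 2
    ring_nf
  rw [hcirc s le_rfl hst, hcirc t hst le_rfl] at hann
  exact (mul_left_cancel₀ Complex.I_ne_zero hann).symm

theorem invDist_one {r : ℝ} (hr : 0 < r) (hr1 : r ≠ 1) (ψ : ℝ) :
    invDist r 1 (ψ : AddCircle (2 * Real.pi))
      = ((1 / Real.sqrt (1 + r ^ 2 - 2 * r * Real.cos ψ) : ℝ) : ℂ) := by
  have hreg := regular_one hr hr1
  have h1 := distSq_re r 1 ψ
  simp only [Complex.ofReal_one, inv_one, sub_self, mul_zero, zero_mul, Complex.ofReal_zero,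
    add_zero] at h1
  have h2 := hreg.2 (ψ : AddCircle (2 * Real.pi))
  rw [h1, Complex.ofReal_re] at h2
  rw [invDist_apply hreg, h1, show (-1 / 2 : ℂ) = ((-(1 / 2) : ℝ) : ℂ) by norm_num,
    ← Complex.ofReal_cpow h2.le, Real.rpow_neg h2.le, ← Real.sqrt_eq_rpow, one_div]
  congr 4
  ring

/-- The Fourier integrals of the inverse distance from a circular orbit are the Laplace
coefficients. -/
theorem fourierInt_invDist_one {r : ℝ} (hr : 0 < r) (hr1 : r ≠ 1) (k : ℤ) :
    fourierInt k (invDist r 1) = ((Real.pi * laplaceB k.natAbs r : ℝ) : ℂ) := by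
  set g : ℝ → ℝ := fun ψ => 1 / Real.sqrt (1 + r ^ 2 - 2 * r * Real.cos ψ) with hg
  have hpos : ∀ ψ, 0 < 1 + r ^ 2 - 2 * r * Real.cos ψ := fun ψ => by
    have := sq_pos_of_ne_zero (sub_ne_zero.2 hr1)
    nlinarith [Real.cos_le_one ψ]
  have hgc : Continuous g := by
    refine Continuous.div (by fun_prop) (by fun_prop) fun ψ => (Real.sqrt_pos.2 (hpos ψ)).ne'
  have hF : ∀ k : ℤ, fourierInt k (invDist r 1)
      = ∫ ψ in (0 : ℝ)..(2 * Real.pi), Complex.exp (k * ψ * Complex.I) * (g ψ : ℂ) := fun k => by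
    rw [fourierInt_apply]
    exact intervalIntegral.integral_congr fun ψ _ => by simp only [invDist_one hr hr1, hg]
  have hsymm : fourierInt k (invDist r 1)
      = ∫ ψ in (0 : ℝ)..(2 * Real.pi), Complex.exp (-(k * ψ * Complex.I)) * (g ψ : ℂ) := by
    rw [hF]
    have := intervalIntegral.integral_comp_sub_left
      (fun ψ : ℝ => Complex.exp (k * ψ * Complex.I) * (g ψ : ℂ)) (2 * Real.pi)
      (a := 0) (b := 2 * Real.pi)
    rw [sub_self, sub_zero] at this
    rw [← this]
    refine intervalIntegral.integral_congr fun ψ _ => ?_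
    have e1 : g (2 * Real.pi - ψ) = g ψ := by
      simp only [hg, Real.cos_two_pi_sub]
    have e2 := exp_int_mul_add_two_pi k (-ψ)
    rw [e1, show 2 * Real.pi - ψ = -ψ + 2 * Real.pi by ring, e2]
    congr 2
    push_cast
    ring
  have hi : ∀ s : ℂ, IntervalIntegrable
      (fun ψ : ℝ => Complex.exp (s * ψ * Complex.I) * (g ψ : ℂ)) MeasureTheory.volume 0
        (2 * Real.pi) := fun s =>
    Continuous.intervalIntegrable (by fun_prop) _ _
  have hi' : IntervalIntegrable
      (fun ψ : ℝ => Complex.exp (-(k * ψ * Complex.I)) * (g ψ : ℂ)) MeasureTheory.volume 0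
        (2 * Real.pi) := Continuous.intervalIntegrable (by fun_prop) _ _
  have h2 : 2 * fourierInt k (invDist r 1)
      = ∫ ψ in (0 : ℝ)..(2 * Real.pi), ((2 * (Real.cos (k.natAbs * ψ) * g ψ) : ℝ) : ℂ) := by
    rw [two_mul]
    nth_rw 1 [hF]
    rw [hsymm, ← intervalIntegral.integral_add (hi k) hi']
    refine intervalIntegral.integral_congr fun ψ _ => ?_
    have e3 : Real.cos (k.natAbs * ψ) = Real.cos (k * ψ) := by
      have : ((k.natAbs : ℕ) : ℝ) = |(k : ℝ)| := by
        rw [Nat.cast_natAbs, Int.cast_abs]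
      rw [this]
      rcases abs_choice (k : ℝ) with h | h <;> rw [h]
      rw [neg_mul, Real.cos_neg]
    rw [e3, ← neg_mul, Complex.exp_mul_I, Complex.exp_mul_I, Complex.cos_neg, Complex.sin_neg]
    push_cast
    ring
  rw [intervalIntegral.integral_ofReal, intervalIntegral.integral_const_mul] at h2
  have h3 : Real.pi * laplaceB k.natAbs r
      = ∫ ψ in (0 : ℝ)..(2 * Real.pi), Real.cos (k.natAbs * ψ) * g ψ := by
    rw [laplaceB, ← mul_assoc, mul_one_div_cancel Real.pi_ne_zero, one_mul]
    refine intervalIntegral.integral_congr fun ψ _ => ?_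
    simp only [hg]
    ring
  rw [h3]
  push_cast at h2 ⊢
  exact mul_left_cancel₀ two_ne_zero h2

theorem fourierInt_indirectKernel {n : ℤ} (h1 : n ≠ 1) (h2 : n ≠ -1) (r w : ℂ) :
    fourierInt n (indirectKernel r w) = 0 := by
  have hexp : ∀ k : ℤ, k ≠ 0 →
      ∫ ψ in (0 : ℝ)..(2 * Real.pi), Complex.exp (k * ψ * Complex.I) = 0 := by
    intro k hk
    have hk' : (k : ℂ) * Complex.I ≠ 0 := mul_ne_zero (by exact_mod_cast hk) Complex.I_ne_zero
    have := integral_exp_mul_complex (a := 0) (b := 2 * Real.pi) hk'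
    have e : ∀ ψ : ℝ, (k : ℂ) * ψ * Complex.I = k * Complex.I * ψ := fun ψ => by ring
    simp only [e]
    rw [this]
    have e1 := exp_int_mul_add_two_pi k 0
    rw [zero_add, e, e] at e1
    rw [e1, sub_self, zero_div]
  have hp : fourierInt n angleExp = 0 := by
    rw [fourierInt_apply, ← hexp (n + 1) (by omega)]
    refine intervalIntegral.integral_congr fun ψ _ => ?_
    simp only [angleExp_apply]
    rw [← Complex.exp_add]
    congr 1
    push_cast
    ring
  have hm : fourierInt n angleExpNeg = 0 := by
    rw [fourierInt_apply, ← hexp (n - 1) (by omega)]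
    refine intervalIntegral.integral_congr fun ψ _ => ?_
    simp only [angleExpNeg_apply]
    rw [← Complex.exp_add]
    congr 1
    push_cast
    ring
  rw [indirectKernel, cosFun, map_smul, map_add, map_smul, map_smul, hp, hm]
  simp

/-! ### Evaluation on real orbits -/

theorem iteratedDeriv_two_inv_delta1 {r θ : ℝ} (h : 0 < 1 + r ^ 2 - 2 * r * Real.cos θ) :
    iteratedDeriv 2 (fun θ => 1 / delta1 r θ) θ
      = -(r * Real.cos θ * (1 / delta1 r θ) ^ 3)
        + 3 * r ^ 2 * (Real.sin θ ^ 2 * (1 / delta1 r θ) ^ 5) := by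
  have hd : ∀ θ, 0 < 1 + r ^ 2 - 2 * r * Real.cos θ →
      HasDerivAt (fun θ => 1 / delta1 r θ) (-(r * (Real.sin θ * (1 / delta1 r θ) ^ 3))) θ := by
    intro θ h
    have h0 : 0 < delta1 r θ := Real.sqrt_pos.2 h
    have h1 : HasDerivAt (fun θ => 1 + r ^ 2 - 2 * r * Real.cos θ) (2 * r * Real.sin θ) θ := by
      refine ((Real.hasDerivAt_cos θ).const_mul (2 * r)).const_sub (1 + r ^ 2) |>.congr_deriv ?_
      ring
    have h2 : HasDerivAt (delta1 r) (2 * r * Real.sin θ / (2 * delta1 r θ)) θ := h1.sqrt h.ne'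
    have h3 : HasDerivAt (fun θ => 1 / delta1 r θ)
        ((0 * delta1 r θ - 1 * (2 * r * Real.sin θ / (2 * delta1 r θ))) / delta1 r θ ^ 2) θ :=
      (hasDerivAt_const θ (1 : ℝ)).fun_div h2 h0.ne'
    refine h3.congr_deriv ?_
    field_simp
    ring
  have hopen : ∀ᶠ θ in 𝓝 θ, 0 < 1 + r ^ 2 - 2 * r * Real.cos θ :=
    (show Continuous fun θ => 1 + r ^ 2 - 2 * r * Real.cos θ by fun_prop).continuousAt.eventually
      (lt_mem_nhds h)
  rw [iteratedDeriv_succ, iteratedDeriv_one]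
  have e : deriv (fun θ => 1 / delta1 r θ)
      =ᶠ[𝓝 θ] fun θ => -(r * (Real.sin θ * (1 / delta1 r θ) ^ 3)) := by
    filter_upwards [hopen] with x hx using (hd x hx).deriv
  rw [e.deriv_eq]
  have h4 := (((Real.hasDerivAt_sin θ).fun_mul ((hd θ h).fun_pow 3)).const_mul r).fun_neg
  rw [h4.deriv]
  push_cast
  ring

/-- If `w exp(iψ) = exp(iθ)`, the kernels are the quantities in the integrand of `stabC`. -/
theorem kernels_eq {r θ ψ : ℝ} {w : ℂ} (h : Regular r w)
    (hθ : w * Complex.exp (ψ * Complex.I) = Complex.exp (θ * Complex.I)) :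
    directKernel r w (ψ : AddCircle (2 * Real.pi))
        = ((r * iteratedDeriv 2 (fun θ => 1 / delta1 r θ) θ : ℝ) : ℂ) ∧
      indirectKernel r w (ψ : AddCircle (2 * Real.pi)) = ((Real.cos θ / r : ℝ) : ℂ) := by
  have hθ' : w⁻¹ * Complex.exp (-(ψ * Complex.I)) = Complex.exp (-(θ * Complex.I)) := by
    rw [Complex.exp_neg, Complex.exp_neg, ← mul_inv, hθ]
  have hC : cosFun w (ψ : AddCircle (2 * Real.pi)) = (Real.cos θ : ℂ) := by
    rw [cosFun_apply]
    have := Complex.two_cos (θ : ℂ)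
    rw [neg_mul] at this
    rw [Complex.ofReal_cos]
    linear_combination (1 / 2 : ℂ) * hθ + (1 / 2 : ℂ) * hθ' - (1 / 2 : ℂ) * this
  have hD : distSq r w (ψ : AddCircle (2 * Real.pi))
      = ((1 + r ^ 2 - 2 * r * Real.cos θ : ℝ) : ℂ) := by
    rw [distSq_apply]
    rw [cosFun_apply] at hC
    push_cast at hC ⊢
    linear_combination (-2 * r : ℂ) * hC
  have hpos := h.2 (ψ : AddCircle (2 * Real.pi))
  rw [hD, Complex.ofReal_re] at hpos
  have hS : invDist r w (ψ : AddCircle (2 * Real.pi)) = ((1 / delta1 r θ : ℝ) : ℂ) := by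
    rw [invDist_apply h, hD, show (-1 / 2 : ℂ) = ((-(1 / 2) : ℝ) : ℂ) by norm_num,
      ← Complex.ofReal_cpow hpos.le, Real.rpow_neg hpos.le, ← Real.sqrt_eq_rpow, one_div, delta1]
  refine ⟨?_, ?_⟩
  · rw [iteratedDeriv_two_inv_delta1 hpos]
    simp only [directKernel, ContinuousMap.add_apply, ContinuousMap.smul_apply,
      ContinuousMap.neg_apply, ContinuousMap.mul_apply, ContinuousMap.pow_apply,
      ContinuousMap.sub_apply, ContinuousMap.one_apply, smul_eq_mul, hC, hS]
    rw [Real.sin_sq]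
    push_cast
    ring
  · rw [indirectKernel, ContinuousMap.smul_apply, hC, smul_eq_mul]
    push_cast
    ring

/-! ### Laplace coefficients and Taylor expansions -/

theorem binomOp_succ (σ c : ℝ) (k : ℕ) (F : ℝ → ℝ) (x : ℝ) : binomOp σ c (k + 1) F x
    = (σ * (x * deriv (binomOp σ c k F) x) + (c - k) * binomOp σ c k F x) / (k + 1) := rfl

theorem analyticAt_binomOp {F : ℝ → ℝ} {α : ℝ} (hF : AnalyticAt ℝ F α) (σ c : ℝ) (k : ℕ) :
    AnalyticAt ℝ (binomOp σ c k F) α := by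
  induction k with
  | zero => exact hF
  | succ k ih =>
    exact ((analyticAt_const.fun_mul (analyticAt_id.fun_mul ih.deriv)).fun_add
      (analyticAt_const.fun_mul ih)).div_const

theorem tendsto_mul_one_add_rpow (α σ : ℝ) :
    Tendsto (fun y : ℝ => α * (1 + y) ^ σ) (𝓝 0) (𝓝 α) := by
  have h : ContinuousAt (fun y : ℝ => α * (1 + y) ^ σ) 0 := by
    refine continuousAt_const.mul (ContinuousAt.rpow_const (by fun_prop) (Or.inl ?_))
    norm_num
  simpa using h.tendsto

/-- With `x = α (1 + y)^σ` one has `d/dy = (1 + y)⁻¹ σ D`, `D = x d/dx`, so each differentiation of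
`(1 + y)^(c - k) G(x)` in `y` applies `σ D + c - k` to `G`. -/
theorem iteratedDeriv_eventuallyEq_binomOp {F : ℝ → ℝ} {α : ℝ} (hF : AnalyticAt ℝ F α)
    (σ c : ℝ) (k : ℕ) :
    iteratedDeriv k (fun y => (1 + y) ^ c * F (α * (1 + y) ^ σ)) =ᶠ[𝓝 0]
      fun y => k.factorial * ((1 + y) ^ (c - k) * binomOp σ c k F (α * (1 + y) ^ σ)) := by
  induction k with
  | zero =>
    refine Eventually.of_forall fun y => ?_
    simp [binomOp]
  | succ k ih =>
    have hB := (analyticAt_binomOp hF σ c k).eventually_analyticAt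
    filter_upwards [ih.eventually_nhds, (tendsto_mul_one_add_rpow α σ).eventually hB,
      eventually_gt_nhds (show (-1 : ℝ) < 0 by norm_num)] with y hy hBy hy1
    have hpos : 0 < 1 + y := by linarith
    rw [iteratedDeriv_succ, EventuallyEq.deriv_eq hy]
    have h0 : HasDerivAt (fun y : ℝ => 1 + y) 1 y := (hasDerivAt_id y).const_add 1
    have h1 : HasDerivAt (fun y : ℝ => (1 + y) ^ (c - k)) (1 * (c - k) * (1 + y) ^ (c - k - 1)) y :=
      h0.rpow_const (Or.inl hpos.ne')
    have h2 : HasDerivAt (fun y : ℝ => α * (1 + y) ^ σ) (α * (1 * σ * (1 + y) ^ (σ - 1))) y :=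
      (h0.rpow_const (Or.inl hpos.ne')).const_mul α
    have h3 := HasDerivAt.comp y hBy.differentiableAt.hasDerivAt h2
    have h4 := (h1.fun_mul h3).const_mul (k.factorial : ℝ)
    simp only [Function.comp_def] at h4
    rw [h4.deriv]
    have e1 : (1 + y) ^ (c - k) = (1 + y) ^ (c - k - 1) * (1 + y) := by
      rw [← Real.rpow_add_one hpos.ne']; congr 1; ring
    have e2 : α * (1 + y) ^ σ = α * ((1 + y) ^ (σ - 1) * (1 + y)) := by
      rw [← Real.rpow_add_one hpos.ne']; congr 2; ring
    have e3 : c - ((k + 1 : ℕ) : ℝ) = c - k - 1 := by push_cast; ring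
    have hk : ((k : ℝ) + 1) ≠ 0 := by positivity
    rw [e3, binomOp_succ, Nat.factorial_succ, e1]
    generalize deriv (binomOp σ c k F) (α * (1 + y) ^ σ) = B
    generalize binomOp σ c k F (α * (1 + y) ^ σ) = b
    rw [e2]
    push_cast
    field_simp
    ring

theorem taylorCoeff_binomOp {F : ℝ → ℝ} {α : ℝ} (hF : AnalyticAt ℝ F α) (σ c : ℝ) (k : ℕ) :
    taylorCoeff (fun y => (1 + y) ^ c * F (α * (1 + y) ^ σ)) k = binomOp σ c k F α := by
  have h := (iteratedDeriv_eventuallyEq_binomOp hF σ c k).eq_of_nhds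
  have hk : (k.factorial : ℝ) ≠ 0 := by exact_mod_cast k.factorial_ne_zero
  rw [taylorCoeff, h]
  simp [hk]

theorem taylorCoeff_mul {f g : ℝ → ℝ} (hf : AnalyticAt ℝ f 0) (hg : AnalyticAt ℝ g 0) (n : ℕ) :
    taylorCoeff (fun y => f y * g y) n
      = ∑ k ∈ Finset.range (n + 1), taylorCoeff f k * taylorCoeff g (n - k) := by
  have h := iteratedDeriv_fun_mul (n := n) (x := (0 : ℝ)) (hf.contDiffAt (n := n))
    (hg.contDiffAt (n := n))
  rw [taylorCoeff, h, Finset.sum_div]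
  refine Finset.sum_congr rfl fun k hk => ?_
  have hkn : k ≤ n := Nat.lt_succ_iff.1 (Finset.mem_range.1 hk)
  have h1 : (n.choose k : ℝ) * k.factorial * (n - k).factorial = n.factorial := by
    exact_mod_cast Nat.choose_mul_factorial_mul_factorial hkn
  have h2 : (k.factorial : ℝ) ≠ 0 := by exact_mod_cast k.factorial_ne_zero
  have h3 : ((n - k).factorial : ℝ) ≠ 0 := by exact_mod_cast (n - k).factorial_ne_zero
  have h4 : (n.factorial : ℝ) ≠ 0 := by exact_mod_cast n.factorial_ne_zero
  rw [taylorCoeff, taylorCoeff]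
  field_simp
  rw [← h1]
  ring

theorem taylorCoeff_exp (b : ℝ) (n : ℕ) :
    taylorCoeff (fun y => Real.exp (b * y)) n = b ^ n / n.factorial := by
  rw [taylorCoeff, iteratedDeriv_exp_const_mul]
  simp

/-- The coefficients of `(1 + y)^c F(α (1 + y)^σ) exp(b y)`. -/
theorem taylorCoeff_binomOp_mul_exp {F : ℝ → ℝ} {α : ℝ} (hF : AnalyticAt ℝ F α) (σ c b : ℝ)
    (n : ℕ) :
    taylorCoeff (fun y => (1 + y) ^ c * F (α * (1 + y) ^ σ) * Real.exp (b * y)) n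
      = ∑ k ∈ Finset.range (n + 1), b ^ (n - k) / (n - k).factorial * binomOp σ c k F α := by
  have hr : ∀ s : ℝ, AnalyticAt ℝ (fun y : ℝ => (1 + y) ^ s) 0 := fun s => by
    have : ContDiffAt ℝ ω (fun y : ℝ => (1 + y) ^ s) 0 :=
      ContDiffAt.rpow_const_of_ne (by fun_prop) (by norm_num)
    exact this.analyticAt
  have h1 : AnalyticAt ℝ (fun y => (1 + y) ^ c * F (α * (1 + y) ^ σ)) 0 := by
    refine (hr c).fun_mul (AnalyticAt.fun_comp (g := F) ?_ (analyticAt_const.fun_mul (hr σ)))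
    simpa using hF
  have h2 : AnalyticAt ℝ (fun y : ℝ => Real.exp (b * y)) 0 :=
    by fun_prop
  rw [taylorCoeff_mul h1 h2]
  refine Finset.sum_congr rfl fun k _ => ?_
  rw [taylorCoeff_binomOp hF, taylorCoeff_exp, mul_comm]

theorem laplaceB_inv (n : ℕ) {r : ℝ} (hr : 0 < r) : laplaceB n r⁻¹ = r * laplaceB n r := by
  rw [laplaceB, laplaceB, mul_left_comm, ← intervalIntegral.integral_const_mul r]
  refine congrArg (fun z => 1 / Real.pi * z) (intervalIntegral.integral_congr fun θ _ => ?_)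
  have h1 : 1 + r⁻¹ ^ 2 - 2 * r⁻¹ * Real.cos θ
      = (1 + r ^ 2 - 2 * r * Real.cos θ) / r ^ 2 := by
    field_simp
    ring
  rw [h1, Real.sqrt_div' _ (sq_nonneg r), Real.sqrt_sq hr.le]
  rw [div_div_eq_mul_div, mul_comm r, mul_div_right_comm]

theorem analyticAt_laplaceB (n : ℕ) {a : ℝ} (ha : 0 < a) (ha1 : a ≠ 1) :
    AnalyticAt ℝ (laplaceB n) a := by
  have h1 : AnalyticAt ℂ (fun z : ℂ => fourierInt n (invDist z 1)) (a : ℂ) := by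
    refine ((fourierInt n).analyticAt _).fun_comp (f := fun z : ℂ => invDist z 1) ?_
    exact AnalyticAt.fun_comp (g := fun v : ℂ × ℂ => invDist v.1 v.2) (f := fun z : ℂ => (z, 1))
      (analyticAt_invDist ha ha1) (analyticAt_id.prod analyticAt_const)
  have h2 : AnalyticAt ℝ (fun r : ℝ => (fourierInt n (invDist (r : ℂ) 1)).re) a :=
    (Complex.reCLM.analyticAt _).fun_comp
      ((h1.restrictScalars (𝕜 := ℝ)).fun_comp (Complex.ofRealCLM.analyticAt a))
  refine (analyticAt_const (v := Real.pi⁻¹).fun_mul h2).congr ?_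
  filter_upwards [eventually_gt_nhds ha, eventually_ne_nhds ha1] with r hr hr1
  rw [fourierInt_invDist_one hr hr1, Complex.ofReal_re, Int.natAbs_natCast, ← mul_assoc,
    inv_mul_cancel₀ Real.pi_ne_zero, one_mul]

/-! ### The averaged kernels -/

/-- The radius `a (1 - e cos E)` as a function of `(u, v) = (e exp(iE), e exp(-iE))`. -/
noncomputable def parR (a : ℝ) (y : ℂ × ℂ) : ℂ := a * (1 - (y.1 + y.2) / 2)

/-- The quotient `β / e = 1 / (1 + √(1 - e²))` as a function of `(e exp(iE), e exp(-iE))`. -/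
noncomputable def parK (y : ℂ × ℂ) : ℂ := (1 + (1 - y.1 * y.2) ^ (1 / 2 : ℂ))⁻¹

/-- The factor `exp(i (ν - E + c e sin E))`, where `ν` is the true anomaly, as a function of
`(e exp(iE), e exp(-iE))`. -/
noncomputable def parW (c : ℝ) (y : ℂ × ℂ) : ℂ :=
  (1 - parK y * y.2) / (1 - parK y * y.1) * Complex.exp (c * (y.1 - y.2) / 2)

theorem parR_zero (a : ℝ) : parR a 0 = a := by simp [parR]

theorem parK_of_mul_eq_zero {y : ℂ × ℂ} (h : y.1 * y.2 = 0) : parK y = 1 / 2 := by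
  rw [parK, h, sub_zero, Complex.one_cpow]
  norm_num

theorem parW_zero (c : ℝ) : parW c 0 = 1 := by simp [parW]

theorem analyticAt_parR (a : ℝ) : AnalyticAt ℂ (parR a) 0 := by
  have : ContDiffAt ℂ ω (parR a) 0 := by unfold parR; fun_prop
  exact this.analyticAt

theorem analyticAt_parK : AnalyticAt ℂ parK 0 := by
  have h1 : AnalyticAt ℂ (fun y : ℂ × ℂ => 1 - y.1 * y.2) 0 := by fun_prop
  have h2 : AnalyticAt ℂ (fun y : ℂ × ℂ => (1 - y.1 * y.2) ^ (1 / 2 : ℂ)) 0 :=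
    h1.cpow analyticAt_const (Or.inl (by simp))
  refine (analyticAt_const.fun_add h2).fun_inv ?_
  simp

theorem analyticAt_parW (c : ℝ) : AnalyticAt ℂ (parW c) 0 := by
  have hK := analyticAt_parK
  have h1 : AnalyticAt ℂ (fun y : ℂ × ℂ => Complex.exp (c * (y.1 - y.2) / 2)) 0 :=
    (show ContDiffAt ℂ ω (fun y : ℂ × ℂ => Complex.exp (c * (y.1 - y.2) / 2)) 0 by
      fun_prop).analyticAt
  have h2 : AnalyticAt ℂ (fun y : ℂ × ℂ => 1 - parK y * y.2) 0 :=
    analyticAt_const.fun_sub (hK.fun_mul analyticAt_snd)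
  have h3 : AnalyticAt ℂ (fun y : ℂ × ℂ => 1 - parK y * y.1) 0 :=
    analyticAt_const.fun_sub (hK.fun_mul analyticAt_fst)
  exact (h2.fun_div h3 (by simp)).fun_mul h1

theorem tendsto_par (a c : ℝ) :
    Tendsto (fun y => (parR a y, parW c y)) (𝓝 0) (𝓝 ((a : ℂ), (1 : ℂ))) := by
  have := ((analyticAt_parR a).continuousAt.prodMk (analyticAt_parW c).continuousAt).tendsto
  simpa only [parR_zero, parW_zero] using this

theorem eventually_regular_par {a : ℝ} (ha : 0 < a) (ha1 : a ≠ 1) (c : ℝ) :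
    ∀ᶠ y in 𝓝 0, Regular (parR a y) (parW c y) :=
  (tendsto_par a c).eventually (eventually_regular ha ha1)

theorem analyticAt_directKernel_par {a : ℝ} (ha : 0 < a) (ha1 : a ≠ 1) (c : ℝ) :
    AnalyticAt ℂ (fun y => directKernel (parR a y) (parW c y)) 0 := by
  refine AnalyticAt.fun_comp (g := fun v : ℂ × ℂ => directKernel v.1 v.2)
    (f := fun y => (parR a y, parW c y)) ?_ ((analyticAt_parR a).prod (analyticAt_parW c))
  rw [parR_zero, parW_zero]
  exact analyticAt_directKernel ha ha1

theorem analyticAt_indirectKernel_par {a : ℝ} (ha : 0 < a) (c : ℝ) :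
    AnalyticAt ℂ (fun y => indirectKernel (parR a y) (parW c y)) 0 := by
  refine AnalyticAt.fun_comp (g := fun v : ℂ × ℂ => indirectKernel v.1 v.2)
    (f := fun y => (parR a y, parW c y)) ?_ ((analyticAt_parR a).prod (analyticAt_parW c))
  rw [parR_zero, parW_zero]
  exact analyticAt_indirectKernel ha

/-- For real parameters the contour can be moved to the unit circle. -/
theorem fourierInt_directKernel_real {r w : ℝ} (hr : 0 < r) (hw : 0 < w)
    (h : r * (w + w⁻¹) < 1 + r ^ 2) (n : ℤ) :
    fourierInt n (directKernel r w)
      = ((-(n ^ 2 * Real.pi * (r * laplaceB n.natAbs r)) * w ^ (-n) : ℝ) : ℂ) := by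
  have hww : w * w⁻¹ = 1 := mul_inv_cancel₀ hw.ne'
  have hwi : 0 < w⁻¹ := inv_pos.2 hw
  have h2 : 2 ≤ w + w⁻¹ := by nlinarith [sq_nonneg (w - w⁻¹), sq_nonneg (w + w⁻¹ - 2)]
  have hr1 : r ≠ 1 := by
    rintro rfl
    linarith
  -- `ρ + ρ⁻¹` decreases for `ρ ≤ 1` and increases for `ρ ≥ 1`
  have hconv : ∀ ρ : ℝ, 0 < ρ → 0 ≤ (w - ρ) * (w * ρ - 1) → r * (ρ + ρ⁻¹) < 1 + r ^ 2 := by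
    intro ρ hρ hle
    have h5 : (w + w⁻¹) - (ρ + ρ⁻¹) = (w - ρ) * (w * ρ - 1) / (w * ρ) := by
      field_simp
      ring
    have : 0 ≤ (w - ρ) * (w * ρ - 1) / (w * ρ) := by positivity
    nlinarith
  have hrad : (w : ℂ) ^ n * fourierInt n (invDist r w) = fourierInt n (invDist r 1) := by
    rcases le_total w 1 with h1 | h1
    · have := fourierInt_invDist_radius hr hw h1 (fun ρ a b => hconv ρ (by linarith)
        (mul_nonneg_of_nonpos_of_nonpos (by linarith) (by nlinarith))) n
      simpa using this
    · have := fourierInt_invDist_radius hr one_pos h1 (fun ρ a b => hconv ρ (by linarith)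
        (mul_nonneg (by linarith) (by nlinarith))) n
      simpa using this.symm
  have hw0 : (w : ℂ) ≠ 0 := by exact_mod_cast hw.ne'
  rw [fourierInt_invDist_one hr hr1] at hrad
  have h3 : fourierInt n (invDist r w)
      = (w : ℂ) ^ (-n) * ((Real.pi * laplaceB n.natAbs r : ℝ) : ℂ) := by
    rw [← hrad, ← mul_assoc, ← zpow_add₀ hw0, neg_add_cancel, zpow_zero, one_mul]
  rw [fourierInt_directKernel (regular_of_lt hr hw h), h3]
  push_cast
  ring

section

/-- The Fourier integral of index `s q`, `s = ±1`, of the direct kernel at `(-2y, 0)`, which is that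
of index `-s q` at `(0, -2y)`, up to a constant. -/
noncomputable def axisFun (a : ℝ) (p q : ℕ) (s : ℤ) (y : ℝ) : ℝ :=
  (1 + y) ^ ((s * q : ℤ) : ℝ) * (a * (1 + y) * laplaceB q (a * (1 + y))) * Real.exp (s * p * y)

theorem analyticAt_axisFun {a : ℝ} (ha : 0 < a) (ha1 : a ≠ 1) (p q : ℕ) (s : ℤ) :
    AnalyticAt ℝ (axisFun a p q s) 0 := by
  have h1 : AnalyticAt ℝ (fun y : ℝ => (1 + y) ^ ((s * q : ℤ) : ℝ)) 0 :=
    (show ContDiffAt ℝ ω (fun y : ℝ => (1 + y) ^ ((s * q : ℤ) : ℝ)) 0 from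
      ContDiffAt.rpow_const_of_ne (by fun_prop) (by norm_num)).analyticAt
  have h2 : AnalyticAt ℝ (fun y : ℝ => a * (1 + y)) 0 := by fun_prop
  have h3 : AnalyticAt ℝ (fun y : ℝ => laplaceB q (a * (1 + y))) 0 := by
    refine AnalyticAt.fun_comp (g := laplaceB q) ?_ h2
    rw [add_zero, mul_one]
    exact analyticAt_laplaceB q ha ha1
  have h4 : AnalyticAt ℝ (fun y : ℝ => Real.exp (s * p * y)) 0 := by fun_prop
  exact (h1.fun_mul (h2.fun_mul h3)).fun_mul h4

/-- On the axes the factor `w` of `exp(iθ) = w exp(iψ)` is `W` and `W⁻¹`, respectively, with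
`W = exp(c u / 2) / (1 - u / 2)`. -/
theorem eventually_fourierInt_axis {a : ℝ} (ha : 0 < a) (ha1 : a ≠ 1) {p q : ℕ} (hq : 0 < q)
    {s : ℤ} (hs : s ^ 2 = 1) :
    ∀ᶠ u : ℝ in 𝓝 0,
      fourierInt (s * q) (directKernel (parR a ((u : ℂ), 0)) (parW ((p : ℝ) / q) ((u : ℂ), 0)))
        = ((-(Real.pi * q ^ 2) * axisFun a p q s (-1 / 2 * u) : ℝ) : ℂ) ∧
      fourierInt (-(s * q))
          (directKernel (parR a (0, (u : ℂ))) (parW ((p : ℝ) / q) (0, (u : ℂ))))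
        = ((-(Real.pi * q ^ 2) * axisFun a p q s (-1 / 2 * u) : ℝ) : ℂ) := by
  set c : ℝ := (p : ℝ) / q with hc
  set R : ℝ → ℝ := fun u => a * (1 - u / 2) with hR
  set W : ℝ → ℝ := fun u => (1 - u / 2)⁻¹ * Real.exp (c * u / 2) with hW
  have hRc : ContinuousAt R 0 := by simp only [hR]; fun_prop
  have hWc : ContinuousAt W 0 := by
    simp only [hW]
    exact ContinuousAt.mul (ContinuousAt.inv₀ (by fun_prop) (by norm_num)) (by fun_prop)
  have hlt : ∀ᶠ u in 𝓝 0, R u * (W u + (W u)⁻¹) < 1 + R u ^ 2 := by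
    refine ContinuousAt.eventually_lt
      (hRc.mul (hWc.add (hWc.inv₀ (by simp [hW])))) (continuousAt_const.add (hRc.pow 2)) ?_
    simp only [hR, hW]
    have := sq_pos_of_ne_zero (sub_ne_zero.2 ha1)
    norm_num
    nlinarith
  filter_upwards [hlt, eventually_lt_nhds (show (0 : ℝ) < 2 by norm_num)] with u hu hu2
  have hy : 0 < 1 - u / 2 := by linarith
  have hRp : 0 < R u := mul_pos ha hy
  have hWp : 0 < W u := mul_pos (inv_pos.2 hy) (Real.exp_pos _)
  have hyc : (1 - (u : ℂ) / 2) ≠ 0 := by exact_mod_cast hy.ne'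
  have eR : parR a ((u : ℂ), 0) = R u ∧ parR a (0, (u : ℂ)) = R u := by
    simp [parR, hR]
  have eW : parW c ((u : ℂ), 0) = W u := by
    rw [parW, parK_of_mul_eq_zero (by simp)]
    simp only [hW]
    push_cast
    congr 1
    · rw [mul_zero, sub_zero, one_div]
      congr 1
      ring
    · congr 1
      ring
  have eW' : parW c (0, (u : ℂ)) = ((W u)⁻¹ : ℝ) := by
    rw [parW, parK_of_mul_eq_zero (by simp)]
    simp only [hW]
    rw [mul_inv, inv_inv, ← Real.exp_neg]
    push_cast
    congr 1
    · rw [mul_zero, sub_zero, div_one]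
      ring
    · congr 1
      ring
  have hnat : (s * q : ℤ).natAbs = q := by
    rcases mul_self_eq_one_iff.1 ((sq s).symm.trans hs) with h | h <;> simp [h]
  have hax : axisFun a p q s (-1 / 2 * u)
      = R u * laplaceB q (R u) * W u ^ (-(s * q : ℤ)) := by
    have e1 : 1 + -1 / 2 * u = 1 - u / 2 := by ring
    have hq0 : (q : ℝ) ≠ 0 := by exact_mod_cast hq.ne'
    have e2 : s * p * (-1 / 2 * u) = c * u / 2 * ((-(s * q : ℤ) : ℤ) : ℝ) := by
      rw [hc]
      push_cast
      field_simp
    rw [axisFun, e1, e2, Real.rpow_intCast]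
    simp only [hW, hR]
    rw [mul_zpow, inv_zpow', neg_neg, Real.exp_mul, Real.rpow_intCast]
    ring
  have hsq : ((s * q : ℤ) : ℝ) ^ 2 = q ^ 2 := by
    have : ((s : ℝ)) ^ 2 = 1 := by exact_mod_cast hs
    push_cast
    rw [mul_pow, this, one_mul]
  constructor
  · rw [eR.1, eW, fourierInt_directKernel_real hRp hWp hu, hnat, hax]
    congr 1
    rw [hsq]
    ring
  · rw [eR.2, eW', fourierInt_directKernel_real hRp (inv_pos.2 hWp) (by
      rw [inv_inv, add_comm (W u)⁻¹]; exact hu), Int.natAbs_neg, hnat, hax]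
    congr 1
    rw [inv_zpow', neg_neg, Int.cast_neg, neg_sq, hsq]
    ring

theorem exp_sign_mul_pi {s : ℤ} (hs : s ^ 2 = 1) (N : ℕ) :
    Complex.exp (s * (N * Real.pi) * Complex.I) = (-1) ^ N := by
  have hpi : Complex.exp ((s : ℂ) * Real.pi * Complex.I) = -1 := by
    rcases mul_self_eq_one_iff.1 ((sq s).symm.trans hs) with h | h <;> rw [h]
    · simp
    · rw [show ((-1 : ℤ) : ℂ) * Real.pi * Complex.I = -(Real.pi * Complex.I) by push_cast; ring,
        Complex.exp_neg, Complex.exp_pi_mul_I]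
      norm_num
  rw [← hpi, ← Complex.exp_nat_mul]
  congr 1
  ring

/-- The semimajor axis of the resonant orbits. -/
noncomputable def resA (p q : ℕ) : ℝ := ((p : ℝ) / q) ^ ((2 : ℝ) / 3)

/-- The value at `E = 0` of the phase of the line along which the kernels are averaged. -/
noncomputable def phase (p q nl ng : ℕ) : ℝ := p / q * (nl * Real.pi) + ng * Real.pi

variable {p q : ℕ}

theorem resA_pos (hp : 0 < p) (hq : 0 < q) : 0 < resA p q := by
  have : (0 : ℝ) < p / q := by positivity
  exact Real.rpow_pos_of_pos this _

theorem resA_ne_one (hp : 0 < p) (hq : 0 < q) (hne : p ≠ q) : resA p q ≠ 1 := by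
  have h0 : (0 : ℝ) < p / q := by positivity
  intro h
  have h1 : (p : ℝ) / q = 1 := (Real.rpow_left_inj h0.le zero_le_one
    (by norm_num : (2 : ℝ) / 3 ≠ 0)).1 (by rw [Real.one_rpow]; exact h)
  rw [div_eq_one_iff_eq (by positivity)] at h1
  exact hne (by exact_mod_cast h1)

theorem isCoprime_sub (hpq : Nat.Coprime p q) : IsCoprime ((q : ℤ) - p) q := by
  have := (Nat.isCoprime_iff_coprime.2 hpq).neg_left
  simpa [sub_eq_add_neg, add_comm] using this.add_mul_right_left 1

/-- The coefficients of the average of the direct kernel. The powers of `u` and `v` contribute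
equally, whence the factor `2`; `(-1/2)^|q-p|` comes from the variable `y = -u / 2`. -/
theorem exists_hasTaylor_average_directKernel (hp : 0 < p) (hq : 0 < q) (hpq : Nat.Coprime p q)
    (hne : p ≠ q) (nl ng : ℕ) :
    ∃ A : ℕ → ℂ,
      HasTaylor (fun e : ℝ => ∫ x in (0 : ℝ)..(2 * Real.pi),
        directKernel (parR (resA p q) ((e : ℂ) • circlePair q x))
          (parW ((p : ℝ) / q) ((e : ℂ) • circlePair q x))
          ((((q : ℤ) - p : ℤ) * x + phase p q nl ng : ℝ) : AddCircle (2 * Real.pi))) A ∧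
      (∀ j < ((q : ℤ) - p).natAbs, A j = 0) ∧
      A ((q : ℤ) - p).natAbs = ((-2 * Real.pi * q ^ 2 * (-1) ^ (ng * q + nl * p)
        * (-1 / 2) ^ ((q : ℤ) - p).natAbs
        * taylorCoeff (axisFun (resA p q) p q ((q : ℤ) - p).sign)
          ((q : ℤ) - p).natAbs : ℝ) : ℂ) := by
  have ha := resA_pos hp hq
  have ha1 := resA_ne_one hp hq hne
  have hd : ((q : ℤ) - p) ≠ 0 := by omega
  have hs : ((q : ℤ) - p).sign ^ 2 = 1 := by
    rcases Int.lt_or_gt_of_ne hd with h | h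
    · rw [Int.sign_eq_neg_one_of_neg h]; norm_num
    · rw [Int.sign_eq_one_of_pos h]; norm_num
  have hmean : ∀ᶠ y in 𝓝 0,
      fourierInt 0 (directKernel (parR (resA p q) y) (parW ((p : ℝ) / q) y)) = 0 := by
    filter_upwards [eventually_regular_par ha ha1 ((p : ℝ) / q)] with y hy
    rw [fourierInt_directKernel hy]
    simp
  obtain ⟨A, h1, h2, h3⟩ := exists_hasTaylor_resonantIntegral
    (analyticAt_directKernel_par ha ha1 ((p : ℝ) / q)) hmean hd (isCoprime_sub hpq)
    (phase p q nl ng)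
  refine ⟨A, h1, h2, ?_⟩
  set m := ((q : ℤ) - p).natAbs with hm
  set s := ((q : ℤ) - p).sign with hsdef
  obtain ⟨b, hb⟩ := (analyticAt_axisFun ha ha1 p q s).exists_hasTaylor
  have hbu : HasTaylor (fun u : ℝ =>
      ((-(Real.pi * q ^ 2) * axisFun (resA p q) p q s (-1 / 2 * u) : ℝ) : ℂ))
      fun j => ((-(Real.pi * q ^ 2) * ((-1 / 2) ^ j * b j) : ℝ) : ℂ) :=
    ((hb.comp_mul (-1 / 2)).map
      (Complex.ofRealCLM.comp (ContinuousLinearMap.mul ℝ ℝ (-(Real.pi * q ^ 2)))))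
  have hev := eventually_fourierInt_axis ha ha1 hq hs (p := p)
  rw [h3 _ _ (hbu.congr (hev.mono fun u hu => hu.1.symm))
    (hbu.congr (hev.mono fun u hu => hu.2.symm)), hb.taylorCoeff_eq]
  have hq0 : (q : ℂ) ≠ 0 := by exact_mod_cast hq.ne'
  have eN : ((s * q : ℤ) : ℂ) * (phase p q nl ng : ℝ)
      = s * (((ng * q + nl * p : ℕ) : ℂ) * Real.pi) := by
    rw [phase]
    push_cast
    field_simp
    ring
  have hs' : (-s) ^ 2 = 1 := by rw [neg_sq, hs]
  have e1 : Complex.exp (((s * q : ℤ) : ℂ) * (phase p q nl ng : ℝ) * Complex.I)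
      = (-1) ^ (ng * q + nl * p) := by
    rw [eN, exp_sign_mul_pi hs]
  have e2 : Complex.exp (-((s * q : ℤ) : ℂ) * (phase p q nl ng : ℝ) * Complex.I)
      = (-1) ^ (ng * q + nl * p) := by
    rw [neg_mul, eN, ← neg_mul, ← Int.cast_neg, exp_sign_mul_pi hs']
  rw [e1, e2]
  push_cast
  ring

/-- The coefficients of the average of the indirect kernel, whose only harmonics in `ψ` are `±1`. -/
theorem exists_hasTaylor_average_indirectKernel (hp : 0 < p) (hq : 0 < q) (hpq : Nat.Coprime p q)
    (hne : p ≠ q) (nl ng : ℕ) :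
    ∃ A : ℕ → ℂ,
      HasTaylor (fun e : ℝ => ∫ x in (0 : ℝ)..(2 * Real.pi),
        indirectKernel (parR (resA p q) ((e : ℂ) • circlePair q x))
          (parW ((p : ℝ) / q) ((e : ℂ) • circlePair q x))
          ((((q : ℤ) - p : ℤ) * x + phase p q nl ng : ℝ) : AddCircle (2 * Real.pi))) A ∧
      (∀ j < ((q : ℤ) - p).natAbs, A j = 0) ∧
      (q ≠ 1 → A ((q : ℤ) - p).natAbs = 0) := by
  have ha := resA_pos hp hq
  have hd : ((q : ℤ) - p) ≠ 0 := by omega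
  obtain ⟨A, h1, h2, h3⟩ := exists_hasTaylor_resonantIntegral
    (analyticAt_indirectKernel_par ha ((p : ℝ) / q))
    (Eventually.of_forall fun y => fourierInt_indirectKernel (by norm_num) (by norm_num) _ _)
    hd (isCoprime_sub hpq) (phase p q nl ng)
  refine ⟨A, h1, h2, fun hq1 => ?_⟩
  have hzero : HasTaylor (fun _ : ℝ => (0 : ℂ)) fun _ => 0 :=
    Eventually.of_forall fun x => by simp
  have hne1 : ∀ s : ℤ, s = 1 ∨ s = -1 → s * q ≠ 1 ∧ s * q ≠ -1 := by
    rintro s (rfl | rfl) <;> constructor <;> omega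
  have hsg : ((q : ℤ) - p).sign = 1 ∨ ((q : ℤ) - p).sign = -1 := by
    rcases Int.lt_or_gt_of_ne hd with h | h
    · exact Or.inr (Int.sign_eq_neg_one_of_neg h)
    · exact Or.inl (Int.sign_eq_one_of_pos h)
  obtain ⟨g1, g2⟩ := hne1 _ hsg
  rw [h3 (fun _ => 0) (fun _ => 0)]
  · simp
  · refine hzero.congr (Eventually.of_forall fun u => ?_)
    exact (fourierInt_indirectKernel g1 g2 _ _).symm
  · refine hzero.congr (Eventually.of_forall fun u => ?_)
    exact (fourierInt_indirectKernel (by omega) (by omega) _ _).symm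

end

/-! ### The coefficient `C` as an average over the eccentric anomaly -/

section

theorem parR_circlePair (a e : ℝ) (q : ℤ) (x : ℝ) :
    parR a ((e : ℂ) • circlePair q x) = ((a * (1 - e * Real.cos (q * x)) : ℝ) : ℂ) := by
  have h := Complex.two_cos ((q * x : ℝ) : ℂ)
  rw [neg_mul] at h
  rw [parR, circlePair]
  push_cast at h ⊢
  simp only [Prod.smul_mk, smul_eq_mul]
  linear_combination (a * e / 2 : ℂ) * h

theorem parK_circlePair {e : ℝ} (he : |e| < 1) (q : ℤ) (x : ℝ) :
    parK ((e : ℂ) • circlePair q x) = ((1 / (1 + Real.sqrt (1 - e ^ 2)) : ℝ) : ℂ) := by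
  have h0 : 0 ≤ 1 - e ^ 2 := (Real.sqrt_pos.1 (sqrt_one_sub_sq_pos he)).le
  have h1 : Complex.exp (q * x * Complex.I) * Complex.exp (-(q * x * Complex.I)) = 1 := by
    rw [← Complex.exp_add, add_neg_cancel, Complex.exp_zero]
  have h2 : (1 : ℂ) - ((e : ℂ) • circlePair q x).1 * ((e : ℂ) • circlePair q x).2
      = ((1 - e ^ 2 : ℝ) : ℂ) := by
    simp only [circlePair, Prod.smul_mk, smul_eq_mul]
    push_cast
    linear_combination (-(e : ℂ) ^ 2) * h1
  rw [parK, h2, show (1 / 2 : ℂ) = ((1 / 2 : ℝ) : ℂ) by norm_num, ← Complex.ofReal_cpow h0,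
    ← Real.sqrt_eq_rpow]
  push_cast
  rw [one_div]

theorem abs_betaOf_lt_one {e : ℝ} (he : |e| < 1) : |betaOf e| < 1 := by
  have hs := sqrt_one_sub_sq_pos he
  rw [betaOf, abs_div, abs_of_pos (show 0 < 1 + Real.sqrt (1 - e ^ 2) by linarith),
    div_lt_one (by linarith)]
  linarith

theorem one_sub_betaOf_mul_ne_zero {e : ℝ} (he : |e| < 1) {z : ℂ} (hz : ‖z‖ = 1) :
    1 - (betaOf e : ℂ) * z ≠ 0 := by
  intro h
  have h1 : ‖(betaOf e : ℂ) * z‖ = 1 := by rw [← sub_eq_zero.1 h, norm_one]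
  rw [norm_mul, hz, mul_one, Complex.norm_real, Real.norm_eq_abs] at h1
  linarith [abs_betaOf_lt_one he]

/-- The relation `exp(iν) = (exp(iE) - β) / (1 - β exp(iE))` between the true and the eccentric
anomaly. -/
theorem exp_trueAnomaly {e : ℝ} (he : |e| < 1) (E : ℝ) :
    Complex.exp (trueAnomaly e (E - e * Real.sin E) * Complex.I)
        * (1 - betaOf e * Complex.exp (E * Complex.I))
      = Complex.exp (E * Complex.I) - betaOf e := by
  have hE : eccAnomaly e (E - e * Real.sin E) = E := eccAnomaly_eq he rfl
  have hc := cos_trueAnomaly he (E - e * Real.sin E)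
  have hs := sin_trueAnomaly he (E - e * Real.sin E)
  have hpos := one_sub_mul_cos_pos he E
  have hsq := sq_sqrt_one_sub_sq he
  have hβ : betaOf e * (1 + Real.sqrt (1 - e ^ 2)) = e :=
    div_mul_cancel₀ _ (by linarith [sqrt_one_sub_sq_pos he])
  have hs0 := sqrt_one_sub_sq_pos he
  rw [hE] at hc hs
  have hc' := (eq_div_iff hpos.ne').1 hc
  have hs' := (eq_div_iff hpos.ne').1 hs
  have hβe : betaOf e * e = 1 - Real.sqrt (1 - e ^ 2) := by
    have h1 : (1 + Real.sqrt (1 - e ^ 2)) ≠ 0 := by linarith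
    refine mul_right_cancel₀ h1 ?_
    linear_combination e * hβ + hsq
  rw [Complex.exp_mul_I, Complex.exp_mul_I, ← Complex.ofReal_cos, ← Complex.ofReal_sin,
    ← Complex.ofReal_cos, ← Complex.ofReal_sin]
  have hsc := Real.sin_sq_add_cos_sq E
  generalize Real.cos (trueAnomaly e (E - e * Real.sin E)) = cν at *
  generalize Real.sin (trueAnomaly e (E - e * Real.sin E)) = sν at *
  generalize Real.sqrt (1 - e ^ 2) = σ at *
  generalize betaOf e = β at *
  generalize Real.cos E = C at *
  generalize Real.sin E = S at *
  apply Complex.ext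
  · simp only [Complex.add_re, Complex.mul_re, Complex.sub_re, Complex.one_re, Complex.ofReal_re,
      Complex.ofReal_im, Complex.I_re, Complex.I_im, Complex.add_im, Complex.mul_im,
      Complex.sub_im, Complex.one_im]
    refine mul_right_cancel₀ hpos.ne' ?_
    linear_combination (1 - β * C) * hc' + β * S * hs' + σ * β * hsc + (1 - C ^ 2) * hβ
      + 0 * hβe
  · simp only [Complex.add_re, Complex.mul_re, Complex.sub_re, Complex.one_re, Complex.ofReal_re,
      Complex.ofReal_im, Complex.I_re, Complex.I_im, Complex.add_im, Complex.mul_im,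
      Complex.sub_im, Complex.one_im]
    refine mul_right_cancel₀ hpos.ne' ?_
    linear_combination (-β * S) * hc' + (1 - β * C) * hs' + S * hβe - S * C * hβ

theorem parW_circlePair {e : ℝ} (he : |e| < 1) (c : ℝ) (q : ℤ) (x : ℝ) :
    parW c ((e : ℂ) • circlePair q x) * Complex.exp (((q * x : ℝ) : ℂ) * Complex.I)
      = Complex.exp (((trueAnomaly e (q * x - e * Real.sin (q * x))
          + c * (e * Real.sin (q * x)) : ℝ) : ℂ) * Complex.I) := by
  set E : ℝ := q * x with hE
  have h1 := exp_trueAnomaly he E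
  have hpair : (e : ℂ) • circlePair q x
      = (e * Complex.exp (E * Complex.I), e * Complex.exp (-(E * Complex.I))) := by
    simp [circlePair, hE]
  have hβ : parK ((e : ℂ) • circlePair q x) * e = betaOf e := by
    rw [parK_circlePair he, betaOf]
    push_cast
    ring
  have hne := one_sub_betaOf_mul_ne_zero he (Complex.norm_exp_ofReal_mul_I E)
  have hee : Complex.exp (E * Complex.I) * Complex.exp (-(E * Complex.I)) = 1 := by
    rw [← Complex.exp_add, add_neg_cancel, Complex.exp_zero]
  have hsin : Complex.exp (E * Complex.I) - Complex.exp (-(E * Complex.I))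
      = 2 * Real.sin E * Complex.I := by
    have := Complex.two_sin (E : ℂ)
    rw [neg_mul] at this
    rw [Complex.ofReal_sin]
    linear_combination (-Complex.I) * this
      + (Complex.exp (E * Complex.I) - Complex.exp (-(E * Complex.I))) * Complex.I_sq
  rw [parW]
  have e1 : parK ((e : ℂ) • circlePair q x) * ((e : ℂ) • circlePair q x).1
      = betaOf e * Complex.exp (E * Complex.I) := by
    rw [← hβ, hpair]
    ring
  have e2 : parK ((e : ℂ) • circlePair q x) * ((e : ℂ) • circlePair q x).2
      = betaOf e * Complex.exp (-(E * Complex.I)) := by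
    rw [← hβ, hpair]
    ring
  have e3 : (c : ℂ) * (((e : ℂ) • circlePair q x).1 - ((e : ℂ) • circlePair q x).2) / 2
      = ((c * (e * Real.sin E) : ℝ) : ℂ) * Complex.I := by
    rw [hpair]
    push_cast at hsin ⊢
    linear_combination (c * e / 2 : ℂ) * hsin
  rw [e1, e2, e3, Complex.ofReal_add, add_mul, Complex.exp_add]
  rw [mul_right_comm]
  congr 1
  rw [div_mul_eq_mul_div, div_eq_iff hne, h1]
  linear_combination (-(betaOf e : ℂ)) * hee

theorem continuous_resonantIntegrand {Φ : ℂ × ℂ → AngleFun} (hΦ : AnalyticAt ℂ Φ 0) (q d : ℤ)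
    (c : ℝ) :
    ∀ᶠ e : ℝ in 𝓝 0, Continuous fun x : ℝ =>
      Φ ((e : ℂ) • circlePair q x) ((d * x + c : ℝ) : AddCircle (2 * Real.pi)) := by
  obtain ⟨ρ, hρ, h⟩ := Metric.eventually_nhds_iff_ball.1 hΦ.eventually_analyticAt
  filter_upwards [Metric.ball_mem_nhds (0 : ℝ) hρ] with e he
  have h1 : Continuous fun x : ℝ => Φ ((e : ℂ) • circlePair q x) := by
    refine continuous_iff_continuousAt.2 fun x => ?_
    refine ContinuousAt.comp (f := fun x : ℝ => (e : ℂ) • circlePair q x) (h _ ?_).continuousAt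
      ((continuous_circlePair q).const_smul (e : ℂ)).continuousAt
    rw [mem_ball_zero_iff, norm_smul, norm_circlePair, mul_one, Complex.norm_real]
    simpa using he
  exact h1.eval ((AddCircle.continuous_mk' _).comp (by fun_prop))

variable {p q : ℕ}

/-- The integrand of `stabC`. -/
noncomputable def stabIntegrand (p q nl ng : ℕ) (e t : ℝ) : ℝ :=
  iteratedDeriv 2 (fun θ => 1 / delta1 (orbitR p q nl e t) θ) (orbitTheta p q nl ng e t)
    + Real.cos (orbitTheta p q nl ng e t) / orbitR p q nl e t ^ 2

/-- The time as a function of the eccentric anomaly `q x`. -/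
noncomputable def timeOf (p q nl : ℕ) (e x : ℝ) : ℝ :=
  p / q * (q * x - e * Real.sin (q * x) - nl * Real.pi)

theorem hasDerivAt_timeOf (hq : 0 < q) (nl : ℕ) (e x : ℝ) :
    HasDerivAt (timeOf p q nl e) (p * (1 - e * Real.cos (q * x))) x := by
  have hq' : (q : ℝ) ≠ 0 := by positivity
  have h1 : HasDerivAt (fun x : ℝ => (q : ℝ) * x) q x := by
    simpa using (hasDerivAt_id x).const_mul (q : ℝ)
  refine (((h1.fun_sub (h1.sin.const_mul e)).sub_const (nl * Real.pi)).const_mul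
    ((p : ℝ) / q)).congr_deriv ?_
  field_simp

/-- Substitution of the eccentric anomaly `q x`, `dt = p (1 - e cos (q x)) dx`. -/
theorem stabC_eq_integral_timeOf (hp : 0 < p) (hq : 0 < q) (nl ng : ℕ) {e : ℝ} (he : |e| < 1) :
    stabC p q nl ng e = -(6 * Real.pi * p ^ 2) *
      ∫ x in (nl * Real.pi / q : ℝ)..(nl * Real.pi / q + 2 * Real.pi),
        resA p q * (1 - e * Real.cos (q * x)) * stabIntegrand p q nl ng e (timeOf p q nl e x) := by
  have hp' : (0 : ℝ) < p := by positivity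
  have hq' : (0 : ℝ) < q := by positivity
  have h0 : timeOf p q nl e (nl * Real.pi / q) = 0 := by
    rw [timeOf, mul_div_cancel₀ _ hq'.ne', Real.sin_nat_mul_pi]
    ring
  have h1 : timeOf p q nl e (nl * Real.pi / q + 2 * Real.pi) = 2 * Real.pi * p := by
    rw [timeOf, mul_add, mul_div_cancel₀ _ hq'.ne', Real.sin_add_nat_mul_two_pi,
      Real.sin_nat_mul_pi]
    field_simp
    ring
  have hsub := intervalIntegral.integral_deriv_smul_comp_of_deriv_nonneg
    (a := nl * Real.pi / q) (b := nl * Real.pi / q + 2 * Real.pi) (f := timeOf p q nl e)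
    (f' := fun x => p * (1 - e * Real.cos (q * x))) (g := stabIntegrand p q nl ng e)
    (fun x _ => (hasDerivAt_timeOf hq nl e x).continuousAt.continuousWithinAt)
    (fun x _ => hasDerivAt_timeOf hq nl e x)
    (fun x _ => mul_nonneg hp'.le (one_sub_mul_cos_pos he _).le)
  rw [h0, h1] at hsub
  have hcoef : 6 * Real.pi * (p : ℝ) ^ ((5 : ℝ) / 3) / (q : ℝ) ^ ((2 : ℝ) / 3)
      = 6 * Real.pi * p * resA p q := by
    rw [resA, Real.div_rpow hp'.le hq'.le, show (5 : ℝ) / 3 = 2 / 3 + 1 by norm_num,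
      Real.rpow_add hp', Real.rpow_one]
    ring
  have hst : stabC p q nl ng e = -(6 * Real.pi * p * resA p q) *
      ∫ t in (0 : ℝ)..(2 * Real.pi * p), stabIntegrand p q nl ng e t := by
    rw [← hcoef]
    rfl
  rw [hst, ← hsub, ← intervalIntegral.integral_const_mul, ← intervalIntegral.integral_const_mul]
  refine intervalIntegral.integral_congr fun x _ => ?_
  simp only [smul_eq_mul, Function.comp_apply]
  ring

/-- The integrand of `stabC` in terms of the kernels. -/
theorem kernels_circlePair (hp : 0 < p) (hq : 0 < q) (nl ng : ℕ) {e : ℝ} (he : |e| < 1) (x : ℝ)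
    (hreg : Regular (parR (resA p q) ((e : ℂ) • circlePair q x))
      (parW ((p : ℝ) / q) ((e : ℂ) • circlePair q x))) :
    directKernel (parR (resA p q) ((e : ℂ) • circlePair q x))
          (parW ((p : ℝ) / q) ((e : ℂ) • circlePair q x))
          ((((q : ℤ) - p : ℤ) * x + phase p q nl ng : ℝ) : AddCircle (2 * Real.pi))
        + indirectKernel (parR (resA p q) ((e : ℂ) • circlePair q x))
          (parW ((p : ℝ) / q) ((e : ℂ) • circlePair q x))
          ((((q : ℤ) - p : ℤ) * x + phase p q nl ng : ℝ) : AddCircle (2 * Real.pi))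
      = ((resA p q * (1 - e * Real.cos (q * x))
          * stabIntegrand p q nl ng e (timeOf p q nl e x) : ℝ) : ℂ) := by
  have hp' : (0 : ℝ) < p := by positivity
  have hq' : (0 : ℝ) < q := by positivity
  have hl : q * timeOf p q nl e x / p + nl * Real.pi = q * x - e * Real.sin (q * x) := by
    rw [timeOf]
    field_simp
    ring
  have hR : orbitR p q nl e (timeOf p q nl e x) = resA p q * (1 - e * Real.cos (q * x)) := by
    rw [orbitR, hl, radius, eccAnomaly_eq he rfl, resA]
  have hθ : orbitTheta p q nl ng e (timeOf p q nl e x)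
      = trueAnomaly e (q * x - e * Real.sin (q * x)) + (p : ℝ) / q * (e * Real.sin (q * x))
        + (-(p : ℝ) * x + phase p q nl ng) := by
    rw [orbitTheta, hl, timeOf, phase]
    field_simp
    ring
  have hr : 0 < resA p q * (1 - e * Real.cos (q * x)) :=
    mul_pos (resA_pos hp hq) (one_sub_mul_cos_pos he _)
  have hX : parW ((p : ℝ) / q) ((e : ℂ) • circlePair q x)
      * Complex.exp (((((q : ℤ) - p : ℤ) * x + phase p q nl ng : ℝ) : ℂ) * Complex.I)
      = Complex.exp ((orbitTheta p q nl ng e (timeOf p q nl e x) : ℂ) * Complex.I) := by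
    have h1 := parW_circlePair he ((p : ℝ) / q) q x
    have hs : ∀ A B : ℝ, Complex.exp (((A + B : ℝ) : ℂ) * Complex.I)
        = Complex.exp (A * Complex.I) * Complex.exp (B * Complex.I) := fun A B => by
      rw [Complex.ofReal_add, add_mul, Complex.exp_add]
    simp only [Int.cast_natCast] at h1
    rw [hθ, hs (_ + _) (-(p : ℝ) * x + phase p q nl ng), ← h1, mul_assoc, ← Complex.exp_add]
    congr 2
    push_cast
    ring
  rw [parR_circlePair] at hreg ⊢
  simp only [Int.cast_natCast] at hreg ⊢
  obtain ⟨k1, k2⟩ := kernels_eq hreg hX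
  rw [k1, k2, stabIntegrand, hR, ← Complex.ofReal_add]
  congr 1
  have hr0 := hr.ne'
  generalize resA p q * (1 - e * Real.cos (q * x)) = ρ at hr0 ⊢
  field_simp

/-- For small eccentricities `C` is a multiple of the sum of the averages of the two kernels. -/
theorem eventually_stabC_eq (hp : 0 < p) (hq : 0 < q) (hne : p ≠ q) (nl ng : ℕ) :
    ∀ᶠ e : ℝ in 𝓝 0, (stabC p q nl ng e : ℂ) = -(6 * Real.pi * p ^ 2) *
      ((∫ x in (0 : ℝ)..(2 * Real.pi), directKernel (parR (resA p q) ((e : ℂ) • circlePair q x))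
          (parW ((p : ℝ) / q) ((e : ℂ) • circlePair q x))
          ((((q : ℤ) - p : ℤ) * x + phase p q nl ng : ℝ) : AddCircle (2 * Real.pi)))
        + ∫ x in (0 : ℝ)..(2 * Real.pi), indirectKernel (parR (resA p q) ((e : ℂ) • circlePair q x))
          (parW ((p : ℝ) / q) ((e : ℂ) • circlePair q x))
          ((((q : ℤ) - p : ℤ) * x + phase p q nl ng : ℝ) : AddCircle (2 * Real.pi))) := by
  have ha := resA_pos hp hq
  have ha1 := resA_ne_one hp hq hne
  obtain ⟨ρ, hρ, hreg⟩ := Metric.eventually_nhds_iff_ball.1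
    (eventually_regular_par ha ha1 ((p : ℝ) / q))
  filter_upwards [Metric.ball_mem_nhds (0 : ℝ) hρ, Metric.ball_mem_nhds (0 : ℝ) one_pos,
    continuous_resonantIntegrand (analyticAt_directKernel_par ha ha1 ((p : ℝ) / q)) q
      ((q : ℤ) - p) (phase p q nl ng),
    continuous_resonantIntegrand (analyticAt_indirectKernel_par ha ((p : ℝ) / q)) q
      ((q : ℤ) - p) (phase p q nl ng)] with e heρ he1 hc1 hc2
  have he : |e| < 1 := by simpa using he1
  have hr : ∀ x, Regular (parR (resA p q) ((e : ℂ) • circlePair q x))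
      (parW ((p : ℝ) / q) ((e : ℂ) • circlePair q x)) := fun x => by
    refine hreg _ ?_
    rw [mem_ball_zero_iff, norm_smul, norm_circlePair, mul_one, Complex.norm_real]
    simpa using heρ
  rw [← intervalIntegral.integral_add (hc1.intervalIntegrable _ _) (hc2.intervalIntegrable _ _)]
  rw [stabC_eq_integral_timeOf hp hq nl ng he, Complex.ofReal_mul,
    ← intervalIntegral.integral_ofReal]
  have hk := fun x => kernels_circlePair hp hq nl ng he x (hr x)
  simp only [← hk]
  push_cast
  congr 1
  set F : ℝ → ℂ := fun x => directKernel (parR (resA p q) ((e : ℂ) • circlePair q x))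
          (parW ((p : ℝ) / q) ((e : ℂ) • circlePair q x))
          ((((q : ℤ) - p : ℤ) * x + phase p q nl ng : ℝ) : AddCircle (2 * Real.pi))
      + indirectKernel (parR (resA p q) ((e : ℂ) • circlePair q x))
          (parW ((p : ℝ) / q) ((e : ℂ) • circlePair q x))
          ((((q : ℤ) - p : ℤ) * x + phase p q nl ng : ℝ) : AddCircle (2 * Real.pi)) with hF
  have hper : Function.Periodic F (2 * Real.pi) := fun x => by
    have e1 : circlePair q (x + 2 * Real.pi) = circlePair q x := by
      rw [circlePair, circlePair, Complex.exp_neg, Complex.exp_neg, exp_int_mul_add_two_pi]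
    have e2 : (((((q : ℤ) - p : ℤ) * (x + 2 * Real.pi) + phase p q nl ng : ℝ)) :
        AddCircle (2 * Real.pi)) = ((((q : ℤ) - p : ℤ) * x + phase p q nl ng : ℝ)) := by
      rw [show (((q : ℤ) - p : ℤ) : ℝ) * (x + 2 * Real.pi) + phase p q nl ng
        = (((q : ℤ) - p : ℤ) * x + phase p q nl ng) + ((q : ℤ) - p) • (2 * Real.pi) by
          rw [zsmul_eq_mul]; ring,
        AddCircle.coe_add, AddCircle.coe_zsmul, AddCircle.coe_period, smul_zero, add_zero]
    simp only [hF]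
    rw [e1, e2]
  have := hper.intervalIntegral_add_eq (nl * Real.pi / q) 0
  rw [zero_add] at this
  simpa [hF] using this

end

/-! ### The Bessel series -/

theorem betaOf_mul {e : ℝ} (he : |e| < 1) : e * (1 + betaOf e ^ 2) = 2 * betaOf e := by
  have hs := sqrt_one_sub_sq_pos he
  have hsq := sq_sqrt_one_sub_sq he
  rw [betaOf]
  have h1 : (1 + Real.sqrt (1 - e ^ 2)) ≠ 0 := by linarith
  field_simp
  linear_combination e * hsq

/-- The expansion of `cos θ / r` in terms of the eccentric anomaly, which comes from
`exp(iν) / r = (1 + β²) / a · z / (1 - β z)²` with `z = exp(iE)`. -/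
theorem hasSum_cos_div_radius {e a : ℝ} (he : |e| < 1) (ha : 0 < a) (p N : ℕ) (x : ℝ) :
    HasSum (fun k : ℕ => (-1) ^ N * ((1 + betaOf e ^ 2) / a) * (((k : ℝ) + 1)
        * Real.cos (((p : ℤ) - 1 - k : ℤ) * x - e * p * Real.sin x) * betaOf e ^ k))
      (Real.cos (trueAnomaly e (x - e * Real.sin x) + p * (e * Real.sin x)
        + (-(p : ℝ) * x + N * Real.pi)) / (a * (1 - e * Real.cos x))) := by
  set β := betaOf e with hβ
  set z := Complex.exp (x * Complex.I) with hz
  set z' := Complex.exp (-(x * Complex.I)) with hz'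
  have hzz : z * z' = 1 := by rw [hz, hz', ← Complex.exp_add, add_neg_cancel, Complex.exp_zero]
  have hzn : ‖z‖ = 1 := Complex.norm_exp_ofReal_mul_I x
  have hzn' : ‖z'‖ = 1 := by
    have := congrArg norm hzz
    rwa [norm_mul, hzn, one_mul, norm_one] at this
  have hβz : ‖(β : ℂ) * z‖ < 1 := by
    rw [norm_mul, hzn, mul_one, Complex.norm_real]
    exact abs_betaOf_lt_one he
  have hne := one_sub_betaOf_mul_ne_zero he hzn
  have hne' := one_sub_betaOf_mul_ne_zero he hzn'
  have hpos := one_sub_mul_cos_pos he x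
  have hν := exp_trueAnomaly he x
  have hgeo := hasSum_choose_mul_geometric_of_norm_lt_one 1 hβz
  set Y := Complex.exp (((e * p * Real.sin x - p * x : ℝ) : ℂ) * Complex.I) with hY
  set K : ℂ := (-1) ^ N * ((1 + (β : ℂ) ^ 2) / a) * (z * Y) with hK
  have h1 := Complex.reCLM.hasSum (hgeo.mul_left K)
  have hN : Complex.exp (((N * Real.pi : ℝ) : ℂ) * Complex.I) = (-1) ^ N := by
    have := exp_sign_mul_pi (s := 1) (by norm_num) N
    simpa using this
  convert h1 using 1
  · funext k
    have e1 : K * (((k + 1).choose 1 : ℕ) * (β * z) ^ k)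
        = (((-1) ^ N * ((1 + β ^ 2) / a) * (((k : ℝ) + 1) * β ^ k) : ℝ) : ℂ)
          * Complex.exp (((-(((p : ℤ) - 1 - k : ℤ) * x - e * p * Real.sin x) : ℝ) : ℂ)
            * Complex.I) := by
      have e2 : Complex.exp (((-(((p : ℤ) - 1 - k : ℤ) * x - e * p * Real.sin x) : ℝ) : ℂ)
          * Complex.I) = z ^ k * z * Y := by
        rw [hz, hY, ← Complex.exp_nat_mul, ← Complex.exp_add, ← Complex.exp_add]
        congr 1
        push_cast
        ring
      rw [e2, hK, Nat.choose_one_right, mul_pow]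
      push_cast
      ring
    simp only [Complex.reCLM_apply]
    rw [e1, Complex.re_ofReal_mul, Complex.exp_ofReal_mul_I_re, Real.cos_neg]
    ring
  · have e3 : Complex.exp (((trueAnomaly e (x - e * Real.sin x) + p * (e * Real.sin x)
        + (-(p : ℝ) * x + N * Real.pi) : ℝ) : ℂ) * Complex.I)
        = Complex.exp (trueAnomaly e (x - e * Real.sin x) * Complex.I) * Y * (-1) ^ N := by
      rw [← hN, hY, ← Complex.exp_add, ← Complex.exp_add]
      congr 1
      push_cast
      ring
    have e4 : ((1 - e * Real.cos x : ℝ) : ℂ) * (1 + (β : ℂ) ^ 2)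
        = (1 - β * z) * (1 - β * z') := by
      have h2 := betaOf_mul he
      rw [← hβ] at h2
      have h2' : (e : ℂ) * (1 + (β : ℂ) ^ 2) = 2 * β := by exact_mod_cast h2
      have h3 := Complex.two_cos (x : ℂ)
      rw [neg_mul, ← hz, ← hz'] at h3
      push_cast
      linear_combination (-Complex.cos x) * h2' - (β : ℂ) * h3 - (β : ℂ) ^ 2 * hzz
    have e5 : Complex.exp (trueAnomaly e (x - e * Real.sin x) * Complex.I) * (1 - β * z)
        = z * (1 - β * z') := by
      rw [hν]
      linear_combination (β : ℂ) * hzz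
    have hr : ((1 - e * Real.cos x : ℝ) : ℂ) ≠ 0 := by exact_mod_cast hpos.ne'
    have ha' : (a : ℂ) ≠ 0 := by exact_mod_cast ha.ne'
    have e6 : K * (1 / (1 - β * z) ^ (1 + 1))
        = Complex.exp (((trueAnomaly e (x - e * Real.sin x) + p * (e * Real.sin x)
          + (-(p : ℝ) * x + N * Real.pi) : ℝ) : ℂ) * Complex.I)
          / ((a * (1 - e * Real.cos x) : ℝ) : ℂ) := by
      rw [e3, hK, Complex.ofReal_mul]
      have e7 : (1 + (β : ℂ) ^ 2) * z * ((1 - e * Real.cos x : ℝ) : ℂ)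
          = Complex.exp (trueAnomaly e (x - e * Real.sin x) * Complex.I) * (1 - β * z) ^ 2 := by
        linear_combination z * e4 - (1 - β * z) * e5
      rw [mul_one_div, div_eq_div_iff (pow_ne_zero _ hne) (mul_ne_zero ha' hr), one_add_one_eq_two]
      field_simp
      linear_combination Y * e7
    rw [e6, Complex.reCLM_apply, Complex.div_ofReal_re, Complex.exp_ofReal_mul_I_re]

/-- Integration of `hasSum_cos_div_radius` term by term. -/
theorem integral_cos_div_radius {e : ℝ} (he : |e| < 1) {p : ℕ} (hp : 0 < p) (nl ng : ℕ) :
    ∫ x in (0 : ℝ)..(2 * Real.pi), Real.cos (trueAnomaly e (x - e * Real.sin x)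
        + p * (e * Real.sin x) + (-(p : ℝ) * x + (ng + nl * p : ℕ) * Real.pi))
          / ((p : ℝ) ^ ((2 : ℝ) / 3) * (1 - e * Real.cos x))
      = besselSeries p nl ng e := by
  have ha : 0 < (p : ℝ) ^ ((2 : ℝ) / 3) := Real.rpow_pos_of_pos (by exact_mod_cast hp) _
  set N := ng + nl * p with hN
  set c : ℝ := (-1) ^ N * ((1 + betaOf e ^ 2) / (p : ℝ) ^ ((2 : ℝ) / 3)) with hc
  have hsum : Summable fun k : ℕ => |c| * (((k : ℝ) + 1) * |betaOf e| ^ k) := by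
    have := (hasSum_choose_mul_geometric_of_norm_lt_one (𝕜 := ℝ) 1
      (r := |betaOf e|) (by simpa using abs_betaOf_lt_one he)).summable
    refine (this.congr fun k => ?_).mul_left _
    rw [Nat.choose_one_right]
    push_cast
    ring
  set F : ℕ → ℝ → ℝ := fun k x => c * (((k : ℝ) + 1)
        * Real.cos (((p : ℤ) - 1 - k : ℤ) * x - e * p * Real.sin x) * betaOf e ^ k) with hF
  have key := intervalIntegral.hasSum_integral_of_dominated_convergence
    (μ := MeasureTheory.volume) (a := 0) (b := 2 * Real.pi) (F := F)
    (fun k _ => |c| * (((k : ℝ) + 1) * |betaOf e| ^ k))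
    (fun k => (show Continuous (F k) by simp only [hF]; fun_prop).aestronglyMeasurable)
    (fun k => Eventually.of_forall fun x _ => by
      simp only [hF]
      rw [Real.norm_eq_abs, abs_mul c, abs_mul (_ * _) (betaOf e ^ k), abs_mul ((k : ℝ) + 1),
        abs_pow, abs_of_nonneg (show (0 : ℝ) ≤ (k : ℝ) + 1 by positivity)]
      gcongr
      exact mul_le_of_le_one_right (by positivity) (Real.abs_cos_le_one _))
    (Eventually.of_forall fun x _ => hsum) intervalIntegrable_const
    (Eventually.of_forall fun x _ => hasSum_cos_div_radius he ha p N x)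
  rw [← key.tsum_eq, besselSeries]
  have hterm : ∀ k : ℕ, ∫ x in (0 : ℝ)..(2 * Real.pi), F k x
      = c * (2 * Real.pi) * (((k : ℝ) + 1) * besselJ ((p : ℤ) - 1 - k) (e * p) * betaOf e ^ k) := by
    intro k
    simp only [hF]
    rw [intervalIntegral.integral_const_mul, intervalIntegral.integral_mul_const,
      intervalIntegral.integral_const_mul, besselJ]
    have := Real.pi_ne_zero
    field_simp
  simp only [hterm]
  rw [tsum_mul_left, hc, ← hN]
  ring

/-- For `q = 1` the average of the indirect kernel is the Bessel series. -/
theorem eventually_average_indirectKernel {p : ℕ} (hp : 0 < p) (hp1 : p ≠ 1) (nl ng : ℕ) :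
    ∀ᶠ e : ℝ in 𝓝 0,
      ∫ x in (0 : ℝ)..(2 * Real.pi),
        indirectKernel (parR (resA p 1) ((e : ℂ) • circlePair (1 : ℕ) x))
          (parW ((p : ℝ) / (1 : ℕ)) ((e : ℂ) • circlePair (1 : ℕ) x))
          (((((1 : ℕ) : ℤ) - p : ℤ) * x + phase p 1 nl ng : ℝ) : AddCircle (2 * Real.pi))
        = (besselSeries p nl ng e : ℂ) := by
  obtain ⟨ρ, hρ, hreg⟩ := Metric.eventually_nhds_iff_ball.1
    (eventually_regular_par (resA_pos hp one_pos) (resA_ne_one hp one_pos hp1)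
      ((p : ℝ) / (1 : ℕ)))
  filter_upwards [Metric.ball_mem_nhds (0 : ℝ) hρ, Metric.ball_mem_nhds (0 : ℝ) one_pos]
    with e heρ he1
  have he : |e| < 1 := by simpa using he1
  rw [← integral_cos_div_radius he hp nl ng, ← intervalIntegral.integral_ofReal]
  refine intervalIntegral.integral_congr fun x _ => ?_
  have hr : Regular (parR (resA p 1) ((e : ℂ) • circlePair (1 : ℕ) x))
      (parW ((p : ℝ) / (1 : ℕ)) ((e : ℂ) • circlePair (1 : ℕ) x)) := by
    refine hreg _ ?_
    rw [mem_ball_zero_iff, norm_smul, norm_circlePair, mul_one, Complex.norm_real]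
    simpa using heρ
  have hW := parW_circlePair he ((p : ℝ) / (1 : ℕ)) (1 : ℕ) x
  rw [parR_circlePair] at hr
  simp only [parR_circlePair]
  simp only [Nat.cast_one, Int.cast_one, one_mul, div_one] at hr hW ⊢
  refine (kernels_eq (θ := trueAnomaly e (x - e * Real.sin x) + p * (e * Real.sin x)
    + (-(p : ℝ) * x + (ng + nl * p : ℕ) * Real.pi)) hr ?_).2.trans ?_
  · have hs : ∀ A B : ℝ, Complex.exp (((A + B : ℝ) : ℂ) * Complex.I)
        = Complex.exp (A * Complex.I) * Complex.exp (B * Complex.I) := fun A B => by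
      rw [Complex.ofReal_add, add_mul, Complex.exp_add]
    rw [hs (_ + _) (-(p : ℝ) * x + _), ← hW, mul_assoc, ← Complex.exp_add]
    congr 2
    rw [phase]
    push_cast
    ring
  · rw [resA]
    simp

/-! ### The leading coefficient -/

section

variable {p q : ℕ}

theorem taylorCoeff_congr {f g : ℝ → ℝ} (h : f =ᶠ[𝓝 0] g) (n : ℕ) :
    taylorCoeff f n = taylorCoeff g n := by
  rw [taylorCoeff, taylorCoeff, (EventuallyEq.iteratedDeriv_eq n h)]

theorem leadingInner_eq (hp : 0 < p) (hpq : p < q) (nl ng : ℕ) :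
    leadingInner p q nl ng = -2 * Real.pi * q ^ 2 * (-1) ^ (ng * q + nl * p) * (-1 / 2) ^ (q - p)
      * taylorCoeff (axisFun (resA p q) p q 1) (q - p) := by
  have ha := resA_pos hp (hp.trans hpq)
  have ha1 := resA_ne_one hp (hp.trans hpq) hpq.ne
  have hF : AnalyticAt ℝ (fun α => α * laplaceB q α) (resA p q) :=
    analyticAt_id.fun_mul (analyticAt_laplaceB q ha ha1)
  have h := taylorCoeff_binomOp_mul_exp hF 1 q p (q - p)
  have e : axisFun (resA p q) p q 1 = fun y => (1 + y) ^ (q : ℝ)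
      * (fun α => α * laplaceB q α) (resA p q * (1 + y) ^ (1 : ℝ)) * Real.exp (p * y) := by
    funext y
    simp [axisFun]
  rw [e, h, leadingInner, ← resA, div_pow]
  ring

/-- Here `r b_q(r) = b_q(1 / r)` brings the coefficient into the form with `α = 1 / a`. -/
theorem leadingOuter_eq (hq : 0 < q) (hpq : q < p) (nl ng : ℕ) :
    leadingOuter p q nl ng = -2 * Real.pi * q ^ 2 * (-1) ^ (ng * q + nl * p) * (-1 / 2) ^ (p - q)
      * taylorCoeff (axisFun (resA p q) p q (-1)) (p - q) := by
  have hp := hq.trans hpq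
  have ha := resA_pos hp hq
  have hinv : ((q : ℝ) / p) ^ ((2 : ℝ) / 3) = (resA p q)⁻¹ := by
    rw [resA, ← Real.inv_rpow (by positivity), inv_div]
  have hb : resA q p = (resA p q)⁻¹ := hinv
  have hF : AnalyticAt ℝ (laplaceB q) (resA p q)⁻¹ := by
    rw [← hb]
    exact analyticAt_laplaceB q (resA_pos hq hp) (resA_ne_one hq hp hpq.ne)
  have h := taylorCoeff_binomOp_mul_exp hF (-1) (-q) (-p) (p - q)
  have e : axisFun (resA p q) p q (-1) =ᶠ[𝓝 0] fun y => (1 + y) ^ (-q : ℝ)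
      * laplaceB q ((resA p q)⁻¹ * (1 + y) ^ (-1 : ℝ)) * Real.exp (-p * y) := by
    filter_upwards [eventually_gt_nhds (show (-1 : ℝ) < 0 by norm_num)] with y hy
    have hy' : 0 < 1 + y := by linarith
    rw [axisFun, Real.rpow_neg_one, ← mul_inv, laplaceB_inv q (mul_pos ha hy')]
    push_cast
    rw [neg_one_mul, neg_one_mul]
  rw [taylorCoeff_congr e, h, leadingOuter, hinv, Finset.mul_sum, Finset.mul_sum]
  refine Finset.sum_congr rfl fun k hk => ?_
  have hk' : k ≤ p - q := Nat.lt_succ_iff.1 (Finset.mem_range.1 hk)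
  have e1 : (-1 / 2 : ℝ) ^ (p - q) * (-p : ℝ) ^ (p - q - k)
      = 1 / 2 ^ (p - q) * ((-1) ^ k * (p : ℝ) ^ (p - q - k)) := by
    have e2 : (-1 : ℝ) ^ (p - q) * (-1) ^ (p - q - k) = (-1) ^ k := by
      rw [← pow_add, show p - q + (p - q - k) = k + 2 * (p - q - k) by omega, pow_add, pow_mul]
      norm_num
    rw [neg_eq_neg_one_mul (p : ℝ), mul_pow, div_pow, ← e2]
    ring
  linear_combination (-2 * Real.pi * q ^ 2 * (-1) ^ (ng * q + nl * p)
    / (p - q - k).factorial * binomOp (-1) (-q) k (laplaceB q) (resA p q)⁻¹) * (-e1)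

/-- The power series of `C` about `e = 0`. -/
theorem exists_hasTaylor_stabC (hp : 0 < p) (hq : 0 < q) (hpq : Nat.Coprime p q) (hne : p ≠ q)
    (nl ng : ℕ) :
    ∃ b : ℕ → ℝ, HasTaylor (stabC p q nl ng) b ∧ (∀ j < ((p : ℤ) - q).natAbs, b j = 0) ∧
      b ((p : ℤ) - q).natAbs = leadingC p q nl ng := by
  obtain ⟨A, hA, hA0, hAm⟩ := exists_hasTaylor_average_directKernel hp hq hpq hne nl ng
  obtain ⟨B, hB, hB0, hBm⟩ := exists_hasTaylor_average_indirectKernel hp hq hpq hne nl ng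
  have hm : ((q : ℤ) - p).natAbs = ((p : ℤ) - q).natAbs := by omega
  rw [hm] at hA0 hAm hB0 hBm
  have hAB := ((hA.add hB).map (Complex.reCLM.comp
    (ContinuousLinearMap.mul ℝ ℂ (-(6 * Real.pi * p ^ 2) : ℝ))))
  refine ⟨_, hAB.congr ?_, fun j hj => ?_, ?_⟩
  · filter_upwards [eventually_stabC_eq hp hq hne nl ng] with e he
    have := congrArg Complex.re he
    rw [Complex.ofReal_re] at this
    rw [this]
    simp
  · simp [hA0 j hj, hB0 j hj]
  · have hlead : A ((p : ℤ) - q).natAbs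
        = ((if p < q then leadingInner p q nl ng else leadingOuter p q nl ng : ℝ) : ℂ) := by
      rw [hAm]
      congr 1
      split_ifs with h
      · rw [leadingInner_eq hp h, Int.sign_eq_one_of_pos (by omega),
          show ((p : ℤ) - q).natAbs = q - p by omega]
      · rw [leadingOuter_eq hq (by omega), Int.sign_eq_neg_one_of_neg (by omega),
          show ((p : ℤ) - q).natAbs = p - q by omega]
    have hbes : B ((p : ℤ) - q).natAbs
        = ((if q = 1 then taylorCoeff (besselSeries p nl ng) (p - 1) else 0 : ℝ) : ℂ) := by
      split_ifs with h
      · subst h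
        have hev := eventually_average_indirectKernel hp hne nl ng
        obtain ⟨c, hc⟩ : ∃ c, HasTaylor (besselSeries p nl ng) c :=
          ⟨_, (hB.map Complex.reCLM).congr (hev.mono fun e he => by
            simp only [he, Complex.reCLM_apply, Complex.ofReal_re])⟩
        have h1 := (hc.map Complex.ofRealCLM).congr (hev.mono fun e he => he.symm)
        rw [hB.unique h1, hc.taylorCoeff_eq, show ((p : ℤ) - (1 : ℕ)).natAbs = p - 1 by omega]
        rfl
      · rw [hBm h, Complex.ofReal_zero]
    simp only [hlead, hbes, leadingC]
    rw [← Complex.ofReal_add, ContinuousLinearMap.comp_apply, ContinuousLinearMap.mul_apply',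
      Complex.reCLM_apply, Complex.re_ofReal_mul, Complex.ofReal_re]
    ring

theorem besselSeries_eq_mul (p nl ng : ℕ) (e : ℝ) :
    besselSeries p nl ng e = (-1) ^ (ng + nl * p) * besselSeries p 0 0 e := by
  simp only [besselSeries]
  ring

theorem taylorCoeff_const_mul (c : ℝ) (f : ℝ → ℝ) (n : ℕ) :
    taylorCoeff (fun x => c * f x) n = c * taylorCoeff f n := by
  rw [taylorCoeff, taylorCoeff, iteratedDeriv_const_mul_field, mul_div_assoc]

/-- The leading coefficient depends on `n_l`, `n_g` only through a sign. -/
theorem leadingC_eq_mul (p q nl ng : ℕ) :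
    leadingC p q nl ng = (-1) ^ (p * nl + q * ng) * leadingC p q 0 0 := by
  have h1 : leadingInner p q nl ng = (-1) ^ (p * nl + q * ng) * leadingInner p q 0 0 := by
    simp only [leadingInner, zero_mul, add_zero, pow_zero]
    rw [show ng * q + nl * p = p * nl + q * ng by ring]
    ring
  have h2 : leadingOuter p q nl ng = (-1) ^ (p * nl + q * ng) * leadingOuter p q 0 0 := by
    simp only [leadingOuter, zero_mul, add_zero, pow_zero]
    rw [show ng * q + nl * p = p * nl + q * ng by ring]
    ring
  have h3 : (if q = 1 then taylorCoeff (besselSeries p nl ng) (p - 1) else 0)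
      = (-1) ^ (p * nl + q * ng)
        * (if q = 1 then taylorCoeff (besselSeries p 0 0) (p - 1) else 0) := by
    split_ifs with h
    · rw [funext (besselSeries_eq_mul p nl ng), taylorCoeff_const_mul, h,
        show ng + nl * p = p * nl + 1 * ng by ring]
    · rw [mul_zero]
  rw [leadingC, leadingC, h1, h2, h3]
  split_ifs <;> ring

theorem leadingC_add_leadingC (p q : ℕ) {nl ng nl' ng' : ℕ}
    (h : ¬ p * nl + q * ng ≡ p * nl' + q * ng' [MOD 2]) :
    leadingC p q nl ng + leadingC p q nl' ng' = 0 := by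
  rw [leadingC_eq_mul p q nl ng, leadingC_eq_mul p q nl' ng']
  rcases Nat.even_or_odd (p * nl + q * ng) with h1 | h1 <;>
    rcases Nat.even_or_odd (p * nl' + q * ng') with h2 | h2
  · exact absurd ((Nat.even_iff.1 h1).trans (Nat.even_iff.1 h2).symm) h
  · rw [h1.neg_one_pow, h2.neg_one_pow]; ring
  · rw [h1.neg_one_pow, h2.neg_one_pow]; ring
  · exact absurd ((Nat.odd_iff.1 h1).trans (Nat.odd_iff.1 h2).symm) h

end

end RTBP

theorem theorem1 (p q : ℕ) (hp : 0 < p) (hq : 0 < q) (hpq : Nat.Coprime p q) :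
    (∀ e : ℝ, 0 < e → e < 1 →
      (∀ nl ng : Fin 2,
        (∀ t : ℝ, 0 < RTBP.delta1 (RTBP.orbitR p q nl e t) (RTBP.orbitTheta p q nl ng e t)) →
        ∃ (μ₀ : ℝ) (γ : ℝ → ℝ → RTBP.State) (T : ℝ → ℝ),
          RTBP.IsFamily p q e nl ng μ₀ γ T ∧
          (∀ μ ∈ Set.Ioo (-μ₀) μ₀, γ μ 0 1 = RTBP.resG p q e) ∧
          (∃ δ > 0,
            (∀ μ ∈ Set.Ioo (-μ₀) μ₀, RTBP.IsNearby p q e nl ng δ μ (γ μ) (T μ)) ∧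
            ∀ μ ∈ Set.Ioo (-μ₀) μ₀, ∀ (c c' : ℝ → RTBP.State) (τ τ' : ℝ),
              RTBP.IsNearby p q e nl ng δ μ c τ → RTBP.IsNearby p q e nl ng δ μ c' τ' →
              c 0 1 = c' 0 1 → c = c' ∧ τ = τ') ∧
          ∃ lamP lamM : ℝ → ℂ,
            (∀ μ ∈ Set.Ioo (-μ₀) μ₀,
              RTBP.AreMultipliers μ (γ μ) (T μ) {1, 1, lamP μ, lamM μ}) ∧
            (fun μ : ℝ => lamP μ
              - (1 + ((RTBP.stabC p q nl ng e * μ : ℝ) : ℂ) ^ (1 / 2 : ℂ))) =O[𝓝[>] 0]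
                (fun μ : ℝ => μ) ∧
            (fun μ : ℝ => lamM μ
              - (1 - ((RTBP.stabC p q nl ng e * μ : ℝ) : ℂ) ^ (1 / 2 : ℂ))) =O[𝓝[>] 0]
                (fun μ : ℝ => μ)) ∧
      (∀ nl ng nl' ng' : Fin 2,
        (p * (nl : ℕ) + q * (ng : ℕ) ≡ p * (nl' : ℕ) + q * (ng' : ℕ) [MOD 2] →
          ∀ (μ₀ : ℝ) (γ : ℝ → ℝ → RTBP.State) (T : ℝ → ℝ),
            RTBP.IsFamily p q e nl ng μ₀ γ T →
            ∃ (γ' : ℝ → ℝ → RTBP.State) (σ : ℝ → ℝ),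
              RTBP.IsFamily p q e nl' ng' μ₀ γ' T ∧
              ∀ μ ∈ Set.Ioo (-μ₀) μ₀, ∀ t, RTBP.SameState (γ' μ t) (γ μ (t + σ μ))) ∧
        (¬ p * (nl : ℕ) + q * (ng : ℕ) ≡ p * (nl' : ℕ) + q * (ng' : ℕ) [MOD 2] →
          ∀ (μ₀ μ₀' : ℝ) (γ γ' : ℝ → ℝ → RTBP.State) (T T' : ℝ → ℝ),
            RTBP.IsFamily p q e nl ng μ₀ γ T → RTBP.IsFamily p q e nl' ng' μ₀' γ' T' →
            ∃ μ₁ > 0, ∀ μ ∈ Set.Ioo (-μ₁) μ₁, ∀ t t' : ℝ,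
              ¬ RTBP.SameState (γ μ t) (γ' μ t')))) ∧
    (p ≠ q →
      (∀ nl ng : Fin 2,
        AnalyticAt ℝ (RTBP.stabC p q nl ng) 0 ∧
        (RTBP.stabC p q nl ng) =O[𝓝 0] (fun e : ℝ => e ^ ((p : ℤ) - q).natAbs) ∧
        RTBP.taylorCoeff (RTBP.stabC p q nl ng) ((p : ℤ) - q).natAbs
          = RTBP.leadingC p q nl ng) ∧
      (∀ nl ng nl' ng' : Fin 2,
        ¬ p * (nl : ℕ) + q * (ng : ℕ) ≡ p * (nl' : ℕ) + q * (ng' : ℕ) [MOD 2] →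
        RTBP.taylorCoeff (RTBP.stabC p q nl ng) ((p : ℤ) - q).natAbs
          + RTBP.taylorCoeff (RTBP.stabC p q nl' ng') ((p : ℤ) - q).natAbs = 0)) := by
  refine ⟨fun e he he1 => ⟨fun nl ng hΔ => ?_, fun nl ng nl' ng' => ⟨?_, ?_⟩⟩, fun hne => ⟨?_, ?_⟩⟩
  · obtain ⟨μ₀, γ, T, η, Y, h, δ, hδ, hnear, huniq⟩ := RTBP.exists_isContinuation hp hq he he1 hΔ
    obtain ⟨μ₁, hμ₁, hle, κ, hmult, hκ⟩ := h.exists_multipliers hp hq he he1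
    have hs : Set.Ioo (-μ₁) μ₁ ⊆ Set.Ioo (-μ₀) μ₀ := Set.Ioo_subset_Ioo (by linarith) hle
    have hasym := fun s => (RTBP.multiplier_sub_isBigO hκ s).mono
      (nhdsWithin_le_nhds : 𝓝[>] (0 : ℝ) ≤ 𝓝 0)
    refine ⟨μ₁, γ, T, h.family.mono hμ₁ hle, fun μ hμ => h.action_G μ (hs hμ),
      ⟨δ, hδ, fun μ hμ => hnear μ (hs hμ), fun μ hμ => huniq μ (hs hμ)⟩,
      fun μ => RTBP.multiplier 1 (κ μ), fun μ => RTBP.multiplier (-1) (κ μ), hmult, ?_, ?_⟩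
    · refine (hasym 1).congr_left fun μ => ?_
      rw [one_mul]
    · refine (hasym (-1)).congr_left fun μ => ?_
      ring
  · intro hpar μ₀ γ T h
    exact h.exists_shift hp hq hpq he he1 hpar
  · intro hpar μ₀ μ₀' γ γ' T T' h h'
    exact h.disjoint hp hq he he1 hpar h'
  · intro nl ng
    obtain ⟨b, hb, hb0, hbm⟩ := RTBP.exists_hasTaylor_stabC hp hq hpq hne nl ng
    exact ⟨hb.analyticAt, hb.isBigO hb0, (hb.taylorCoeff_eq _).trans hbm⟩
  · intro nl ng nl' ng' hpar
    obtain ⟨b, hb, -, hbm⟩ := RTBP.exists_hasTaylor_stabC hp hq hpq hne nl ng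
    obtain ⟨b', hb', -, hbm'⟩ := RTBP.exists_hasTaylor_stabC hp hq hpq hne nl' ng'
    rw [hb.taylorCoeff_eq, hb'.taylorCoeff_eq, hbm, hbm']
    exact RTBP.leadingC_add_leadingC p q hpar
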